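/- **Conventions.** A *vectoid* is a symmetric monoidal (ACU) category $\mathcal A$ that has all small colimits, whose tensor product commutes with small colimits in each variable, that has finite limits, in which all epimorphisms are universally effective (every pullback of an epimorphism is the cokernel of its kernel pair) and all equivalence relations are effective, that has a small set of generators, and that is complete: every presheaf of sets on $\mathcal A$ that takes small colimits in $\mathcal A$ to limits is representable. A *morphism* $f:\mathcal B\to\mathcal A$ of vectoids is an adjoint pair $f^*\dashv f_*$, $f^*:\mathcal A\to\mathcal B$, with $f^*$ a strong symmetric monoidal functor; a 2-morphism $f\to g$ is a monoidal natural transformation $f^*\to g^*$. For vectoids $\mathcal B,\mathcal C$ over $\mathcal A$ (with structure morphisms $p,q$), a morphism over $\mathcal A$ is a morphism $f:\mathcal B\to\mathcal C$ with a monoidal isomorphism $f^*q^*\cong p^*$, and 2-morphisms over $\mathcal A$ are those compatible with these isomorphisms. The composition product on endomorphisms over $\mathcal A$ is the composition $f\circ g$, with $(f\circ g)^*=g^*f^*$. Let $\mathbf N_{iso}$ be the category of the finite sets $\mathbf n=\{1,\dots,n\}$, $n\ge 0$, and bijections, monoidal under disjoint union (in block order), and let $q_o\mathcal A=\mathrm{Fun}(\mathbf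 N_{iso}^{op},\mathcal A)$ be the category of symmetric sequences $X=(X_n)_{n\ge0}$ in $\mathcal A$ (right $\mathfrak S_n$-action on $X_n$), with the Day convolution as tensor product, with the structure morphism $p:q_o\mathcal A\to\mathcal A$, $p^*a=(a,\emptyset,\emptyset,\dots)$, $p_*X=X_0$, and with the object $X_o=(\emptyset,\mathbf 1,\emptyset,\dots)$, where $\emptyset$ is the initial object and $\mathbf 1$ the unit of $\mathcal A$. Bijections of standard finite sets act contravariantly on symmetric sequences. A *symmetric operad* in $\mathcal A$ is a symmetric sequence $P$ with a unit $\mathbf 1\to P_1$ and composition maps $\gamma_{p_1,\dots,p_s}:P_s\otimes P_{p_1}\otimes\dots\otimes P_{p_s}\to P_{p_1+\dots+p_s}$ (for all $s\ge0$ and $p_i\ge0$), which are equivariant for $\mathfrak S_{p_1}\times\dots\times\mathfrak S_{p_s}$ and for $\mathfrak S_s$, associative and unital; morphisms of operads are the morphisms of symmetric sequences that commute with the units and the composition maps. **Theorem.** Let $\mathcal A$ be an arbitrary vectoid. 1. $q_o\mathcal A$ is a vectoid, and $(q_o\mathcal A,p,X_o)$ is the object classifier over $\mathcal A$: for every vectoid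 $\mathcal B$ over $\mathcal A$ the functor $f\mapsto f^*X_o$ from the category of morphisms $\mathcal B\to q_o\mathcal A$ over $\mathcal A$ to $\mathcal B$ is an equivalence. In particular, $\theta:f\mapsto f^*X_o$ is an equivalence $\mathrm{End}_{\mathcal A}(q_o\mathcal A)\to q_o\mathcal A$. 2. Under $\theta$ the composition product is the plethysm of symmetric sequences: for $X=\theta(f)$, $Y=\theta(g)$ and $X\circ Y=\theta(f\circ g)$ the canonical maps $\kappa_{p_1,\dots,p_s}:X_s\otimes Y_{p_1}\otimes\dots\otimes Y_{p_s}\to(X\circ Y)_{p_1+\dots+p_s}$ exhibit, for every $n\ge0$, $$(X\circ Y)_n=\Bigl(\bigsqcup_{p_1+\dots+p_s=n}X_s\otimes\mathrm{Ind}^{\mathfrak S_n}_{\mathfrak S_{p_1}\times\dots\times\mathfrak S_{p_s}}(Y_{p_1}\otimes\dots\otimes Y_{p_s})\Bigr)\Big/\mathfrak S_s .$$ 3. Algebrads of the object classifier over $\mathcal A$, that is, monoids $(M,\mu,\epsilon)$ in $\mathrm{End}_{\mathcal A}(q_o\mathcal A)$ with respect to the composition product, are precisely the symmetric operads in $\mathcal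 A$: there is an equivalence between the category of these monoids and the category of symmetric operads in $\mathcal A$ that takes a monoid $M$ to an operad with underlying symmetric sequence $\Sigma=\theta(M)$ (up to a natural isomorphism), with unit $\mathbf 1\to(X_o)_1\xrightarrow{\epsilon}\Sigma_1$, and with composition maps $\Sigma_s\otimes\Sigma_{p_1}\otimes\dots\otimes\Sigma_{p_s}\xrightarrow{\kappa}(\Sigma\circ\Sigma)_{p_1+\dots+p_s}\xrightarrow{\mu}\Sigma_{p_1+\dots+p_s}$. -/

import Mathlib

open CategoryTheory MonoidalCategory Limits Opposite ExternalProduct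

universe w v u

noncomputable section

/-- The category of the standard finite sets `Fin n`, `n = 0, 1, 2, …`, and their bijections. -/
structure NIso where
  /-- The number of elements. -/
  card : ℕ

namespace NIso

instance : Category NIso where
  Hom m n := Fin m.card ≃ Fin n.card
  id m := Equiv.refl _
  comp f g := f.trans g

/-- The disjoint union of two bijections, in block order. -/
def sum {m m' n n' : ℕ} (σ : Fin m ≃ Fin m') (τ : Fin n ≃ Fin n') : Fin (m + n) ≃ Fin (m' + n') :=
  finSumFinEquiv.symm.trans ((Equiv.sumCongr σ τ).trans finSumFinEquiv)

@[simp] lemma sum_castAdd {m m' n n' : ℕ} (σ : Fin m ≃ Fin m') (τ : Fin n ≃ Fin n') (i : Fin m) :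
    sum σ τ (Fin.castAdd n i) = Fin.castAdd n' (σ i) := by simp [sum]
@[simp] lemma sum_natAdd {m m' n n' : ℕ} (σ : Fin m ≃ Fin m') (τ : Fin n ≃ Fin n') (i : Fin n) :
    sum σ τ (Fin.natAdd m i) = Fin.natAdd m' (τ i) := by simp [sum]

/-- The exchange of two blocks. -/
def swap (m n : ℕ) : Fin (m + n) ≃ Fin (n + m) :=
  finSumFinEquiv.symm.trans ((Equiv.sumComm _ _).trans finSumFinEquiv)

@[simp] lemma swap_castAdd {m n : ℕ} (i : Fin m) :
    swap m n (Fin.castAdd n i) = Fin.natAdd n i := by simp [swap]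
@[simp] lemma swap_natAdd {m n : ℕ} (i : Fin n) :
    swap m n (Fin.natAdd m i) = Fin.castAdd m i := by simp [swap]

/-- A bijection as an isomorphism of `NIso`. -/
def isoMk {m n : NIso} (σ : Fin m.card ≃ Fin n.card) : m ≅ n where
  hom := σ
  inv := σ.symm
  hom_inv_id := σ.self_trans_symm
  inv_hom_id := σ.symm_trans_self

lemma sum_refl (m n : ℕ) : sum (Equiv.refl (Fin m)) (Equiv.refl (Fin n)) = Equiv.refl _ := by
  ext i; refine Fin.addCases (fun i => ?_) (fun i => ?_) i <;> simp

lemma sum_trans {m m' m'' n n' n'' : ℕ} (σ : Fin m ≃ Fin m') (τ : Fin n ≃ Fin n')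
    (σ' : Fin m' ≃ Fin m'') (τ' : Fin n' ≃ Fin n'') :
    (sum σ τ).trans (sum σ' τ') = sum (σ.trans σ') (τ.trans τ') := by
  ext i; refine Fin.addCases (fun i => ?_) (fun i => ?_) i <;> simp

/-- The canonical bijection of the two bracketings of three blocks. -/
def assoc (a b c : ℕ) : Fin (a + b + c) ≃ Fin (a + (b + c)) := finCongr (Nat.add_assoc a b c)

@[simp] lemma assoc_1 {a b c : ℕ} (i : Fin a) :
    assoc a b c (Fin.castAdd c (Fin.castAdd b i)) = Fin.castAdd (b + c) i := rfl
@[simp] lemma assoc_2 {a b c : ℕ} (i : Fin b) :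
    assoc a b c (Fin.castAdd c (Fin.natAdd a i)) = Fin.natAdd a (Fin.castAdd c i) := rfl
@[simp] lemma assoc_3 {a b c : ℕ} (i : Fin c) :
    assoc a b c (Fin.natAdd (a + b) i) = Fin.natAdd a (Fin.natAdd b i) := by
  ext; simp [assoc, Nat.add_assoc]

lemma sum_assoc {a b c a' b' c' : ℕ} (f : Fin a ≃ Fin a') (g : Fin b ≃ Fin b') (h : Fin c ≃ Fin c') :
    (sum (sum f g) h).trans (assoc a' b' c') = (assoc a b c).trans (sum f (sum g h)) := by
  ext i
  refine Fin.addCases (fun i => ?_) (fun i => ?_) i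
  · refine Fin.addCases (fun i => ?_) (fun i => ?_) i <;> simp
  · simp

/-- The canonical bijection for an empty first block -/
def zeroAdd (a : ℕ) : Fin (0 + a) ≃ Fin a := finCongr (Nat.zero_add a)

/-- The canonical bijection for an empty second block -/
def addZero (a : ℕ) : Fin (a + 0) ≃ Fin a := finCongr (Nat.add_zero a)

lemma zeroAdd_natAdd {a : ℕ} (i : Fin a) : zeroAdd a (Fin.natAdd 0 i) = i := by
  ext; simp [zeroAdd]

lemma addZero_castAdd {a : ℕ} (i : Fin a) : addZero a (Fin.castAdd 0 i) = i := rfl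

lemma zero_sum {a a' : ℕ} (f : Fin a ≃ Fin a') :
    (sum (Equiv.refl (Fin 0)) f).trans (zeroAdd a') = (zeroAdd a).trans f := by
  ext i
  refine Fin.addCases (fun i => i.elim0) (fun i => ?_) i
  simp only [Equiv.trans_apply, sum_natAdd, zeroAdd_natAdd]

lemma sum_zero {a a' : ℕ} (f : Fin a ≃ Fin a') :
    (sum f (Equiv.refl (Fin 0))).trans (addZero a') = (addZero a).trans f := by
  ext i
  refine Fin.addCases (fun i => ?_) (fun i => i.elim0) i
  simp only [Equiv.trans_apply, sum_castAdd, addZero_castAdd]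

lemma assoc_pentagon (a b c d : ℕ) :
    (sum (assoc a b c) (Equiv.refl (Fin d))).trans
      ((assoc a (b + c) d).trans (sum (Equiv.refl (Fin a)) (assoc b c d)))
      = (assoc (a + b) c d).trans (assoc a b (c + d)) := by
  ext i
  refine Fin.addCases (fun i => ?_) (fun i => ?_) i
  · refine Fin.addCases (fun i => ?_) (fun i => ?_) i
    · refine Fin.addCases (fun i => ?_) (fun i => ?_) i <;> simp
    · simp
  · simp

lemma assoc_triangle (a b : ℕ) :
    (assoc a 0 b).trans (sum (Equiv.refl (Fin a)) (zeroAdd b))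
      = sum (addZero a) (Equiv.refl (Fin b)) := by
  ext i
  refine Fin.addCases (fun i => ?_) (fun i => ?_) i
  · refine Fin.addCases (fun i => ?_) (fun i => i.elim0) i
    rw [Equiv.trans_apply, assoc_1, sum_castAdd, sum_castAdd, addZero_castAdd]
    rfl
  · have : assoc a 0 b (Fin.natAdd (a + 0) i) = Fin.natAdd a (Fin.natAdd 0 i) := assoc_3 i
    rw [Equiv.trans_apply, this, sum_natAdd, sum_natAdd, zeroAdd_natAdd]
    rfl

/-- The tensor product of `NIso` is the disjoint union of finite sets, in block order. -/
instance : MonoidalCategory NIso where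
  tensorObj m n := ⟨m.card + n.card⟩
  tensorUnit := ⟨0⟩
  tensorHom f g := sum f g
  whiskerLeft _ _ _ g := sum (Equiv.refl _) g
  whiskerRight f _ := sum f (Equiv.refl _)
  associator a b c := isoMk (assoc a.card b.card c.card)
  leftUnitor a := isoMk (zeroAdd a.card)
  rightUnitor a := isoMk (addZero a.card)
  tensorHom_def f g := (sum_trans f (Equiv.refl _) (Equiv.refl _) g).symm
  id_tensorHom_id _ _ := sum_refl _ _
  tensorHom_comp_tensorHom f g f' g' := sum_trans f g f' g'
  whiskerLeft_id _ _ := sum_refl _ _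
  id_whiskerRight _ _ := sum_refl _ _
  associator_naturality f g h := sum_assoc f g h
  leftUnitor_naturality f := zero_sum f
  rightUnitor_naturality f := sum_zero f
  pentagon a b c d := assoc_pentagon a.card b.card c.card d.card
  triangle a b := assoc_triangle a.card b.card

lemma sum_swap {a b a' b' : ℕ} (f : Fin a ≃ Fin a') (g : Fin b ≃ Fin b') :
    (sum f g).trans (swap a' b') = (swap a b).trans (sum g f) := by
  ext i; refine Fin.addCases (fun i => ?_) (fun i => ?_) i <;> simp

lemma swap_hexagon (a b c : ℕ) :
    (assoc a b c).trans ((swap a (b + c)).trans (assoc b c a))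
      = (sum (swap a b) (Equiv.refl (Fin c))).trans
          ((assoc b a c).trans (sum (Equiv.refl (Fin b)) (swap a c))) := by
  ext i
  refine Fin.addCases (fun i => ?_) (fun i => ?_) i
  · refine Fin.addCases (fun i => ?_) (fun i => ?_) i <;> simp
  · simp

lemma swap_swap (a b : ℕ) : (swap a b).trans (swap b a) = Equiv.refl _ := by
  ext i; refine Fin.addCases (fun i => ?_) (fun i => ?_) i <;> simp

lemma swap_hexagon' (a b c : ℕ) :
    (assoc a b c).symm.trans ((swap (a + b) c).trans (assoc c a b).symm)
      = (sum (Equiv.refl (Fin a)) (swap b c)).trans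
          ((assoc a c b).symm.trans (sum (swap a c) (Equiv.refl (Fin b)))) := by
  have h1 : ∀ {a b c : ℕ} (i : Fin a), (assoc a b c).symm (Fin.castAdd (b + c) i)
      = Fin.castAdd c (Fin.castAdd b i) := fun i => by rw [← assoc_1, Equiv.symm_apply_apply]
  have h2 : ∀ {a b c : ℕ} (i : Fin b), (assoc a b c).symm (Fin.natAdd a (Fin.castAdd c i))
      = Fin.castAdd c (Fin.natAdd a i) := fun i => by rw [← assoc_2, Equiv.symm_apply_apply]
  have h3 : ∀ {a b c : ℕ} (i : Fin c), (assoc a b c).symm (Fin.natAdd a (Fin.natAdd b i))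
      = Fin.natAdd (a + b) i := fun i => by rw [← assoc_3, Equiv.symm_apply_apply]
  apply Equiv.ext
  intro i
  refine Fin.addCases (fun i => ?_) (fun i => ?_) i
  · simp [h1, h2]
  · refine Fin.addCases (fun i => ?_) (fun i => ?_) i <;> simp [h1, h2, h3]

instance : SymmetricCategory NIso where
  braiding m n := isoMk (swap m.card n.card)
  braiding_naturality_right _ _ _ f := sum_swap (Equiv.refl _) f
  braiding_naturality_left f _ := sum_swap f (Equiv.refl _)
  hexagon_forward a b c := swap_hexagon a.card b.card c.card
  hexagon_reverse a b c := swap_hexagon' a.card b.card c.card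
  symmetry a b := swap_swap a.card b.card

instance : SymmetricCategory NIsoᵒᵖ where
  symmetry a b := Quiver.Hom.unop_inj (SymmetricCategory.symmetry a.unop b.unop)

end NIso

section TensorFam

variable {D : Type u} [Category.{v} D] [MonoidalCategory D]

/-- The tensor product `X 0 ⊗ (X 1 ⊗ (⋯ ⊗ (X (n - 1) ⊗ 𝟙_)))` of a finite family of objects. -/
def tensorFam : (n : ℕ) → (Fin n → D) → D
  | 0, _ => 𝟙_ D
  | n + 1, X => X 0 ⊗ tensorFam n fun i => X i.succ

/-- The tensor product of a finite family of morphisms. -/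
def tensorFamMap : (n : ℕ) → {X Y : Fin n → D} → (∀ i, X i ⟶ Y i) →
    (tensorFam n X ⟶ tensorFam n Y)
  | 0, _, _, _ => 𝟙 (𝟙_ D)
  | n + 1, _, _, f => f 0 ⊗ₘ tensorFamMap n fun i => f i.succ

theorem tensorFamMap_id : (n : ℕ) → (X : Fin n → D) →
    tensorFamMap n (fun i => 𝟙 (X i)) = 𝟙 (tensorFam n X)
  | 0, _ => rfl
  | n + 1, X => by
    rw [tensorFamMap, tensorFamMap_id]
    exact MonoidalCategory.id_tensorHom_id _ _

theorem tensorFamMap_comp : (n : ℕ) → {X Y Z : Fin n → D} → (f : ∀ i, X i ⟶ Y i) →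
    (g : ∀ i, Y i ⟶ Z i) → tensorFamMap n (fun i => f i ≫ g i) = tensorFamMap n f ≫ tensorFamMap n g
  | 0, _, _, _, _, _ => (Category.id_comp _).symm
  | n + 1, X, Y, Z, f, g => by
    rw [tensorFamMap, tensorFamMap, tensorFamMap, tensorFamMap_comp]
    exact (MonoidalCategory.tensorHom_comp_tensorHom _ _ _ _).symm

/-- The canonical isomorphism from the unit to a finite tensor product of units. -/
def tensorFamUnit : (n : ℕ) → (𝟙_ D ⟶ tensorFam n fun _ => 𝟙_ D)
  | 0 => 𝟙 (𝟙_ D)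
  | n + 1 => (λ_ (𝟙_ D)).inv ≫ 𝟙_ D ◁ tensorFamUnit n

/-- Relabelling of a finite tensor product along an equality of lengths. -/
def tensorFamCast {m n : ℕ} (h : m = n) {X : Fin m → D} {Y : Fin n → D}
    (e : ∀ i, X i = Y (Fin.cast h i)) : tensorFam m X ⟶ tensorFam n Y :=
  eqToHom (by subst h; exact congrArg (tensorFam m) (funext e))

/-- Concatenation (rebracketing) of two finite tensor products. -/
def tensorFamAppend : (m n : ℕ) → (Z : Fin (m + n) → D) →
    (tensorFam m (fun i => Z (Fin.castAdd n i)) ⊗ tensorFam n (fun j => Z (Fin.natAdd m j)) ⟶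
      tensorFam (m + n) Z)
  | 0, n, _ => (λ_ (tensorFam n _)).hom ≫
      tensorFamCast (Nat.zero_add n).symm fun _ => congrArg _ (Fin.ext (by simp))
  | m + 1, n, Z => (α_ (Z (Fin.castAdd n 0)) (tensorFam m fun i => Z (Fin.castAdd n i.succ))
        (tensorFam n fun j => Z (Fin.natAdd (m + 1) j))).hom ≫
      Z (Fin.castAdd n 0) ◁ (tensorFam m _ ◁
        (tensorFamMap n fun j => eqToHom (congrArg Z (Fin.ext (by simp; omega)))) ≫
        tensorFamAppend m n fun i => Z (Fin.cast (Nat.succ_add m n).symm i.succ)) ≫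
      tensorFamCast (X := fun i => Z (Fin.cast (Nat.succ_add m n).symm i))
        (Nat.succ_add m n).symm fun _ => rfl

theorem finSigmaFinEquiv_cons_zero {s : ℕ} (p : Fin (s + 1) → ℕ) (j : Fin (p 0)) :
    finSigmaFinEquiv ⟨0, j⟩
      = Fin.cast (Fin.sum_univ_succ p).symm (Fin.castAdd (∑ i : Fin s, p i.succ) j) :=
  Fin.ext (by simp [finSigmaFinEquiv_apply])

theorem finSigmaFinEquiv_cons_succ {s : ℕ} (p : Fin (s + 1) → ℕ) (i : Fin s)
    (j : Fin (p i.succ)) :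
    finSigmaFinEquiv ⟨i.succ, j⟩ = Fin.cast (Fin.sum_univ_succ p).symm
      (Fin.natAdd (p 0) (finSigmaFinEquiv (n := fun i : Fin s => p i.succ) ⟨i, j⟩)) := by
  apply Fin.ext
  simp only [finSigmaFinEquiv_apply, Fin.val_cast, Fin.val_natAdd]
  rw [← Nat.add_assoc]
  congr 1
  exact Fin.sum_univ_succ (n := i.val) _

/-- Flattening (rebracketing) of a finite tensor product of finite tensor products. -/
def tensorFamFlatten : (s : ℕ) → (p : Fin s → ℕ) → (Z : Fin (∑ i, p i) → D) →
    (tensorFam s (fun i => tensorFam (p i) fun j => Z (finSigmaFinEquiv ⟨i, j⟩)) ⟶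
      tensorFam (∑ i, p i) Z)
  | 0, _, _ => tensorFamCast (X := Fin.elim0) (Fin.sum_univ_zero _).symm fun i => i.elim0
  | s + 1, p, Z =>
      ((tensorFamMap (p 0) fun j => eqToHom (congrArg Z (finSigmaFinEquiv_cons_zero p j))) ⊗ₘ
        ((tensorFamMap s fun i => tensorFamMap (p i.succ) fun j =>
            eqToHom (congrArg Z (finSigmaFinEquiv_cons_succ p i j))) ≫
          tensorFamFlatten s (fun i => p i.succ) fun k =>
            Z (Fin.cast (Fin.sum_univ_succ p).symm (Fin.natAdd (p 0) k)))) ≫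
      tensorFamAppend (p 0) (∑ i : Fin s, p i.succ)
        (fun k => Z (Fin.cast (Fin.sum_univ_succ p).symm k)) ≫
      tensorFamCast (Fin.sum_univ_succ p).symm fun _ => rfl

variable [SymmetricCategory D]

/-- The shuffle `(⨂ X i) ⊗ (⨂ Y i) ⟶ ⨂ (X i ⊗ Y i)`. -/
def tensorFamTensor : (n : ℕ) → (X Y : Fin n → D) →
    (tensorFam n X ⊗ tensorFam n Y ⟶ tensorFam n fun i => X i ⊗ Y i)
  | 0, _, _ => (λ_ (𝟙_ D)).hom
  | n + 1, X, Y =>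
      tensorμ (X 0) (tensorFam n fun i => X i.succ) (Y 0) (tensorFam n fun i => Y i.succ) ≫
        (X 0 ⊗ Y 0) ◁ tensorFamTensor n (fun i => X i.succ) (fun i => Y i.succ)

/-- The insertion of a factor at its place in a finite tensor product, by means of the symmetry. -/
def tensorFamInsert : (n : ℕ) → (k : Fin (n + 1)) → (X : Fin (n + 1) → D) →
    (X k ⊗ tensorFam n (fun i => X (k.succAbove i)) ⟶ tensorFam (n + 1) X)
  | 0, k, X => eqToHom (congrArg X (Fin.fin_one_eq_zero k)) ▷ 𝟙_ D
  | n + 1, k, X => Fin.cases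
      (motive := fun k => X k ⊗ tensorFam (n + 1) (fun i => X (k.succAbove i)) ⟶
        tensorFam (n + 2) X)
      (X 0 ◁ tensorFamMap (n + 1) fun i => eqToHom (congrArg X (Fin.succAbove_zero_apply i)))
      (fun j =>
        (α_ (X j.succ) (X (j.succ.succAbove 0))
            (tensorFam n fun i => X (j.succ.succAbove i.succ))).inv ≫
          (β_ (X j.succ) (X (j.succ.succAbove 0))).hom ▷ _ ≫
          (α_ (X (j.succ.succAbove 0)) (X j.succ) _).hom ≫
          (eqToHom (congrArg X (Fin.succ_succAbove_zero j)) ⊗ₘ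
            (X j.succ ◁ tensorFamMap n fun i =>
                eqToHom (congrArg X (Fin.succ_succAbove_succ j i))) ≫
              tensorFamInsert n j (fun i => X i.succ))) k

/-- The permutation of the remaining elements after the removal of `0` from the source and of its
image from the target. -/
def permTail {n : ℕ} (σ : Equiv.Perm (Fin (n + 1))) : Equiv.Perm (Fin n) :=
  (finSuccAboveEquiv 0).trans
    ((σ.subtypeEquiv fun a => by simp).trans (finSuccAboveEquiv (σ 0)).symm)

theorem succAbove_permTail {n : ℕ} (σ : Equiv.Perm (Fin (n + 1))) (i : Fin n) :
    (σ 0).succAbove (permTail σ i) = σ i.succ := by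
  have h : ∀ x, (σ 0).succAbove x = (finSuccAboveEquiv (σ 0) x).1 := fun _ => rfl
  rw [h, permTail, Equiv.trans_apply, Equiv.trans_apply, Equiv.apply_symm_apply]
  simp [finSuccAboveEquiv_apply]

/-- The permutation `⨂ X (σ i) ⟶ ⨂ X i` of the factors of a finite tensor product. -/
def tensorFamPerm : (n : ℕ) → (σ : Equiv.Perm (Fin n)) → (X : Fin n → D) →
    (tensorFam n (fun i => X (σ i)) ⟶ tensorFam n X)
  | 0, _, _ => 𝟙 (𝟙_ D)
  | n + 1, σ, X =>
      X (σ 0) ◁ (tensorFamMap n (fun i => eqToHom (congrArg X (succAbove_permTail σ i).symm)) ≫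
        tensorFamPerm n (permTail σ) (fun i => X ((σ 0).succAbove i))) ≫
      tensorFamInsert n (σ 0) X

end TensorFam

/-- The structure map `⨂ F (X i) ⟶ F (⨂ X i)` of a lax monoidal functor. -/
def tensorFamμ {C : Type*} {D : Type*} [Category* C] [MonoidalCategory C] [Category* D]
    [MonoidalCategory D] (F : C ⥤ D) [F.LaxMonoidal] :
    (n : ℕ) → (X : Fin n → C) → (tensorFam n (fun i => F.obj (X i)) ⟶ F.obj (tensorFam n X))
  | 0, _ => Functor.LaxMonoidal.ε F
  | n + 1, X => F.obj (X 0) ◁ tensorFamμ F n (fun i => X i.succ) ≫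
      Functor.LaxMonoidal.μ F (X 0) (tensorFam n fun i => X i.succ)

/-- A pair of morphisms `p, q : R ⟶ X` is an equivalence relation on `X`: it is jointly
monomorphic, and reflexive, symmetric and transitive on generalised elements. -/
structure IsEqRel {A : Type u} [Category.{v} A] {R X : A} (p q : R ⟶ X) : Prop where
  jointlyMono : ∀ ⦃T : A⦄ (a b : T ⟶ R), a ≫ p = b ≫ p → a ≫ q = b ≫ q → a = b
  refl : ∀ ⦃T : A⦄ (x : T ⟶ X), ∃ r : T ⟶ R, r ≫ p = x ∧ r ≫ q = x
  symm : ∀ ⦃T : A⦄ (r : T ⟶ R), ∃ r' : T ⟶ R, r' ≫ p = r ≫ q ∧ r' ≫ q = r ≫ p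
  trans : ∀ ⦃T : A⦄ (r s : T ⟶ R), r ≫ q = s ≫ p →
    ∃ t : T ⟶ R, t ≫ p = r ≫ p ∧ t ≫ q = s ≫ q

/-- A prevectoid: a symmetric monoidal (ACU) category with small colimits, preserved by the tensor
product in each variable, with finite limits, in which all epimorphisms are universally effective
(each pullback of an epimorphism, in particular the epimorphism itself, is the cokernel of its
kernel pair), all equivalence relations are effective (each is the kernel pair of its cokernel), and
which has a small set of generators. -/
class Prevectoid (A : Type u) [Category.{v} A] [MonoidalCategory A] [SymmetricCategory A] :
    Prop where
  hasColimits : HasColimitsOfSize.{v, v} A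
  preservesColimits_tensorLeft : ∀ X : A, PreservesColimitsOfSize.{v, v} (tensorLeft X)
  preservesColimits_tensorRight : ∀ X : A, PreservesColimitsOfSize.{v, v} (tensorRight X)
  hasFiniteLimits : HasFiniteLimits A
  epi_effective : ∀ ⦃X Y X' Y' : A⦄ (f : X ⟶ Y) (f' : X' ⟶ Y') (g' : X' ⟶ X) (g : Y' ⟶ Y),
    Epi f → IsPullback g' f' f g → ∀ ⦃R : A⦄ (p q : R ⟶ X') (h : IsKernelPair f' p q),
      Nonempty (IsColimit (Cofork.ofπ f' h.w))
  equivalenceRelation_effective : ∀ ⦃R X : A⦄ (p q : R ⟶ X), IsEqRel p q →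
    ∀ ⦃Q : A⦄ (π : X ⟶ Q) (w : p ≫ π = q ≫ π), Nonempty (IsColimit (Cofork.ofπ π w)) →
      IsKernelPair π p q
  exists_generators : ∃ G : ObjectProperty A, ObjectProperty.Small.{v} G ∧ G.IsSeparating

/-- A vectoid: a prevectoid that is complete in the sense that every presheaf of sets which takes
small colimits to limits is representable. -/
class Vectoid (A : Type u) [Category.{v} A] [MonoidalCategory A] [SymmetricCategory A] : Prop
    extends Prevectoid A where
  total : ∀ F : Aᵒᵖ ⥤ Type v, PreservesLimitsOfSize.{v, v} F → F.IsRepresentable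

section VectoidMorphisms

universe v₁ v₂ v₃ u₁ u₂ u₃

/-- A morphism `B → A` of vectoids: an adjoint pair whose left adjoint, the inverse image functor
`A ⥤ B`, is a `⊗`-functor compatible with the associativity, commutativity and unit constraints. -/
structure VectoidHom (B : Type u₁) (A : Type u₂) [Category.{v₁} B] [MonoidalCategory B]
    [SymmetricCategory B] [Category.{v₂} A] [MonoidalCategory A] [SymmetricCategory A] where
  /-- The inverse image functor `f^*`. -/
  invImage : A ⥤ B
  /-- The direct image functor `f_*`. -/
  dirImage : B ⥤ A
  /-- The adjunction. -/
  adj : invImage ⊣ dirImage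
  /-- The `⊗`-structure of the inverse image functor. -/
  braided : invImage.Braided

attribute [instance] VectoidHom.braided

variable {B : Type u₁} {A : Type u₂} {C : Type u₃} [Category.{v₁} B] [MonoidalCategory B]
  [SymmetricCategory B] [Category.{v₂} A] [MonoidalCategory A] [SymmetricCategory A]
  [Category.{v₃} C] [MonoidalCategory C] [SymmetricCategory C]

/-- A morphism `B → C` of vectoids over `A`, for the structure morphisms `p : B → A` and
`q : C → A`: a morphism `f` with a monoidal isomorphism `f^* q^* ≅ p^*`. -/
structure OverHom (p : VectoidHom B A) (q : VectoidHom C A) where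
  /-- The underlying morphism of vectoids. -/
  hom : VectoidHom B C
  /-- The isomorphism of the two inverse image functors from the base. -/
  iso : q.invImage ⋙ hom.invImage ≅ p.invImage
  isMonoidal : iso.hom.IsMonoidal

namespace OverHom

/-- A 2-morphism `f ⟶ g` over `A`: a monoidal natural transformation `f^* ⟶ g^*` compatible with
the isomorphisms over `A`. -/
@[ext]
structure Hom {p : VectoidHom B A} {q : VectoidHom C A} (f g : OverHom p q) where
  /-- The underlying natural transformation. -/
  app : f.hom.invImage ⟶ g.hom.invImage
  isMonoidal : app.IsMonoidal
  w : ∀ a : A, app.app (q.invImage.obj a) ≫ g.iso.hom.app a = f.iso.hom.app a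

instance (p : VectoidHom B A) (q : VectoidHom C A) : Category (OverHom p q) where
  Hom f g := Hom f g
  id f :=
    { app := 𝟙 _
      isMonoidal := inferInstance
      w a := by simp }
  comp f g :=
    { app := f.app ≫ g.app
      isMonoidal := by
        have := f.isMonoidal
        have := g.isMonoidal
        infer_instance
      w a := by rw [NatTrans.comp_app, Category.assoc, g.w, f.w] }
  id_comp f := Hom.ext (Category.id_comp f.app)
  comp_id f := Hom.ext (Category.comp_id f.app)
  assoc f g h := Hom.ext (Category.assoc f.app g.app h.app)

/-- The value `f^* X` of a morphism over `A` on an object. -/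
def eval (p : VectoidHom B A) (q : VectoidHom C A) (X : C) : OverHom p q ⥤ B where
  obj f := f.hom.invImage.obj X
  map τ := τ.app.app X

/-- The identity morphism over `A`. -/
def idHom (p : VectoidHom B A) : OverHom p p where
  hom :=
    { invImage := 𝟭 B
      dirImage := 𝟭 B
      adj := Adjunction.id
      braided := inferInstance }
  iso := p.invImage.rightUnitor
  isMonoidal := inferInstance

/-- The composition product `f ∘ g` of endomorphisms over `A`; its inverse image functor is
`X ↦ g^* (f^* X)`. -/
def compHom {p : VectoidHom B A} (f g : OverHom p p) : OverHom p p where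
  hom :=
    { invImage := f.hom.invImage ⋙ g.hom.invImage
      dirImage := g.hom.dirImage ⋙ f.hom.dirImage
      adj := f.hom.adj.comp g.hom.adj
      braided := inferInstance }
  iso := (Functor.associator _ _ _).symm ≪≫
    Functor.isoWhiskerRight f.iso g.hom.invImage ≪≫ g.iso
  isMonoidal := by
    have := f.isMonoidal
    have := g.isMonoidal
    have h1 : NatTrans.IsMonoidal
        (Functor.associator p.invImage f.hom.invImage g.hom.invImage).inv := inferInstance
    have h2 : NatTrans.IsMonoidal (Functor.whiskerRight f.iso.hom g.hom.invImage) := inferInstance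
    have h3 := NatTrans.IsMonoidal.comp (Functor.whiskerRight f.iso.hom g.hom.invImage) g.iso.hom
    exact NatTrans.IsMonoidal.comp
      (Functor.associator p.invImage f.hom.invImage g.hom.invImage).inv
      (Functor.whiskerRight f.iso.hom g.hom.invImage ≫ g.iso.hom)

theorem compHom_iso_hom_app {p : VectoidHom B A} (f g : OverHom p p) (a : A) :
    (compHom f g).iso.hom.app a
      = g.hom.invImage.map (f.iso.hom.app a) ≫ g.iso.hom.app a := by
  simp [compHom]

/-- An isomorphism over `A` from an isomorphism of inverse image functors. -/
def isoMk {p : VectoidHom B A} {q : VectoidHom C A} {f g : OverHom p q}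
    (e : f.hom.invImage ≅ g.hom.invImage) (he : e.hom.IsMonoidal)
    (w : ∀ a : A, e.hom.app (q.invImage.obj a) ≫ g.iso.hom.app a = f.iso.hom.app a) : f ≅ g where
  hom := { app := e.hom, isMonoidal := he, w := w }
  inv :=
    { app := e.inv
      isMonoidal := inferInstance
      w a := by rw [← w a, ← Category.assoc, ← NatTrans.comp_app, e.inv_hom_id, NatTrans.id_app,
        Category.id_comp] }
  hom_inv_id := Hom.ext e.hom_inv_id
  inv_hom_id := Hom.ext e.inv_hom_id

/-- Horizontal composition of 2-morphisms over `A`. -/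
def compMap {p : VectoidHom B A} {f f' g g' : OverHom p p} (τ : Hom f f') (θ : Hom g g') :
    Hom (compHom f g) (compHom f' g') where
  app := τ.app ◫ θ.app
  isMonoidal := by
    have := τ.isMonoidal
    have := θ.isMonoidal
    exact NatTrans.IsMonoidal.hcomp τ.app θ.app
  w a := by
    rw [compHom_iso_hom_app, compHom_iso_hom_app, NatTrans.hcomp_app]
    change (θ.app.app (f.hom.invImage.obj (p.invImage.obj a)) ≫
      g'.hom.invImage.map (τ.app.app (p.invImage.obj a))) ≫ _ ≫ _ = _
    rw [Category.assoc, ← Functor.map_comp_assoc, τ.w, ← θ.app.naturality_assoc, θ.w]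

variable {p : VectoidHom B A}

/-- Associativity of the composition product. -/
def assocIso (f g h : OverHom p p) : compHom (compHom f g) h ≅ compHom f (compHom g h) := isoMk
    (Functor.associator f.hom.invImage g.hom.invImage h.hom.invImage)
    (inferInstanceAs (NatTrans.IsMonoidal (Functor.associator _ _ _).hom)) fun a => by
      have e : h.hom.invImage.map (g.hom.invImage.map (f.iso.hom.app a) ≫ g.iso.hom.app a) ≫
          h.iso.hom.app a = h.hom.invImage.map (g.hom.invImage.map (f.iso.hom.app a)) ≫
            h.hom.invImage.map (g.iso.hom.app a) ≫ h.iso.hom.app a := by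
        rw [Functor.map_comp, Category.assoc]
      rw [compHom_iso_hom_app, compHom_iso_hom_app, compHom_iso_hom_app, compHom_iso_hom_app]
      exact (Category.id_comp _).trans e.symm

/-- Left unitality of the composition product. -/
def leftUnitorIso (f : OverHom p p) : compHom (idHom p) f ≅ f := isoMk
    (Functor.leftUnitor f.hom.invImage)
    (inferInstanceAs (NatTrans.IsMonoidal (Functor.leftUnitor _).hom)) fun a => by
      rw [compHom_iso_hom_app]
      change 𝟙 _ ≫ _ = f.hom.invImage.map (𝟙 _) ≫ _
      rw [CategoryTheory.Functor.map_id]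

/-- Right unitality of the composition product. -/
def rightUnitorIso (f : OverHom p p) : compHom f (idHom p) ≅ f := isoMk
    (Functor.rightUnitor f.hom.invImage)
    (inferInstanceAs (NatTrans.IsMonoidal (Functor.rightUnitor _).hom)) fun a => by
      rw [compHom_iso_hom_app]
      change 𝟙 _ ≫ _ = f.iso.hom.app a ≫ 𝟙 _
      rw [Category.comp_id, Category.id_comp]

variable (p) in
/-- Endomorphisms over `A` with the composition product `f ∘ g`. -/
instance : MonoidalCategoryStruct (OverHom p p) where
  tensorObj f g := compHom f g
  tensorUnit := idHom p
  tensorHom τ θ := compMap τ θ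
  whiskerLeft f _ _ θ := compMap (𝟙 f : Hom f f) θ
  whiskerRight τ g := compMap τ (𝟙 g : Hom g g)
  associator f g h := assocIso f g h
  leftUnitor f := leftUnitorIso f
  rightUnitor f := rightUnitorIso f

theorem hom_ext' {q : VectoidHom C A} {f g : OverHom p q} {τ θ : f ⟶ g}
    (h : ∀ X, τ.app.app X = θ.app.app X) : τ = θ :=
  Hom.ext (NatTrans.ext (funext h))

variable (p) in
instance : MonoidalCategory (OverHom p p) := MonoidalCategory.ofTensorHom
  (id_tensorHom_id := fun f g => hom_ext' fun X => by
    change 𝟙 _ ≫ g.hom.invImage.map (𝟙 _) = 𝟙 _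
    rw [CategoryTheory.Functor.map_id]
    exact Category.id_comp _)
  (id_tensorHom := fun _ _ _ _ => rfl)
  (tensorHom_id := fun _ _ => rfl)
  (tensorHom_comp_tensorHom := fun τ θ τ' θ' =>
    Hom.ext (NatTrans.exchange (Hom.app τ) (Hom.app τ') (Hom.app θ) (Hom.app θ')).symm)
  (associator_naturality := fun {_ _ _ f g h} τ θ ω => hom_ext' fun X => by
    change (ω.app.app _ ≫ h.hom.invImage.map (θ.app.app _ ≫ g.hom.invImage.map (τ.app.app _))) ≫
      𝟙 _ = 𝟙 _ ≫ (ω.app.app _ ≫ h.hom.invImage.map (θ.app.app _)) ≫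
        h.hom.invImage.map (g.hom.invImage.map (τ.app.app _))
    rw [Functor.map_comp, Category.comp_id, Category.id_comp, Category.assoc])
  (leftUnitor_naturality := fun {f g} τ => hom_ext' fun X => by
    change (τ.app.app _ ≫ g.hom.invImage.map (𝟙 _)) ≫ 𝟙 _ = 𝟙 _ ≫ τ.app.app _
    rw [CategoryTheory.Functor.map_id, Category.comp_id, Category.id_comp, Category.comp_id])
  (rightUnitor_naturality := fun {f g} τ => hom_ext' fun X => by
    change (𝟙 _ ≫ τ.app.app _) ≫ 𝟙 _ = 𝟙 _ ≫ τ.app.app _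
    rw [Category.comp_id])
  (pentagon := fun f g h k => hom_ext' fun X => by
    change (𝟙 _ ≫ k.hom.invImage.map (𝟙 _)) ≫ 𝟙 _ ≫ 𝟙 _ ≫
      k.hom.invImage.map (h.hom.invImage.map (g.hom.invImage.map (𝟙 _))) = 𝟙 _ ≫ 𝟙 _
    simp only [CategoryTheory.Functor.map_id, Category.comp_id])
  (triangle := fun f g => hom_ext' fun X => by
    change 𝟙 _ ≫ 𝟙 _ ≫ g.hom.invImage.map (𝟙 _) = 𝟙 _ ≫ g.hom.invImage.map (𝟙 _)
    rw [Category.id_comp])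

end OverHom
end VectoidMorphisms

section SymmetricSequences

variable {A : Type u} [Category.{v} A] [MonoidalCategory A] [SymmetricCategory A] [Prevectoid A]

theorem hasColimitsOfShape_type (J : Type) [SmallCategory J] : HasColimitsOfShape J A :=
  have := Prevectoid.hasColimits (A := A)
  have := hasColimitsOfSizeShrink.{0, 0, v, v} A
  inferInstance
theorem preservesColimits_tensorLeft_type (J : Type) [SmallCategory J] (X : A) : PreservesColimitsOfShape J (tensorLeft X) :=
  have := Prevectoid.preservesColimits_tensorLeft X
  have := preservesColimitsOfSize_shrink.{0,v,0,v} (tensorLeft X)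
  inferInstance
theorem preservesColimits_tensorRight_type (J : Type) [SmallCategory J] (X : A) : PreservesColimitsOfShape J (tensorRight X) :=
  have := Prevectoid.preservesColimits_tensorRight X
  have := preservesColimitsOfSize_shrink.{0,v,0,v} (tensorRight X)
  inferInstance

instance (F G : NIsoᵒᵖ ⥤ A) : (tensor NIsoᵒᵖ).HasPointwiseLeftKanExtension (F ⊠ G) :=
  fun _ => (hasColimitsOfShape_type (A := A) _).has_colimit _
instance : (Functor.fromPUnit.{0} (𝟙_ NIsoᵒᵖ)).HasPointwiseLeftKanExtension
        (Functor.fromPUnit.{0} (𝟙_ A)) :=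
  fun _ => (hasColimitsOfShape_type (A := A) _).has_colimit _
instance (X : A) (d : NIsoᵒᵖ) : PreservesColimitsOfShape
      (CostructuredArrow (tensor NIsoᵒᵖ) d) (tensorLeft X) := preservesColimits_tensorLeft_type _ X
instance (X : A) (d : NIsoᵒᵖ) : PreservesColimitsOfShape
      (CostructuredArrow (tensor NIsoᵒᵖ) d) (tensorRight X) := preservesColimits_tensorRight_type _ X
instance (X : A) (d : NIsoᵒᵖ) : PreservesColimitsOfShape
      (CostructuredArrow (Functor.fromPUnit.{0} (𝟙_ NIsoᵒᵖ)) d) (tensorLeft X) := preservesColimits_tensorLeft_type _ X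
instance (X : A) (d : NIsoᵒᵖ) : PreservesColimitsOfShape
      (CostructuredArrow (Functor.fromPUnit.{0} (𝟙_ NIsoᵒᵖ)) d) (tensorRight X) := preservesColimits_tensorRight_type _ X
instance (X : A) (d : NIsoᵒᵖ × NIsoᵒᵖ) : PreservesColimitsOfShape
      (CostructuredArrow ((𝟭 NIsoᵒᵖ).prod (Functor.fromPUnit.{0} (𝟙_ NIsoᵒᵖ))) d)
        (tensorRight X) := preservesColimits_tensorRight_type _ X
instance (X : A) (d : NIsoᵒᵖ × NIsoᵒᵖ) : PreservesColimitsOfShape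
      (CostructuredArrow ((tensor NIsoᵒᵖ).prod (𝟭 NIsoᵒᵖ)) d)
        (tensorRight X) := preservesColimits_tensorRight_type _ X
variable (A) in
/-- The category `q_o A` of symmetric sequences in `A`: functors `NIsoᵒᵖ ⥤ A`, with the Day
convolution as tensor product. -/
abbrev QO := DayFunctor NIsoᵒᵖ A
instance : MonoidalCategory (QO A) := inferInstance

/-- A morphism of symmetric sequences from its underlying natural transformation. -/
abbrev QO.homMk {F G : QO A} (α : F.functor ⟶ G.functor) : F ⟶ G := DayFunctor.Hom.mk α

section
open LawfulDayConvolutionMonoidalCategoryStruct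
attribute [local instance] convolution convolution₂ convolution₂'

theorem QO.map_associator_inv (F G H : QO A) :
    (ι NIsoᵒᵖ A (QO A)).map (α_ F G H).inv
      = (DayConvolution.associator ((ι NIsoᵒᵖ A (QO A)).obj F) ((ι NIsoᵒᵖ A (QO A)).obj G)
          ((ι NIsoᵒᵖ A (QO A)).obj H)).inv := by
  have h : (ι NIsoᵒᵖ A (QO A)).mapIso (α_ F G H)
      = DayConvolution.associator ((ι NIsoᵒᵖ A (QO A)).obj F) ((ι NIsoᵒᵖ A (QO A)).obj G)
          ((ι NIsoᵒᵖ A (QO A)).obj H) :=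
    Iso.ext (ι_map_associator_hom_eq_associator_hom NIsoᵒᵖ A (QO A) F G H)
  exact congrArg Iso.inv h

/-- The symmetry of the Day convolution. -/
def QO.braiding (F G : QO A) : F ⊗ G ≅ G ⊗ F where
  hom := QO.homMk (F := F ⊗ G) (G := G ⊗ F)
    (DayConvolution.braiding ((ι NIsoᵒᵖ A (QO A)).obj F) ((ι NIsoᵒᵖ A (QO A)).obj G)).hom
  inv := QO.homMk (F := G ⊗ F) (G := F ⊗ G)
    (DayConvolution.braiding ((ι NIsoᵒᵖ A (QO A)).obj F) ((ι NIsoᵒᵖ A (QO A)).obj G)).inv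
  hom_inv_id := by
    apply (ι NIsoᵒᵖ A (QO A)).map_injective
    exact (DayConvolution.braiding ((ι NIsoᵒᵖ A (QO A)).obj F)
      ((ι NIsoᵒᵖ A (QO A)).obj G)).hom_inv_id
  inv_hom_id := by
    apply (ι NIsoᵒᵖ A (QO A)).map_injective
    exact (DayConvolution.braiding ((ι NIsoᵒᵖ A (QO A)).obj F)
      ((ι NIsoᵒᵖ A (QO A)).obj G)).inv_hom_id

theorem QO.map_braiding_hom (F G : QO A) : (ι NIsoᵒᵖ A (QO A)).map (QO.braiding F G).hom
    = (DayConvolution.braiding ((ι NIsoᵒᵖ A (QO A)).obj F) ((ι NIsoᵒᵖ A (QO A)).obj G)).hom := rfl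

theorem QO.η_braiding' (F G : QO A) (x y : NIsoᵒᵖ) :
    (DayFunctor.η F G).app (x, y) ≫ (QO.braiding F G).hom.natTrans.app (x ⊗ y)
      = (β_ (F.functor.obj x) (G.functor.obj y)).hom ≫ (DayFunctor.η G F).app (y, x) ≫
          (G ⊗ F).functor.map (β_ y x).hom := by
  have h := DayConvolution.unit_app_braiding_hom_app ((ι NIsoᵒᵖ A (QO A)).obj F)
    ((ι NIsoᵒᵖ A (QO A)).obj G) x y
  exact h

instance : SymmetricCategory (QO A) where
  braiding F G := QO.braiding F G
  braiding_naturality_right F G H f := by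
    apply (ι NIsoᵒᵖ A (QO A)).map_injective
    rw [Functor.map_comp, Functor.map_comp, ← MonoidalCategory.id_tensorHom,
      ← MonoidalCategory.tensorHom_id,
      ι_map_tensorHom_hom_eq_tensorHom, ι_map_tensorHom_hom_eq_tensorHom,
      CategoryTheory.Functor.map_id, QO.map_braiding_hom, QO.map_braiding_hom]
    exact DayConvolution.braiding_naturality_right ((ι NIsoᵒᵖ A (QO A)).obj F)
      ((ι NIsoᵒᵖ A (QO A)).map f)
  braiding_naturality_left {F G} f H := by
    apply (ι NIsoᵒᵖ A (QO A)).map_injective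
    rw [Functor.map_comp, Functor.map_comp, ← MonoidalCategory.id_tensorHom,
      ← MonoidalCategory.tensorHom_id,
      ι_map_tensorHom_hom_eq_tensorHom, ι_map_tensorHom_hom_eq_tensorHom,
      CategoryTheory.Functor.map_id, QO.map_braiding_hom, QO.map_braiding_hom]
    exact DayConvolution.braiding_naturality_left ((ι NIsoᵒᵖ A (QO A)).map f)
      ((ι NIsoᵒᵖ A (QO A)).obj H)
  hexagon_forward F G H := by
    apply (ι NIsoᵒᵖ A (QO A)).map_injective
    simp only [Functor.map_comp]
    rw [ι_map_associator_hom_eq_associator_hom, ι_map_associator_hom_eq_associator_hom,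
      ι_map_associator_hom_eq_associator_hom, ← MonoidalCategory.tensorHom_id,
      ← MonoidalCategory.id_tensorHom, ι_map_tensorHom_hom_eq_tensorHom,
      ι_map_tensorHom_hom_eq_tensorHom, CategoryTheory.Functor.map_id,
      CategoryTheory.Functor.map_id]
    exact DayConvolution.hexagon_forward ((ι NIsoᵒᵖ A (QO A)).obj F) ((ι NIsoᵒᵖ A (QO A)).obj G)
      ((ι NIsoᵒᵖ A (QO A)).obj H)
  hexagon_reverse F G H := by
    apply (ι NIsoᵒᵖ A (QO A)).map_injective
    simp only [Functor.map_comp]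
    rw [QO.map_associator_inv, QO.map_associator_inv, QO.map_associator_inv,
      ← MonoidalCategory.tensorHom_id,
      ← MonoidalCategory.id_tensorHom, ι_map_tensorHom_hom_eq_tensorHom,
      ι_map_tensorHom_hom_eq_tensorHom, CategoryTheory.Functor.map_id,
      CategoryTheory.Functor.map_id]
    exact DayConvolution.hexagon_reverse ((ι NIsoᵒᵖ A (QO A)).obj F) ((ι NIsoᵒᵖ A (QO A)).obj G)
      ((ι NIsoᵒᵖ A (QO A)).obj H)
  symmetry F G := by
    apply (ι NIsoᵒᵖ A (QO A)).map_injective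
    exact DayConvolution.symmetry ((ι NIsoᵒᵖ A (QO A)).obj F) ((ι NIsoᵒᵖ A (QO A)).obj G)

end

theorem QO.η_braiding (F G : QO A) (x y : NIsoᵒᵖ) :
    (DayFunctor.η F G).app (x, y) ≫ (β_ F G).hom.natTrans.app (x ⊗ y)
      = (β_ (F.functor.obj x) (G.functor.obj y)).hom ≫ (DayFunctor.η G F).app (y, x) ≫
          (G ⊗ F).functor.map (β_ y x).hom :=
  QO.η_braiding' F G x y

instance (J : Type) : HasCoproductsOfShape J A := hasColimitsOfShape_type _

/-- Maps out of a tensor product of two coproducts. -/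
def sigmaTensorDesc {I J : Type} {f : I → A} {g : J → A} {Z : A}
    (φ : ∀ i j, f i ⊗ g j ⟶ Z) : (∐ f) ⊗ (∐ g) ⟶ Z :=
  have := preservesColimits_tensorRight_type (Discrete I) (∐ g)
  (PreservesCoproduct.iso (tensorRight (∐ g)) f).hom ≫ Sigma.desc (fun i =>
    have := preservesColimits_tensorLeft_type (Discrete J) (f i)
    (PreservesCoproduct.iso (tensorLeft (f i)) g).hom ≫ Sigma.desc (fun j => φ i j))

theorem ι_sigmaTensorDesc {I J : Type} {f : I → A} {g : J → A} {Z : A}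
    (φ : ∀ i j, f i ⊗ g j ⟶ Z) (i : I) (j : J) :
    (Sigma.ι f i ⊗ₘ Sigma.ι g j) ≫ sigmaTensorDesc φ = φ i j := by
  have := preservesColimits_tensorRight_type (Discrete I) (∐ g)
  have := preservesColimits_tensorLeft_type (Discrete J) (f i)
  have h1 : Sigma.ι f i ▷ (∐ g) ≫ (PreservesCoproduct.iso (tensorRight (∐ g)) f).hom
      = Sigma.ι (fun i => f i ⊗ (∐ g)) i := by
    rw [← Iso.eq_comp_inv, PreservesCoproduct.inv_hom]
    exact (ι_comp_sigmaComparison (tensorRight (∐ g)) f i).symm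
  have h2 : f i ◁ Sigma.ι g j ≫ (PreservesCoproduct.iso (tensorLeft (f i)) g).hom
      = Sigma.ι (fun j => f i ⊗ g j) j := by
    rw [← Iso.eq_comp_inv, PreservesCoproduct.inv_hom]
    exact (ι_comp_sigmaComparison (tensorLeft (f i)) g j).symm
  rw [MonoidalCategory.tensorHom_def', sigmaTensorDesc, Category.assoc, reassoc_of% h1]
  erw [Sigma.ι_desc]
  rw [reassoc_of% h2]
  erw [Sigma.ι_desc]

theorem sigmaTensor_hom_ext {I J : Type} {f : I → A} {g : J → A} {Z : A}
    {φ ψ : (∐ f) ⊗ (∐ g) ⟶ Z}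
    (h : ∀ i j, (Sigma.ι f i ⊗ₘ Sigma.ι g j) ≫ φ = (Sigma.ι f i ⊗ₘ Sigma.ι g j) ≫ ψ) : φ = ψ := by
  have := preservesColimits_tensorRight_type (Discrete I) (∐ g)
  rw [← cancel_epi (PreservesCoproduct.iso (tensorRight (∐ g)) f).inv]
  apply Sigma.hom_ext
  intro i
  have := preservesColimits_tensorLeft_type (Discrete J) (f i)
  rw [← cancel_epi (PreservesCoproduct.iso (tensorLeft (f i)) g).inv]
  apply Sigma.hom_ext
  intro j
  rw [PreservesCoproduct.inv_hom, PreservesCoproduct.inv_hom]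
  have h1 := ι_comp_sigmaComparison (tensorRight (∐ g)) f i
  have h2 := ι_comp_sigmaComparison (tensorLeft (f i)) g j
  rw [reassoc_of% h1]
  erw [reassoc_of% h2]
  erw [reassoc_of% h2]
  rw [reassoc_of% h1]
  have := h i j
  rw [MonoidalCategory.tensorHom_def', Category.assoc, Category.assoc] at this
  exact this

namespace QO

/-- The symmetric sequence `a · h_n`, the copower of `a` with the presheaf represented by `n`. -/
def mono (a : A) (n : NIso) : QO A where
  functor :=
    { obj m := ∐ fun _ : (m.unop ⟶ n) => a
      map f := Sigma.desc fun g => Sigma.ι (fun _ => a) (f.unop ≫ g) }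

/-- The universal element of `a · h_n`. -/
def monoι (a : A) (n : NIso) : a ⟶ (mono a n).functor.obj (op n) :=
  Sigma.ι (fun _ : (n ⟶ n) => a) (𝟙 n)

theorem monoι_map (a : A) (n : NIso) {m : NIso} (g : m ⟶ n) :
    monoι a n ≫ (mono a n).functor.map g.op = Sigma.ι (fun _ : (m ⟶ n) => a) g := by
  dsimp [monoι, mono]
  rw [Sigma.ι_desc, Category.comp_id]

/-- The morphism `a · h_n ⟶ Z` given by a morphism `a ⟶ Z_n`. -/
def monoDesc {a : A} {n : NIso} {Z : QO A} (φ : a ⟶ Z.functor.obj (op n)) : mono a n ⟶ Z :=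
  homMk
    { app m := Sigma.desc fun g : (m.unop ⟶ n) => φ ≫ Z.functor.map g.op
      naturality m m' f := by
        apply Sigma.hom_ext
        intro g
        simp [mono] }

theorem monoι_monoDesc {a : A} {n : NIso} {Z : QO A} (φ : a ⟶ Z.functor.obj (op n)) :
    monoι a n ≫ (monoDesc φ).natTrans.app (op n) = φ := by
  dsimp only [monoι, monoDesc]
  erw [Sigma.ι_desc]
  simp

theorem mono_hom_ext {a : A} {n : NIso} {Z : QO A} {α β : mono a n ⟶ Z}
    (h : monoι a n ≫ α.natTrans.app (op n) = monoι a n ≫ β.natTrans.app (op n)) : α = β := by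
  apply DayFunctor.hom_ext
  ext m
  apply Sigma.hom_ext
  intro (g : m.unop ⟶ n)
  have h1 := α.natTrans.naturality g.op
  have h2 := β.natTrans.naturality g.op
  have h3 := monoι_map a n g
  dsimp at h1 h2 h3
  change _ ≫ α.natTrans.app (op m.unop) = _ ≫ β.natTrans.app (op m.unop)
  erw [← h3]
  rw [Category.assoc, Category.assoc, h1, h2, reassoc_of% h]

end QO
namespace QO

theorem η_naturality (F G : QO A) {x x' y y' : NIsoᵒᵖ} (f : x ⟶ x') (g : y ⟶ y') :
    (F.functor.map f ⊗ₘ G.functor.map g) ≫ (DayFunctor.η F G).app (x', y')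
      = (DayFunctor.η F G).app (x, y) ≫ (F ⊗ G).functor.map (f ⊗ₘ g) := by
  have h := (DayFunctor.η F G).naturality (X := (x, y)) (Y := (x', y')) (Prod.mkHom f g)
  dsimp at h
  rw [← MonoidalCategory.tensorHom_def] at h
  exact h

open LawfulDayConvolutionMonoidalCategoryStruct in
theorem η_tensorHom {F F' G G' : QO A} (f : F ⟶ F') (g : G ⟶ G') (x y : NIsoᵒᵖ) :
    (DayFunctor.η F G).app (x, y) ≫ (f ⊗ₘ g).natTrans.app (x ⊗ y)
      = (f.natTrans.app x ⊗ₘ g.natTrans.app y) ≫ (DayFunctor.η F' G').app (x, y) :=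
  convolutionExtensionUnit_comp_ι_map_tensorHom_app NIsoᵒᵖ A f g x y

theorem η_whiskerRight {F F' : QO A} (f : F ⟶ F') (G : QO A) (x y : NIsoᵒᵖ) :
    (DayFunctor.η F G).app (x, y) ≫ (f ▷ G).natTrans.app (x ⊗ y)
      = f.natTrans.app x ▷ G.functor.obj y ≫ (DayFunctor.η F' G).app (x, y) := by
  rw [← MonoidalCategory.tensorHom_id, η_tensorHom, ← MonoidalCategory.tensorHom_id]
  rfl

theorem η_whiskerLeft (F : QO A) {G G' : QO A} (g : G ⟶ G') (x y : NIsoᵒᵖ) :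
    (DayFunctor.η F G).app (x, y) ≫ (F ◁ g).natTrans.app (x ⊗ y)
      = F.functor.obj x ◁ g.natTrans.app y ≫ (DayFunctor.η F G').app (x, y) := by
  rw [← MonoidalCategory.id_tensorHom, η_tensorHom, ← MonoidalCategory.id_tensorHom]
  rfl

open LawfulDayConvolutionMonoidalCategoryStruct in
theorem η_associator (F G H : QO A) (x y z : NIsoᵒᵖ) :
    (DayFunctor.η F G).app (x, y) ▷ H.functor.obj z ≫ (DayFunctor.η (F ⊗ G) H).app (x ⊗ y, z) ≫
        (α_ F G H).hom.natTrans.app ((x ⊗ y) ⊗ z)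
      = (α_ _ _ _).hom ≫ F.functor.obj x ◁ (DayFunctor.η G H).app (y, z) ≫
          (DayFunctor.η F (G ⊗ H)).app (x, y ⊗ z) ≫
            (F ⊗ G ⊗ H).functor.map (α_ x y z).inv :=
  associator_hom_unit_unit A F G H x y z

open LawfulDayConvolutionMonoidalCategoryStruct in
theorem η_leftUnitor (F : QO A) (y : NIsoᵒᵖ) :
    DayFunctor.ν NIsoᵒᵖ A ▷ F.functor.obj y ≫ (DayFunctor.η (𝟙_ (QO A)) F).app (𝟙_ NIsoᵒᵖ, y) ≫
        (λ_ F).hom.natTrans.app (𝟙_ NIsoᵒᵖ ⊗ y)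
      = (λ_ (F.functor.obj y)).hom ≫ F.functor.map (λ_ y).inv :=
  leftUnitor_hom_unit_app A F y

open LawfulDayConvolutionMonoidalCategoryStruct in
theorem η_rightUnitor (F : QO A) (y : NIsoᵒᵖ) :
    F.functor.obj y ◁ DayFunctor.ν NIsoᵒᵖ A ≫ (DayFunctor.η F (𝟙_ (QO A))).app (y, 𝟙_ NIsoᵒᵖ) ≫
        (ρ_ F).hom.natTrans.app (y ⊗ 𝟙_ NIsoᵒᵖ)
      = (ρ_ (F.functor.obj y)).hom ≫ F.functor.map (ρ_ y).inv :=
  rightUnitor_hom_unit_app A F y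

theorem ι_map (a : A) (n : NIso) {m m' : NIsoᵒᵖ} (f : m ⟶ m') (g : m.unop ⟶ n) :
    Sigma.ι (fun _ : (m.unop ⟶ n) => a) g ≫ (mono a n).functor.map f
      = Sigma.ι (fun _ : (m'.unop ⟶ n) => a) (f.unop ≫ g) := by
  dsimp [mono]
  erw [Sigma.ι_desc]

/-- `(a · h_m) ⊗ (b · h_n) ⟶ (a ⊗ b) · h_{m ⊔ n}` -/
def monoTensor (a b : A) (m n : NIso) : mono a m ⊗ mono b n ⟶ mono (a ⊗ b) (m ⊗ n) :=
  DayFunctor.tensorDesc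
    { app p := sigmaTensorDesc (f := fun _ : (p.1.unop ⟶ m) => a) (g := fun _ : (p.2.unop ⟶ n) => b)
        fun g h => Sigma.ι (fun _ : (p.1.unop ⊗ p.2.unop ⟶ m ⊗ n) => a ⊗ b) (g ⊗ₘ h)
      naturality p q f := by
        apply sigmaTensor_hom_ext (f := fun _ : (p.1.unop ⟶ m) => a)
          (g := fun _ : (p.2.unop ⟶ n) => b)
        intro g h
        have h1 := ι_map a m f.1 g
        have h2 := ι_map b n f.2 h
        have h3 := ι_map (a ⊗ b) (m ⊗ n) (f.1 ⊗ₘ f.2) (g ⊗ₘ h)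
        change _ ≫ ((mono a m).functor.map f.1 ▷ _ ≫ _ ◁ (mono b n).functor.map f.2) ≫ _
          = _ ≫ _ ≫ (mono (a ⊗ b) (m ⊗ n)).functor.map (f.1 ⊗ₘ f.2)
        rw [← MonoidalCategory.tensorHom_def]
        erw [MonoidalCategory.tensorHom_comp_tensorHom_assoc, h1, h2]
        erw [ι_sigmaTensorDesc]
        erw [← Category.assoc, ι_sigmaTensorDesc, h3]
        rw [← MonoidalCategory.tensorHom_comp_tensorHom]
        rfl }

/-- The inverse of `monoTensor`. -/
def monoTensorInv (a b : A) (m n : NIso) : mono (a ⊗ b) (m ⊗ n) ⟶ mono a m ⊗ mono b n :=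
  monoDesc ((monoι a m ⊗ₘ monoι b n) ≫ (DayFunctor.η (mono a m) (mono b n)).app (op m, op n))

theorem monoι_η_monoTensor (a b : A) (m n : NIso) :
    (monoι a m ⊗ₘ monoι b n) ≫ (DayFunctor.η (mono a m) (mono b n)).app (op m, op n) ≫
      (monoTensor a b m n).natTrans.app (op m ⊗ op n) = monoι (a ⊗ b) (m ⊗ n) := by
  rw [monoTensor, DayFunctor.η_comp_tensorDesc_app]
  refine (ι_sigmaTensorDesc _ _ _).trans ?_
  rw [MonoidalCategory.id_tensorHom_id]
  rfl

theorem monoTensorInv_monoTensor (a b : A) (m n : NIso) :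
    monoTensorInv a b m n ≫ monoTensor a b m n = 𝟙 _ := by
  apply mono_hom_ext
  have h := monoι_η_monoTensor a b m n
  dsimp
  erw [reassoc_of% @monoι_monoDesc, Category.assoc, h, Category.comp_id]

theorem monoTensor_hom_ext {a b : A} {m n : NIso} {Z : QO A} {α β : mono a m ⊗ mono b n ⟶ Z}
    (H : (monoι a m ⊗ₘ monoι b n) ≫ (DayFunctor.η (mono a m) (mono b n)).app (op m, op n) ≫
        α.natTrans.app (op m ⊗ op n)
      = (monoι a m ⊗ₘ monoι b n) ≫ (DayFunctor.η (mono a m) (mono b n)).app (op m, op n) ≫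
        β.natTrans.app (op m ⊗ op n)) : α = β := by
  apply DayFunctor.tensor_hom_ext
  intro x y
  apply sigmaTensor_hom_ext (f := fun _ : (x.unop ⟶ m) => a)
          (g := fun _ : (y.unop ⟶ n) => b)
  intro g h
  have h4 := η_naturality (mono a m) (mono b n) g.op h.op
  have key : ∀ (γ : mono a m ⊗ mono b n ⟶ Z),
      ((monoι a m ≫ (mono a m).functor.map g.op) ⊗ₘ (monoι b n ≫ (mono b n).functor.map h.op)) ≫
        (DayFunctor.η (mono a m) (mono b n)).app (x, y) ≫ γ.natTrans.app (x ⊗ y)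
      = ((monoι a m ⊗ₘ monoι b n) ≫ (DayFunctor.η (mono a m) (mono b n)).app (op m, op n) ≫
        γ.natTrans.app (op m ⊗ op n)) ≫ Z.functor.map (g.op ⊗ₘ h.op) := by
    intro γ
    rw [← MonoidalCategory.tensorHom_comp_tensorHom, Category.assoc, Category.assoc,
      Category.assoc]
    erw [reassoc_of% h4]
    erw [γ.natTrans.naturality (g.op ⊗ₘ h.op)]
  rw [monoι_map, monoι_map] at key
  exact (key α).trans ((congrArg (· ≫ _) H).trans (key β).symm)

theorem monoTensor_monoTensorInv (a b : A) (m n : NIso) :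
    monoTensor a b m n ≫ monoTensorInv a b m n = 𝟙 _ := by
  apply monoTensor_hom_ext
  have h := monoι_η_monoTensor a b m n
  dsimp
  rw [reassoc_of% h]
  erw [monoι_monoDesc, Category.comp_id]

/-- `(a · h_m) ⊗ (b · h_n) ≅ (a ⊗ b) · h_{m ⊔ n}` -/
def monoTensorIso (a b : A) (m n : NIso) : mono a m ⊗ mono b n ≅ mono (a ⊗ b) (m ⊗ n) where
  hom := monoTensor a b m n
  inv := monoTensorInv a b m n
  hom_inv_id := monoTensor_monoTensorInv a b m n
  inv_hom_id := monoTensorInv_monoTensor a b m n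

/-- The functoriality of `a · h_n` in `a` and `n`. -/
def monoMap {a b : A} {m n : NIso} (f : a ⟶ b) (g : m ⟶ n) : mono a m ⟶ mono b n :=
  monoDesc (f ≫ monoι b n ≫ (mono b n).functor.map g.op)

theorem monoι_monoMap {a b : A} {m n : NIso} (f : a ⟶ b) (g : m ⟶ n) :
    monoι a m ≫ (monoMap f g).natTrans.app (op m)
      = f ≫ monoι b n ≫ (mono b n).functor.map g.op := monoι_monoDesc _

theorem monoMap_comp {a b c : A} {l m n : NIso} (f : a ⟶ b) (g : l ⟶ m) (f' : b ⟶ c) (g' : m ⟶ n) :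
    monoMap f g ≫ monoMap f' g' = monoMap (f ≫ f') (g ≫ g') := by
  apply mono_hom_ext
  have := (monoMap f' g').natTrans.naturality g.op
  dsimp
  rw [reassoc_of% @monoι_monoMap, monoι_monoMap, this, reassoc_of% @monoι_monoMap]
  simp

theorem monoMap_id (a : A) (n : NIso) : monoMap (𝟙 a) (𝟙 n) = 𝟙 (mono a n) := by
  apply mono_hom_ext
  rw [monoι_monoMap]
  simp

variable (A) in
/-- The functor `a ↦ a · h_0 = (a, ∅, ∅, …)`. -/
def const : A ⥤ QO A where
  obj a := mono a (𝟙_ NIso)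
  map f := monoMap f (𝟙 _)
  map_id a := monoMap_id a _
  map_comp f g := by rw [monoMap_comp, Category.comp_id]

variable (A) in
/-- The functor `X ↦ X_n`. -/
def eval (n : NIso) : QO A ⥤ A :=
  (DayFunctor.equiv NIsoᵒᵖ A).functor ⋙ (evaluation _ _).obj (op n)

/-- Maps `a · h_n ⟶ Z` are maps `a ⟶ Z_n`. -/
def monoHomEquiv (a : A) (n : NIso) (Z : QO A) : (mono a n ⟶ Z) ≃ (a ⟶ Z.functor.obj (op n)) where
  toFun α := monoι a n ≫ α.natTrans.app (op n)
  invFun φ := monoDesc φ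
  left_inv _ := mono_hom_ext (monoι_monoDesc _)
  right_inv φ := monoι_monoDesc φ

variable (A) in
/-- The functor `a ↦ (a, ∅, ∅, …)` is left adjoint to `X ↦ X_0`. -/
def constAdj : const A ⊣ eval A (𝟙_ NIso) :=
  Adjunction.mkOfHomEquiv
    { homEquiv a F := monoHomEquiv a (𝟙_ NIso) F
      homEquiv_naturality_left_symm f φ := by
        apply mono_hom_ext
        change monoι _ _ ≫ (monoDesc (f ≫ φ)).natTrans.app _
          = monoι _ _ ≫ (monoMap f (𝟙 _)).natTrans.app _ ≫ (monoDesc φ).natTrans.app _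
        erw [monoι_monoDesc, reassoc_of% @monoι_monoMap]
        erw [CategoryTheory.Functor.map_id, Category.id_comp, monoι_monoDesc]
      homEquiv_naturality_right α β := (Category.assoc _ _ _).symm }

open Functor

/-- The oplax structure map of `a ↦ a · h_0`. -/
def constδ (a b : A) : (const A).obj (a ⊗ b) ⟶ (const A).obj a ⊗ (const A).obj b :=
  monoDesc ((monoι a (𝟙_ NIso) ⊗ₘ monoι b (𝟙_ NIso)) ≫
    (DayFunctor.η (mono a (𝟙_ NIso)) (mono b (𝟙_ NIso))).app (𝟙_ NIsoᵒᵖ, 𝟙_ NIsoᵒᵖ) ≫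
      (mono a (𝟙_ NIso) ⊗ mono b (𝟙_ NIso)).functor.map (λ_ (𝟙_ NIsoᵒᵖ)).hom)

theorem monoι_constδ (a b : A) : monoι (a ⊗ b) (𝟙_ NIso) ≫ (constδ a b).natTrans.app (𝟙_ NIsoᵒᵖ)
    = (monoι a (𝟙_ NIso) ⊗ₘ monoι b (𝟙_ NIso)) ≫
    (DayFunctor.η (mono a (𝟙_ NIso)) (mono b (𝟙_ NIso))).app (𝟙_ NIsoᵒᵖ, 𝟙_ NIsoᵒᵖ) ≫
      (mono a (𝟙_ NIso) ⊗ mono b (𝟙_ NIso)).functor.map (λ_ (𝟙_ NIsoᵒᵖ)).hom :=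
  monoι_monoDesc _

/-- The universal element of `a · h_0`. -/
def constι (a : A) : a ⟶ ((const A).obj a).functor.obj (𝟙_ NIsoᵒᵖ) := monoι a (𝟙_ NIso)

theorem const_hom_ext {a : A} {Z : QO A} {α β : (const A).obj a ⟶ Z}
    (h : constι a ≫ α.natTrans.app (𝟙_ NIsoᵒᵖ) = constι a ≫ β.natTrans.app (𝟙_ NIsoᵒᵖ)) : α = β :=
  mono_hom_ext h

theorem constι_map {a b : A} (f : a ⟶ b) :
    constι a ≫ ((const A).map f).natTrans.app (𝟙_ NIsoᵒᵖ) = f ≫ constι b := by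
  refine (monoι_monoMap f (𝟙 _)).trans ?_
  erw [CategoryTheory.Functor.map_id, Category.comp_id]
  rfl

theorem constι_constδ (a b : A) : constι (a ⊗ b) ≫ (constδ a b).natTrans.app (𝟙_ NIsoᵒᵖ)
    = (constι a ⊗ₘ constι b) ≫
    (DayFunctor.η ((const A).obj a) ((const A).obj b)).app (𝟙_ NIsoᵒᵖ, 𝟙_ NIsoᵒᵖ) ≫
      ((const A).obj a ⊗ (const A).obj b).functor.map (λ_ (𝟙_ NIsoᵒᵖ)).hom :=
  monoι_monoDesc _

/-- The unit structure map of `a ↦ a · h_0`. -/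
def constη : (const A).obj (𝟙_ A) ⟶ 𝟙_ (QO A) := monoDesc (DayFunctor.ν NIsoᵒᵖ A)

theorem constι_constη : constι (𝟙_ A) ≫ constη.natTrans.app (𝟙_ NIsoᵒᵖ) = DayFunctor.ν NIsoᵒᵖ A :=
  monoι_monoDesc _

instance : IsIso (constη (A := A)) := by
  refine ⟨DayFunctor.unitDesc (constι (𝟙_ A)), ?_, ?_⟩
  · apply const_hom_ext
    dsimp
    rw [reassoc_of% @constι_constη, DayFunctor.ν_comp_unitDesc, Category.comp_id]
  · apply DayFunctor.unit_hom_ext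
    dsimp
    rw [DayFunctor.ν_comp_unitDesc_assoc, constι_constη, Category.comp_id]

theorem constδ_eq (a b : A) :
    constδ a b = monoMap (𝟙 _) (λ_ (𝟙_ NIso)).inv ≫ monoTensorInv a b _ _ := by
  apply const_hom_ext
  rw [constι_constδ]
  have := (monoTensorInv a b (𝟙_ NIso) (𝟙_ NIso)).natTrans.naturality (λ_ (𝟙_ NIso)).inv.op
  erw [reassoc_of% @monoι_monoMap, Category.id_comp, this]
  erw [reassoc_of% @monoι_monoDesc]
  exact (Category.assoc _ _ _).symm

instance (a b : A) : IsIso (constδ a b) := by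
  rw [constδ_eq]
  have : IsIso (monoMap (𝟙 (a ⊗ b)) (λ_ (𝟙_ NIso)).inv) :=
    ⟨monoMap (𝟙 _) (λ_ (𝟙_ NIso)).hom, by rw [monoMap_comp]; simp [monoMap_id], by
      rw [monoMap_comp]; simp [monoMap_id]⟩
  have : IsIso (monoTensorInv a b (𝟙_ NIso) (𝟙_ NIso)) :=
    (monoTensorIso a b (𝟙_ NIso) (𝟙_ NIso)).isIso_inv
  exact IsIso.comp_isIso' ‹_› ‹_›

end QO
namespace QO
open Functor

theorem constι_constδ_app {a b : A} {Z : QO A} (γ : (const A).obj a ⊗ (const A).obj b ⟶ Z) :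
    constι (a ⊗ b) ≫ (constδ a b).natTrans.app (𝟙_ NIsoᵒᵖ) ≫ γ.natTrans.app (𝟙_ NIsoᵒᵖ)
    = (constι a ⊗ₘ constι b) ≫
    (DayFunctor.η ((const A).obj a) ((const A).obj b)).app (𝟙_ NIsoᵒᵖ, 𝟙_ NIsoᵒᵖ) ≫
      γ.natTrans.app (𝟙_ NIsoᵒᵖ ⊗ 𝟙_ NIsoᵒᵖ) ≫ Z.functor.map (λ_ (𝟙_ NIsoᵒᵖ)).hom := by
  rw [reassoc_of% @constι_constδ, γ.natTrans.naturality]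
  rfl

theorem map_whiskerRight_η (F G : QO A) {x x' : NIsoᵒᵖ} (f : x ⟶ x') (y : NIsoᵒᵖ) :
    F.functor.map f ▷ G.functor.obj y ≫ (DayFunctor.η F G).app (x', y)
      = (DayFunctor.η F G).app (x, y) ≫ (F ⊗ G).functor.map (f ▷ y) := by
  have := η_naturality F G f (𝟙 y)
  rwa [CategoryTheory.Functor.map_id, MonoidalCategory.tensorHom_id,
    MonoidalCategory.tensorHom_id] at this

theorem map_whiskerLeft_η (F G : QO A) (x : NIsoᵒᵖ) {y y' : NIsoᵒᵖ} (g : y ⟶ y') :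
    F.functor.obj x ◁ G.functor.map g ≫ (DayFunctor.η F G).app (x, y')
      = (DayFunctor.η F G).app (x, y) ≫ (F ⊗ G).functor.map (x ◁ g) := by
  have := η_naturality F G (𝟙 x) g
  rwa [CategoryTheory.Functor.map_id, MonoidalCategory.id_tensorHom,
    MonoidalCategory.id_tensorHom] at this

theorem const_natural_left {a b : A} (f : a ⟶ b) (c : A) :
    constδ a c ≫ (const A).map f ▷ (const A).obj c = (const A).map (f ▷ c) ≫ constδ b c := by
  apply const_hom_ext
  simp only [DayFunctor.comp_natTrans, NatTrans.comp_app]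
  rw [constι_constδ_app, reassoc_of% @constι_map, constι_constδ, reassoc_of% @η_whiskerRight,
    ← MonoidalCategory.tensorHom_id, ← MonoidalCategory.tensorHom_id,
    MonoidalCategory.tensorHom_comp_tensorHom_assoc,
    MonoidalCategory.tensorHom_comp_tensorHom_assoc, constι_map, Category.comp_id,
    Category.id_comp]

theorem const_natural_right (c : A) {a b : A} (f : a ⟶ b) :
    constδ c a ≫ (const A).obj c ◁ (const A).map f = (const A).map (c ◁ f) ≫ constδ c b := by
  apply const_hom_ext
  simp only [DayFunctor.comp_natTrans, NatTrans.comp_app]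
  rw [constι_constδ_app, reassoc_of% @constι_map, constι_constδ, reassoc_of% @η_whiskerLeft,
    ← MonoidalCategory.id_tensorHom, ← MonoidalCategory.id_tensorHom,
    MonoidalCategory.tensorHom_comp_tensorHom_assoc,
    MonoidalCategory.tensorHom_comp_tensorHom_assoc, constι_map, Category.comp_id,
    Category.id_comp]

theorem const_associativity (a b c : A) :
    constδ (a ⊗ b) c ≫ constδ a b ▷ (const A).obj c ≫ (α_ _ _ _).hom
      = (const A).map (α_ a b c).hom ≫ constδ a (b ⊗ c) ≫ (const A).obj a ◁ constδ b c := by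
  apply const_hom_ext
  simp only [DayFunctor.comp_natTrans, NatTrans.comp_app]
  have h1 := constι_constδ_app (a := a ⊗ b) (b := c)
    (constδ a b ▷ (const A).obj c ≫ (α_ _ _ _).hom)
  simp only [DayFunctor.comp_natTrans, NatTrans.comp_app, Category.assoc] at h1
  rw [h1, reassoc_of% @constι_map, constι_constδ_app, reassoc_of% @η_whiskerRight, reassoc_of% @η_whiskerLeft]
  rw [← MonoidalCategory.tensorHom_id, ← MonoidalCategory.id_tensorHom,
    MonoidalCategory.tensorHom_comp_tensorHom_assoc,
    MonoidalCategory.tensorHom_comp_tensorHom_assoc, constι_constδ, constι_constδ,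
    Category.comp_id, Category.comp_id]
  have e1 : ∀ {a b c d e f : A} (p : a ⟶ b) (q : b ⟶ c) (r : c ⟶ d) (s : e ⟶ f),
      (p ≫ q ≫ r) ⊗ₘ s = (p ⊗ₘ s) ≫ q ▷ _ ≫ r ▷ _ := by
    intros
    rw [← MonoidalCategory.tensorHom_id, ← MonoidalCategory.tensorHom_id,
      MonoidalCategory.tensorHom_comp_tensorHom, MonoidalCategory.tensorHom_comp_tensorHom]
    simp
  have e2 : ∀ {a b c d e f : A} (p : a ⟶ b) (q : b ⟶ c) (r : c ⟶ d) (s : e ⟶ f),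
      s ⊗ₘ (p ≫ q ≫ r) = (s ⊗ₘ p) ≫ _ ◁ q ≫ _ ◁ r := by
    intros
    rw [← MonoidalCategory.id_tensorHom, ← MonoidalCategory.id_tensorHom,
      MonoidalCategory.tensorHom_comp_tensorHom, MonoidalCategory.tensorHom_comp_tensorHom]
    simp
  rw [e1, e2]
  have n1 := map_whiskerRight_η ((const A).obj a ⊗ (const A).obj b) ((const A).obj c)
    (λ_ (𝟙_ NIsoᵒᵖ)).hom (𝟙_ NIsoᵒᵖ)
  have n2 := map_whiskerLeft_η ((const A).obj a) ((const A).obj b ⊗ (const A).obj c)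
    (𝟙_ NIsoᵒᵖ) (λ_ (𝟙_ NIsoᵒᵖ)).hom
  simp only [Category.assoc]
  rw [reassoc_of% n1, reassoc_of% n2]
  have n3 := (α_ ((const A).obj a) ((const A).obj b) ((const A).obj c)).hom.natTrans.naturality
    ((λ_ (𝟙_ NIsoᵒᵖ)).hom ▷ (𝟙_ NIsoᵒᵖ))
  rw [reassoc_of% n3, reassoc_of% @η_associator, MonoidalCategory.associator_naturality_assoc]
  rw [← Functor.map_comp, ← Functor.map_comp, ← Functor.map_comp]
  congr 5

theorem const_left_unitality (a : A) :
    (λ_ ((const A).obj a)).inv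
      = (const A).map (λ_ a).inv ≫ constδ (𝟙_ A) a ≫ constη ▷ (const A).obj a := by
  rw [← cancel_mono (λ_ ((const A).obj a)).hom, Iso.inv_hom_id]
  apply const_hom_ext
  simp only [DayFunctor.comp_natTrans, NatTrans.comp_app, Category.assoc]
  have h1 := constι_constδ_app (a := 𝟙_ A) (b := a)
    (constη ▷ (const A).obj a ≫ (λ_ ((const A).obj a)).hom)
  simp only [DayFunctor.comp_natTrans, NatTrans.comp_app, Category.assoc] at h1
  rw [reassoc_of% @constι_map, h1, reassoc_of% @η_whiskerRight, ← MonoidalCategory.tensorHom_id,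
    MonoidalCategory.tensorHom_comp_tensorHom_assoc, constι_constη, Category.comp_id,
    MonoidalCategory.tensorHom_def', Category.assoc, reassoc_of% @η_leftUnitor, ← Functor.map_comp]
  simp

theorem const_right_unitality (a : A) :
    (ρ_ ((const A).obj a)).inv
      = (const A).map (ρ_ a).inv ≫ constδ a (𝟙_ A) ≫ (const A).obj a ◁ constη := by
  rw [← cancel_mono (ρ_ ((const A).obj a)).hom, Iso.inv_hom_id]
  apply const_hom_ext
  simp only [DayFunctor.comp_natTrans, NatTrans.comp_app, Category.assoc]
  have h1 := constι_constδ_app (a := a) (b := 𝟙_ A)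
    ((const A).obj a ◁ constη ≫ (ρ_ ((const A).obj a)).hom)
  simp only [DayFunctor.comp_natTrans, NatTrans.comp_app, Category.assoc] at h1
  rw [reassoc_of% @constι_map, h1, reassoc_of% @η_whiskerLeft, ← MonoidalCategory.id_tensorHom,
    MonoidalCategory.tensorHom_comp_tensorHom_assoc, constι_constη, Category.comp_id,
    MonoidalCategory.tensorHom_def, Category.assoc, reassoc_of% @η_rightUnitor, ← Functor.map_comp,
    MonoidalCategory.unitors_equal]
  simp

instance : (const A).OplaxMonoidal where
  η := constη
  δ := constδ
  δ_natural_left f b := const_natural_left f b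
  δ_natural_right a f := const_natural_right a f
  oplax_associativity a b c := const_associativity a b c
  oplax_left_unitality a := const_left_unitality a
  oplax_right_unitality a := const_right_unitality a

instance : (const A).Monoidal :=
  have : IsIso (OplaxMonoidal.η (const A)) := inferInstanceAs (IsIso constη)
  have : ∀ a b, IsIso (OplaxMonoidal.δ (const A) a b) :=
    fun a b => inferInstanceAs (IsIso (constδ a b))
  .ofOplaxMonoidal (const A)

theorem constδ_braiding (a b : A) :
    constδ a b ≫ (β_ _ _).hom = (const A).map (β_ a b).hom ≫ constδ b a := by
  apply const_hom_ext
  simp only [DayFunctor.comp_natTrans, NatTrans.comp_app]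
  rw [constι_constδ_app, reassoc_of% @constι_map, constι_constδ]
  have := η_braiding ((const A).obj a) ((const A).obj b) (𝟙_ _) (𝟙_ _)
  rw [reassoc_of% this, BraidedCategory.braiding_naturality_assoc, ← Functor.map_comp]
  rw [braiding_leftUnitor, MonoidalCategory.unitors_equal]

instance : (const A).Braided where
  braided a b := by
    have := constδ_braiding a b
    rw [← cancel_epi (constδ a b)]
    have h1 : ∀ a b : A, constδ a b ≫ LaxMonoidal.μ (const A) a b = 𝟙 _ :=
      fun a b => Monoidal.δ_μ (const A) a b
    rw [reassoc_of% h1, reassoc_of% this, h1, Category.comp_id]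

end QO
/-- The bijection `⊔ Fin (p i) ≃ ⊔ Fin (q i)` of ordered disjoint unions given by bijections of the
blocks. -/
def blockSum {s : ℕ} {p q : Fin s → ℕ} (τ : ∀ i, Fin (p i) ≃ Fin (q i)) :
    Fin (∑ i, p i) ≃ Fin (∑ i, q i) :=
  finSigmaFinEquiv.symm.trans ((Equiv.sigmaCongrRight τ).trans finSigmaFinEquiv)

/-- The permutation of blocks `⊔ Fin (p (σ i)) ≃ ⊔ Fin (p i)`, which takes the block `i` of the
source to the block `σ i` of the target and preserves the order inside every block. -/
def blockPerm {s : ℕ} (σ : Equiv.Perm (Fin s)) (p : Fin s → ℕ) :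
    Fin (∑ i, p (σ i)) ≃ Fin (∑ i, p i) :=
  finSigmaFinEquiv.symm.trans
    ((Equiv.sigmaCongrLeft (β := fun i => Fin (p i)) σ).trans finSigmaFinEquiv)

namespace QO

/-- The term `X_n` of a symmetric sequence. -/
abbrev term (X : QO A) (n : ℕ) : A := X.functor.obj (op ⟨n⟩)

/-- The (contravariant) action of a bijection on a symmetric sequence; for `m = n` this is the right
action of the symmetric group. -/
abbrev act (X : QO A) {m n : ℕ} (σ : Fin m ≃ Fin n) : X.term n ⟶ X.term m :=
  X.functor.map (Quiver.Hom.op (X := (⟨m⟩ : NIso)) (Y := ⟨n⟩) σ)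

/-- The `n`-th component of a morphism of symmetric sequences. -/
abbrev comp {X Y : QO A} (f : X ⟶ Y) (n : ℕ) : X.term n ⟶ Y.term n := f.natTrans.app (op ⟨n⟩)

/-- Equivariance of a family `X_s ⊗ Y_{p_1} ⊗ ⋯ ⊗ Y_{p_s} ⟶ Z_{p_1 + ⋯ + p_s}`. -/
structure IsEquivariantFamily (X Y Z : QO A)
    (φ : ∀ (s : ℕ) (p : Fin s → ℕ),
      X.term s ⊗ tensorFam s (fun i => Y.term (p i)) ⟶ Z.term (∑ i, p i)) : Prop where
  /-- Equivariance for the product of the symmetric groups on `p_1`, ..., `p_s` letters. -/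
  inner : ∀ (s : ℕ) (p : Fin s → ℕ) (τ : ∀ i, Equiv.Perm (Fin (p i))),
    X.term s ◁ tensorFamMap s (fun i => Y.act (τ i)) ≫ φ s p = φ s p ≫ Z.act (blockSum τ)
  /-- Equivariance for the symmetric group on `s` letters, which acts on `X_s`, permutes the factors
  `Y_{p_i}` and permutes the blocks. -/
  outer : ∀ (s : ℕ) (p : Fin s → ℕ) (σ : Equiv.Perm (Fin s)),
    X.act σ ▷ tensorFam s (fun i => Y.term (p (σ i))) ≫ φ s (fun i => p (σ i))
      = X.term s ◁ tensorFamPerm s σ (fun i => Y.term (p i)) ≫ φ s p ≫ Z.act (blockPerm σ p)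

/-- The composition product formula
`W_n = (⊔_{p_1 + ⋯ + p_s = n} X_s ⊗ Ind (Y_{p_1} ⊗ ⋯ ⊗ Y_{p_s})) / 𝔖_s`
for a symmetric sequence `W` with structure maps `κ`. The induction from
`𝔖_{p_1} × ⋯ × 𝔖_{p_s}` to `𝔖_n` is the coproduct over all bijections `h` between `Fin n` and
`⊔ Fin (p_i)`, divided by the inner symmetric groups; so the formula says that `W_n` is the
coproduct of copies of `X_s ⊗ Y_{p_1} ⊗ ⋯ ⊗ Y_{p_s}`, one for each `s`, `p` and `h`, divided by
the relations of the inner and of the outer symmetric groups. The symmetric group on `n` letters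
acts through `h`, which is expressed by the coprojections `κ_{s, p} ≫ W(h)`. -/
structure IsPlethysm (X Y W : QO A)
    (κ : ∀ (s : ℕ) (p : Fin s → ℕ),
      X.term s ⊗ tensorFam s (fun i => Y.term (p i)) ⟶ W.term (∑ i, p i)) : Prop where
  /-- The structure maps satisfy the relations. -/
  equivariant : IsEquivariantFamily X Y W κ
  /-- They are universal with this property. -/
  existsUnique_desc : ∀ (n : ℕ) (T : A)
    (φ : ∀ (s : ℕ) (p : Fin s → ℕ), (Fin n ≃ Fin (∑ i, p i)) →
      (X.term s ⊗ tensorFam s (fun i => Y.term (p i)) ⟶ T)),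
    (∀ (s : ℕ) (p : Fin s → ℕ) (h : Fin n ≃ Fin (∑ i, p i)) (τ : ∀ i, Equiv.Perm (Fin (p i))),
      X.term s ◁ tensorFamMap s (fun i => Y.act (τ i)) ≫ φ s p h
        = φ s p (h.trans (blockSum τ))) →
    (∀ (s : ℕ) (p : Fin s → ℕ) (σ : Equiv.Perm (Fin s)) (h : Fin n ≃ Fin (∑ i, p (σ i))),
      X.act σ ▷ tensorFam s (fun i => Y.term (p (σ i))) ≫ φ s (fun i => p (σ i)) h
        = X.term s ◁ tensorFamPerm s σ (fun i => Y.term (p i)) ≫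
            φ s p (h.trans (blockPerm σ p))) →
    ∃! t : W.term n ⟶ T, ∀ (s : ℕ) (p : Fin s → ℕ) (h : Fin n ≃ Fin (∑ i, p i)),
      κ s p ≫ W.act h ≫ t = φ s p h

end QO

variable (A) in
/-- A symmetric operad in a symmetric monoidal category: a symmetric sequence with composition maps
`P_s ⊗ P_{p_1} ⊗ ⋯ ⊗ P_{p_s} ⟶ P_{p_1 + ⋯ + p_s}` and a unit `𝟙_ ⟶ P_1`. -/
structure SymOperad where
  /-- The underlying symmetric sequence. -/
  seq : QO A
  /-- The unit. -/
  one : 𝟙_ A ⟶ seq.term 1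
  /-- The composition maps. -/
  mul : ∀ (s : ℕ) (p : Fin s → ℕ),
    seq.term s ⊗ tensorFam s (fun i => seq.term (p i)) ⟶ seq.term (∑ i, p i)
  /-- The composition maps are equivariant. -/
  equivariant : QO.IsEquivariantFamily seq seq seq mul
  /-- `1 ∘ x = x`. -/
  one_mul : ∀ n : ℕ, (λ_ (seq.term n)).inv ≫ (one ⊗ₘ (ρ_ (seq.term n)).inv) ≫ mul 1 (fun _ => n)
    = seq.act (finCongr (Fin.sum_univ_one fun _ => n))
  /-- `x ∘ (1, ..., 1) = x`. -/
  mul_one : ∀ n : ℕ, (ρ_ (seq.term n)).inv ≫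
      seq.term n ◁ (tensorFamUnit n ≫ tensorFamMap n fun _ => one) ≫ mul n (fun _ => 1)
    = seq.act (finCongr (by simp : ∑ _ : Fin n, 1 = n))
  /-- `(x ∘ (y_i)) ∘ (z_{i, j}) = x ∘ (y_i ∘ (z_{i, j}))`. -/
  mul_assoc : ∀ (s : ℕ) (p : Fin s → ℕ) (q : Fin (∑ i, p i) → ℕ),
    (α_ (seq.term s) (tensorFam s fun i => seq.term (p i))
        (tensorFam s fun i => tensorFam (p i) fun j => seq.term (q (finSigmaFinEquiv ⟨i, j⟩)))).inv ≫
      (mul s p ⊗ₘ tensorFamFlatten s p fun k => seq.term (q k)) ≫ mul (∑ i, p i) q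
    = seq.term s ◁ (tensorFamTensor s _ _ ≫
          tensorFamMap s fun i => mul (p i) fun j => q (finSigmaFinEquiv ⟨i, j⟩)) ≫
        mul s (fun i => ∑ j, q (finSigmaFinEquiv ⟨i, j⟩)) ≫
          seq.act (finCongr (by
            rw [← finSigmaFinEquiv.sum_comp, Fintype.sum_sigma] :
              ∑ k, q k = ∑ i, ∑ j, q (finSigmaFinEquiv ⟨i, j⟩)))

namespace SymOperad

/-- A morphism of symmetric operads: a morphism of symmetric sequences that commutes with the units
and the composition maps. -/
@[ext]
structure Hom (P Q : SymOperad A) where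
  /-- The underlying morphism of symmetric sequences. -/
  hom : P.seq ⟶ Q.seq
  one_hom : P.one ≫ QO.comp hom 1 = Q.one
  mul_hom : ∀ (s : ℕ) (p : Fin s → ℕ), P.mul s p ≫ QO.comp hom (∑ i, p i)
    = (QO.comp hom s ⊗ₘ tensorFamMap s fun i => QO.comp hom (p i)) ≫ Q.mul s p

instance : Category (SymOperad A) where
  Hom := Hom
  id P :=
    { hom := 𝟙 P.seq
      one_hom := Category.comp_id _
      mul_hom s p := by
        refine (Category.comp_id _).trans (Eq.trans ?_
          (congrArg (fun t => (𝟙 _ ⊗ₘ t) ≫ P.mul s p) (tensorFamMap_id s _).symm))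
        rw [MonoidalCategory.id_tensorHom_id, Category.id_comp] }
  comp f g :=
    { hom := f.hom ≫ g.hom
      one_hom := by
        rw [← g.one_hom, ← f.one_hom, Category.assoc]; rfl
      mul_hom s p := by
        have h1 := f.mul_hom s p
        have h2 := g.mul_hom s p
        change _ ≫ QO.comp f.hom _ ≫ QO.comp g.hom _ = ((QO.comp f.hom s ≫ QO.comp g.hom s) ⊗ₘ
          tensorFamMap s fun i => QO.comp f.hom (p i) ≫ QO.comp g.hom (p i)) ≫ _
        rw [tensorFamMap_comp, ← MonoidalCategory.tensorHom_comp_tensorHom, Category.assoc, ← h2,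
          ← Category.assoc, h1, Category.assoc] }
  id_comp f := Hom.ext (Category.id_comp f.hom)
  comp_id f := Hom.ext (Category.comp_id f.hom)
  assoc f g h := Hom.ext (Category.assoc f.hom g.hom h.hom)

variable (A) in
/-- The underlying symmetric sequence of a symmetric operad. -/
def forget : SymOperad A ⥤ QO A where
  obj P := P.seq
  map f := f.hom

end SymOperad

namespace QO

variable (A) in
/-- The structure morphism `q_o A → A` of the vectoid of symmetric sequences, with inverse image
`a ↦ (a, ∅, ∅, …)` and direct image `X ↦ X_0`. -/
def toBase : VectoidHom (QO A) A where
  invImage := const A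
  dirImage := eval A (𝟙_ NIso)
  adj := constAdj A
  braided := inferInstance

variable (A) in
/-- The universal object `X_o = (∅, 𝟙_, ∅, …)`. -/
def univ : QO A := mono (𝟙_ A) ⟨1⟩

/-- The element of `X_o(1)` given by the identity of `1`. -/
def univι : 𝟙_ A ⟶ (univ A).term 1 := monoι (𝟙_ A) ⟨1⟩

variable (A) in
/-- `q_o A`, with its structure morphism to `A` and the object `X_o`, is the object classifier
over `A`: for every vectoid `B` over `A`, the functor `f ↦ f^* X_o` from the category of morphisms
`B → q_o A` over `A` to `B` is an equivalence. -/
def IsObjectClassifier : Prop :=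
  ∀ (B : Type w) [Category.{v} B] [MonoidalCategory B] [SymmetricCategory B] [Vectoid B]
    (p : VectoidHom B A), (OverHom.eval p (toBase A) (univ A)).IsEquivalence

variable (A) in
/-- The category of endomorphisms of the object classifier over `A`. -/
abbrev End := OverHom (toBase A) (toBase A)

variable (A) in
/-- The functor `θ : f ↦ f^* X_o`. -/
abbrev θ : End A ⥤ QO A := OverHom.eval (toBase A) (toBase A) (univ A)

/-- The canonical morphism from `X_o ⊗ ⋯ ⊗ X_o` to the sequence represented by `s`. -/
def univPow : (s : ℕ) → (tensorFam s (fun _ => univ A) ⟶ mono (𝟙_ A) ⟨s⟩)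
  | 0 => DayFunctor.unitDesc (monoι (𝟙_ A) ⟨0⟩)
  | s + 1 => univ A ◁ univPow s ≫ monoTensor (𝟙_ A) (𝟙_ A) ⟨1⟩ ⟨s⟩ ≫
      monoMap (λ_ (𝟙_ A)).hom (NIso.isoMk (m := ⟨1⟩ ⊗ ⟨s⟩) (n := ⟨s + 1⟩)
        (finCongr (Nat.add_comm 1 s))).hom

/-- The canonical morphism `X_s ⊗ X_o ⊗ ⋯ ⊗ X_o ⟶ X`. -/
def termMap (X : QO A) (s : ℕ) :
    (const A).obj (X.term s) ⊗ tensorFam s (fun _ => univ A) ⟶ X :=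
  _ ◁ univPow s ≫ monoTensor (X.term s) (𝟙_ A) (𝟙_ NIso) ⟨s⟩ ≫
    monoMap (ρ_ (X.term s)).hom (λ_ (⟨s⟩ : NIso)).hom ≫ monoDesc (𝟙 (X.term s))

/-- The canonical morphism `⨂ (Y i)_{p_i} ⟶ (⨂ Y i)_{p_1 + ⋯ + p_s}` to the Day convolution. -/
def tensorFamη : (s : ℕ) → (p : Fin s → ℕ) → (Y : Fin s → QO A) →
    (tensorFam s (fun i => (Y i).term (p i)) ⟶ (tensorFam s Y).term (∑ i, p i))
  | 0, _, _ => DayFunctor.ν NIsoᵒᵖ A ≫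
      (𝟙_ (QO A)).act (finCongr (Fin.sum_univ_zero _) : Fin (∑ _ : Fin 0, _) ≃ Fin 0)
  | s + 1, p, Y => (Y 0).term (p 0) ◁ tensorFamη s (fun i => p i.succ) (fun i => Y i.succ) ≫
      (DayFunctor.η (Y 0) (tensorFam s fun i => Y i.succ)).app
        (op ⟨p 0⟩, op ⟨∑ i : Fin s, p i.succ⟩) ≫
      (tensorFam (s + 1) Y).act (finCongr (Fin.sum_univ_succ p))

/-- The canonical morphism `X_s ⊗ Y ⊗ ⋯ ⊗ Y ⟶ g^* X` for `Y = g^* X_o`, in `q_o A`. -/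
def pullbackTermMap (g : End A) (X : QO A) (s : ℕ) :
    (const A).obj (X.term s) ⊗ tensorFam s (fun _ => (θ A).obj g) ⟶ g.hom.invImage.obj X :=
  (g.iso.inv.app (X.term s) ⊗ₘ tensorFamμ g.hom.invImage s fun _ => univ A) ≫
    Functor.LaxMonoidal.μ g.hom.invImage _ _ ≫ g.hom.invImage.map (termMap X s)

/-- The canonical morphisms
`X_s ⊗ Y_{p_1} ⊗ ⋯ ⊗ Y_{p_s} ⟶ (X ∘ Y)_{p_1 + ⋯ + p_s}` to the composition product, where
`X = f^* X_o`, `Y = g^* X_o` and `X ∘ Y = (f ∘ g)^* X_o`. -/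
def plethysmMap (f g : End A) (s : ℕ) (p : Fin s → ℕ) :
    ((θ A).obj f).term s ⊗ tensorFam s (fun i => ((θ A).obj g).term (p i)) ⟶
      ((θ A).obj (f ⊗ g)).term (∑ i, p i) :=
  (constι (((θ A).obj f).term s) ⊗ₘ tensorFamη s p fun _ => (θ A).obj g) ≫
    (DayFunctor.η _ _).app (𝟙_ NIsoᵒᵖ, op ⟨∑ i, p i⟩) ≫
    comp (pullbackTermMap g ((θ A).obj f) s) (0 + ∑ i, p i) ≫
    ((θ A).obj (f ⊗ g)).act (NIso.zeroAdd (∑ i, p i)).symm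

end QO

end SymmetricSequences

end

/-!
A vectoid is a prevectoid that is complete. Completeness is automatic (`Prevectoid.vectoid`): a
prevectoid is cocomplete, has a small set of generators, and is well-copowered because all its
epimorphisms are effective, so the special adjoint functor theorem applies. That `QO A` is a
prevectoid is checked degree by degree: colimits, finite limits, epimorphisms and equivalence
relations of symmetric sequences are those of their components. The same adjoint functor theorem
makes every prevectoid monoidal closed, and internal Homs are used throughout.

**The object classifier.** Every symmetric sequence is the quotient of the coproduct of the
`(X_n, ∅, ∅, …) ⊗ X_o ^ n` by the symmetric groups, because morphisms `(a, ∅, ∅, …) ⊗ X_o ^ n ⟶ Z`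
are morphisms `a ⟶ Z_n` (`QO.termHomEquiv`). If `f` is a morphism over `A` with values in `B` and
`b = f^* X_o`, then `f^*` preserves this quotient, so that `f^* X` is the realization
`⊔ (p^* X_n ⊗ b ^ n) / 𝔖_n` of `X` at `b` (`OverHom.isRealization`). Hence a 2-morphism over `A` is
the same as a morphism between the images of `X_o` (`OverHom.evalFullyFaithful`). Conversely, for an
object `b` of `B` the realization at `b` is left adjoint to `c ↦ (n ↦ p_* Hom(b ^ n, c))`
(`realizationAdj`). It is symmetric monoidal, because both `|X| ⊗ |Y|` and `|X ⊗ Y|` are universal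
for families of morphisms out of `p^* X_m ⊗ b ^ m ⊗ p^* Y_n ⊗ b ^ n` (`realizationμIso`), and it
takes `X_o` to `b`. This gives `eval_isEquivalence`.

**The plethysm formula.** For an endomorphism `g` over `A`, with `Y = g^* X_o`, composing the map of
the realization in degree `s` with the structure maps of the Day convolution `Y ^ s` gives the
substitution maps `X_s ⊗ Y_{p_1} ⊗ ⋯ ⊗ Y_{p_s} ⟶ (g^* X)_{p_1 + ⋯ + p_s}` (`QO.substMap`). The
universal properties of realizations and of finite Day convolutions (`QO.exists_tensorFam_desc`)
combine into a universal property among symmetric sequences (`QO.exists_substMap_desc`). Applied to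
the cofree sequences `m ↦ ∏_{n ≃ m} T`, it becomes the universal property of the single object
`(g^* X)_n`, which is the plethysm formula (`QO.isPlethysm_substMap`).

**Operads.** Substitution is associative and unital (`QO.substMap_substMap`, `QO.substMap_univι`,
`QO.substMap_id`). Associativity is reduced to the multiplicativity of the realization maps, through
the compatibility of substitution with finite Day convolutions (`QO.tensorFamMap_substMap`). So a
monoid of endomorphisms becomes an operad (`toSymOperad`) by composing its substitution maps with
the multiplication. This functor is full and faithful because morphisms out of `g^* X` are
determined by the substitution maps. It is essentially surjective (`QO.exists_monObj`) because the
composition maps of an operad `P = θ f` form an equivariant family, and therefore come from a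
morphism `f^* P ⟶ P`, which lifts along the equivalence `θ` to a multiplication on `f`. The monoid
laws may be tested on the (iterated) substitution maps (`QO.substMap_substMap_hom_ext`), where they
are the axioms of an operad.
-/

set_option linter.unusedSectionVars false

noncomputable section

/-! ### Prevectoids -/

namespace Prevectoid

variable {A : Type u} [Category.{v} A] [MonoidalCategory A] [SymmetricCategory A] [Prevectoid A]

/-- An epimorphism is the cokernel of its kernel pair, so a morphism factors through it as soon as
it identifies the generalised elements that the epimorphism identifies. -/
theorem exists_factor_of_epi {X Q T : A} (q : X ⟶ Q) [Epi q] (r : X ⟶ T)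
    (h : ∀ ⦃Z : A⦄ (a b : Z ⟶ X), a ≫ q = b ≫ q → a ≫ r = b ≫ r) : ∃ t : Q ⟶ T, q ≫ t = r := by
  have := Prevectoid.hasFiniteLimits (A := A)
  have hk := IsKernelPair.of_hasPullback q
  obtain ⟨hc⟩ := Prevectoid.epi_effective q q (𝟙 X) (𝟙 Q) inferInstance
    (IsPullback.of_horiz_isIso ⟨by simp⟩) _ _ hk
  exact ⟨Cofork.IsColimit.desc hc r (h _ _ hk.w), Cofork.IsColimit.π_desc' hc _ _⟩

variable (A) in
/-- A quotient of `X` is determined by the pairs of generalised elements of `X`, defined on the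
generators, that it identifies; these pairs form a small set. -/
theorem wellPowered_op : WellPowered.{v} Aᵒᵖ where
  subobject_small X := by
    obtain ⟨G, hG, hsep⟩ := Prevectoid.exists_generators (A := A)
    have : Small.{v} (Σ g : Subtype G, (g.1 ⟶ X.unop) × (g.1 ⟶ X.unop)) := by
      have : Small.{v} (Subtype G) := hG
      infer_instance
    let f : Subobject X → Set (Σ g : Subtype G, (g.1 ⟶ X.unop) × (g.1 ⟶ X.unop)) := fun S =>
      {t | t.2.1 ≫ S.arrow.unop = t.2.2 ≫ S.arrow.unop}
    have le : ∀ S T : Subobject X, f S ⊆ f T → T ≤ S := by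
      intro S T h
      obtain ⟨t, ht⟩ := exists_factor_of_epi S.arrow.unop T.arrow.unop (by
        intro Z a b hab
        apply hsep
        intro g hg k
        have := @h ⟨⟨g, hg⟩, k ≫ a, k ≫ b⟩ (by simp [f, hab])
        simpa [f] using this)
      exact Subobject.le_of_comm t.op (Quiver.Hom.unop_inj ht)
    exact small_of_injective (f := f) fun S T h => le_antisymm (le _ _ h.ge) (le _ _ h.le)

/-- The special adjoint functor theorem for prevectoids. -/
theorem isLeftAdjoint {D : Type w} [Category.{v} D] (F : A ⥤ D)
    [PreservesColimitsOfSize.{v, v} F] : F.IsLeftAdjoint := by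
  have := Prevectoid.hasColimits (A := A)
  have := wellPowered_op A
  obtain ⟨G, hG, hsep⟩ := Prevectoid.exists_generators (A := A)
  exact isLeftAdjoint_of_preservesColimits_of_isSeparating hsep F

variable (A) in
/-- The special adjoint functor theorem applies to a prevectoid, so the completeness condition is
automatic. -/
theorem vectoid : Vectoid A where
  total F hF := by
    have : PreservesColimitsOfSize.{v, v} F.rightOp :=
      preservesColimitsOfSize_rightOp F
    have := isLeftAdjoint F.rightOp
    let adj := Adjunction.ofIsLeftAdjoint F.rightOp
    refine ⟨F.rightOp.rightAdjoint.obj (op PUnit), ⟨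
      { homEquiv {X} := (adj.homEquiv X (op PUnit)).symm.trans
          ((opEquiv _ _).trans (TypeCat.homEquiv.trans (Equiv.punitArrowEquiv _)))
        homEquiv_comp {X X'} f g := ?_ }⟩⟩
    change ((adj.homEquiv X (op PUnit)).symm (f ≫ g)).unop PUnit.unit
      = F.map f.op (((adj.homEquiv X' (op PUnit)).symm g).unop PUnit.unit)
    rw [adj.homEquiv_naturality_left_symm]
    rfl

variable (A) in
/-- A prevectoid is monoidal closed. -/
@[reducible]
def monoidalClosed : MonoidalClosed A where
  closed X :=
    have := Prevectoid.preservesColimits_tensorLeft X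
    have := isLeftAdjoint (tensorLeft X)
    { rightAdj := (tensorLeft X).rightAdjoint
      adj := Adjunction.ofIsLeftAdjoint _ }

end Prevectoid

/-! ### Components of symmetric sequences and of their tensor products -/

namespace QO

variable {A : Type u} [Category.{v} A] [MonoidalCategory A] [SymmetricCategory A] [Prevectoid A]

theorem hom_ext_comp {X Y : QO A} {f g : X ⟶ Y} (h : ∀ n, comp f n = comp g n) : f = g := by
  apply DayFunctor.hom_ext
  ext ⟨n⟩
  exact h n.card

theorem act_comp {X Y : QO A} (f : X ⟶ Y) {m n : ℕ} (σ : Fin m ≃ Fin n) :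
    X.act σ ≫ comp f m = comp f n ≫ Y.act σ :=
  f.natTrans.naturality _

theorem act_act (X : QO A) {l m n : ℕ} (σ : Fin l ≃ Fin m) (τ : Fin m ≃ Fin n) :
    X.act τ ≫ X.act σ = X.act (σ.trans τ) :=
  (X.functor.map_comp _ _).symm

@[simp]
theorem act_refl (X : QO A) (n : ℕ) : X.act (Equiv.refl (Fin n)) = 𝟙 _ :=
  X.functor.map_id _

theorem act_of_eq (X : QO A) {n : ℕ} {σ : Fin n ≃ Fin n} (h : σ = Equiv.refl _) :
    X.act σ = 𝟙 _ := by
  rw [h, act_refl]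

instance isIso_act (X : QO A) {m n : ℕ} (σ : Fin m ≃ Fin n) : IsIso (X.act σ) :=
  ⟨X.act σ.symm, by rw [act_act, Equiv.symm_trans_self, act_refl],
    by rw [act_act, Equiv.self_trans_symm, act_refl]⟩

@[simp]
theorem comp_id (X : QO A) (n : ℕ) : comp (𝟙 X) n = 𝟙 _ := rfl

@[simp]
theorem comp_comp {X Y Z : QO A} (f : X ⟶ Y) (g : Y ⟶ Z) (n : ℕ) :
    comp (f ≫ g) n = comp f n ≫ comp g n := rfl

/-- The morphism `X ⟶ Y` with given components. -/
def ofComp {X Y : QO A} (f : ∀ n, X.term n ⟶ Y.term n)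
    (h : ∀ (n : ℕ) (σ : Equiv.Perm (Fin n)), X.act σ ≫ f n = f n ≫ Y.act σ) : X ⟶ Y :=
  homMk
    { app n := f n.unop.card
      naturality := by
        rintro ⟨⟨m⟩⟩ ⟨⟨n⟩⟩ ⟨σ⟩
        obtain rfl : n = m := Fin.equiv_iff_eq.1 ⟨σ⟩
        exact h n σ }

@[simp]
theorem comp_ofComp {X Y : QO A} (f : ∀ n, X.term n ⟶ Y.term n)
    (h : ∀ (n : ℕ) (σ : Equiv.Perm (Fin n)), X.act σ ≫ f n = f n ≫ Y.act σ) (n : ℕ) :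
    comp (ofComp f h) n = f n := rfl

/-- The structure map `X_m ⊗ Y_n ⟶ (X ⊗ Y)_{m + n}` of the Day convolution. -/
def dayι (X Y : QO A) (m n : ℕ) : X.term m ⊗ Y.term n ⟶ (X ⊗ Y).term (m + n) :=
  (DayFunctor.η X Y).app (op ⟨m⟩, op ⟨n⟩)

theorem act_dayι (X Y : QO A) {m m' n n' : ℕ} (σ : Fin m ≃ Fin m') (τ : Fin n ≃ Fin n') :
    (X.act σ ⊗ₘ Y.act τ) ≫ dayι X Y m n = dayι X Y m' n' ≫ (X ⊗ Y).act (NIso.sum σ τ) :=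
  η_naturality X Y _ _

theorem act_whiskerRight_dayι (X Y : QO A) {m m' : ℕ} (n : ℕ) (σ : Fin m ≃ Fin m') :
    X.act σ ▷ Y.term n ≫ dayι X Y m n
      = dayι X Y m' n ≫ (X ⊗ Y).act (NIso.sum σ (Equiv.refl _)) :=
  map_whiskerRight_η X Y _ _

theorem act_whiskerLeft_dayι (X Y : QO A) (m : ℕ) {n n' : ℕ} (τ : Fin n ≃ Fin n') :
    X.term m ◁ Y.act τ ≫ dayι X Y m n
      = dayι X Y m n' ≫ (X ⊗ Y).act (NIso.sum (Equiv.refl _) τ) :=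
  map_whiskerLeft_η X Y _ _

theorem dayι_tensorHom {X X' Y Y' : QO A} (f : X ⟶ X') (g : Y ⟶ Y') (m n : ℕ) :
    dayι X Y m n ≫ comp (f ⊗ₘ g) (m + n) = (comp f m ⊗ₘ comp g n) ≫ dayι X' Y' m n :=
  η_tensorHom f g _ _

theorem dayι_whiskerRight {X X' : QO A} (f : X ⟶ X') (Y : QO A) (m n : ℕ) :
    dayι X Y m n ≫ comp (f ▷ Y) (m + n) = comp f m ▷ Y.term n ≫ dayι X' Y m n :=
  η_whiskerRight f Y _ _

theorem dayι_whiskerLeft (X : QO A) {Y Y' : QO A} (g : Y ⟶ Y') (m n : ℕ) :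
    dayι X Y m n ≫ comp (X ◁ g) (m + n) = X.term m ◁ comp g n ≫ dayι X Y' m n :=
  η_whiskerLeft X g _ _

theorem dayι_associator (X Y Z : QO A) (l m n : ℕ) :
    dayι X Y l m ▷ Z.term n ≫ dayι (X ⊗ Y) Z (l + m) n ≫ comp (α_ X Y Z).hom (l + m + n)
      = (α_ _ _ _).hom ≫ X.term l ◁ dayι Y Z m n ≫ dayι X (Y ⊗ Z) l (m + n) ≫
          (X ⊗ Y ⊗ Z).act (NIso.assoc l m n) :=
  η_associator X Y Z _ _ _

theorem dayι_braiding (X Y : QO A) (m n : ℕ) :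
    dayι X Y m n ≫ comp (β_ X Y).hom (m + n)
      = (β_ (X.term m) (Y.term n)).hom ≫ dayι Y X n m ≫ (Y ⊗ X).act (NIso.swap m n) :=
  η_braiding X Y _ _

/-- The universal element of the unit sequence. -/
def unitι : 𝟙_ A ⟶ (𝟙_ (QO A)).term 0 := DayFunctor.ν NIsoᵒᵖ A

theorem dayι_leftUnitor (X : QO A) (n : ℕ) :
    unitι ▷ X.term n ≫ dayι (𝟙_ (QO A)) X 0 n ≫ comp (λ_ X).hom (0 + n)
      = (λ_ (X.term n)).hom ≫ X.act (NIso.zeroAdd n) :=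
  η_leftUnitor X _

theorem dayι_rightUnitor (X : QO A) (n : ℕ) :
    X.term n ◁ unitι ≫ dayι X (𝟙_ (QO A)) n 0 ≫ comp (ρ_ X).hom (n + 0)
      = (ρ_ (X.term n)).hom ≫ X.act (NIso.addZero n) :=
  η_rightUnitor X _

theorem tensor_hom_ext {X Y Z : QO A} {f g : X ⊗ Y ⟶ Z}
    (h : ∀ m n, dayι X Y m n ≫ comp f (m + n) = dayι X Y m n ≫ comp g (m + n)) : f = g :=
  DayFunctor.tensor_hom_ext fun x y => h x.unop.card y.unop.card

theorem unit_hom_ext {Z : QO A} {f g : 𝟙_ (QO A) ⟶ Z}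
    (h : unitι ≫ comp f 0 = unitι ≫ comp g 0) : f = g :=
  DayFunctor.unit_hom_ext h

/-- The morphism out of a Day convolution given by an equivariant family. -/
def dayDesc {X Y Z : QO A} (φ : ∀ m n, X.term m ⊗ Y.term n ⟶ Z.term (m + n))
    (h₁ : ∀ m n (σ : Equiv.Perm (Fin m)), X.act σ ▷ Y.term n ≫ φ m n
      = φ m n ≫ Z.act (NIso.sum σ (Equiv.refl _)))
    (h₂ : ∀ m n (τ : Equiv.Perm (Fin n)), X.term m ◁ Y.act τ ≫ φ m n
      = φ m n ≫ Z.act (NIso.sum (Equiv.refl _) τ)) : X ⊗ Y ⟶ Z :=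
  DayFunctor.tensorDesc
    { app p := φ p.1.unop.card p.2.unop.card
      naturality := by
        rintro ⟨⟨⟨m⟩⟩, ⟨⟨n⟩⟩⟩ ⟨⟨⟨m'⟩⟩, ⟨⟨n'⟩⟩⟩ ⟨⟨σ⟩, ⟨τ⟩⟩
        obtain rfl : m' = m := Fin.equiv_iff_eq.1 ⟨σ⟩
        obtain rfl : n' = n := Fin.equiv_iff_eq.1 ⟨τ⟩
        change (X.act σ ▷ Y.term n' ≫ X.term m' ◁ Y.act τ) ≫ φ m' n'
          = φ m' n' ≫ Z.act (NIso.sum σ τ)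
        rw [Category.assoc, h₂, ← Category.assoc, h₁, Category.assoc, act_act, NIso.sum_trans]
        rfl }

@[simp]
theorem dayι_dayDesc {X Y Z : QO A} (φ : ∀ m n, X.term m ⊗ Y.term n ⟶ Z.term (m + n)) (h₁ h₂)
    (m n : ℕ) : dayι X Y m n ≫ comp (dayDesc φ h₁ h₂) (m + n) = φ m n :=
  DayFunctor.η_comp_tensorDesc_app _ _ _

/-! ### Symmetric sequences form a vectoid -/

instance eval_preservesColimitsOfSize (n : NIso) : PreservesColimitsOfSize.{v, v} (eval A n) := by
  have := Prevectoid.hasColimits (A := A)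
  unfold eval
  infer_instance

instance eval_preservesFiniteLimits (n : NIso) : PreservesFiniteLimits (eval A n) := by
  have := Prevectoid.hasFiniteLimits (A := A)
  unfold eval
  infer_instance

theorem hasColimits : HasColimitsOfSize.{v, v} (QO A) := by
  have := Prevectoid.hasColimits (A := A)
  exact Adjunction.has_colimits_of_equivalence (DayFunctor.equiv NIsoᵒᵖ A).functor

theorem hasFiniteLimits : HasFiniteLimits (QO A) := by
  have := Prevectoid.hasFiniteLimits (A := A)
  exact ⟨fun J _ _ => Adjunction.hasLimitsOfShape_of_equivalence
    (DayFunctor.equiv NIsoᵒᵖ A).functor⟩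

/-- The components of an epimorphism are epimorphisms, because evaluation at `n` preserves pushouts.
-/
theorem epi_comp {X Y : QO A} (f : X ⟶ Y) [Epi f] (n : NIsoᵒᵖ) : Epi (f.natTrans.app n) := by
  have := eval_preservesColimitsOfSize (A := A) n.unop
  have := hasColimits (A := A)
  have := preservesColimitsOfSize_shrink.{0, v, 0, v} (eval A n.unop)
  exact inferInstanceAs (Epi ((eval A n.unop).map f))

/-- A cocone of symmetric sequences is a colimit as soon as its components are. -/
def isColimitOfEval {J : Type w} [Category.{w} J] [HasColimitsOfShape J A] {K : J ⥤ QO A}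
    (c : Cocone K) (h : ∀ n, IsColimit ((eval A n).mapCocone c)) : IsColimit c :=
  isColimitOfReflects (DayFunctor.equiv NIsoᵒᵖ A).functor
    (evaluationJointlyReflectsColimits _ fun n => h n.unop)

/-- Day convolution commutes with colimits: on each summand `X_m ⊗ Y_n` this holds in `A`, and Day
convolutions are universal for equivariant families on these summands. -/
theorem preservesColimits_tensorLeft (X : QO A) :
    PreservesColimitsOfSize.{v, v} (tensorLeft X) where
  preservesColimitsOfShape {J _} := ⟨fun {K} => ⟨fun {c} hc => ⟨by
    have := Prevectoid.hasColimits (A := A)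
    have hX := fun m => Prevectoid.preservesColimits_tensorLeft (A := A) (X.functor.obj m)
    have h1 : ∀ m n : ℕ, IsColimit
        ((tensorLeft (X.term m)).mapCocone ((eval A ⟨n⟩).mapCocone c)) :=
      fun m n => isColimitOfPreserves _ (isColimitOfPreserves _ hc)
    have h1_ext : ∀ (m n : ℕ) {Z : A} {f g : X.term m ⊗ c.pt.term n ⟶ Z},
        (∀ j, X.term m ◁ comp (c.ι.app j) n ≫ f = X.term m ◁ comp (c.ι.app j) n ≫ g) → f = g :=
      fun m n _ _ _ h => (h1 m n).hom_ext h
    -- the components of the descended morphism, on the summand `X_m ⊗ c_n`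
    have h2 : ∀ (s : Cocone (K ⋙ tensorLeft X)) (m n : ℕ),
        ∃ φ : X.term m ⊗ c.pt.term n ⟶ s.pt.term (m + n), ∀ j,
          X.term m ◁ comp (c.ι.app j) n ≫ φ = dayι X (K.obj j) m n ≫ comp (s.ι.app j) (m + n) :=
      fun s m n => ⟨(h1 m n).desc
        { pt := s.pt.term (m + n)
          ι :=
            { app j := dayι X (K.obj j) m n ≫ comp (s.ι.app j) (m + n)
              naturality i j f := by
                change X.term m ◁ comp (K.map f) n ≫ _ ≫ _ = (_ ≫ _) ≫ 𝟙 _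
                rw [← reassoc_of% dayι_whiskerLeft X (K.map f) m n, Category.comp_id, ← comp_comp]
                exact congrArg (fun t => _ ≫ comp t (m + n)) (s.w f) } }, (h1 m n).fac _⟩
    choose φ hφ using h2
    have ha : ∀ (j : J) (n : ℕ) (σ : Equiv.Perm (Fin n)),
        (K.obj j).act σ ≫ comp (c.ι.app j) n = comp (c.ι.app j) n ≫ c.pt.act σ :=
      fun j n σ => act_comp (c.ι.app j) σ
    have hs : ∀ (s : Cocone (K ⋙ tensorLeft X)) (j : J) (n : ℕ) (σ : Equiv.Perm (Fin n)),
        (X ⊗ K.obj j).act σ ≫ comp (s.ι.app j) n = comp (s.ι.app j) n ≫ s.pt.act σ :=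
      fun s j n σ => act_comp (s.ι.app j) σ
    refine
      { desc s := dayDesc (φ s)
          (fun m n σ => h1_ext m n fun j => ?_) (fun m n σ => h1_ext m n fun j => ?_)
        fac s j := tensor_hom_ext fun m n => ?_
        uniq s t ht := tensor_hom_ext fun m n => h1_ext m n fun j => ?_ }
    · refine (whisker_exchange_assoc (X.act σ) (comp (c.ι.app j) n) (φ s m n)).trans ?_
      rw [hφ, reassoc_of% hφ, ← hs]
      exact (reassoc_of% (act_whiskerRight_dayι X (K.obj j) n σ)) _
    · rw [← MonoidalCategory.whiskerLeft_comp_assoc, ← ha, MonoidalCategory.whiskerLeft_comp_assoc,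
        hφ, reassoc_of% hφ, ← hs]
      exact (reassoc_of% (act_whiskerLeft_dayι X (K.obj j) m σ)) _
    · change dayι X (K.obj j) m n ≫ comp (X ◁ c.ι.app j ≫ _) _ = _
      rw [comp_comp, reassoc_of% dayι_whiskerLeft X (c.ι.app j) m n]
      refine Eq.trans ?_ (hφ s m n j)
      congr 1
      exact dayι_dayDesc _ _ _ m n
    · rw [dayι_dayDesc]
      refine Eq.trans ?_ (hφ s m n j).symm
      refine ((reassoc_of% (dayι_whiskerLeft X (c.ι.app j) m n)) _).symm.trans ?_
      rw [← ht]
      rfl⟩⟩⟩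

theorem epi_effective ⦃X Y X' Y' : QO A⦄ (f : X ⟶ Y) (f' : X' ⟶ Y') (g' : X' ⟶ X) (g : Y' ⟶ Y)
    (hf : Epi f) (h : IsPullback g' f' f g) ⦃R : QO A⦄ (p q : R ⟶ X') (hk : IsKernelPair f' p q) :
    Nonempty (IsColimit (Cofork.ofπ f' hk.w)) := by
  have h1 : ∀ n, Nonempty (IsColimit (Cofork.ofπ (f'.natTrans.app n) (hk.map (eval A n.unop)).w)) :=
    fun n => Prevectoid.epi_effective (f.natTrans.app n) (f'.natTrans.app n) (g'.natTrans.app n)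
      (g.natTrans.app n) (epi_comp f n) (h.map (eval A n.unop)) _ _ (hk.map (eval A n.unop))
  have := hasColimitsOfShape_type (A := A) WalkingParallelPair
  exact ⟨isColimitOfEval _ fun n => (isColimitMapCoconeCoforkEquiv (eval A n) hk.w).symm
    (h1 (op n)).some⟩

/-- The components of an equivalence relation are equivalence relations, because the generalised
elements `a ⟶ X_n` are the morphisms `a · h_n ⟶ X`. -/
theorem isEqRel_comp {R X : QO A} {p q : R ⟶ X} (h : IsEqRel p q) (n : NIso) :
    IsEqRel (p.natTrans.app (op n)) (q.natTrans.app (op n)) := by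
  have key : ∀ {a : A} {Y Z : QO A} (x : a ⟶ Y.functor.obj (op n)) (f : Y ⟶ Z),
      monoDesc x ≫ f = monoDesc (x ≫ f.natTrans.app (op n)) := fun x f => mono_hom_ext (by
    rw [DayFunctor.comp_natTrans, NatTrans.comp_app, reassoc_of% @monoι_monoDesc, monoι_monoDesc])
  have inj : ∀ {a : A} {Y : QO A} {x y : a ⟶ Y.functor.obj (op n)},
      monoDesc x = monoDesc y → x = y := fun h => (monoHomEquiv _ _ _).symm.injective h
  have sur : ∀ {a : A} {Y : QO A} (f : mono a n ⟶ Y), ∃ x, f = monoDesc x := fun f =>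
    ⟨_, ((monoHomEquiv _ _ _).symm_apply_apply f).symm⟩
  refine ⟨fun T a b h1 h2 => ?_, fun T x => ?_, fun T r => ?_, fun T r s hrs => ?_⟩
  · exact inj (h.jointlyMono _ _ (by rw [key, key, h1]) (by rw [key, key, h2]))
  · obtain ⟨r, h1, h2⟩ := h.refl (monoDesc x)
    obtain ⟨r, rfl⟩ := sur r
    rw [key] at h1 h2
    exact ⟨r, inj h1, inj h2⟩
  · obtain ⟨t, h1, h2⟩ := h.symm (monoDesc r)
    obtain ⟨t, rfl⟩ := sur t
    rw [key, key] at h1 h2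
    exact ⟨t, inj h1, inj h2⟩
  · obtain ⟨t, h1, h2⟩ := h.trans (monoDesc r) (monoDesc s) (by rw [key, key, hrs])
    obtain ⟨t, rfl⟩ := sur t
    rw [key, key] at h1 h2
    exact ⟨t, inj h1, inj h2⟩

theorem equivalenceRelation_effective ⦃R X : QO A⦄ (p q : R ⟶ X) (h : IsEqRel p q) ⦃Q : QO A⦄
    (π : X ⟶ Q) (w : p ≫ π = q ≫ π) (hc : Nonempty (IsColimit (Cofork.ofπ π w))) :
    IsKernelPair π p q := by
  have := Prevectoid.hasFiniteLimits (A := A)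
  have h1 : ∀ n : NIso, IsKernelPair ((eval A n).map π) ((eval A n).map p) ((eval A n).map q) :=
    fun n =>
      have := preservesColimitsOfSize_shrink.{0, v, 0, v} (eval A n)
      Prevectoid.equivalenceRelation_effective _ _ (isEqRel_comp h n) _ _
        ⟨isColimitCoforkMapOfIsColimit (eval A n) w hc.some⟩
  refine ⟨⟨w⟩, ⟨isLimitOfReflects (DayFunctor.equiv NIsoᵒᵖ A).functor
    (evaluationJointlyReflectsLimits _ fun n => ?_)⟩⟩
  exact (isLimitMapConePullbackConeEquiv (eval A n.unop) w).symm (h1 n.unop).isLimit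

/-- The free sequences on the generators of `A`, placed in all degrees, are generators. -/
theorem exists_generators : ∃ G : ObjectProperty (QO A), ObjectProperty.Small.{v} G ∧
    G.IsSeparating := by
  obtain ⟨G, hG, hsep⟩ := Prevectoid.exists_generators (A := A)
  have : Small.{v} (Subtype G) := hG
  refine ⟨.ofObj fun t : Subtype G × ℕ => mono t.1.1 ⟨t.2⟩, inferInstance, ?_⟩
  intro X Y f g h
  apply DayFunctor.hom_ext
  ext ⟨n⟩
  apply hsep
  intro a ha x
  -- a morphism `a ⟶ X_n` is tested on the morphism `a · h_n ⟶ X` that it corresponds to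
  have := h (mono a n) (ObjectProperty.ofObj_apply _ (⟨⟨a, ha⟩, n.card⟩ : Subtype G × ℕ)) (monoDesc x)
  have := congrArg (fun t => monoι a n ≫ t.natTrans.app (op n)) this
  simpa [reassoc_of% @monoι_monoDesc] using this

instance : Prevectoid (QO A) where
  hasColimits := hasColimits
  preservesColimits_tensorLeft := preservesColimits_tensorLeft
  preservesColimits_tensorRight X :=
    have := preservesColimits_tensorLeft X
    preservesColimits_of_natIso (BraidedCategory.tensorLeftIsoTensorRight X)
  hasFiniteLimits := hasFiniteLimits
  epi_effective := epi_effective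
  equivalenceRelation_effective := equivalenceRelation_effective
  exists_generators := exists_generators

instance : Vectoid (QO A) := Prevectoid.vectoid _

end QO

/-! ### Tensor powers and the action of the symmetric groups -/

section TensorPower

variable {D : Type u} [Category.{v} D] [MonoidalCategory D]

/-- The empty tensor product; the identity, used to keep track of types. -/
def famNil (X : Fin 0 → D) : 𝟙_ D ≅ tensorFam 0 X := Iso.refl _

/-- The decomposition of a tensor product into its first factor and the others; the identity, used
to keep track of types. -/
def famCons {n : ℕ} (X : Fin (n + 1) → D) :
    X 0 ⊗ tensorFam n (fun i => X i.succ) ≅ tensorFam (n + 1) X := Iso.refl _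

/-- The tensor power `b ⊗ (b ⊗ ⋯ ⊗ 𝟙_)`. -/
abbrev tpow (b : D) (n : ℕ) : D := tensorFam n fun _ => b

/-- The morphism `b ⊗ f`, as a morphism of tensor powers. -/
def tcons (b : D) {m n : ℕ} (f : tpow b m ⟶ tpow b n) : tpow b (m + 1) ⟶ tpow b (n + 1) :=
  b ◁ f

theorem tcons_comp (b : D) {l m n : ℕ} (f : tpow b l ⟶ tpow b m) (g : tpow b m ⟶ tpow b n) :
    tcons b (f ≫ g) = tcons b f ≫ tcons b g :=
  MonoidalCategory.whiskerLeft_comp _ _ _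

@[simp]
theorem tcons_id (b : D) (n : ℕ) : tcons b (𝟙 (tpow b n)) = 𝟙 _ :=
  MonoidalCategory.whiskerLeft_id _ _

variable [SymmetricCategory D]

/-- The exchange of the first two factors of a tensor product. -/
def swapFirst (a b c : D) : a ⊗ (b ⊗ c) ⟶ b ⊗ (a ⊗ c) :=
  (α_ a b c).inv ≫ (β_ a b).hom ▷ c ≫ (α_ b a c).hom

theorem swapFirst_swapFirst (a b c : D) : swapFirst a b c ≫ swapFirst b a c = 𝟙 _ := by
  simp only [swapFirst, Category.assoc, Iso.hom_inv_id_assoc]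
  rw [← comp_whiskerRight_assoc, SymmetricCategory.symmetry]
  simp

theorem swapFirst_natural {a b c a' b' c' : D} (f : a ⟶ a') (g : b ⟶ b') (h : c ⟶ c') :
    (f ⊗ₘ (g ⊗ₘ h)) ≫ swapFirst a' b' c' = swapFirst a b c ≫ (g ⊗ₘ (f ⊗ₘ h)) := by
  simp only [swapFirst, Category.assoc]
  rw [MonoidalCategory.associator_inv_naturality_assoc, ← MonoidalCategory.associator_naturality,
    ← MonoidalCategory.tensorHom_id, ← MonoidalCategory.tensorHom_id,
    MonoidalCategory.tensorHom_comp_tensorHom_assoc, MonoidalCategory.tensorHom_comp_tensorHom_assoc,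
    BraidedCategory.braiding_naturality, Category.id_comp, Category.comp_id]

theorem swapFirst_whiskerLeft (a b : D) {c c' : D} (h : c ⟶ c') :
    a ◁ b ◁ h ≫ swapFirst a b c' = swapFirst a b c ≫ b ◁ a ◁ h := by
  simpa using swapFirst_natural (𝟙 a) (𝟙 b) h

/-- The Yang–Baxter equation. -/
theorem swapFirst_yangBaxter (a b c d : D) :
    swapFirst a b (c ⊗ d) ≫ b ◁ swapFirst a c d ≫ swapFirst b c (a ⊗ d)
      = a ◁ swapFirst b c d ≫ swapFirst a c (b ⊗ d) ≫ c ◁ swapFirst a b d := by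
  have h := congrArg (fun t => 𝟙 (a ⊗ b ⊗ c ⊗ d) ⊗≫ (t ▷ d) ⊗≫ 𝟙 (c ⊗ b ⊗ a ⊗ d)) (BraidedCategory.yang_baxter' a b c)
  calc
    _ = 𝟙 _ ⊗≫ (((β_ a b).hom ▷ c ⊗≫ b ◁ (β_ a c).hom ⊗≫ (β_ b c).hom ▷ a) ▷ d) ⊗≫ 𝟙 _ := by
      dsimp only [swapFirst]; monoidal
    _ = _ := h
    _ = _ := by dsimp only [swapFirst]; monoidal

variable (b : D)

/-- The exchange of the first two factors of a tensor power. -/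
def tswap (n : ℕ) : tpow b (n + 2) ⟶ tpow b (n + 2) := swapFirst b b (tpow b n)

theorem tswap_tswap (n : ℕ) : tswap b n ≫ tswap b n = 𝟙 _ := swapFirst_swapFirst _ _ _

theorem tswap_natural {m n : ℕ} (f : tpow b m ⟶ tpow b n) :
    tcons b (tcons b f) ≫ tswap b n = tswap b m ≫ tcons b (tcons b f) :=
  swapFirst_whiskerLeft b b f

theorem tswap_yangBaxter (n : ℕ) :
    tswap b (n + 1) ≫ tcons b (tswap b n) ≫ tswap b (n + 1)
      = tcons b (tswap b n) ≫ tswap b (n + 1) ≫ tcons b (tswap b n) :=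
  swapFirst_yangBaxter b b b _

/-- The permutation of a tensor power that moves the first factor to the place `k` and preserves the
order of the others. -/
def tins : (n : ℕ) → Fin (n + 1) → (tpow b (n + 1) ⟶ tpow b (n + 1))
  | 0, _ => 𝟙 _
  | n + 1, k => Fin.cases (𝟙 _) (fun j => tswap b n ≫ tcons b (tins n j)) k

@[simp] theorem tins_zero : (n : ℕ) → tins b n 0 = 𝟙 _
  | 0 => rfl
  | _ + 1 => rfl

theorem tins_succ (n : ℕ) (j : Fin (n + 1)) :
    tins b (n + 1) j.succ = tswap b n ≫ tcons b (tins b n j) := rfl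

theorem succAbove_comm {n : ℕ} {k : Fin (n + 2)} {l : Fin (n + 1)} {k' : Fin (n + 1)}
    {l' : Fin (n + 2)} (hl : l' = k.succAbove l) (hk : l'.succAbove k' = k) (i : Fin n) :
    l'.succAbove (k'.succAbove i) = k.succAbove (l.succAbove i) := by
  subst hl
  have hk' := congrArg Fin.val hk
  ext
  simp only [Fin.succAbove, Fin.lt_def] at *
  split_ifs at * <;> simp at * <;> omega

/-- The insertions of two factors may be exchanged. -/
theorem tins_tins : ∀ (n : ℕ) (k : Fin (n + 2)) (l : Fin (n + 1)) (k' : Fin (n + 1))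
    (l' : Fin (n + 2)), l' = k.succAbove l → l'.succAbove k' = k →
    tswap b n ≫ tcons b (tins b n k') ≫ tins b (n + 1) l'
      = tcons b (tins b n l) ≫ tins b (n + 1) k := by
  intro n
  induction n with
  | zero =>
    intro k l k' l' hl hk
    obtain rfl := Fin.fin_one_eq_zero l
    obtain rfl := Fin.fin_one_eq_zero k'
    refine Fin.cases (fun hl hk => ?_) (fun j hl hk => ?_) k hl hk
    · obtain rfl : l' = Fin.succ 0 := hl
      rw [tins_succ, tins_zero, tins_zero, tcons_id, Category.id_comp, Category.comp_id,
        tswap_tswap]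
      exact (Category.comp_id _).symm
    · obtain rfl : l' = 0 := by simpa using hl
      obtain rfl := Fin.fin_one_eq_zero j
      rw [tins_succ, tins_zero, tins_zero, Category.comp_id, tcons_id, Category.id_comp]
  | succ n ih =>
    intro k l k' l' hl hk
    refine Fin.cases (fun hl hk => ?_) (fun j hl hk => ?_) k hl hk
    · obtain rfl : l' = l.succ := by simpa using hl
      obtain rfl : k' = 0 := by
        refine Fin.cases (fun _ => rfl) (fun i hi => ?_) k' hk
        rw [Fin.succ_succAbove_succ] at hi
        exact absurd hi (Fin.succ_ne_zero _)
      simp [tins_succ, reassoc_of% tswap_tswap]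
    · revert hl
      refine Fin.cases (fun hl => ?_) (fun i hl => ?_) l
      · obtain rfl : l' = 0 := by simpa using hl
        obtain rfl : k' = j := by simpa using hk
        simp [tins_succ]
      · rw [Fin.succ_succAbove_succ] at hl
        subst hl
        revert hk
        refine Fin.cases (fun hk => ?_) (fun k'' hk => ?_) k'
        · exact absurd hk.symm (by simp)
        · rw [Fin.succ_succAbove_succ, Fin.succ_inj] at hk
          have h := ih j i k'' _ rfl hk
          rw [tins_succ, tins_succ, tins_succ, tins_succ, tcons_comp, tcons_comp]
          simp only [Category.assoc]
          rw [reassoc_of% tswap_natural b (tins b n k''), ← tcons_comp,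
            reassoc_of% tswap_natural b (tins b n i), ← tcons_comp, ← h, tcons_comp, tcons_comp,
            reassoc_of% tswap_yangBaxter, tcons_comp]

/-- The action of a permutation on a tensor power: the factor `i` is moved to the place `σ i`. -/
def tperm : (n : ℕ) → Equiv.Perm (Fin n) → (tpow b n ⟶ tpow b n)
  | 0, _ => 𝟙 _
  | n + 1, σ => tcons b (tperm n (permTail σ)) ≫ tins b n (σ 0)

theorem tperm_succ (n : ℕ) (σ : Equiv.Perm (Fin (n + 1))) :
    tperm b (n + 1) σ = tcons b (tperm b n (permTail σ)) ≫ tins b n (σ 0) := rfl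

theorem permTail_eq {n : ℕ} {σ : Equiv.Perm (Fin (n + 1))} {τ : Equiv.Perm (Fin n)}
    (h : ∀ i, (σ 0).succAbove (τ i) = σ i.succ) : permTail σ = τ := by
  ext1 i
  apply Fin.succAbove_right_injective (p := σ 0)
  rw [succAbove_permTail, h]

theorem tins_tperm (n : ℕ) : ∀ (k : Fin (n + 1)) (σ : Equiv.Perm (Fin (n + 1)))
    (τ : Equiv.Perm (Fin n)), (∀ i, (σ k).succAbove (τ i) = σ (k.succAbove i)) →
    tins b n k ≫ tperm b (n + 1) σ = tcons b (tperm b n τ) ≫ tins b n (σ k) := by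
  induction n with
  | zero =>
    intro k σ τ h
    obtain rfl := Fin.fin_one_eq_zero k
    rw [tins_zero, Category.id_comp, tperm_succ, permTail_eq h]
  | succ n ih =>
    intro k σ τ
    refine Fin.cases (fun h => ?_) (fun j h => ?_) k
    · rw [tins_zero, Category.id_comp, tperm_succ, permTail_eq h]
    · have h0 : σ 0 = (σ j.succ).succAbove (τ 0) := by rw [h]; simp
      have h1 : (σ 0).succAbove (permTail σ j) = σ j.succ := succAbove_permTail σ j
      rw [tins_succ, tperm_succ, Category.assoc, ← reassoc_of% @tcons_comp, ih j (permTail σ) (permTail τ),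
        tcons_comp, Category.assoc, ← reassoc_of% tswap_natural, tins_tins b n _ _ _ _ h0 h1,
        tperm_succ, tcons_comp, Category.assoc]
      intro i
      apply Fin.succAbove_right_injective (p := σ 0)
      rw [succAbove_comm h0 h1, succAbove_permTail, succAbove_permTail, h, Fin.succ_succAbove_succ]


theorem exists_perm_succAbove {n : ℕ} (k : Fin (n + 1)) (σ : Equiv.Perm (Fin (n + 1))) :
    ∃ τ : Equiv.Perm (Fin n), ∀ i, (σ k).succAbove (τ i) = σ (k.succAbove i) := by
  have h : ∀ i, ∃ j, (σ k).succAbove j = σ (k.succAbove i) := fun i =>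
    Fin.exists_succAbove_eq fun e => Fin.succAbove_ne k i (σ.injective e)
  choose f hf using h
  refine ⟨Equiv.ofBijective f ((Finite.injective_iff_bijective).1 fun i j e => ?_), hf⟩
  have := hf i
  rw [e, hf j] at this
  exact Fin.succAbove_right_injective (σ.injective this.symm)

/-- The braiding defines an action of the symmetric group on tensor powers: the first factor is
moved to its final position by `tins_tperm`, and the remaining ones by induction. -/
theorem tperm_trans (n : ℕ) (σ τ : Equiv.Perm (Fin n)) :
    tperm b n σ ≫ tperm b n τ = tperm b n (σ.trans τ) := by
  induction n with
  | zero => exact Category.comp_id _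
  | succ n ih =>
    obtain ⟨τ', h⟩ := exists_perm_succAbove (σ 0) τ
    rw [tperm_succ, Category.assoc, tins_tperm b n _ _ _ h, ← reassoc_of% @tcons_comp, ih,
      tperm_succ]
    congr 3
    refine (permTail_eq fun i => ?_).symm
    change (τ (σ 0)).succAbove (τ' (permTail σ i)) = τ (σ i.succ)
    rw [h, succAbove_permTail]

theorem tperm_of_fix (n : ℕ) {σ : Equiv.Perm (Fin (n + 1))} {τ : Equiv.Perm (Fin n)}
    (h0 : σ 0 = 0) (h : ∀ i, σ i.succ = (τ i).succ) :
    tperm b (n + 1) σ = tcons b (tperm b n τ) := by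
  rw [tperm_succ, h0, tins_zero, Category.comp_id, permTail_eq fun i => ?_]
  rw [h0, h, Fin.succAbove_zero]

@[simp]
theorem tperm_refl (n : ℕ) : tperm b n (Equiv.refl _) = 𝟙 _ := by
  induction n with
  | zero => rfl
  | succ n ih => rw [tperm_of_fix b n (τ := Equiv.refl _) rfl fun _ => rfl, ih, tcons_id]

theorem tperm_eq_tins (n : ℕ) {k : Fin (n + 1)} {σ : Equiv.Perm (Fin (n + 1))}
    (h0 : σ 0 = k) (h : ∀ i, σ i.succ = k.succAbove i) : tperm b (n + 1) σ = tins b n k := by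
  rw [tperm_succ, permTail_eq (τ := Equiv.refl _) fun i => ?_, tperm_refl, tcons_id,
    Category.id_comp, h0]
  rw [h0, h, Equiv.refl_apply]

/-- The functoriality of tensor powers with respect to bijections. -/
def tmap {m n : ℕ} (σ : Fin m ≃ Fin n) : tpow b m ⟶ tpow b n :=
  tperm b m (σ.trans (finCongr (Fin.equiv_iff_eq.1 ⟨σ⟩).symm)) ≫
    eqToHom (congrArg (tpow b) (Fin.equiv_iff_eq.1 ⟨σ⟩))

@[simp]
theorem tmap_eq_tperm {n : ℕ} (σ : Equiv.Perm (Fin n)) : tmap b σ = tperm b n σ :=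
  Category.comp_id _

theorem tmap_trans {l m n : ℕ} (σ : Fin l ≃ Fin m) (τ : Fin m ≃ Fin n) :
    tmap b σ ≫ tmap b τ = tmap b (σ.trans τ) := by
  obtain rfl := Fin.equiv_iff_eq.1 ⟨σ⟩
  obtain rfl := Fin.equiv_iff_eq.1 ⟨τ⟩
  simp only [tmap_eq_tperm, tperm_trans]

theorem tmap_refl (n : ℕ) : tmap b (Equiv.refl (Fin n)) = 𝟙 _ := by simp

theorem tcons_tmap {m n : ℕ} (τ : Fin m ≃ Fin n) {σ : Fin (m + 1) ≃ Fin (n + 1)}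
    (h0 : σ 0 = 0) (h : ∀ i, σ i.succ = (τ i).succ) : tcons b (tmap b τ) = tmap b σ := by
  obtain rfl := Fin.equiv_iff_eq.1 ⟨τ⟩
  rw [tmap_eq_tperm, tmap_eq_tperm, tperm_of_fix b _ h0 h]


/-- The empty tensor power. -/
abbrev tnil : 𝟙_ D ≅ tpow b 0 := famNil fun _ => b

/-- The decomposition of a tensor power into its first factor and the others. -/
abbrev tcons' (n : ℕ) : b ⊗ tpow b n ≅ tpow b (n + 1) := famCons fun _ => b

theorem whiskerLeft_tcons' {m n : ℕ} (f : tpow b m ⟶ tpow b n) :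
    b ◁ f ≫ (tcons' b n).hom = (tcons' b m).hom ≫ tcons b f :=
  (Category.comp_id _).trans (Category.id_comp _).symm

theorem tcons'_inv_whiskerLeft {m n : ℕ} (f : tpow b m ⟶ tpow b n) :
    (tcons' b m).inv ≫ b ◁ f = tcons b f ≫ (tcons' b n).inv :=
  (Category.id_comp _).trans (Category.comp_id _).symm

theorem swapFirst_tcons' (n : ℕ) :
    swapFirst b b (tpow b n) ≫ b ◁ (tcons' b n).hom ≫ (tcons' b (n + 1)).hom
      = b ◁ (tcons' b n).hom ≫ (tcons' b (n + 1)).hom ≫ tswap b n := by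
  change swapFirst b b (tpow b n) ≫ b ◁ 𝟙 (b ⊗ tpow b n) ≫ 𝟙 (b ⊗ b ⊗ tpow b n)
    = b ◁ 𝟙 (b ⊗ tpow b n) ≫ 𝟙 (b ⊗ b ⊗ tpow b n) ≫ swapFirst b b (tpow b n)
  simp

/-- Concatenation of two tensor powers. -/
def tapp : (m n : ℕ) → (tpow b m ⊗ tpow b n ⟶ tpow b (m + n))
  | 0, n => (tnil b).inv ▷ _ ≫ (λ_ (tpow b n)).hom ≫ tmap b (NIso.zeroAdd n).symm
  | m + 1, n => (tcons' b m).inv ▷ _ ≫ (α_ b (tpow b m) (tpow b n)).hom ≫ b ◁ tapp m n ≫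
      (tcons' b (m + n)).hom ≫ tmap b (finCongr (Nat.succ_add m n).symm)

theorem tapp_zero (n : ℕ) :
    tapp b 0 n = (tnil b).inv ▷ _ ≫ (λ_ (tpow b n)).hom ≫ tmap b (NIso.zeroAdd n).symm := rfl

theorem tapp_succ (m n : ℕ) : tapp b (m + 1) n =
    (tcons' b m).inv ▷ _ ≫ (α_ b (tpow b m) (tpow b n)).hom ≫ b ◁ tapp b m n ≫
      (tcons' b (m + n)).hom ≫ tmap b (finCongr (Nat.succ_add m n).symm) := rfl

instance isIso_tmap {m n : ℕ} (σ : Fin m ≃ Fin n) : IsIso (tmap b σ) :=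
  ⟨tmap b σ.symm, by rw [tmap_trans, Equiv.self_trans_symm, tmap_refl],
    by rw [tmap_trans, Equiv.symm_trans_self, tmap_refl]⟩

instance isIso_tapp : ∀ m n : ℕ, IsIso (tapp b m n)
  | 0, n => by rw [tapp_zero]; infer_instance
  | m + 1, n => by
    have := isIso_tapp m n
    rw [tapp_succ]
    infer_instance

/-- The extension of a bijection by a first element. -/
def consEquiv {m n : ℕ} (τ : Fin m ≃ Fin n) : Fin (m + 1) ≃ Fin (n + 1) :=
  (finSuccEquiv m).trans ((Equiv.optionCongr τ).trans (finSuccEquiv n).symm)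

@[simp] theorem consEquiv_zero {m n : ℕ} (τ : Fin m ≃ Fin n) : consEquiv τ 0 = 0 := by
  simp [consEquiv]

@[simp] theorem consEquiv_succ {m n : ℕ} (τ : Fin m ≃ Fin n) (i : Fin m) :
    consEquiv τ i.succ = (τ i).succ := by
  simp [consEquiv]

theorem tcons_tmap' {m n : ℕ} (τ : Fin m ≃ Fin n) :
    tcons b (tmap b τ) = tmap b (consEquiv τ) :=
  tcons_tmap b τ (by simp) (by simp)

section
variable {m n : ℕ}

@[simp] theorem finCongr_succ_add_zero : finCongr (Nat.succ_add m n).symm 0 = Fin.castAdd n 0 := by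
  ext; simp
@[simp] theorem finCongr_succ_add_castAdd (i : Fin m) :
    finCongr (Nat.succ_add m n).symm (Fin.castAdd n i).succ = Fin.castAdd n i.succ := by
  ext; simp
@[simp] theorem finCongr_succ_add_natAdd (i : Fin n) :
    finCongr (Nat.succ_add m n).symm (Fin.natAdd m i).succ = Fin.natAdd (m + 1) i := by
  ext; simp; omega
@[simp] theorem zeroAdd_symm_apply (i : Fin n) : (NIso.zeroAdd n).symm i = Fin.natAdd 0 i := by
  rw [Equiv.symm_apply_eq, NIso.zeroAdd_natAdd]

theorem equiv_ext_succ_add {α : Type*} {σ τ : Fin (m + n + 1) ≃ α} (h0 : σ 0 = τ 0)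
    (h1 : ∀ i : Fin m, σ (Fin.castAdd n i).succ = τ (Fin.castAdd n i).succ)
    (h2 : ∀ i : Fin n, σ (Fin.natAdd m i).succ = τ (Fin.natAdd m i).succ) : σ = τ := by
  apply Equiv.ext
  refine Fin.cases h0 (Fin.addCases h1 h2)

end

@[simp] theorem sum_finCongr_refl {m m' n : ℕ} (h : m = m') :
    NIso.sum (finCongr h) (Equiv.refl (Fin n)) = finCongr (congrArg (· + n) h) := by
  subst h; exact NIso.sum_refl _ _

@[simp] theorem sum_refl_finCongr {m n n' : ℕ} (h : n = n') :
    NIso.sum (Equiv.refl (Fin m)) (finCongr h) = finCongr (congrArg (m + ·) h) := by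
  subst h; exact NIso.sum_refl _ _

@[simp] theorem consEquiv_finCongr {m n : ℕ} (h : m = n) :
    consEquiv (finCongr h) = finCongr (congrArg (· + 1) h) := by
  subst h
  apply Equiv.ext
  refine Fin.cases ?_ fun i => ?_ <;> simp

/-- Permuting the factors of the second of two concatenated tensor powers. -/
theorem tapp_natural_right (m : ℕ) {n n' : ℕ} (τ : Fin n ≃ Fin n') :
    tpow b m ◁ tmap b τ ≫ tapp b m n' = tapp b m n ≫ tmap b (NIso.sum (Equiv.refl _) τ) := by
  induction m with
  | zero =>
    rw [tapp_zero, tapp_zero, whisker_exchange_assoc, leftUnitor_naturality_assoc, tmap_trans,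
      Category.assoc, Category.assoc, tmap_trans]
    refine congrArg (fun t => _ ≫ _ ≫ tmap b t) ?_
    apply Equiv.ext
    intro i
    simp only [Equiv.trans_apply, zeroAdd_symm_apply, NIso.sum_natAdd]
  | succ m ih =>
    rw [tapp_succ, tapp_succ, whisker_exchange_assoc, associator_naturality_right_assoc,
      ← MonoidalCategory.whiskerLeft_comp_assoc, ih, MonoidalCategory.whiskerLeft_comp_assoc,
      reassoc_of% whiskerLeft_tcons' b (tmap b _), tcons_tmap']
    simp only [Category.assoc, tmap_trans]
    refine congrArg (fun t => _ ≫ _ ≫ _ ≫ _ ≫ tmap b t) ?_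
    apply equiv_ext_succ_add <;> simp only [Equiv.trans_apply, consEquiv_succ, consEquiv_zero, finCongr_succ_add_zero,
      finCongr_succ_add_castAdd, finCongr_succ_add_natAdd, NIso.sum_castAdd, NIso.sum_natAdd,
      Equiv.refl_apply, implies_true]

theorem swapFirst_whiskerRight (a b c d : D) :
    swapFirst a b c ▷ d ≫ (α_ b (a ⊗ c) d).hom ≫ b ◁ (α_ a c d).hom
      = (α_ a (b ⊗ c) d).hom ≫ a ◁ (α_ b c d).hom ≫ swapFirst a b (c ⊗ d) := by
  dsimp only [swapFirst]
  monoidal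

theorem tmap_swap (n : ℕ) : tmap b (Equiv.swap (0 : Fin (n + 2)) 1) = tswap b n := by
  rw [tmap_eq_tperm, ← Fin.succ_zero_eq_one, tperm_eq_tins b _ (k := Fin.succ 0) (Equiv.swap_apply_left _ _) ?_, tins_succ,
    tins_zero, tcons_id, Category.comp_id]
  refine Fin.cases ?_ fun i => ?_
  · exact Equiv.swap_apply_right _ _
  · rw [Equiv.swap_apply_of_ne_of_ne, Fin.succ_succAbove_succ, Fin.succAbove_zero]
    · exact Fin.succ_ne_zero _
    · exact fun h => Fin.succ_ne_zero _ (Fin.succ_injective _ h)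

/-- The permutations of the sets `Fin n` are generated by the exchanges of `0` and `1`, if one may
extend a permutation by a first element. -/
theorem perm_induction {P : ∀ n : ℕ, Equiv.Perm (Fin n) → Prop} (refl : ∀ n, P n (Equiv.refl _))
    (trans : ∀ n σ τ, P n σ → P n τ → P n (σ.trans τ))
    (cons : ∀ n σ, P n σ → P (n + 1) (consEquiv σ))
    (swap : ∀ n, P (n + 2) (Equiv.swap 0 1)) (n : ℕ) (σ : Equiv.Perm (Fin n)) : P n σ := by
  have cyc : ∀ (n : ℕ) (k : Fin (n + 1)), ∃ σ : Equiv.Perm (Fin (n + 1)), P _ σ ∧ σ 0 = k ∧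
      ∀ i, σ i.succ = k.succAbove i := by
    intro n
    induction n with
    | zero => exact fun k => ⟨_, refl _, (Fin.fin_one_eq_zero k).symm, fun i => i.elim0⟩
    | succ n ih =>
      refine Fin.cases ⟨_, refl _, rfl, fun i => by simp⟩ fun j => ?_
      obtain ⟨σ, h, h0, h1⟩ := ih j
      refine ⟨_, trans _ _ _ (swap n) (cons _ _ h), ?_, ?_⟩
      · rw [Equiv.trans_apply, Equiv.swap_apply_left]
        exact (consEquiv_succ σ 0).trans (congrArg _ h0)
      · refine Fin.cases ?_ fun i => ?_
        · rw [Equiv.trans_apply, Fin.succ_zero_eq_one, Equiv.swap_apply_right]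
          simp
        · rw [Equiv.trans_apply, Equiv.swap_apply_of_ne_of_ne, Fin.succ_succAbove_succ,
            consEquiv_succ, h1]
          · exact Fin.succ_ne_zero _
          · exact fun h => Fin.succ_ne_zero _ (Fin.succ_injective _ h)
  induction n with
  | zero => rw [Subsingleton.elim σ (Equiv.refl _)]; exact refl 0
  | succ n ih =>
    obtain ⟨τ, h, h0, h1⟩ := cyc n (σ 0)
    have e : σ = (consEquiv (permTail σ)).trans τ := by
      apply Equiv.ext
      refine Fin.cases ?_ fun i => ?_
      · simp [h0]
      · rw [Equiv.trans_apply, consEquiv_succ, h1, succAbove_permTail]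
    rw [e]
    exact trans _ _ _ (cons _ _ (ih _)) h

/-- Permuting the factors of the first of two concatenated tensor powers; by `perm_induction` only
the exchange of the first two factors needs an argument. -/
theorem tapp_natural_left {m m' : ℕ} (n : ℕ) (σ : Fin m ≃ Fin m') :
    tmap b σ ▷ tpow b n ≫ tapp b m' n = tapp b m n ≫ tmap b (NIso.sum σ (Equiv.refl _)) := by
  obtain rfl := Fin.equiv_iff_eq.1 ⟨σ⟩
  revert σ
  refine perm_induction (P := fun m σ => tmap b σ ▷ tpow b n ≫ tapp b m n
    = tapp b m n ≫ tmap b (NIso.sum σ (Equiv.refl _))) (fun m => ?_) (fun m σ τ hσ hτ => ?_)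
    (fun m σ h => ?_) (fun m => ?_) m
  · rw [tmap_refl, NIso.sum_refl, tmap_refl]
    simp
  · rw [← tmap_trans, comp_whiskerRight, Category.assoc, hτ, reassoc_of% hσ, tmap_trans,
      NIso.sum_trans, Equiv.refl_trans]
  · rw [← tcons_tmap', tapp_succ, ← comp_whiskerRight_assoc, ← tcons'_inv_whiskerLeft,
      comp_whiskerRight_assoc, associator_naturality_middle_assoc,
      ← MonoidalCategory.whiskerLeft_comp_assoc, h, MonoidalCategory.whiskerLeft_comp_assoc,
      reassoc_of% whiskerLeft_tcons' b (tmap b _), tcons_tmap']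
    simp only [Category.assoc, tmap_trans]
    refine congrArg (fun t => _ ≫ _ ≫ _ ≫ _ ≫ tmap b t) ?_
    apply equiv_ext_succ_add <;> simp only [Equiv.trans_apply, consEquiv_succ, consEquiv_zero, finCongr_succ_add_zero,
      finCongr_succ_add_castAdd, finCongr_succ_add_natAdd, NIso.sum_castAdd, NIso.sum_natAdd,
      Equiv.refl_apply, implies_true]
  · have h1 : (tswap b m ▷ tpow b n) ≫ (tcons' b (m + 1)).inv ▷ _ ≫
        (α_ b (tpow b (m + 1)) (tpow b n)).hom ≫ b ◁ (tcons' b m).inv ▷ _ ≫ b ◁ (α_ _ _ _).hom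
        = (tcons' b (m + 1)).inv ▷ _ ≫ (α_ b (tpow b (m + 1)) (tpow b n)).hom ≫
          b ◁ (tcons' b m).inv ▷ _ ≫ b ◁ (α_ _ _ _).hom ≫ swapFirst b b _ := by
      have h : b ◁ (tcons' b m).inv ▷ tpow b n = 𝟙 _ := by
        change b ◁ (𝟙 _ ▷ tpow b n) = _
        rw [MonoidalCategory.id_whiskerRight, MonoidalCategory.whiskerLeft_id]
      have h' : (tcons' b (m + 1)).inv ▷ tpow b n = 𝟙 _ := MonoidalCategory.id_whiskerRight _ _
      rw [h, h']
      erw [Category.id_comp, Category.id_comp, Category.id_comp, Category.id_comp]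
      exact swapFirst_whiskerRight b b (tpow b m) (tpow b n)
    rw [tapp_succ, tapp_succ, tmap_swap]
    simp only [MonoidalCategory.whiskerLeft_comp, Category.assoc]
    rw [reassoc_of% h1, ← reassoc_of% swapFirst_whiskerLeft]
    have h2 : ∀ {k l : ℕ} (e : Fin k ≃ Fin l), b ◁ tmap b e ≫ (tcons' b l).hom
        = (tcons' b k).hom ≫ tmap b (consEquiv e) := fun e => by
      rw [whiskerLeft_tcons', tcons_tmap']
    rw [reassoc_of% h2 (finCongr (Nat.succ_add m n).symm), reassoc_of% swapFirst_tcons',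
      ← tmap_swap]
    rw [reassoc_of% h2 (finCongr (Nat.succ_add m n).symm)]
    simp only [tmap_trans]
    refine congrArg (fun t => _ ≫ _ ≫ _ ≫ _ ≫ _ ≫ _ ≫ _ ≫ tmap b t) ?_
    apply Equiv.ext
    have e1 : Equiv.swap (0 : Fin (m + n + 2)) 1 0 = Fin.succ 0 := Equiv.swap_apply_left _ _
    have e2 : Equiv.swap (0 : Fin (m + n + 2)) 1 (Fin.succ 0) = 0 := Equiv.swap_apply_right _ _
    have e3 : Equiv.swap (0 : Fin (m + 2)) 1 0 = Fin.succ 0 := Equiv.swap_apply_left _ _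
    have e4 : Equiv.swap (0 : Fin (m + 2)) 1 (Fin.succ 0) = 0 := Equiv.swap_apply_right _ _
    have e5 : ∀ {k : ℕ} (i : Fin k), Equiv.swap (0 : Fin (k + 2)) 1 i.succ.succ = i.succ.succ :=
      fun i => Equiv.swap_apply_of_ne_of_ne (Fin.succ_ne_zero _)
        fun h => Fin.succ_ne_zero _ (Fin.succ_injective _ h)
    refine Fin.cases ?_ (Fin.cases ?_ (Fin.addCases (fun i => ?_) fun i => ?_)) <;>
    simp only [Equiv.trans_apply, consEquiv_succ, consEquiv_zero, finCongr_succ_add_zero,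
      finCongr_succ_add_castAdd, finCongr_succ_add_natAdd, NIso.sum_castAdd, NIso.sum_natAdd,
      Equiv.refl_apply, e1, e2, e3, e4, e5]

theorem tapp_assoc (l m n : ℕ) :
    tapp b l m ▷ tpow b n ≫ tapp b (l + m) n ≫ tmap b (NIso.assoc l m n)
      = (α_ _ _ _).hom ≫ tpow b l ◁ tapp b m n ≫ tapp b l (m + n) := by
  induction l with
  | zero =>
    rw [tapp_zero, tapp_zero]
    simp only [comp_whiskerRight, Category.assoc]
    rw [reassoc_of% tapp_natural_left, tmap_trans, whisker_exchange_assoc,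
      leftUnitor_naturality_assoc, ← associator_naturality_left_assoc, leftUnitor_tensor_hom_assoc,
      Iso.hom_inv_id_assoc]
    refine congrArg (fun t => _ ≫ _ ≫ _ ≫ tmap b t) ?_
    apply Equiv.ext
    refine Fin.addCases (fun i => ?_) fun i => ?_
    · simp only [Equiv.trans_apply, NIso.sum_castAdd, zeroAdd_symm_apply, NIso.assoc_2]
    · simp only [Equiv.trans_apply, NIso.sum_natAdd, zeroAdd_symm_apply, Equiv.refl_apply]
      exact NIso.assoc_3 i
  | succ l ih =>
    have ih' : tapp b l m ▷ tpow b n ≫ tapp b (l + m) n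
      = (α_ _ _ _).hom ≫ tpow b l ◁ tapp b m n ≫ tapp b l (m + n) ≫
        tmap b (NIso.assoc l m n).symm := by
      rw [← cancel_mono (tmap b (NIso.assoc l m n)), Category.assoc, ih]
      simp only [Category.assoc, tmap_trans, Equiv.symm_trans_self, tmap_refl, Category.comp_id]
    rw [tapp_succ, tapp_succ]
    simp only [comp_whiskerRight, Category.assoc]
    rw [reassoc_of% tapp_natural_left, tmap_trans, tapp_succ]
    simp only [Category.assoc]
    rw [← comp_whiskerRight_assoc (tcons' b (l + m)).hom, Iso.hom_inv_id, id_whiskerRight_assoc,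
      associator_naturality_middle_assoc, ← MonoidalCategory.whiskerLeft_comp_assoc, ih',
      whisker_exchange_assoc, ← associator_naturality_left_assoc, associator_naturality_right_assoc]
    simp only [MonoidalCategory.whiskerLeft_comp, Category.assoc]
    rw [reassoc_of% whiskerLeft_tcons' b (tmap b _), tcons_tmap', pentagon_assoc, tmap_trans,
      tmap_trans]
    refine congrArg (fun t => _ ≫ _ ≫ _ ≫ _ ≫ _ ≫ _ ≫ tmap b t) ?_
    simp only [NIso.assoc, finCongr_symm, sum_finCongr_refl, consEquiv_finCongr]
    rfl

theorem tapp_rightUnit (n : ℕ) :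
    tpow b n ◁ (tnil b).hom ≫ tapp b n 0 ≫ tmap b (NIso.addZero n) = (ρ_ (tpow b n)).hom := by
  induction n with
  | zero =>
    rw [tapp_zero]
    simp only [Category.assoc, tmap_trans]
    have e : (NIso.zeroAdd 0).symm.trans (NIso.addZero 0) = Equiv.refl _ := Subsingleton.elim _ _
    rw [e, tmap_refl, whisker_exchange_assoc, leftUnitor_naturality_assoc, Category.comp_id,
      unitors_equal, rightUnitor_naturality_assoc, Iso.inv_hom_id, Category.comp_id]
  | succ n ih =>
    rw [tapp_succ]
    simp only [Category.assoc, tmap_trans]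
    have e : (finCongr (Nat.succ_add n 0).symm).trans (NIso.addZero (n + 1))
      = consEquiv (NIso.addZero n) := by
      apply Equiv.ext
      refine Fin.cases ?_ fun i => ?_ <;> simp [NIso.addZero]
    rw [e, ← tcons_tmap', ← whiskerLeft_tcons', whisker_exchange_assoc,
      associator_naturality_right_assoc, ← MonoidalCategory.whiskerLeft_comp_assoc,
      ← MonoidalCategory.whiskerLeft_comp_assoc, Category.assoc, ih, ← rightUnitor_tensor_hom_assoc,
      rightUnitor_naturality_assoc, Iso.inv_hom_id, Category.comp_id]

/-- The cyclic permutation that moves the first element behind the next `n` elements. -/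
def cycEquiv (n m : ℕ) : Fin (n + m + 1) ≃ Fin (n + (m + 1)) :=
  (finCongr (by omega : n + m + 1 = 1 + n + m)).trans
    ((NIso.sum (NIso.swap 1 n) (Equiv.refl _)).trans (finCongr (by omega : n + 1 + m = n + (m + 1))))

@[simp] theorem cycEquiv_zero (n m : ℕ) : cycEquiv n m 0 = Fin.natAdd n 0 := by
  have h : finCongr (by omega : n + m + 1 = 1 + n + m) 0 = Fin.castAdd m (Fin.castAdd n 0) := by
    ext; simp
  rw [cycEquiv, Equiv.trans_apply, Equiv.trans_apply, h, NIso.sum_castAdd, NIso.swap_castAdd]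
  rfl

@[simp] theorem cycEquiv_castAdd (n m : ℕ) (i : Fin n) :
    cycEquiv n m (Fin.castAdd m i).succ = Fin.castAdd (m + 1) i := by
  have h : finCongr (by omega : n + m + 1 = 1 + n + m) (Fin.castAdd m i).succ
      = Fin.castAdd m (Fin.natAdd 1 i) := by
    ext; simp; omega
  rw [cycEquiv, Equiv.trans_apply, Equiv.trans_apply, h, NIso.sum_castAdd, NIso.swap_natAdd]
  rfl

@[simp] theorem cycEquiv_natAdd (n m : ℕ) (i : Fin m) :
    cycEquiv n m (Fin.natAdd n i).succ = Fin.natAdd n i.succ := by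
  have h : finCongr (by omega : n + m + 1 = 1 + n + m) (Fin.natAdd n i).succ
      = Fin.natAdd (1 + n) i := by
    ext; simp; omega
  rw [cycEquiv, Equiv.trans_apply, Equiv.trans_apply, h, NIso.sum_natAdd]
  ext; simp; omega

theorem swapFirst_tensor (a b c d : D) :
    swapFirst a (b ⊗ c) d ≫ (α_ b c (a ⊗ d)).hom
      = a ◁ (α_ b c d).hom ≫ swapFirst a b (c ⊗ d) ≫ b ◁ swapFirst a c d := by
  dsimp only [swapFirst]
  rw [BraidedCategory.braiding_tensor_right_hom]
  monoidal

theorem swapFirst_whiskerMid (a : D) {b b' : D} (f : b ⟶ b') (c : D) :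
    a ◁ f ▷ c ≫ swapFirst a b' c = swapFirst a b c ≫ f ▷ (a ⊗ c) := by
  simpa using swapFirst_natural (𝟙 a) f (𝟙 c)

theorem swapFirst_unit (a c : D) :
    swapFirst a (𝟙_ D) c ≫ (λ_ (a ⊗ c)).hom = a ◁ (λ_ c).hom := by
  dsimp only [swapFirst]
  rw [braiding_tensorUnit_right]
  monoidal

theorem swapFirst_tapp (n m : ℕ) :
    swapFirst b (tpow b n) (tpow b m) ≫ tpow b n ◁ (tcons' b m).hom ≫ tapp b n (m + 1)
      = b ◁ tapp b n m ≫ (tcons' b (n + m)).hom ≫ tmap b (cycEquiv n m) := by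
  induction n with
  | zero =>
    rw [tapp_zero, tapp_zero, whisker_exchange_assoc, leftUnitor_naturality_assoc]
    rw [← reassoc_of% swapFirst_whiskerMid, reassoc_of% swapFirst_unit]
    simp only [MonoidalCategory.whiskerLeft_comp, Category.assoc]
    rw [reassoc_of% whiskerLeft_tcons' b (tmap b _), tcons_tmap', tmap_trans]
    refine congrArg (fun t => _ ≫ _ ≫ _ ≫ tmap b t) ?_
    apply Equiv.ext
    refine Fin.cases ?_ fun i => ?_
    · rw [Equiv.trans_apply, consEquiv_zero, cycEquiv_zero, zeroAdd_symm_apply]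
    · rw [Equiv.trans_apply, consEquiv_succ, zeroAdd_symm_apply, zeroAdd_symm_apply,
        cycEquiv_natAdd]
  | succ n ih =>
    rw [tapp_succ, tapp_succ, whisker_exchange_assoc, associator_naturality_right_assoc,
      ← reassoc_of% swapFirst_whiskerMid, reassoc_of% swapFirst_tensor]
    have ih' := congrArg (b ◁ ·) ih
    simp only [MonoidalCategory.whiskerLeft_comp] at ih'
    rw [reassoc_of% ih']
    simp only [MonoidalCategory.whiskerLeft_comp, Category.assoc]
    have h2 : ∀ {k l : ℕ} (e : Fin k ≃ Fin l), b ◁ tmap b e ≫ (tcons' b l).hom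
        = (tcons' b k).hom ≫ tmap b (consEquiv e) := fun e => by
      rw [whiskerLeft_tcons', tcons_tmap']
    rw [← reassoc_of% swapFirst_whiskerLeft, reassoc_of% h2 (cycEquiv n m),
      reassoc_of% swapFirst_tcons', reassoc_of% h2 (finCongr (Nat.succ_add n m).symm), ← tmap_swap]
    simp only [tmap_trans]
    refine congrArg (fun t => _ ≫ _ ≫ _ ≫ _ ≫ _ ≫ tmap b t) ?_
    apply Equiv.ext
    have e1 : Equiv.swap (0 : Fin (n + m + 2)) 1 0 = Fin.succ 0 := Equiv.swap_apply_left _ _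
    have e2 : Equiv.swap (0 : Fin (n + m + 2)) 1 (Fin.succ 0) = 0 := Equiv.swap_apply_right _ _
    have e5 : ∀ {k : ℕ} (i : Fin k), Equiv.swap (0 : Fin (k + 2)) 1 i.succ.succ = i.succ.succ :=
      fun i => Equiv.swap_apply_of_ne_of_ne (Fin.succ_ne_zero _)
        fun h => Fin.succ_ne_zero _ (Fin.succ_injective _ h)
    refine Fin.cases ?_ (Fin.cases ?_ (Fin.addCases (fun i => ?_) fun i => ?_)) <;>
    simp only [Equiv.trans_apply, consEquiv_succ, consEquiv_zero, finCongr_succ_add_zero,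
      finCongr_succ_add_castAdd, finCongr_succ_add_natAdd, cycEquiv_zero, cycEquiv_castAdd,
      cycEquiv_natAdd, e1, e2, e5]

/-- Braiding two tensor powers is the block transposition of their concatenation. -/
theorem tapp_braiding (m n : ℕ) :
    (β_ (tpow b m) (tpow b n)).hom ≫ tapp b n m = tapp b m n ≫ tmap b (NIso.swap m n) := by
  induction m with
  | zero =>
    have h : (β_ (tpow b 0) (tpow b n)).hom
        = (tnil b).inv ▷ _ ≫ (λ_ _).hom ≫ (ρ_ _).inv ≫ _ ◁ (tnil b).hom := by
      have := BraidedCategory.braiding_naturality_left (tnil b).inv (tpow b n)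
      rw [braiding_tensorUnit_left] at this
      rw [← cancel_mono (tpow b n ◁ (tnil b).inv), ← this]
      simp only [Category.assoc]
      rw [← MonoidalCategory.whiskerLeft_comp, Iso.hom_inv_id, MonoidalCategory.whiskerLeft_id,
        Category.comp_id]
    have h' : tpow b n ◁ (tnil b).hom ≫ tapp b n 0
        = (ρ_ (tpow b n)).hom ≫ tmap b (NIso.addZero n).symm := by
      rw [← tapp_rightUnit]
      simp only [Category.assoc, tmap_trans, Equiv.self_trans_symm, tmap_refl, Category.comp_id]
    rw [tapp_zero, h]
    simp only [Category.assoc, tmap_trans]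
    rw [h', Iso.inv_hom_id_assoc]
    refine congrArg (fun t => _ ≫ _ ≫ tmap b t) ?_
    apply Equiv.ext
    intro i
    rw [Equiv.trans_apply, zeroAdd_symm_apply, NIso.swap_natAdd]
    rfl
  | succ m ih =>
    have h : (β_ (tpow b (m + 1)) (tpow b n)).hom = (tcons' b m).inv ▷ _ ≫ (α_ _ _ _).hom ≫
        b ◁ (β_ (tpow b m) (tpow b n)).hom ≫ swapFirst b (tpow b n) (tpow b m) ≫
          tpow b n ◁ (tcons' b m).hom := by
      have := BraidedCategory.braiding_naturality_left (tcons' b m).inv (tpow b n)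
      rw [BraidedCategory.braiding_tensor_left_hom] at this
      rw [← cancel_mono (tpow b n ◁ (tcons' b m).inv), ← this]
      simp only [Category.assoc, swapFirst]
      rw [← MonoidalCategory.whiskerLeft_comp, Iso.hom_inv_id, MonoidalCategory.whiskerLeft_id,
        Category.comp_id]
    rw [tapp_succ, h]
    simp only [Category.assoc]
    rw [swapFirst_tapp, ← MonoidalCategory.whiskerLeft_comp_assoc, ih]
    simp only [MonoidalCategory.whiskerLeft_comp, Category.assoc]
    rw [reassoc_of% whiskerLeft_tcons' b (tmap b _), tcons_tmap', tmap_trans, tmap_trans]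
    refine congrArg (fun t => _ ≫ _ ≫ _ ≫ _ ≫ tmap b t) ?_
    apply equiv_ext_succ_add <;> simp only [Equiv.trans_apply, consEquiv_succ, consEquiv_zero,
      finCongr_succ_add_zero, finCongr_succ_add_castAdd, finCongr_succ_add_natAdd, cycEquiv_zero,
      cycEquiv_castAdd, cycEquiv_natAdd, NIso.swap_castAdd, NIso.swap_natAdd, implies_true]

end TensorPower

/-! ### Tensor powers under morphisms and lax functors -/

section TensorPowerFunctoriality

universe v₁ u₁ v₂ u₂

variable {D : Type u₁} [Category.{v₁} D] [MonoidalCategory D]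

/-- The tensor power of a morphism. -/
abbrev tpowMap {b c : D} (f : b ⟶ c) (n : ℕ) : tpow b n ⟶ tpow c n := tensorFamMap n fun _ => f

theorem tpowMap_succ {b c : D} (f : b ⟶ c) (n : ℕ) :
    (famCons fun _ => b).hom ≫ tpowMap f (n + 1)
      = (f ⊗ₘ tpowMap f n) ≫ (famCons fun _ => c).hom :=
  (Category.id_comp _).trans (Category.comp_id _).symm

theorem tpowMap_zero {b c : D} (f : b ⟶ c) :
    (famNil fun _ => b).hom ≫ tpowMap f 0 = (famNil fun _ => c).hom :=
  Category.comp_id (𝟙 (𝟙_ D))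

variable [SymmetricCategory D]

theorem tcons_tpowMap {b c : D} (f : b ⟶ c) {m n : ℕ} {s : tpow b m ⟶ tpow b n}
    {t : tpow c m ⟶ tpow c n} (h : s ≫ tpowMap f n = tpowMap f m ≫ t) :
    tcons b s ≫ tpowMap f (n + 1) = tpowMap f (m + 1) ≫ tcons c t := by
  rw [← cancel_epi (tcons' b m).hom, reassoc_of% @tpowMap_succ, ← whiskerLeft_tcons',
    ← reassoc_of% @whiskerLeft_tcons', tpowMap_succ, ← id_tensorHom,
    ← id_tensorHom, tensorHom_comp_tensorHom_assoc, tensorHom_comp_tensorHom_assoc, h,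
    Category.id_comp, Category.comp_id]

theorem tmap_tpowMap {b c : D} (f : b ⟶ c) {m n : ℕ} (σ : Fin m ≃ Fin n) :
    tmap b σ ≫ tpowMap f n = tpowMap f m ≫ tmap c σ := by
  obtain rfl := Fin.equiv_iff_eq.1 ⟨σ⟩
  revert σ
  refine perm_induction (P := fun m σ => tmap b σ ≫ tpowMap f m = tpowMap f m ≫ tmap c σ)
    (fun m => by simp) (fun m σ τ hσ hτ => ?_) (fun m σ h => ?_) (fun m => ?_) m
  · rw [← tmap_trans, ← tmap_trans, Category.assoc, hτ, reassoc_of% hσ]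
  · rw [← tcons_tmap', ← tcons_tmap', tcons_tpowMap f h]
  · rw [tmap_swap, tmap_swap, ← cancel_epi (tcons' b (m + 1)).hom,
      ← cancel_epi (b ◁ (tcons' b m).hom), ← reassoc_of% swapFirst_tcons', reassoc_of% @tpowMap_succ,
      tpowMap_succ]
    have h : ∀ {b' c' : D} (f' : b' ⟶ c'), b' ◁ (tcons' b m).hom ≫ (f' ⊗ₘ tpowMap f (m + 1))
        = (f' ⊗ₘ f ⊗ₘ tpowMap f m) ≫ c' ◁ (tcons' c m).hom := fun f' => by
      rw [← id_tensorHom, ← id_tensorHom, tensorHom_comp_tensorHom, tensorHom_comp_tensorHom,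
        tpowMap_succ, Category.id_comp, Category.comp_id]
    rw [reassoc_of% h, reassoc_of% h, ← swapFirst_tcons', reassoc_of% @swapFirst_natural]

/-- The concatenation of tensor powers is natural in the object. -/
theorem tapp_tpowMap {b c : D} (f : b ⟶ c) (m n : ℕ) :
    tapp b m n ≫ tpowMap f (m + n) = (tpowMap f m ⊗ₘ tpowMap f n) ≫ tapp c m n := by
  induction m with
  | zero =>
    have h : (tnil b).inv ▷ tpow b n = (tpowMap f 0 ≫ (tnil c).inv) ▷ tpow b n := by
      rw [← cancel_epi ((tnil b).hom ▷ tpow b n), ← comp_whiskerRight, ← comp_whiskerRight,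
        reassoc_of% @tpowMap_zero]
      simp
    rw [tapp_zero, tapp_zero, h]
    simp only [Category.assoc, tmap_tpowMap]
    rw [← leftUnitor_naturality_assoc, ← whisker_exchange_assoc, tensorHom_def']
    simp
  | succ m ih =>
    rw [tapp_succ, tapp_succ]
    simp only [Category.assoc, tmap_tpowMap]
    rw [reassoc_of% @tpowMap_succ, ← id_tensorHom, tensorHom_comp_tensorHom_assoc, ih,
      Category.id_comp, ← cancel_epi ((tcons' b m).hom ▷ _)]
    have h : (tcons' b m).hom ▷ tpow b n ≫ (tpowMap f (m + 1) ⊗ₘ tpowMap f n)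
        = ((f ⊗ₘ tpowMap f m) ⊗ₘ tpowMap f n) ≫ (tcons' c m).hom ▷ tpow c n := by
      rw [← tensorHom_id, ← tensorHom_id, tensorHom_comp_tensorHom, tensorHom_comp_tensorHom,
        tpowMap_succ, Category.id_comp, Category.comp_id]
    rw [reassoc_of% h, ← comp_whiskerRight_assoc, ← comp_whiskerRight_assoc, Iso.hom_inv_id,
      Iso.hom_inv_id, id_whiskerRight, Category.id_comp, id_whiskerRight, Category.id_comp,
      associator_naturality_assoc, ← id_tensorHom, tensorHom_comp_tensorHom_assoc,
      Category.comp_id]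

variable {E : Type u₂} [Category.{v₂} E] [MonoidalCategory E] [SymmetricCategory E]
  (F : D ⥤ E)

/-- The structure map `F b ⊗ ⋯ ⊗ F b ⟶ F (b ⊗ ⋯ ⊗ b)` of a lax monoidal functor. -/
abbrev tpowμ [F.LaxMonoidal] (b : D) (n : ℕ) : tpow (F.obj b) n ⟶ F.obj (tpow b n) :=
  tensorFamμ F n fun _ => b

open Functor

theorem tpowμ_zero [F.LaxMonoidal] (b : D) :
    (tnil (F.obj b)).hom ≫ tpowμ F b 0 = LaxMonoidal.ε F ≫ F.map (tnil b).hom := by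
  refine (Category.id_comp _).trans (Eq.trans ?_ (congrArg (LaxMonoidal.ε F ≫ ·) (F.map_id _).symm))
  exact (Category.comp_id _).symm

theorem tpowμ_succ [F.LaxMonoidal] (b : D) (n : ℕ) :
    (tcons' (F.obj b) n).hom ≫ tpowμ F b (n + 1)
      = F.obj b ◁ tpowμ F b n ≫ LaxMonoidal.μ F _ _ ≫ F.map (tcons' b n).hom := by
  refine (Category.id_comp _).trans ?_
  refine Eq.trans ?_ (congrArg (fun t => _ ◁ _ ≫ LaxMonoidal.μ F _ _ ≫ t) (F.map_id _).symm)
  exact congrArg (_ ◁ _ ≫ ·) (Category.comp_id _).symm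

theorem tcons_tpowμ [F.LaxMonoidal] (b : D) {m n : ℕ} {s : tpow (F.obj b) m ⟶ tpow (F.obj b) n}
    {t : tpow b m ⟶ tpow b n} (h : s ≫ tpowμ F b n = tpowμ F b m ≫ F.map t) :
    tcons _ s ≫ tpowμ F b (n + 1) = tpowμ F b (m + 1) ≫ F.map (tcons b t) := by
  rw [← cancel_epi (tcons' (F.obj b) m).hom, reassoc_of% @tpowμ_succ,
    ← reassoc_of% @whiskerLeft_tcons', tpowμ_succ, ← MonoidalCategory.whiskerLeft_comp_assoc, h,
    ← F.map_comp, ← whiskerLeft_tcons', F.map_comp, MonoidalCategory.whiskerLeft_comp_assoc,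
    LaxMonoidal.μ_natural_right_assoc]

theorem swapFirst_μ [F.LaxBraided] (a b c : D) :
    swapFirst (F.obj a) (F.obj b) (F.obj c) ≫ F.obj b ◁ LaxMonoidal.μ F a c ≫
        LaxMonoidal.μ F b (a ⊗ c)
      = F.obj a ◁ LaxMonoidal.μ F b c ≫ LaxMonoidal.μ F a (b ⊗ c) ≫ F.map (swapFirst a b c) := by
  rw [swapFirst, swapFirst]
  simp only [Category.assoc, F.map_comp]
  have h := LaxMonoidal.associativity_inv F a b c
  rw [reassoc_of% h, ← LaxMonoidal.μ_natural_left_assoc, ← LaxMonoidal.associativity,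
    ← comp_whiskerRight_assoc, ← comp_whiskerRight_assoc, LaxBraided.braided]

/-- A braided functor is compatible with the action of bijections on tensor powers. -/
theorem tmap_tpowμ [F.LaxBraided] (b : D) {m n : ℕ} (σ : Fin m ≃ Fin n) :
    tmap (F.obj b) σ ≫ tpowμ F b n = tpowμ F b m ≫ F.map (tmap b σ) := by
  obtain rfl := Fin.equiv_iff_eq.1 ⟨σ⟩
  revert σ
  refine perm_induction (P := fun m σ => tmap (F.obj b) σ ≫ tpowμ F b m
      = tpowμ F b m ≫ F.map (tmap b σ))
    (fun m => by simp) (fun m σ τ hσ hτ => ?_) (fun m σ h => ?_) (fun m => ?_) m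
  · rw [← tmap_trans, ← tmap_trans, Category.assoc, hτ, reassoc_of% hσ, F.map_comp]
  · rw [← tcons_tmap', ← tcons_tmap', tcons_tpowμ F b h]
  · rw [tmap_swap, tmap_swap, ← cancel_epi (tcons' (F.obj b) (m + 1)).hom,
      ← cancel_epi (F.obj b ◁ (tcons' (F.obj b) m).hom), ← reassoc_of% swapFirst_tcons',
      reassoc_of% @tpowμ_succ, tpowμ_succ]
    have h : F.obj b ◁ (tcons' (F.obj b) m).hom ≫ F.obj b ◁ tpowμ F b (m + 1)
        = F.obj b ◁ F.obj b ◁ tpowμ F b m ≫ F.obj b ◁ LaxMonoidal.μ F _ _ ≫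
          F.obj b ◁ F.map (tcons' b m).hom := by
      rw [← MonoidalCategory.whiskerLeft_comp, tpowμ_succ]
      simp
    rw [reassoc_of% h, reassoc_of% h, ← reassoc_of% @swapFirst_whiskerLeft,
      LaxMonoidal.μ_natural_right_assoc, LaxMonoidal.μ_natural_right_assoc, ← F.map_comp,
      ← F.map_comp, ← F.map_comp, ← swapFirst_tcons', F.map_comp (swapFirst _ _ _),
      reassoc_of% swapFirst_μ]

/-- A braided functor is compatible with the concatenation of tensor powers. -/
theorem tapp_tpowμ [F.LaxBraided] (b : D) (m n : ℕ) :
    tapp (F.obj b) m n ≫ tpowμ F b (m + n)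
      = (tpowμ F b m ⊗ₘ tpowμ F b n) ≫ LaxMonoidal.μ F _ _ ≫ F.map (tapp b m n) := by
  induction m with
  | zero =>
    have h : (tnil (F.obj b)).hom ▷ _ ≫ (tpowμ F b 0 ⊗ₘ tpowμ F b n)
        = (LaxMonoidal.ε F ⊗ₘ tpowμ F b n) ≫ F.map (tnil b).hom ▷ _ := by
      rw [← tensorHom_id, ← tensorHom_id, tensorHom_comp_tensorHom, tensorHom_comp_tensorHom,
        tpowμ_zero, Category.id_comp, Category.comp_id]
    rw [← cancel_epi ((tnil (F.obj b)).hom ▷ _), reassoc_of% h, tapp_zero, tapp_zero]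
    simp only [Category.assoc, tmap_tpowμ]
    rw [LaxMonoidal.μ_natural_left_assoc, ← F.map_comp, hom_inv_whiskerRight_assoc,
      hom_inv_whiskerRight_assoc, F.map_comp, tensorHom_def'_assoc,
      ← LaxMonoidal.left_unitality_assoc, leftUnitor_naturality_assoc]
  | succ m ih =>
    have h : (tcons' (F.obj b) m).hom ▷ _ ≫ (tpowμ F b (m + 1) ⊗ₘ tpowμ F b n)
        = ((F.obj b ◁ tpowμ F b m) ⊗ₘ tpowμ F b n) ≫ LaxMonoidal.μ F _ _ ▷ _ ≫
          F.map (tcons' b m).hom ▷ _ := by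
      rw [← comp_whiskerRight, ← tensorHom_id, ← tensorHom_id, tensorHom_comp_tensorHom,
        tensorHom_comp_tensorHom, tpowμ_succ, Category.id_comp, Category.comp_id]
    rw [← cancel_epi ((tcons' (F.obj b) m).hom ▷ _), reassoc_of% h, tapp_succ, tapp_succ]
    simp only [Category.assoc, tmap_tpowμ]
    rw [LaxMonoidal.μ_natural_left_assoc, ← F.map_comp, hom_inv_whiskerRight_assoc,
      hom_inv_whiskerRight_assoc, F.map_comp, F.map_comp, F.map_comp, LaxMonoidal.associativity_assoc,
      reassoc_of% @tpowμ_succ, ← LaxMonoidal.μ_natural_right_assoc,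
      ← MonoidalCategory.whiskerLeft_comp_assoc, ih]
    have h2 := associator_naturality (𝟙 (F.obj b)) (tpowμ F b m) (tpowμ F b n)
    rw [id_tensorHom, id_tensorHom] at h2
    rw [reassoc_of% h2]
    simp only [MonoidalCategory.whiskerLeft_comp, Category.assoc]

end TensorPowerFunctoriality

/-! ### Generalised elements of symmetric sequences -/

section SymSeqElements

variable {A : Type u} [Category.{v} A] [MonoidalCategory A] [SymmetricCategory A] [Prevectoid A]

namespace QO

/-- The product of two generalised elements of symmetric sequences, in the Day convolution. -/
def tmul {X Y : QO A} {a c : A} {m n : ℕ} (x : a ⟶ X.term m) (y : c ⟶ Y.term n) :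
    a ⊗ c ⟶ (X ⊗ Y).term (m + n) :=
  (x ⊗ₘ y) ≫ X.dayι Y m n

section
variable {X X' Y Y' Z : QO A} {a a' b b' c c' : A} {l m n : ℕ}

theorem tensorHom_tmul (f : a' ⟶ a) (g : c' ⟶ c) (x : a ⟶ X.term m) (y : c ⟶ Y.term n) :
    (f ⊗ₘ g) ≫ tmul x y = tmul (f ≫ x) (g ≫ y) := by
  rw [tmul, tmul, tensorHom_comp_tensorHom_assoc]

theorem whiskerLeft_tmul (g : c' ⟶ c) (x : a ⟶ X.term m) (y : c ⟶ Y.term n) :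
    a ◁ g ≫ tmul x y = tmul x (g ≫ y) := by
  rw [← id_tensorHom, tensorHom_tmul, Category.id_comp]

theorem whiskerRight_tmul (f : a' ⟶ a) (x : a ⟶ X.term m) (y : c ⟶ Y.term n) :
    f ▷ c ≫ tmul x y = tmul (f ≫ x) y := by
  rw [← tensorHom_id, tensorHom_tmul, Category.id_comp]

theorem tmul_tensorHom (x : a ⟶ X.term m) (y : c ⟶ Y.term n) (f : X ⟶ X') (g : Y ⟶ Y') :
    tmul x y ≫ comp (f ⊗ₘ g) (m + n) = tmul (x ≫ comp f m) (y ≫ comp g n) := by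
  rw [tmul, Category.assoc, dayι_tensorHom, tensorHom_comp_tensorHom_assoc, tmul]

theorem tmul_whiskerLeft (x : a ⟶ X.term m) (y : c ⟶ Y.term n) (g : Y ⟶ Y') :
    tmul x y ≫ comp (X ◁ g) (m + n) = tmul x (y ≫ comp g n) := by
  rw [← id_tensorHom, tmul_tensorHom, comp_id, Category.comp_id]

theorem tmul_whiskerRight (x : a ⟶ X.term m) (y : c ⟶ Y.term n) (f : X ⟶ X') :
    tmul x y ≫ comp (f ▷ Y) (m + n) = tmul (x ≫ comp f m) y := by
  rw [← tensorHom_id, tmul_tensorHom, comp_id, Category.comp_id]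

theorem tmul_act_act {m' n' : ℕ} (x : a ⟶ X.term m) (y : c ⟶ Y.term n) (σ : Fin m' ≃ Fin m)
    (τ : Fin n' ≃ Fin n) :
    tmul (x ≫ X.act σ) (y ≫ Y.act τ) = tmul x y ≫ (X ⊗ Y).act (NIso.sum σ τ) := by
  rw [tmul, ← tensorHom_comp_tensorHom, Category.assoc, act_dayι, tmul, Category.assoc]

theorem tmul_act_left {m' : ℕ} (x : a ⟶ X.term m) (y : c ⟶ Y.term n) (σ : Fin m' ≃ Fin m) :
    tmul (x ≫ X.act σ) y = tmul x y ≫ (X ⊗ Y).act (NIso.sum σ (Equiv.refl _)) := by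
  rw [← tmul_act_act, act_refl, Category.comp_id]

theorem tmul_act_right {n' : ℕ} (x : a ⟶ X.term m) (y : c ⟶ Y.term n) (τ : Fin n' ≃ Fin n) :
    tmul x (y ≫ Y.act τ) = tmul x y ≫ (X ⊗ Y).act (NIso.sum (Equiv.refl _) τ) := by
  rw [← tmul_act_act, act_refl, Category.comp_id]

theorem tmul_associator (x : a ⟶ X.term l) (y : b ⟶ Y.term m) (z : c ⟶ Z.term n) :
    tmul (tmul x y) z ≫ comp (α_ X Y Z).hom (l + m + n)
      = (α_ a b c).hom ≫ tmul x (tmul y z) ≫ (X ⊗ Y ⊗ Z).act (NIso.assoc l m n) := by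
  have h1 : tmul (tmul x y) z
      = ((x ⊗ₘ y) ⊗ₘ z) ≫ X.dayι Y l m ▷ _ ≫ (X ⊗ Y).dayι Z (l + m) n := by
    rw [← tensorHom_id, tensorHom_comp_tensorHom_assoc, Category.comp_id]; rfl
  have h2 : tmul x (tmul y z) = (x ⊗ₘ (y ⊗ₘ z)) ≫ _ ◁ Y.dayι Z m n ≫ X.dayι (Y ⊗ Z) l (m + n) := by
    rw [← id_tensorHom, tensorHom_comp_tensorHom_assoc, Category.comp_id]; rfl
  rw [h1, h2, Category.assoc, Category.assoc, dayι_associator, associator_naturality_assoc]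
  simp only [Category.assoc]

theorem tmul_associator_inv (x : a ⟶ X.term l) (y : b ⟶ Y.term m) (z : c ⟶ Z.term n) :
    tmul x (tmul y z) ≫ comp (α_ X Y Z).inv (l + (m + n))
      = (α_ a b c).inv ≫ tmul (tmul x y) z ≫ ((X ⊗ Y) ⊗ Z).act (NIso.assoc l m n).symm := by
  rw [Iso.eq_inv_comp]
  have h := tmul_associator x y z
  have h' : tmul x (tmul y z) = tmul x (tmul y z) ≫ (X ⊗ Y ⊗ Z).act (NIso.assoc l m n) ≫
      (X ⊗ Y ⊗ Z).act (NIso.assoc l m n).symm := by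
    rw [act_act, act_of_eq _ (Equiv.symm_trans_self _), Category.comp_id]
  rw [h', Category.assoc, Category.assoc, act_comp, ← reassoc_of% h,
    ← Category.assoc (comp _ _), ← comp_comp, Iso.hom_inv_id, comp_id, Category.id_comp]

theorem tmul_braiding (x : a ⟶ X.term m) (y : c ⟶ Y.term n) :
    tmul x y ≫ comp (β_ X Y).hom (m + n)
      = (β_ a c).hom ≫ tmul y x ≫ (Y ⊗ X).act (NIso.swap m n) := by
  rw [tmul, tmul, Category.assoc, dayι_braiding, BraidedCategory.braiding_naturality_assoc,
    Category.assoc]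

theorem tmul_leftUnitor (x : a ⟶ X.term n) :
    tmul unitι x ≫ comp (λ_ X).hom (0 + n) = (λ_ a).hom ≫ x ≫ X.act (NIso.zeroAdd n) := by
  rw [tmul, tensorHom_def', Category.assoc, Category.assoc, dayι_leftUnitor,
    leftUnitor_naturality_assoc]

theorem tmul_rightUnitor (x : a ⟶ X.term n) :
    tmul x unitι ≫ comp (ρ_ X).hom (n + 0) = (ρ_ a).hom ≫ x ≫ X.act (NIso.addZero n) := by
  rw [tmul, MonoidalCategory.tensorHom_def, Category.assoc, Category.assoc, dayι_rightUnitor,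
    rightUnitor_naturality_assoc]

theorem tmul_swapFirst (x : a ⟶ X.term l) (y : b ⟶ Y.term m) (z : c ⟶ Z.term n) :
    tmul x (tmul y z) ≫ comp (swapFirst X Y Z) (l + (m + n))
      = swapFirst a b c ≫ tmul y (tmul x z) ≫ (Y ⊗ X ⊗ Z).act ((NIso.assoc l m n).symm.trans
          ((NIso.sum (NIso.swap l m) (Equiv.refl _)).trans (NIso.assoc m l n))) := by
  rw [swapFirst, comp_comp, comp_comp, reassoc_of% tmul_associator_inv, reassoc_of% act_comp,
    reassoc_of% tmul_whiskerRight, tmul_braiding, ← whiskerRight_tmul, tmul_act_left]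
  simp only [Category.assoc]
  rw [act_comp, reassoc_of% act_comp, reassoc_of% tmul_associator, swapFirst]
  simp only [Category.assoc, act_act]
  rfl

/-- The exchange of the middle two of four blocks. -/
def _root_.NIso.exchange (k l m n : ℕ) : Fin (k + l + (m + n)) ≃ Fin (k + m + (l + n)) :=
  (NIso.assoc k l (m + n)).trans ((NIso.sum (Equiv.refl _) ((NIso.assoc l m n).symm.trans
    ((NIso.sum (NIso.swap l m) (Equiv.refl _)).trans (NIso.assoc m l n)))).trans
      (NIso.assoc k m (l + n)).symm)

theorem tensorμ_eq {D : Type*} [Category* D] [MonoidalCategory D] [SymmetricCategory D]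
    (a b c d : D) : tensorμ a b c d
      = (α_ a b (c ⊗ d)).hom ≫ a ◁ swapFirst b c d ≫ (α_ a c (b ⊗ d)).inv := by
  rw [tensorμ, swapFirst]
  simp

section
variable {k l m n : ℕ}

theorem _root_.NIso.assoc_symm_1 (i : Fin l) : (NIso.assoc l m n).symm (Fin.castAdd (m + n) i)
    = Fin.castAdd n (Fin.castAdd m i) := by rw [← NIso.assoc_1, Equiv.symm_apply_apply]

theorem _root_.NIso.assoc_symm_2 (i : Fin m) :
    (NIso.assoc l m n).symm (Fin.natAdd l (Fin.castAdd n i))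
      = Fin.castAdd n (Fin.natAdd l i) := by rw [← NIso.assoc_2, Equiv.symm_apply_apply]

theorem _root_.NIso.assoc_symm_3 (i : Fin n) :
    (NIso.assoc l m n).symm (Fin.natAdd l (Fin.natAdd m i)) = Fin.natAdd (l + m) i := by
  rw [← NIso.assoc_3, Equiv.symm_apply_apply]

theorem _root_.NIso.exchange_castAdd_natAdd (i : Fin l) :
    NIso.exchange k l m n (Fin.castAdd (m + n) (Fin.natAdd k i))
      = Fin.natAdd (k + m) (Fin.castAdd n i) := by
  simp only [NIso.exchange, Equiv.trans_apply, NIso.assoc_1, NIso.assoc_2, NIso.assoc_3,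
    NIso.assoc_symm_1, NIso.assoc_symm_2, NIso.assoc_symm_3, NIso.sum_castAdd, NIso.sum_natAdd,
    NIso.swap_castAdd, NIso.swap_natAdd, Equiv.refl_apply]

theorem _root_.NIso.exchange_natAdd_natAdd (i : Fin n) :
    NIso.exchange k l m n (Fin.natAdd (k + l) (Fin.natAdd m i))
      = Fin.natAdd (k + m) (Fin.natAdd l i) := by
  simp only [NIso.exchange, Equiv.trans_apply, NIso.assoc_1, NIso.assoc_2, NIso.assoc_3,
    NIso.assoc_symm_1, NIso.assoc_symm_2, NIso.assoc_symm_3, NIso.sum_castAdd, NIso.sum_natAdd,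
    NIso.swap_castAdd, NIso.swap_natAdd, Equiv.refl_apply]

end

theorem tensorμ_unit {D : Type*} [Category* D] [MonoidalCategory D] [SymmetricCategory D]
    (a b : D) : tensorμ a (𝟙_ D) b (𝟙_ D) ≫ (a ⊗ b) ◁ (λ_ (𝟙_ D)).hom ≫ (ρ_ (a ⊗ b)).hom
      = (ρ_ a).hom ⊗ₘ (ρ_ b).hom := by
  rw [tensorμ_eq, swapFirst, braiding_tensorUnit_left]
  monoidal

/-- The exchange of the two middle factors, on products of generalised elements. -/
theorem tmul_tensorμ {W : QO A} {d : A} {k : ℕ} (x : a ⟶ X.term k) (y : b ⟶ Y.term l)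
    (z : c ⟶ Z.term m) (w : d ⟶ W.term n) :
    tmul (tmul x y) (tmul z w) ≫ comp (tensorμ X Y Z W) (k + l + (m + n))
      = tensorμ a b c d ≫ tmul (tmul x z) (tmul y w) ≫
        ((X ⊗ Z) ⊗ (Y ⊗ W)).act (NIso.exchange k l m n) := by
  rw [tensorμ_eq, tensorμ_eq, comp_comp, comp_comp, reassoc_of% tmul_associator, reassoc_of% act_comp,
    act_comp, reassoc_of% tmul_whiskerLeft, tmul_swapFirst, ← whiskerLeft_tmul, tmul_act_right]
  simp only [Category.assoc]
  rw [reassoc_of% act_comp, reassoc_of% tmul_associator_inv]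
  simp only [act_act]
  rfl

end

/-- A generalised element generates a symmetric sequence if it distinguishes morphisms. -/
def IsGen {a : A} {X : QO A} {n : ℕ} (x : a ⟶ X.term n) : Prop :=
  Epi (monoDesc (n := ⟨n⟩) x)

theorem IsGen.hom_ext {a : A} {X Z : QO A} {n : ℕ} {x : a ⟶ X.term n} (h : IsGen x) {f g : X ⟶ Z}
    (e : x ≫ comp f n = x ≫ comp g n) : f = g := by
  have : Epi (monoDesc (n := ⟨n⟩) x) := h
  rw [← cancel_epi (monoDesc (n := ⟨n⟩) x)]
  apply mono_hom_ext
  have h1 : ∀ k : X ⟶ Z, monoι a ⟨n⟩ ≫ (monoDesc (n := ⟨n⟩) x ≫ k).natTrans.app (op ⟨n⟩)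
      = x ≫ comp k n := fun k => by
    have := monoι_monoDesc (n := ⟨n⟩) x
    rw [DayFunctor.comp_natTrans, NatTrans.comp_app, reassoc_of% this]
  rw [h1, h1, e]

/-- Morphisms out of the free sequence on `a` are generalised elements, so `IsGen` is the statement
that morphisms are determined by their value at `x`. -/
theorem isGen_of_hom_ext {a : A} {X : QO A} {n : ℕ} {x : a ⟶ X.term n}
    (h : ∀ (Z : QO A) (f g : X ⟶ Z), x ≫ comp f n = x ≫ comp g n → f = g) : IsGen x := by
  refine ⟨fun {Z} f g e => h Z f g ?_⟩
  have h1 : ∀ k : X ⟶ Z, monoι a ⟨n⟩ ≫ (monoDesc (n := ⟨n⟩) x ≫ k).natTrans.app (op ⟨n⟩)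
      = x ≫ comp k n := fun k => by
    have := monoι_monoDesc (n := ⟨n⟩) x
    rw [DayFunctor.comp_natTrans, NatTrans.comp_app, reassoc_of% this]
  rw [← h1, ← h1, e]

theorem isGen_monoι (a : A) (n : ℕ) : IsGen (X := mono a ⟨n⟩) (monoι a ⟨n⟩) :=
  isGen_of_hom_ext fun _ _ _ => mono_hom_ext

/-- The universal element of `(a, ∅, ∅, …)`. -/
def constElem (a : A) : a ⟶ ((const A).obj a).term 0 := constι a

theorem isGen_constElem (a : A) : IsGen (constElem a) :=
  isGen_monoι a 0

theorem isGen_univι : IsGen (univι (A := A)) := isGen_monoι _ 1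

theorem isGen_unitι : IsGen (unitι (A := A)) := isGen_of_hom_ext fun _ _ _ => unit_hom_ext

theorem IsGen.act {a : A} {X : QO A} {m n : ℕ} {x : a ⟶ X.term n} (h : IsGen x)
    (σ : Fin m ≃ Fin n) : IsGen (x ≫ X.act σ) :=
  isGen_of_hom_ext fun Z f g e => h.hom_ext <| by
    rw [Category.assoc, Category.assoc, act_comp, act_comp, ← Category.assoc, ← Category.assoc] at e
    have : IsIso (Z.act σ) := isIso_act _ _
    exact (cancel_mono _).1 e

theorem IsGen.comp_epi {a : A} {X Y : QO A} {n : ℕ} {x : a ⟶ X.term n} (h : IsGen x) (f : X ⟶ Y)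
    [Epi f] : IsGen (x ≫ comp f n) :=
  isGen_of_hom_ext fun Z g g' e => by
    rw [← cancel_epi f]
    apply h.hom_ext
    rw [comp_comp, comp_comp, ← Category.assoc, ← Category.assoc, e]

theorem IsGen.precomp {a a' : A} {X : QO A} {n : ℕ} {x : a ⟶ X.term n} (h : IsGen x) (f : a' ⟶ a)
    [Epi f] : IsGen (f ≫ x) :=
  isGen_of_hom_ext fun Z g g' e => h.hom_ext <| by
    rw [← cancel_epi f, ← Category.assoc, ← Category.assoc, e]

theorem epi_whiskerLeft (X : QO A) {Y Z : QO A} (f : Y ⟶ Z) [Epi f] : Epi (X ◁ f) := by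
  have := Prevectoid.preservesColimits_tensorLeft X
  exact inferInstanceAs (Epi ((tensorLeft X).map f))

theorem epi_whiskerRight {Y Z : QO A} (f : Y ⟶ Z) (X : QO A) [Epi f] : Epi (f ▷ X) := by
  have := Prevectoid.preservesColimits_tensorRight X
  exact inferInstanceAs (Epi ((tensorRight X).map f))

/-- Products of generators generate, because tensoring preserves epimorphisms and the product of two
free sequences is generated by the product of their universal elements. -/
theorem IsGen.tmul {a c : A} {X Y : QO A} {m n : ℕ} {x : a ⟶ X.term m} {y : c ⟶ Y.term n}
    (hx : IsGen x) (hy : IsGen y) : IsGen (tmul x y) :=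
  isGen_of_hom_ext fun Z f g e => by
    have : Epi (monoDesc (n := ⟨m⟩) x) := hx
    have : Epi (monoDesc (n := ⟨n⟩) y) := hy
    have h1 := epi_whiskerLeft X (monoDesc (n := ⟨n⟩) y)
    have h2 := epi_whiskerRight (monoDesc (n := ⟨m⟩) x) (mono c ⟨n⟩)
    -- replace `X` and `Y` by the free sequences on the two elements, one after the other
    rw [← cancel_epi (X ◁ monoDesc (n := ⟨n⟩) y), ← cancel_epi (monoDesc (n := ⟨m⟩) x ▷ _)]
    apply monoTensor_hom_ext
    have h : ∀ k : X ⊗ Y ⟶ Z, QO.tmul (X := mono a ⟨m⟩) (Y := mono c ⟨n⟩) (monoι a ⟨m⟩) (monoι c ⟨n⟩) ≫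
        comp (monoDesc (n := ⟨m⟩) x ▷ _ ≫ X ◁ monoDesc (n := ⟨n⟩) y ≫ k) (m + n) = QO.tmul x y ≫ comp k (m + n) := by
      intro k
      have e1 : monoι a ⟨m⟩ ≫ comp (monoDesc (n := ⟨m⟩) x) m = x := monoι_monoDesc (n := ⟨m⟩) x
      have e2 : monoι c ⟨n⟩ ≫ comp (monoDesc (n := ⟨n⟩) y) n = y := monoι_monoDesc (n := ⟨n⟩) y
      rw [comp_comp, comp_comp, reassoc_of% tmul_whiskerRight, reassoc_of% tmul_whiskerLeft, e1, e2]
    have e' := (h f).trans (e.trans (h g).symm)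
    simp only [QO.tmul, Category.assoc] at e'
    exact e'

/-! ### Tensor powers of the universal object -/

/-- The universal element of the tensor power `X_o ⊗ ⋯ ⊗ X_o`. -/
def upowι : (n : ℕ) → (𝟙_ A ⟶ (tpow (univ A) n).term n)
  | 0 => unitι ≫ comp (tnil (univ A)).hom 0
  | n + 1 => (λ_ (𝟙_ A)).inv ≫ tmul univι (upowι n) ≫ comp (tcons' (univ A) n).hom (1 + n) ≫
      (tpow (univ A) (n + 1)).act (finCongr (Nat.add_comm n 1))

theorem upowι_zero : upowι (A := A) 0 = unitι ≫ comp (tnil (univ A)).hom 0 := rfl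

theorem upowι_succ (n : ℕ) : upowι (A := A) (n + 1) = (λ_ (𝟙_ A)).inv ≫ tmul univι (upowι n) ≫
    comp (tcons' (univ A) n).hom (1 + n) ≫
      (tpow (univ A) (n + 1)).act (finCongr (Nat.add_comm n 1)) := rfl

theorem isGen_upowι : ∀ n : ℕ, IsGen (upowι (A := A) n)
  | 0 => isGen_unitι.comp_epi _
  | n + 1 => by
    have h := (((isGen_univι.tmul (isGen_upowι n)).comp_epi (tcons' (univ A) n).hom).act
      (finCongr (Nat.add_comm n 1))).precomp (λ_ (𝟙_ A)).inv
    rw [upowι_succ]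
    simpa only [Category.assoc] using h

/-- Under the isomorphism of `X_o ⊗ ⋯ ⊗ X_o` with the free sequence in degree `n`, the product of
the universal elements corresponds to the universal element. -/
theorem upowι_univPow : ∀ n : ℕ, upowι (A := A) n ≫ comp (univPow n) n = monoι (𝟙_ A) ⟨n⟩
  | 0 => by
    have h : unitι ≫ comp (X := 𝟙_ (QO A)) (univPow 0) 0 = monoι (𝟙_ A) ⟨0⟩ :=
      DayFunctor.ν_comp_unitDesc _
    rw [upowι_zero, Category.assoc, ← comp_comp]
    refine Eq.trans ?_ h
    exact congrArg (fun t => unitι ≫ comp t 0) (Category.id_comp _)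
  | n + 1 => by
    have ih := upowι_univPow n
    obtain ⟨t, h1, h⟩ : ∃ t : univ A ⊗ mono (𝟙_ A) ⟨n⟩ ⟶ mono (𝟙_ A ⊗ 𝟙_ A) ⟨1 + n⟩,
        tmul univι (monoι (𝟙_ A) ⟨n⟩) ≫ comp t (1 + n) = monoι (𝟙_ A ⊗ 𝟙_ A) ⟨1 + n⟩ ∧
        (tcons' (univ A) n).hom ≫ univPow (n + 1) = univ A ◁ univPow n ≫ t ≫
          monoMap (λ_ (𝟙_ A)).hom
            (NIso.isoMk (m := ⟨1 + n⟩) (n := ⟨n + 1⟩) (finCongr (Nat.add_comm 1 n))).hom :=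
      ⟨monoTensor (𝟙_ A) (𝟙_ A) ⟨1⟩ ⟨n⟩,
        (Category.assoc _ _ _).trans (monoι_η_monoTensor (𝟙_ A) (𝟙_ A) ⟨1⟩ ⟨n⟩), Category.id_comp _⟩
    have h2 : monoι (𝟙_ A ⊗ 𝟙_ A) ⟨1 + n⟩ ≫ comp (monoMap (λ_ (𝟙_ A)).hom
          (NIso.isoMk (m := ⟨1 + n⟩) (n := ⟨n + 1⟩) (finCongr (Nat.add_comm 1 n))).hom) (1 + n)
        = (λ_ (𝟙_ A)).hom ≫ monoι (𝟙_ A) ⟨n + 1⟩ ≫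
          (mono (𝟙_ A) ⟨n + 1⟩).act (finCongr (Nat.add_comm 1 n)) :=
      monoι_monoMap _ _
    rw [upowι_succ]
    simp only [Category.assoc]
    rw [act_comp, ← Category.assoc (comp _ _), ← comp_comp, h, comp_comp, comp_comp]
    simp only [Category.assoc]
    rw [reassoc_of% tmul_whiskerLeft, ih, reassoc_of% h1, reassoc_of% h2, act_act,
      Iso.inv_hom_id_assoc, act_of_eq, Category.comp_id]
    rfl

/-- The morphism `(X_n, ∅, ∅, …) ⊗ X_o ⊗ ⋯ ⊗ X_o ⟶ X` takes the universal element to the identity of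
`X_n`, up to unitors. -/
theorem termMap_elem (X : QO A) (n : ℕ) :
    tmul (constElem (X.term n)) (upowι n) ≫
      comp (termMap X n) (0 + n) = (ρ_ (X.term n)).hom ≫ X.act (NIso.zeroAdd n) := by
  obtain ⟨t, h1, h⟩ : ∃ t : (const A).obj (X.term n) ⊗ mono (𝟙_ A) ⟨n⟩ ⟶
        mono (X.term n ⊗ 𝟙_ A) ⟨0 + n⟩,
      tmul (constElem (X.term n)) (monoι (𝟙_ A) ⟨n⟩) ≫
        comp t (0 + n) = monoι (X.term n ⊗ 𝟙_ A) ⟨0 + n⟩ ∧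
      termMap X n = (const A).obj (X.term n) ◁ univPow n ≫ t ≫
        monoMap (ρ_ (X.term n)).hom
          (NIso.isoMk (m := ⟨0 + n⟩) (n := ⟨n⟩) (NIso.zeroAdd n)).hom ≫
            monoDesc (n := ⟨n⟩) (𝟙 (X.term n)) :=
    ⟨monoTensor (X.term n) (𝟙_ A) (𝟙_ NIso) ⟨n⟩,
      (Category.assoc _ _ _).trans (monoι_η_monoTensor (X.term n) (𝟙_ A) (𝟙_ NIso) ⟨n⟩), rfl⟩
  have h2 : monoι (X.term n ⊗ 𝟙_ A) ⟨0 + n⟩ ≫ comp (monoMap (ρ_ (X.term n)).hom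
          (NIso.isoMk (m := ⟨0 + n⟩) (n := ⟨n⟩) (NIso.zeroAdd n)).hom) (0 + n)
      = (ρ_ (X.term n)).hom ≫ monoι (X.term n) ⟨n⟩ ≫
        (mono (X.term n) ⟨n⟩).act (NIso.zeroAdd n) :=
    monoι_monoMap _ _
  have h3 : monoι (X.term n) ⟨n⟩ ≫ comp (monoDesc (n := ⟨n⟩) (𝟙 (X.term n))) n = 𝟙 _ :=
    monoι_monoDesc (n := ⟨n⟩) (𝟙 (X.term n))
  rw [h, comp_comp, comp_comp, comp_comp, reassoc_of% tmul_whiskerLeft, upowι_univPow,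
    reassoc_of% h1, reassoc_of% h2, act_comp, reassoc_of% h3]

/-- Permuting the factors of `X_o ⊗ ⋯ ⊗ X_o` by the braiding agrees, on the universal element, with
the action of the symmetric group on the symmetric sequence. -/
theorem upowι_tmap {m n : ℕ} (σ : Fin m ≃ Fin n) :
    upowι m ≫ comp (tmap (univ A) σ) m = upowι n ≫ (tpow (univ A) n).act σ := by
  obtain rfl := Fin.equiv_iff_eq.1 ⟨σ⟩
  revert σ
  refine perm_induction (P := fun m σ => upowι m ≫ comp (tmap (univ A) σ) m
      = upowι m ≫ (tpow (univ A) m).act σ)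
    (fun m => ?_) (fun m σ τ hσ hτ => ?_) (fun m σ h => ?_) (fun m => ?_) m
  · rw [tmap_refl, comp_id, act_refl]
  · rw [← tmap_trans, comp_comp, reassoc_of% hσ, act_comp, reassoc_of% hτ, act_act]
  · rw [← tcons_tmap', upowι_succ]
    simp only [Category.assoc]
    rw [act_comp, ← Category.assoc (comp _ _), ← comp_comp, ← whiskerLeft_tcons', comp_comp]
    simp only [Category.assoc]
    rw [reassoc_of% tmul_whiskerLeft, h, tmul_act_right, Category.assoc, reassoc_of% act_comp,
      act_act, act_act]
    refine congrArg (fun t => _ ≫ _ ≫ _ ≫ act _ t) ?_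
    apply Equiv.ext
    refine Fin.cases ?_ fun i => ?_
    · simp only [Equiv.trans_apply, consEquiv_zero]
      have e : ∀ k : ℕ, finCongr (Nat.add_comm k 1) 0 = Fin.castAdd k 0 := fun k => by ext; simp
      rw [e, NIso.sum_castAdd, Equiv.refl_apply]
    · simp only [Equiv.trans_apply, consEquiv_succ]
      have e : ∀ (k : ℕ) (i : Fin k), finCongr (Nat.add_comm k 1) i.succ = Fin.natAdd 1 i :=
        fun k i => by ext; simp; omega
      rw [e, e, NIso.sum_natAdd]
  -- the exchange of the first two factors: both are split off from the universal element
  · have h0 : upowι (A := A) (m + 2) = (λ_ (𝟙_ A)).inv ≫ 𝟙_ A ◁ (λ_ (𝟙_ A)).inv ≫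
        tmul univι (tmul univι (upowι m)) ≫ comp (univ A ◁ (tcons' (univ A) m).hom ≫
          (tcons' (univ A) (m + 1)).hom) (1 + (1 + m)) ≫ (tpow (univ A) (m + 2)).act
            (finCongr (by omega)) := by
      have e1 : ∀ σ : Fin (m + 1) ≃ Fin (1 + m), tmul univι (tmul univι (upowι m) ≫
            comp (tcons' (univ A) m).hom (1 + m) ≫ (tpow (univ A) (m + 1)).act σ)
          = tmul univι (tmul univι (upowι m)) ≫ comp (univ A ◁ (tcons' (univ A) m).hom)
            (1 + (1 + m)) ≫ (univ A ⊗ tpow (univ A) (m + 1)).act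
              (NIso.sum (Equiv.refl (Fin 1)) σ) := fun σ => by
        rw [← act_comp, ← Category.assoc, ← tmul_whiskerLeft, tmul_act_right, Category.assoc,
          act_comp]
      rw [upowι_succ, upowι_succ, comp_comp, ← whiskerLeft_tmul, e1]
      simp only [Category.assoc]
      rw [reassoc_of% act_comp, act_act, sum_refl_finCongr]
      rfl
    have h1 : (λ_ (𝟙_ A)).inv ≫ 𝟙_ A ◁ (λ_ (𝟙_ A)).inv ≫ swapFirst (𝟙_ A) (𝟙_ A) (𝟙_ A)
        = (λ_ (𝟙_ A)).inv ≫ 𝟙_ A ◁ (λ_ (𝟙_ A)).inv := by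
      rw [swapFirst, braiding_tensorUnit_left, unitors_equal, Iso.hom_inv_id]
      simp
    rw [tmap_swap, h0]
    simp only [Category.assoc]
    rw [act_comp, ← Category.assoc (comp _ _) (comp _ _), ← comp_comp, Category.assoc,
      ← swapFirst_tcons', comp_comp]
    simp only [Category.assoc]
    rw [reassoc_of% tmul_swapFirst, reassoc_of% h1, reassoc_of% act_comp, act_act, act_act]
    refine congrArg (fun t => _ ≫ _ ≫ _ ≫ _ ≫ act _ t) ?_
    have e0 : finCongr (by omega : m + 2 = 1 + (1 + m)) 0 = Fin.castAdd (1 + m) 0 := by ext; simp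
    have e1 : finCongr (by omega : m + 2 = 1 + (1 + m)) (Fin.succ 0)
        = Fin.natAdd 1 (Fin.castAdd m 0) := by ext; simp
    have e2 : ∀ i : Fin m, finCongr (by omega : m + 2 = 1 + (1 + m)) i.succ.succ
        = Fin.natAdd 1 (Fin.natAdd 1 i) := fun i => by ext; simp; omega
    have s1 : Equiv.swap (0 : Fin (m + 2)) 1 0 = Fin.succ 0 := Equiv.swap_apply_left _ _
    have s2 : Equiv.swap (0 : Fin (m + 2)) 1 (Fin.succ 0) = 0 := Equiv.swap_apply_right _ _
    have s3 : ∀ i : Fin m, Equiv.swap (0 : Fin (m + 2)) 1 i.succ.succ = i.succ.succ :=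
      fun i => Equiv.swap_apply_of_ne_of_ne (Fin.succ_ne_zero _)
        fun h => Fin.succ_ne_zero _ (Fin.succ_injective _ h)
    have a1 : ∀ i : Fin 1, (NIso.assoc 1 1 m).symm (Fin.castAdd (1 + m) i)
        = Fin.castAdd m (Fin.castAdd 1 i) := fun i => by rw [← NIso.assoc_1, Equiv.symm_apply_apply]
    have a2 : ∀ i : Fin 1, (NIso.assoc 1 1 m).symm (Fin.natAdd 1 (Fin.castAdd m i))
        = Fin.castAdd m (Fin.natAdd 1 i) := fun i => by rw [← NIso.assoc_2, Equiv.symm_apply_apply]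
    have a3 : ∀ i : Fin m, (NIso.assoc 1 1 m).symm (Fin.natAdd 1 (Fin.natAdd 1 i))
        = Fin.natAdd (1 + 1) i := fun i => by rw [← NIso.assoc_3, Equiv.symm_apply_apply]
    apply Equiv.ext
    refine Fin.cases ?_ (Fin.cases ?_ fun i => ?_) <;>
      simp only [Equiv.trans_apply, e0, e1, e2, s1, s2, s3, a1, a2, a3, NIso.sum_castAdd,
        NIso.sum_natAdd, NIso.swap_castAdd, NIso.swap_natAdd, NIso.assoc_1, NIso.assoc_2,
        NIso.assoc_3, Equiv.refl_apply]

/-- The universal elements of tensor powers multiply to the universal element of the concatenation.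
-/
theorem upowι_tapp (m n : ℕ) : tmul (upowι m) (upowι n) ≫ comp (tapp (univ A) m n) (m + n)
    = (λ_ (𝟙_ A)).hom ≫ upowι (m + n) := by
  induction m with
  | zero =>
    rw [tapp_zero, comp_comp, comp_comp, reassoc_of% tmul_whiskerRight, upowι_zero, Category.assoc,
      ← comp_comp, Iso.hom_inv_id, comp_id, Category.comp_id, reassoc_of% tmul_leftUnitor, act_comp,
      reassoc_of% upowι_tmap, act_act, act_of_eq, Category.comp_id]
    exact Equiv.self_trans_symm _
  | succ m ih =>
    rw [tapp_succ, comp_comp, comp_comp, comp_comp, comp_comp, reassoc_of% tmul_whiskerRight,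
      upowι_succ]
    simp only [Category.assoc]
    have e : comp (tcons' (univ A) m).hom (1 + m) ≫ (tpow (univ A) (m + 1)).act
          (finCongr (Nat.add_comm m 1)) ≫ comp (tcons' (univ A) m).inv (m + 1)
        = act _ (finCongr (Nat.add_comm m 1)) := by
      rw [act_comp, ← Category.assoc, ← comp_comp, Iso.hom_inv_id, comp_id, Category.id_comp]
    have e' : upowι (A := A) (m + 1 + n) = upowι (m + n + 1) ≫
        comp (tmap (univ A) (finCongr (Nat.succ_add m n).symm)) (m + n + 1) ≫
          (tpow (univ A) (m + 1 + n)).act (finCongr (Nat.succ_add m n)) := by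
      rw [reassoc_of% upowι_tmap, act_act]
      exact ((congrArg (_ ≫ ·) (act_refl _ _)).trans (Category.comp_id _)).symm
    have e'' : (λ_ (𝟙_ A)).inv ▷ 𝟙_ A ≫ (α_ _ _ _).hom ≫ 𝟙_ A ◁ (λ_ (𝟙_ A)).hom
        = (λ_ (𝟙_ A)).hom ≫ (λ_ (𝟙_ A)).inv := by
      monoidal
    rw [e, ← whiskerRight_tmul, tmul_act_left, e', upowι_succ]
    simp only [Category.assoc]
    rw [reassoc_of% act_comp, reassoc_of% act_comp, reassoc_of% act_comp, act_comp,
      reassoc_of% tmul_associator, reassoc_of% act_comp, reassoc_of% act_comp, reassoc_of% act_comp,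
      reassoc_of% tmul_whiskerLeft, ih, ← whiskerLeft_tmul, Category.assoc, reassoc_of% e'',
      reassoc_of% act_comp, act_act, act_act, sum_finCongr_refl]
    rfl

/-- Morphisms out of `(a, ∅, ∅, …) ⊗ X_o ⊗ ⋯ ⊗ X_o` are determined by a single generalised element.
-/
theorem isGen_termMap (a : A) (n : ℕ) :
    IsGen (tmul (constElem a) (upowι n)) :=
  (isGen_constElem a).tmul (isGen_upowι n)

theorem constElem_map {a b : A} (f : a ⟶ b) :
    constElem a ≫ comp ((const A).map f) 0 = f ≫ constElem b := constι_map f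

theorem termMap_natural {X Y : QO A} (f : X ⟶ Y) (n : ℕ) :
    termMap X n ≫ f = (const A).map (comp f n) ▷ _ ≫ termMap Y n := by
  apply (isGen_termMap (X.term n) n).hom_ext
  rw [comp_comp, comp_comp, reassoc_of% termMap_elem, reassoc_of% tmul_whiskerRight,
    constElem_map, ← whiskerRight_tmul, Category.assoc, termMap_elem, act_comp,
    rightUnitor_naturality_assoc]

/-- The morphisms `(X_n, ∅, ∅, …) ⊗ X_o ⊗ ⋯ ⊗ X_o ⟶ X` form an invariant family. -/
theorem termMap_equivariant (X : QO A) {m n : ℕ} (σ : Fin m ≃ Fin n) :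
    (const A).map (X.act σ) ▷ _ ≫ termMap X m
      = (const A).obj (X.term n) ◁ tmap (univ A) σ ≫ termMap X n := by
  apply (isGen_termMap (X.term n) m).hom_ext
  rw [comp_comp, comp_comp, reassoc_of% tmul_whiskerRight, reassoc_of% tmul_whiskerLeft,
    constElem_map, ← whiskerRight_tmul, Category.assoc, termMap_elem,
    rightUnitor_naturality_assoc, upowι_tmap, tmul_act_right, Category.assoc, act_comp,
    reassoc_of% termMap_elem, act_act, act_act, NIso.zero_sum]

/-- Multiplicativity of the universal elements of constant sequences. -/
theorem constElem_tmul (a b : A) :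
    tmul (constElem a) (constElem b) ≫
      comp (Functor.LaxMonoidal.μ (const A) a b) (0 + 0)
      = constElem (a ⊗ b) ≫ ((const A).obj (a ⊗ b)).act (NIso.zeroAdd 0) := by
  have h1 : constElem (a ⊗ b) ≫ comp (constδ a b) 0
      = tmul (constElem a) (constElem b) ≫
        act _ (NIso.zeroAdd 0).symm :=
    (constι_constδ a b).trans (Category.assoc _ _ _).symm
  have h2 : constδ a b ≫ Functor.LaxMonoidal.μ (const A) a b = 𝟙 _ :=
    Functor.Monoidal.δ_μ (const A) a b
  have h3 := congrArg (· ≫ comp (Functor.LaxMonoidal.μ (const A) a b) 0) h1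
  simp only [Category.assoc] at h3
  rw [← comp_comp, h2, comp_id, Category.comp_id, act_comp] at h3
  have h4 := congrArg (· ≫ ((const A).obj (a ⊗ b)).act (NIso.zeroAdd 0)) h3
  simp only [Category.assoc, act_act] at h4
  rw [act_of_eq _ (Equiv.self_trans_symm (NIso.zeroAdd 0)), Category.comp_id] at h4
  exact h4.symm

/-- Multiplicativity of the canonical morphisms `X_n ⊗ X_o ⊗ ⋯ ⊗ X_o ⟶ X`. -/
theorem termMap_tensor (X Y : QO A) (m n : ℕ) :
    tensorμ ((const A).obj (X.term m)) (tpow (univ A) m) ((const A).obj (Y.term n))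
        (tpow (univ A) n) ≫
      (Functor.LaxMonoidal.μ (const A) _ _ ⊗ₘ tapp (univ A) m n) ≫
        (const A).map (X.dayι Y m n) ▷ _ ≫ termMap (X ⊗ Y) (m + n)
      = termMap X m ⊗ₘ termMap Y n := by
  apply ((isGen_termMap (X.term m) m).tmul (isGen_termMap (Y.term n) n)).hom_ext
  rw [tmul_tensorHom, termMap_elem, termMap_elem, comp_comp, comp_comp, comp_comp,
    reassoc_of% tmul_tensorμ, reassoc_of% act_comp, reassoc_of% act_comp, act_comp,
    reassoc_of% tmul_tensorHom, constElem_tmul, upowι_tapp, ← tensorHom_tmul, tmul_act_act]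
  simp only [Category.assoc]
  have h : ((const A).obj (X.term m ⊗ Y.term n)).act (NIso.zeroAdd 0)
      = 𝟙 _ ≫ ((const A).obj (X.term m ⊗ Y.term n)).act (NIso.zeroAdd 0) :=
    (Category.id_comp _).symm
  rw [h, tmul_act_left, Category.assoc, reassoc_of% act_comp, reassoc_of% act_comp,
    reassoc_of% tensorHom_tmul, Category.comp_id, reassoc_of% tmul_whiskerRight, constElem_map,
    ← tensorHom_tmul, Category.assoc, reassoc_of% termMap_elem, act_act, act_act,
    tensorHom_def', Category.assoc, rightUnitor_naturality_assoc, reassoc_of% tensorμ_unit, tmul,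
    Category.assoc]
  refine congrArg (fun t => _ ≫ _ ≫ act _ t) ?_
  apply Equiv.ext
  refine Fin.addCases (Fin.addCases (fun i => i.elim0) fun i => ?_)
    (Fin.addCases (fun i => i.elim0) fun i => ?_) <;>
  simp only [Equiv.trans_apply, NIso.exchange_castAdd_natAdd, NIso.exchange_natAdd_natAdd,
    NIso.sum_natAdd, NIso.sum_castAdd, NIso.zeroAdd_natAdd, Equiv.refl_apply]

end QO

end SymSeqElements

/-! ### Realizations of symmetric sequences -/

section Realization

variable {A : Type u} [Category.{v} A] [MonoidalCategory A] [SymmetricCategory A] [Prevectoid A]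

namespace QO

/-- Morphisms `a ⊗ X_o ⊗ ⋯ ⊗ X_o ⟶ Z` are morphisms `a ⟶ Z_n`. -/
def termHomEquiv (a : A) (n : ℕ) (Z : QO A) :
    (a ⟶ Z.term n) ≃ ((const A).obj a ⊗ tpow (univ A) n ⟶ Z) where
  toFun y := (const A).map y ▷ _ ≫ termMap Z n
  invFun g := (ρ_ a).inv ≫ tmul (constElem a) (upowι n) ≫ comp g (0 + n) ≫
    Z.act (NIso.zeroAdd n).symm
  left_inv y := by
    dsimp only
    rw [comp_comp, Category.assoc, reassoc_of% tmul_whiskerRight, constElem_map,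
      ← whiskerRight_tmul, Category.assoc, reassoc_of% termMap_elem, act_act,
      act_of_eq _ (Equiv.symm_trans_self _), Category.comp_id, rightUnitor_naturality,
      Iso.inv_hom_id_assoc]
  right_inv g := by
    apply (isGen_termMap a n).hom_ext
    dsimp only
    rw [comp_comp, reassoc_of% tmul_whiskerRight, constElem_map, ← whiskerRight_tmul,
      Category.assoc, termMap_elem, rightUnitor_naturality_assoc]
    simp only [Category.assoc, act_act, Iso.hom_inv_id_assoc]
    rw [act_of_eq _ (Equiv.self_trans_symm _), Category.comp_id]

theorem termHomEquiv_apply {a : A} {n : ℕ} {Z : QO A} (y : a ⟶ Z.term n) :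
    termHomEquiv a n Z y = (const A).map y ▷ _ ≫ termMap Z n := rfl

end QO

open QO

variable {B : Type w} [Category.{v} B] [MonoidalCategory B] [SymmetricCategory B]
variable (p : VectoidHom B A)

/-- A family of morphisms `X_n ⊗ b ⊗ ⋯ ⊗ b ⟶ c` that is invariant under the symmetric groups. -/
def InvariantFamily (b : B) (X : QO A) {c : B} (φ : ∀ n, p.invImage.obj (X.term n) ⊗ tpow b n ⟶ c) :
    Prop :=
  ∀ ⦃m n : ℕ⦄ (σ : Fin m ≃ Fin n), p.invImage.map (X.act σ) ▷ tpow b m ≫ φ m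
    = p.invImage.obj (X.term n) ◁ tmap b σ ≫ φ n

/-- An object is the realization `⊔ (X_n ⊗ b ⊗ ⋯ ⊗ b) / 𝔖_n` of a symmetric sequence at the object
`b` if it is universal for invariant families. -/
structure IsRealization (b : B) (X : QO A) {c : B}
    (K : ∀ n, p.invImage.obj (X.term n) ⊗ tpow b n ⟶ c) : Prop where
  invariant : InvariantFamily p b X K
  hom_ext : ∀ {d : B} {s t : c ⟶ d}, (∀ n, K n ≫ s = K n ≫ t) → s = t
  exists_desc : ∀ {d : B} (φ : ∀ n, p.invImage.obj (X.term n) ⊗ tpow b n ⟶ d),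
    InvariantFamily p b X φ → ∃ t : c ⟶ d, ∀ n, K n ≫ t = φ n

namespace IsRealization
variable {p} {b : B} {X : QO A} {c d : B} {K : ∀ n, p.invImage.obj (X.term n) ⊗ tpow b n ⟶ c}

/-- The morphism out of a realization given by an invariant family. -/
def desc (h : IsRealization p b X K) (φ : ∀ n, p.invImage.obj (X.term n) ⊗ tpow b n ⟶ d)
    (hφ : InvariantFamily p b X φ) : c ⟶ d :=
  (h.exists_desc φ hφ).choose

theorem fac (h : IsRealization p b X K) (φ : ∀ n, p.invImage.obj (X.term n) ⊗ tpow b n ⟶ d)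
    (hφ : InvariantFamily p b X φ) (n : ℕ) : K n ≫ h.desc φ hφ = φ n :=
  (h.exists_desc φ hφ).choose_spec n

end IsRealization

namespace OverHom
variable {p} (f : OverHom p (toBase A))

/-- The isomorphism `p^* a ≅ f^* (a, ∅, ∅, …)` for a morphism over `A`. -/
def constIso (a : A) : p.invImage.obj a ≅ f.hom.invImage.obj ((const A).obj a) :=
  (f.iso.app a).symm

theorem constIso_natural {a a' : A} (g : a ⟶ a') :
    p.invImage.map g ≫ (f.constIso a').hom
      = (f.constIso a).hom ≫ f.hom.invImage.map ((const A).map g) :=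
  f.iso.inv.naturality g

open CategoryTheory.Functor hiding const comp

theorem constIso_tensor (a a' : A) :
    ((f.constIso a).hom ⊗ₘ (f.constIso a').hom) ≫ LaxMonoidal.μ f.hom.invImage _ _ ≫
        f.hom.invImage.map (LaxMonoidal.μ (const A) a a')
      = LaxMonoidal.μ p.invImage a a' ≫ (f.constIso (a ⊗ a')).hom := by
  have := f.isMonoidal
  have h := NatTrans.IsMonoidal.tensor (τ := f.iso.hom) a a'
  have h' : (LaxMonoidal.μ f.hom.invImage _ _ ≫ f.hom.invImage.map (LaxMonoidal.μ (const A) a a')) ≫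
      (f.constIso (a ⊗ a')).inv = ((f.constIso a).inv ⊗ₘ (f.constIso a').inv) ≫
        LaxMonoidal.μ p.invImage a a' := h
  rw [Category.assoc] at h'
  rw [← Iso.comp_inv_eq, Category.assoc, Category.assoc, h', tensorHom_comp_tensorHom_assoc,
    Iso.hom_inv_id, Iso.hom_inv_id, id_tensorHom_id, Category.id_comp]

theorem constIso_unit :
    LaxMonoidal.ε p.invImage ≫ (f.constIso (𝟙_ A)).hom
      = LaxMonoidal.ε f.hom.invImage ≫ f.hom.invImage.map (LaxMonoidal.ε (const A)) := by
  have := f.isMonoidal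
  have h := NatTrans.IsMonoidal.unit (τ := f.iso.hom)
  rw [← Iso.eq_comp_inv]
  exact h.symm

/-- The canonical morphism `X_n ⊗ b ⊗ ⋯ ⊗ b ⟶ f^* (X_n ⊗ X_o ⊗ ⋯ ⊗ X_o)`, where `b = f^* X_o`. -/
def monoK (a : A) (n : ℕ) : p.invImage.obj a ⊗ tpow (f.hom.invImage.obj (univ A)) n ⟶
    f.hom.invImage.obj ((const A).obj a ⊗ tpow (univ A) n) :=
  ((f.constIso a).hom ⊗ₘ tpowμ f.hom.invImage (univ A) n) ≫ LaxMonoidal.μ f.hom.invImage _ _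

/-- The canonical morphism `X_n ⊗ b ⊗ ⋯ ⊗ b ⟶ f^* X`, where `b = f^* X_o`. -/
def termK (X : QO A) (n : ℕ) : p.invImage.obj (X.term n) ⊗
    tpow (f.hom.invImage.obj (univ A)) n ⟶ f.hom.invImage.obj X :=
  f.monoK (X.term n) n ≫ f.hom.invImage.map (termMap X n)

instance isIso_tpowμ {C D : Type*} [Category* C] [MonoidalCategory C] [Category* D]
    [MonoidalCategory D] (F : C ⥤ D) [F.Monoidal] (X : C) : ∀ n, IsIso (tpowμ F X n)
  | 0 => inferInstanceAs (IsIso (LaxMonoidal.ε F))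
  | n + 1 =>
    have := isIso_tpowμ F X n
    inferInstanceAs (IsIso (F.obj X ◁ tpowμ F X n ≫ LaxMonoidal.μ F X (tensorFam n fun _ => X)))

instance (a : A) (n : ℕ) : IsIso (f.monoK a n) := by
  unfold monoK; infer_instance

theorem monoK_natural {a a' : A} (g : a ⟶ a') (n : ℕ) :
    p.invImage.map g ▷ _ ≫ f.monoK a' n
      = f.monoK a n ≫ f.hom.invImage.map ((const A).map g ▷ _) := by
  rw [monoK, monoK, Category.assoc, ← LaxMonoidal.μ_natural_left, ← tensorHom_id,
    ← tensorHom_id, tensorHom_comp_tensorHom_assoc, tensorHom_comp_tensorHom_assoc,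
    constIso_natural, Category.id_comp, Category.comp_id]

theorem monoK_tmap (a : A) {m n : ℕ} (σ : Fin m ≃ Fin n) :
    p.invImage.obj a ◁ tmap _ σ ≫ f.monoK a n
      = f.monoK a m ≫ f.hom.invImage.map ((const A).obj a ◁ tmap (univ A) σ) := by
  rw [monoK, monoK, Category.assoc, ← LaxMonoidal.μ_natural_right, ← id_tensorHom,
    ← id_tensorHom, tensorHom_comp_tensorHom_assoc, tensorHom_comp_tensorHom_assoc,
    tmap_tpowμ, Category.id_comp, Category.comp_id]

theorem termK_natural {X Y : QO A} (g : X ⟶ Y) (n : ℕ) :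
    f.termK X n ≫ f.hom.invImage.map g = p.invImage.map (comp g n) ▷ _ ≫ f.termK Y n := by
  rw [termK, termK, reassoc_of% monoK_natural, Category.assoc, ← Functor.map_comp,
    ← Functor.map_comp, termMap_natural]

/-- The inverse image `f^* X` is the realization of `X` at `f^* X_o`. -/
theorem isRealization (X : QO A) :
    IsRealization p (f.hom.invImage.obj (univ A)) X (f.termK X) where
  invariant m n σ := by
    rw [termK, termK, reassoc_of% monoK_natural, reassoc_of% monoK_tmap, ← Functor.map_comp,
      ← Functor.map_comp, termMap_equivariant]
  hom_ext {d s t} h := by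
    apply (f.hom.adj.homEquiv X d).injective
    apply hom_ext_comp
    intro n
    apply (termHomEquiv _ n _).injective
    rw [termHomEquiv_apply, termHomEquiv_apply, ← termMap_natural, ← termMap_natural,
      ← Adjunction.homEquiv_naturality_left, ← Adjunction.homEquiv_naturality_left]
    have := h n
    rw [termK, Category.assoc, Category.assoc, cancel_epi] at this
    rw [this]
  exists_desc {d} φ hφ := by
    -- transpose the family along `f^* ⊣ f_*`; each member then amounts to a morphism
    -- `X_n ⟶ (f_* d)_n`
    let g : ∀ n, (const A).obj (X.term n) ⊗ tpow (univ A) n ⟶ f.hom.dirImage.obj d := fun n =>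
      f.hom.adj.homEquiv _ _ (inv (f.monoK (X.term n) n) ≫ φ n)
    let y : ∀ n, X.term n ⟶ (f.hom.dirImage.obj d).term n := fun n => (termHomEquiv _ n _).symm (g n)
    have hy : ∀ n, (const A).map (y n) ▷ _ ≫ termMap _ n = g n := fun n =>
      (termHomEquiv _ n _).apply_symm_apply (g n)
    have hg : ∀ (n : ℕ) (σ : Equiv.Perm (Fin n)), (const A).map (X.act σ) ▷ _ ≫ g n
        = (const A).obj (X.term n) ◁ tmap (univ A) σ ≫ g n := fun n σ => by
      rw [← Adjunction.homEquiv_naturality_left, ← Adjunction.homEquiv_naturality_left]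
      refine congrArg _ ?_
      rw [← cancel_epi (f.monoK (X.term n) n), ← reassoc_of% monoK_natural,
        ← reassoc_of% monoK_tmap, IsIso.hom_inv_id_assoc, hφ σ]
    have hy' : ∀ (n : ℕ) (σ : Equiv.Perm (Fin n)), X.act σ ≫ y n = y n ≫ act _ σ := fun n σ => by
      apply (termHomEquiv _ n _).injective
      rw [termHomEquiv_apply, termHomEquiv_apply, Functor.map_comp, Functor.map_comp,
        comp_whiskerRight_assoc, comp_whiskerRight_assoc, hy, hg, termMap_equivariant,
        ← whisker_exchange_assoc, hy]
    -- invariance of the family is equivariance of these components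
    refine ⟨(f.hom.adj.homEquiv _ _).symm (ofComp y hy'), fun n => ?_⟩
    rw [termK, Category.assoc, ← Adjunction.homEquiv_naturality_left_symm, termMap_natural,
      comp_ofComp, hy, Equiv.symm_apply_apply, IsIso.hom_inv_id_assoc]

/-- Multiplicativity of the canonical morphisms `X_n ⊗ b ⊗ ⋯ ⊗ b ⟶ f^* X`. -/
theorem termK_tensor (X Y : QO A) (m n : ℕ) :
    (f.termK X m ⊗ₘ f.termK Y n) ≫ LaxMonoidal.μ f.hom.invImage X Y
      = tensorμ (p.invImage.obj (X.term m)) _ (p.invImage.obj (Y.term n)) _ ≫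
        (LaxMonoidal.μ p.invImage _ _ ⊗ₘ tapp _ m n) ≫
          p.invImage.map (X.dayι Y m n) ▷ _ ≫ f.termK (X ⊗ Y) (m + n) := by
  have h1 := tensorμ_comp_μ_tensorHom_μ_comp_μ f.hom.invImage ((const A).obj (X.term m))
    (tpow (univ A) m) ((const A).obj (Y.term n)) (tpow (univ A) n)
  rw [termK, termK, ← tensorHom_comp_tensorHom, Category.assoc, LaxMonoidal.μ_natural,
    ← termMap_tensor, Functor.map_comp, monoK, monoK, ← tensorHom_comp_tensorHom, Category.assoc,
    ← reassoc_of% h1, tensorμ_natural_assoc, tensorHom_comp_tensorHom_assoc, termK,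
    reassoc_of% monoK_natural]
  rw [Functor.map_comp, Functor.map_comp, ← LaxMonoidal.μ_natural_assoc,
    tensorHom_comp_tensorHom_assoc, Category.assoc, Category.assoc, constIso_tensor, ← tapp_tpowμ,
    ← tensorHom_comp_tensorHom, monoK]
  simp only [Category.assoc]

theorem map_whiskerRight_termK {a : A} {X : QO A} {n : ℕ} (y : a ⟶ X.term n) :
    p.invImage.map y ▷ _ ≫ f.termK X n
      = f.monoK a n ≫ f.hom.invImage.map (termHomEquiv a n X y) := by
  rw [termK, reassoc_of% monoK_natural, ← Functor.map_comp, termHomEquiv_apply]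

theorem _root_.QO.termHomEquiv_constElem (a : A) : termHomEquiv a 0 _ (constElem a)
    = _ ◁ (tnil (univ A)).inv ≫ (ρ_ ((const A).obj a)).hom := by
  apply (isGen_termMap a 0).hom_ext
  rw [termHomEquiv_apply, comp_comp, comp_comp, reassoc_of% tmul_whiskerRight,
    reassoc_of% tmul_whiskerLeft, constElem_map, ← whiskerRight_tmul, Category.assoc, termMap_elem,
    upowι_zero, Category.assoc, ← comp_comp, Iso.hom_inv_id, comp_id, Category.comp_id,
    tmul_rightUnitor, rightUnitor_naturality_assoc]
  rfl

theorem _root_.QO.constElem_ε :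
    constElem (𝟙_ A) = unitι ≫ comp (LaxMonoidal.ε (const A)) 0 := by
  have h : constElem (𝟙_ A) ≫ comp constη 0 = unitι := constι_constη
  have h' : constη ≫ LaxMonoidal.ε (const A) = 𝟙 _ := Functor.Monoidal.η_ε (const A)
  rw [← h, Category.assoc, ← comp_comp, h', comp_id, Category.comp_id]

theorem _root_.QO.termHomEquiv_unitι : LaxMonoidal.ε (const A) ▷ _ ≫ termHomEquiv (𝟙_ A) 0 _ unitι
    = 𝟙_ (QO A) ◁ (tnil (univ A)).inv ≫ (λ_ (𝟙_ (QO A))).hom := by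
  apply (isGen_unitι.tmul (isGen_upowι 0)).hom_ext
  rw [termHomEquiv_apply, comp_comp, comp_comp, comp_comp, reassoc_of% tmul_whiskerRight,
    reassoc_of% tmul_whiskerRight, ← constElem_ε, constElem_map, ← whiskerRight_tmul,
    reassoc_of% tmul_whiskerLeft, Category.assoc, termMap_elem,
    upowι_zero, Category.assoc, ← comp_comp, Iso.hom_inv_id, comp_id, Category.comp_id,
    tmul_leftUnitor, rightUnitor_naturality_assoc, unitors_equal]

theorem _root_.QO.termHomEquiv_univι :
    LaxMonoidal.ε (const A) ▷ _ ≫ termHomEquiv (𝟙_ A) 1 _ univι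
      = 𝟙_ (QO A) ◁ ((tcons' (univ A) 0).inv ≫ univ A ◁ (tnil (univ A)).inv ≫ (ρ_ (univ A)).hom) ≫
        (λ_ (univ A)).hom := by
  apply (isGen_unitι.tmul (isGen_upowι 1)).hom_ext
  have h : upowι (A := A) 1 ≫ comp ((tcons' (univ A) 0).inv ≫ univ A ◁ (tnil (univ A)).inv ≫
      (ρ_ (univ A)).hom) 1 = univι := by
    have e : (tcons' (univ A) 0).hom ≫ (tcons' (univ A) 0).inv ≫ univ A ◁ (tnil (univ A)).inv ≫
      (ρ_ (univ A)).hom = univ A ◁ (tnil (univ A)).inv ≫ (ρ_ (univ A)).hom :=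
      Iso.hom_inv_id_assoc _ _
    have e' := congrArg (fun t => comp t (1 + 0)) e
    simp only [comp_comp] at e'
    rw [upowι_succ, comp_comp, comp_comp]
    simp only [Category.assoc]
    rw [reassoc_of% act_comp, reassoc_of% act_comp, act_comp, reassoc_of% e',
      reassoc_of% tmul_whiskerLeft, upowι_zero, Category.assoc, ← comp_comp, Iso.hom_inv_id,
      comp_id, Category.comp_id, reassoc_of% tmul_rightUnitor, act_act, act_of_eq, Category.comp_id,
      ← unitors_equal, Iso.inv_hom_id_assoc]
    rfl
  rw [termHomEquiv_apply, comp_comp, comp_comp, comp_comp, reassoc_of% tmul_whiskerRight,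
    reassoc_of% tmul_whiskerRight, ← constElem_ε, constElem_map, ← whiskerRight_tmul,
    reassoc_of% tmul_whiskerLeft, Category.assoc, termMap_elem, h,
    tmul_leftUnitor, rightUnitor_naturality_assoc, unitors_equal]

/-- The realization map of `(a, ∅, ∅, …)` in degree `0` recovers the isomorphism
`p^* a ≅ f^* (a, ∅, ∅, …)`. -/
theorem termK_constElem (a : A) : (ρ_ (p.invImage.obj a)).inv ≫
    p.invImage.obj a ◁ (tnil (f.hom.invImage.obj (univ A))).hom ≫
      p.invImage.map (constElem a) ▷ _ ≫ f.termK ((const A).obj a) 0 = (f.constIso a).hom := by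
  rw [map_whiskerRight_termK, termHomEquiv_constElem, monoK, ← id_tensorHom, Category.assoc,
    tensorHom_comp_tensorHom_assoc, tpowμ_zero, Category.id_comp, Functor.map_comp,
    ← LaxMonoidal.μ_natural_right_assoc, ← id_tensorHom, tensorHom_comp_tensorHom_assoc,
    Category.comp_id, Category.assoc, ← Functor.map_comp, Iso.hom_inv_id, CategoryTheory.Functor.map_id,
    Category.comp_id, MonoidalCategory.tensorHom_def, Category.assoc,
    ← LaxMonoidal.right_unitality, rightUnitor_naturality, Iso.inv_hom_id_assoc]

theorem monoK_unit (n : ℕ) : (LaxMonoidal.ε p.invImage) ▷ _ ≫ f.monoK (𝟙_ A) n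
    = (LaxMonoidal.ε f.hom.invImage ⊗ₘ tpowμ f.hom.invImage (univ A) n) ≫
        LaxMonoidal.μ f.hom.invImage _ _ ≫
          f.hom.invImage.map (LaxMonoidal.ε (const A) ▷ _) := by
  rw [monoK, ← tensorHom_id, tensorHom_comp_tensorHom_assoc, constIso_unit, Category.id_comp,
    ← LaxMonoidal.μ_natural_left, ← tensorHom_id, tensorHom_comp_tensorHom_assoc, Category.comp_id]

/-- The realization map of the unit sequence in degree `0` recovers the unit constraint of `f^*`. -/
theorem termK_unitι : (λ_ (𝟙_ B)).inv ≫ (LaxMonoidal.ε p.invImage ⊗ₘ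
      (tnil (f.hom.invImage.obj (univ A))).hom) ≫
      p.invImage.map unitι ▷ _ ≫ f.termK (𝟙_ (QO A)) 0 = LaxMonoidal.ε f.hom.invImage := by
  rw [map_whiskerRight_termK, MonoidalCategory.tensorHom_def', Category.assoc,
    reassoc_of% monoK_unit, ← Functor.map_comp, termHomEquiv_unitι, Functor.map_comp,
    ← LaxMonoidal.μ_natural_right_assoc, ← id_tensorHom, ← id_tensorHom,
    tensorHom_comp_tensorHom_assoc, tensorHom_comp_tensorHom_assoc, Category.assoc,
    tpowμ_zero, Category.assoc, ← Functor.map_comp, Iso.hom_inv_id, CategoryTheory.Functor.map_id,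
    Category.comp_id, Category.id_comp, MonoidalCategory.tensorHom_def',
    Category.assoc, ← LaxMonoidal.left_unitality, leftUnitor_naturality, Iso.inv_hom_id_assoc]

theorem tpowμ_one : ((ρ_ _).inv ≫ _ ◁ (tnil (f.hom.invImage.obj (univ A))).hom ≫
      (tcons' _ 0).hom) ≫ tpowμ f.hom.invImage (univ A) 1 ≫ f.hom.invImage.map
        ((tcons' (univ A) 0).inv ≫ univ A ◁ (tnil (univ A)).inv ≫ (ρ_ (univ A)).hom) = 𝟙 _ := by
  have h : f.hom.invImage.obj (univ A) ◁ (tnil (f.hom.invImage.obj (univ A))).hom ≫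
      f.hom.invImage.obj (univ A) ◁ tpowμ f.hom.invImage (univ A) 0 ≫
        f.hom.invImage.obj (univ A) ◁ f.hom.invImage.map (tnil (univ A)).inv
      = f.hom.invImage.obj (univ A) ◁ LaxMonoidal.ε f.hom.invImage := by
    rw [← MonoidalCategory.whiskerLeft_comp, ← MonoidalCategory.whiskerLeft_comp,
      reassoc_of% @tpowμ_zero, ← Functor.map_comp, Iso.hom_inv_id, CategoryTheory.Functor.map_id,
      Category.comp_id]
  simp only [Category.assoc, Functor.map_comp]
  rw [reassoc_of% @tpowμ_succ, ← f.hom.invImage.map_comp_assoc, Iso.hom_inv_id,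
    CategoryTheory.Functor.map_id, Category.id_comp, ← LaxMonoidal.μ_natural_right_assoc,
    reassoc_of% h, ← LaxMonoidal.right_unitality, Iso.inv_hom_id]

/-- The realization map of `X_o` in degree `1` is the identity, up to unitors. -/
theorem termK_univι : (λ_ _).inv ≫ (LaxMonoidal.ε p.invImage ⊗ₘ
      ((ρ_ _).inv ≫ _ ◁ (tnil (f.hom.invImage.obj (univ A))).hom ≫ (tcons' _ 0).hom)) ≫
      p.invImage.map univι ▷ _ ≫ f.termK (univ A) 1 = 𝟙 _ := by
  rw [map_whiskerRight_termK, MonoidalCategory.tensorHom_def', Category.assoc,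
    reassoc_of% monoK_unit, ← Functor.map_comp, termHomEquiv_univι, Functor.map_comp,
    ← LaxMonoidal.μ_natural_right_assoc, ← id_tensorHom,
    tensorHom_comp_tensorHom_assoc, reassoc_of% @tensorHom_comp_whiskerLeft, Category.assoc,
    tpowμ_one, Category.id_comp, tensorHom_id, ← LaxMonoidal.left_unitality,
    Iso.inv_hom_id]

end OverHom

end Realization

/-! ### Tensor products of realizations -/

section RealizationTensor

variable {A : Type u} [Category.{v} A] [MonoidalCategory A] [SymmetricCategory A] [Prevectoid A]
variable {B : Type w} [Category.{v} B] [MonoidalCategory B] [SymmetricCategory B] [Prevectoid B]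

open QO

namespace IsRealization
variable {p : VectoidHom B A} {b c c' d : B} {X Y : QO A}
  {K : ∀ n, p.invImage.obj (X.term n) ⊗ tpow b n ⟶ c}
  {K' : ∀ n, p.invImage.obj (Y.term n) ⊗ tpow b n ⟶ c'}

/-- Realizations are stable under tensor products with an object, because `B` is closed. -/
theorem whiskerLeft_hom_ext (h : IsRealization p b X K) {z : B} {s t : z ⊗ c ⟶ d}
    (e : ∀ n, z ◁ K n ≫ s = z ◁ K n ≫ t) : s = t := by
  let _ := Prevectoid.monoidalClosed B
  apply MonoidalClosed.curry_injective
  apply h.hom_ext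
  intro n
  rw [← MonoidalClosed.curry_natural_left, ← MonoidalClosed.curry_natural_left, e]

theorem whiskerRight_hom_ext (h : IsRealization p b X K) {z : B} {s t : c ⊗ z ⟶ d}
    (e : ∀ n, K n ▷ z ≫ s = K n ▷ z ≫ t) : s = t := by
  rw [← cancel_epi (β_ _ _).hom]
  apply h.whiskerLeft_hom_ext
  intro n
  rw [BraidedCategory.braiding_naturality_right_assoc,
    BraidedCategory.braiding_naturality_right_assoc, e]

/-- Morphisms out of a tensor product of two realizations are determined on the tensor products of
the realization maps. -/
theorem tensor_hom_ext (h : IsRealization p b X K) (h' : IsRealization p b Y K') {s t : c ⊗ c' ⟶ d}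
    (e : ∀ m n, (K m ⊗ₘ K' n) ≫ s = (K m ⊗ₘ K' n) ≫ t) : s = t := by
  apply h.whiskerRight_hom_ext
  intro m
  apply h'.whiskerLeft_hom_ext
  intro n
  rw [← MonoidalCategory.tensorHom_def'_assoc, ← MonoidalCategory.tensorHom_def'_assoc, e]

theorem tensor₃_hom_ext {c'' : B} {Z : QO A}
    {K'' : ∀ n, p.invImage.obj (Z.term n) ⊗ tpow b n ⟶ c''} (h : IsRealization p b X K)
    (h' : IsRealization p b Y K') (h'' : IsRealization p b Z K'') {s t : (c ⊗ c') ⊗ c'' ⟶ d}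
    (e : ∀ l m n, ((K l ⊗ₘ K' m) ⊗ₘ K'' n) ≫ s = ((K l ⊗ₘ K' m) ⊗ₘ K'' n) ≫ t) : s = t := by
  let _ := Prevectoid.monoidalClosed B
  rw [← cancel_epi (α_ c c' c'').inv]
  apply h.whiskerRight_hom_ext
  intro l
  apply MonoidalClosed.curry_injective
  apply h'.tensor_hom_ext h''
  intro m n
  rw [← MonoidalClosed.curry_natural_left, ← MonoidalClosed.curry_natural_left,
    ← MonoidalCategory.tensorHom_def'_assoc, ← MonoidalCategory.tensorHom_def'_assoc,
    associator_inv_naturality_assoc, associator_inv_naturality_assoc, e]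

theorem whiskerLeft_exists_desc (h : IsRealization p b X K) {z : B}
    (φ : ∀ n, z ⊗ p.invImage.obj (X.term n) ⊗ tpow b n ⟶ d)
    (hφ : ∀ ⦃m n : ℕ⦄ (σ : Fin m ≃ Fin n), z ◁ p.invImage.map (X.act σ) ▷ tpow b m ≫ φ m
      = z ◁ p.invImage.obj (X.term n) ◁ tmap b σ ≫ φ n) :
    ∃ t : z ⊗ c ⟶ d, ∀ n, z ◁ K n ≫ t = φ n := by
  let _ := Prevectoid.monoidalClosed B
  obtain ⟨t, ht⟩ := h.exists_desc (fun n => MonoidalClosed.curry (φ n)) fun m n σ => by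
    rw [← MonoidalClosed.curry_natural_left, ← MonoidalClosed.curry_natural_left, hφ]
  refine ⟨MonoidalClosed.uncurry t, fun n => ?_⟩
  rw [← MonoidalClosed.uncurry_natural_left, ht, MonoidalClosed.uncurry_curry]

theorem whiskerRight_exists_desc (h : IsRealization p b X K) {z : B}
    (φ : ∀ n, (p.invImage.obj (X.term n) ⊗ tpow b n) ⊗ z ⟶ d)
    (hφ : ∀ ⦃m n : ℕ⦄ (σ : Fin m ≃ Fin n), (p.invImage.map (X.act σ) ▷ tpow b m) ▷ z ≫ φ m
      = (p.invImage.obj (X.term n) ◁ tmap b σ) ▷ z ≫ φ n) :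
    ∃ t : c ⊗ z ⟶ d, ∀ n, K n ▷ z ≫ t = φ n := by
  obtain ⟨t, ht⟩ := h.whiskerLeft_exists_desc (z := z) (fun n => (β_ _ _).hom ≫ φ n) fun m n σ => by
    rw [BraidedCategory.braiding_naturality_right_assoc,
      BraidedCategory.braiding_naturality_right_assoc, hφ]
  refine ⟨(β_ _ _).hom ≫ t, fun n => ?_⟩
  rw [BraidedCategory.braiding_naturality_left_assoc, ht, SymmetricCategory.symmetry_assoc]

/-- A tensor product of two realizations is universal for the families that are invariant in each
variable. -/
theorem tensor_exists_desc (h : IsRealization p b X K) (h' : IsRealization p b Y K')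
    (φ : ∀ m n, (p.invImage.obj (X.term m) ⊗ tpow b m) ⊗ p.invImage.obj (Y.term n) ⊗ tpow b n ⟶ d)
    (h₁ : ∀ ⦃m m' : ℕ⦄ (σ : Fin m ≃ Fin m') (n : ℕ),
      (p.invImage.map (X.act σ) ▷ tpow b m) ▷ _ ≫ φ m n
        = (p.invImage.obj (X.term m') ◁ tmap b σ) ▷ _ ≫ φ m' n)
    (h₂ : ∀ (m : ℕ) ⦃n n' : ℕ⦄ (σ : Fin n ≃ Fin n'),
      _ ◁ p.invImage.map (Y.act σ) ▷ tpow b n ≫ φ m n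
        = _ ◁ p.invImage.obj (Y.term n') ◁ tmap b σ ≫ φ m n') :
    ∃ t : c ⊗ c' ⟶ d, ∀ m n, (K m ⊗ₘ K' n) ≫ t = φ m n := by
  choose ψ hψ using fun m => h'.whiskerLeft_exists_desc (φ m) (h₂ m)
  obtain ⟨t, ht⟩ := h.whiskerRight_exists_desc ψ fun m n σ => by
    apply h'.whiskerLeft_hom_ext
    intro k
    rw [whisker_exchange_assoc, whisker_exchange_assoc, hψ, hψ, h₁]
  refine ⟨t, fun m n => ?_⟩
  rw [MonoidalCategory.tensorHom_def'_assoc, ht, hψ]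

end IsRealization

end RealizationTensor

/-! ### Morphisms over the base are determined by the image of the universal object -/

section EvalFullyFaithful

variable {A : Type u} [Category.{v} A] [MonoidalCategory A] [SymmetricCategory A] [Prevectoid A]
variable {B : Type w} [Category.{v} B] [MonoidalCategory B] [SymmetricCategory B] [Prevectoid B]

open QO

namespace OverHom

open CategoryTheory.Functor hiding const comp

variable {p : VectoidHom B A} {f g : OverHom p (toBase A)}

theorem tpowμ_naturality {C : Type*} {D : Type*} [Category* C] [MonoidalCategory C]
    [Category* D] [MonoidalCategory D] {F G : C ⥤ D} [F.LaxMonoidal] [G.LaxMonoidal] (τ : F ⟶ G)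
    [τ.IsMonoidal] (X : C) : ∀ n, tpowμ F X n ≫ τ.app (tpow X n)
      = tpowMap (τ.app X) n ≫ tpowμ G X n
  | 0 => (NatTrans.IsMonoidal.unit (τ := τ)).trans (Category.id_comp _).symm
  | n + 1 => by
    have ih := tpowμ_naturality τ X n
    have h : (F.obj X ◁ tpowμ F X n ≫ LaxMonoidal.μ F X (tpow X n)) ≫ τ.app (X ⊗ tpow X n)
        = (τ.app X ⊗ₘ tpowMap (τ.app X) n) ≫ G.obj X ◁ tpowμ G X n ≫
          LaxMonoidal.μ G X (tpow X n) := by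
      rw [Category.assoc, NatTrans.IsMonoidal.tensor, ← id_tensorHom, ← id_tensorHom,
        tensorHom_comp_tensorHom_assoc, tensorHom_comp_tensorHom_assoc, ih, Category.id_comp,
        Category.comp_id]
    exact h

/-- Compatibility of a 2-morphism over `A` with the structure isomorphisms, in terms of `constIso`.
-/
theorem constIso_app (τ : f ⟶ g) (a : A) :
    (f.constIso a).hom ≫ τ.app.app ((const A).obj a) = (g.constIso a).hom := by
  have h : τ.app.app ((const A).obj a) ≫ (g.constIso a).inv = (f.constIso a).inv := τ.w a
  rw [← cancel_mono (g.constIso a).inv, Category.assoc, h, Iso.hom_inv_id, Iso.hom_inv_id]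

/-- A 2-morphism over `A` is determined by its value at the universal object. -/
theorem termK_app (τ : f ⟶ g) (X : QO A) (n : ℕ) : f.termK X n ≫ τ.app.app X
    = _ ◁ tpowMap (τ.app.app (univ A)) n ≫ g.termK X n := by
  have := τ.isMonoidal
  rw [termK, termK, Category.assoc, τ.app.naturality, monoK, monoK, Category.assoc,
    NatTrans.IsMonoidal.tensor_assoc, tensorHom_comp_tensorHom_assoc, tpowμ_naturality,
    constIso_app, ← id_tensorHom, Category.assoc, tensorHom_comp_tensorHom_assoc, Category.id_comp]

/-- A morphism between the images of `X_o` induces morphisms between realizations. -/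
theorem exists_lift (β : f.hom.invImage.obj (univ A) ⟶ g.hom.invImage.obj (univ A)) (X : QO A) :
    ∃ t : f.hom.invImage.obj X ⟶ g.hom.invImage.obj X, ∀ n,
      f.termK X n ≫ t = _ ◁ tpowMap β n ≫ g.termK X n :=
  (f.isRealization X).exists_desc _ fun m n σ => by
    rw [← whisker_exchange_assoc, (g.isRealization X).invariant,
      ← MonoidalCategory.whiskerLeft_comp_assoc, ← MonoidalCategory.whiskerLeft_comp_assoc,
      tmap_tpowMap]

/-- The 2-morphism over `A` with a given value at the universal object. -/
def lift (β : f.hom.invImage.obj (univ A) ⟶ g.hom.invImage.obj (univ A)) :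
    f.hom.invImage ⟶ g.hom.invImage where
  app X := (exists_lift β X).choose
  naturality X Y h := by
    apply (f.isRealization X).hom_ext
    intro n
    rw [reassoc_of% termK_natural, (exists_lift β Y).choose_spec,
      reassoc_of% (exists_lift β X).choose_spec, termK_natural, whisker_exchange_assoc]

variable (β : f.hom.invImage.obj (univ A) ⟶ g.hom.invImage.obj (univ A))

theorem termK_lift (X : QO A) (n : ℕ) :
    f.termK X n ≫ (lift β).app X = _ ◁ tpowMap β n ≫ g.termK X n :=
  (exists_lift β X).choose_spec n

theorem lift_univ : (lift β).app (univ A) = β := by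
  have h := f.termK_univι
  have h' := g.termK_univι
  rw [← Category.id_comp ((lift β).app _), ← h]
  simp only [Category.assoc]
  have hj : ((ρ_ _).inv ≫ _ ◁ (tnil (f.hom.invImage.obj (univ A))).hom ≫ (tcons' _ 0).hom) ≫
      tpowMap β 1 = β ≫ (ρ_ _).inv ≫ _ ◁ (tnil (g.hom.invImage.obj (univ A))).hom ≫
        (tcons' _ 0).hom := by
    have e : (tcons' (f.hom.invImage.obj (univ A)) 0).hom ≫ tpowMap β 1
        = (β ⊗ₘ tpowMap β 0) ≫ (tcons' (g.hom.invImage.obj (univ A)) 0).hom := tpowMap_succ β 0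
    have e' : (tnil (f.hom.invImage.obj (univ A))).hom ≫ tpowMap β 0 = (tnil _).hom :=
      tpowMap_zero β
    simp only [Category.assoc]
    rw [e, ← id_tensorHom, tensorHom_comp_tensorHom_assoc, e', Category.id_comp,
      MonoidalCategory.tensorHom_def, Category.assoc, ← rightUnitor_inv_naturality_assoc]
  simp only [Category.assoc] at hj
  rw [termK_lift, ← whisker_exchange_assoc, reassoc_of% @tensorHom_comp_whiskerLeft]
  simp only [Category.assoc]
  rw [hj, ← whiskerLeft_comp_tensorHom_assoc, ← leftUnitor_inv_naturality_assoc, h',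
    Category.comp_id]

/-- It suffices to compare the two sides on tensor products of realization maps, which are
multiplicative. -/
theorem isMonoidal_lift : (lift β).IsMonoidal where
  unit := by
    rw [← f.termK_unitι, ← g.termK_unitι]
    simp only [Category.assoc]
    rw [termK_lift, ← whisker_exchange_assoc]
    have : (tnil (f.hom.invImage.obj (univ A))).hom ≫ tpowMap β 0 = (tnil _).hom := tpowMap_zero β
    rw [← id_tensorHom, tensorHom_comp_tensorHom_assoc, Category.comp_id, this]
  tensor X Y := by
    apply (f.isRealization X).tensor_hom_ext (f.isRealization Y)
    intro m n
    rw [reassoc_of% termK_tensor, termK_lift, tensorHom_comp_tensorHom_assoc, termK_lift, termK_lift,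
      ← whisker_exchange_assoc, ← tensorHom_comp_tensorHom, Category.assoc, termK_tensor,
      ← id_tensorHom, ← id_tensorHom, ← id_tensorHom, tensorμ_natural_assoc,
      tensorHom_comp_tensorHom_assoc, tensorHom_comp_tensorHom_assoc, tapp_tpowMap, id_tensorHom_id,
      Category.id_comp, Category.comp_id]

theorem lift_w (a : A) :
    (lift β).app ((const A).obj a) ≫ g.iso.hom.app a = f.iso.hom.app a := by
  have h : (f.constIso a).hom ≫ (lift β).app ((const A).obj a) = (g.constIso a).hom := by
    rw [← f.termK_constElem, ← g.termK_constElem]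
    simp only [Category.assoc]
    rw [termK_lift, ← whisker_exchange_assoc, ← MonoidalCategory.whiskerLeft_comp_assoc]
    exact congrArg (fun t => _ ≫ _ ◁ t ≫ _) (tpowMap_zero β)
  have h' : (lift β).app ((const A).obj a) ≫ (g.constIso a).inv = (f.constIso a).inv := by
    rw [← cancel_epi (f.constIso a).hom, reassoc_of% h, Iso.hom_inv_id, Iso.hom_inv_id]
  exact h'

/-- `f ↦ f^* X_o` is full and faithful. -/
def evalFullyFaithful : (OverHom.eval p (toBase A) (univ A)).FullyFaithful where
  preimage β :=
    { app := lift β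
      isMonoidal := isMonoidal_lift β
      w := lift_w β }
  map_preimage β := lift_univ β
  preimage_map τ := by
    apply OverHom.hom_ext'
    intro X
    refine (OverHom.isRealization _ X).hom_ext fun n => ?_
    exact (termK_lift _ X n).trans (termK_app τ X n).symm

end OverHom

end EvalFullyFaithful

/-! ### Existence of realizations -/

section RealizationExistence

variable {A : Type u} [Category.{v} A] [MonoidalCategory A] [SymmetricCategory A] [Prevectoid A]
variable {B : Type w} [Category.{v} B] [MonoidalCategory B] [SymmetricCategory B] [Prevectoid B]

open QO

attribute [local instance] Prevectoid.monoidalClosed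

variable (p : VectoidHom B A) (b : B)

/-- The symmetric sequence `n ↦ p_* Hom(b ⊗ ⋯ ⊗ b, c)`. -/
def corealization : B ⥤ QO A where
  obj c :=
    { functor :=
        { obj n := p.dirImage.obj ((ihom (tpow b n.unop.card)).obj c)
          map f := p.dirImage.map ((MonoidalClosed.pre (tmap b (id f.unop : Fin _ ≃ Fin _))).app c)
          map_id n := by
            refine Eq.trans (congrArg (fun t => p.dirImage.map ((MonoidalClosed.pre t).app c))
              (tmap_refl (b := b) n.unop.card)) ?_
            rw [MonoidalClosed.pre_id]
            exact p.dirImage.map_id _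
          map_comp f g := by
            refine Eq.trans (congrArg (fun t => p.dirImage.map ((MonoidalClosed.pre t).app c))
              (tmap_trans (b := b) (id g.unop : Fin _ ≃ Fin _) (id f.unop : Fin _ ≃ Fin _)).symm) ?_
            rw [MonoidalClosed.pre_map, NatTrans.comp_app, Functor.map_comp] } }
  map h := homMk
    { app n := p.dirImage.map ((ihom _).map h)
      naturality m n f := by
        change p.dirImage.map _ ≫ p.dirImage.map _ = p.dirImage.map _ ≫ p.dirImage.map _
        rw [← Functor.map_comp, ← Functor.map_comp, NatTrans.naturality] }
  map_id c := by
    apply hom_ext_comp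
    intro n
    change p.dirImage.map ((ihom _).map (𝟙 c)) = 𝟙 _
    rw [CategoryTheory.Functor.map_id, CategoryTheory.Functor.map_id]
  map_comp f g := by
    apply hom_ext_comp
    intro n
    change p.dirImage.map ((ihom _).map (f ≫ g))
      = p.dirImage.map ((ihom _).map f) ≫ p.dirImage.map ((ihom _).map g)
    rw [Functor.map_comp, Functor.map_comp]

/-- Morphisms `a ⟶ p_* Hom(b ⊗ ⋯ ⊗ b, c)` are morphisms `p^* a ⊗ b ⊗ ⋯ ⊗ b ⟶ c`. -/
def corealizationEquiv (a : A) (n : ℕ) (c : B) :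
    (p.invImage.obj a ⊗ tpow b n ⟶ c) ≃ (a ⟶ ((corealization p b).obj c).term n) :=
  ((β_ (p.invImage.obj a) (tpow b n)).homFromEquiv.trans
    (((ihom.adjunction (tpow b n)).homEquiv _ _).trans (p.adj.homEquiv _ _)))

variable {p b}

theorem corealizationEquiv_apply {a : A} {n : ℕ} {c : B} (φ : p.invImage.obj a ⊗ tpow b n ⟶ c) :
    corealizationEquiv p b a n c φ = p.adj.homEquiv _ _ (MonoidalClosed.curry ((β_ _ _).inv ≫ φ)) := rfl

theorem corealizationEquiv_whiskerRight {a a' : A} {n : ℕ} {c : B} (f : a' ⟶ a)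
    (φ : p.invImage.obj a ⊗ tpow b n ⟶ c) :
    corealizationEquiv p b a' n c (p.invImage.map f ▷ _ ≫ φ) = f ≫ corealizationEquiv p b a n c φ := by
  rw [corealizationEquiv_apply, corealizationEquiv_apply]
  refine Eq.trans ?_ (p.adj.homEquiv_naturality_left f _)
  rw [← MonoidalClosed.curry_natural_left, BraidedCategory.braiding_inv_naturality_right_assoc]

/-- Permuting the factors of the tensor power corresponds to the action of the symmetric group. -/
theorem corealizationEquiv_tmap {a : A} {m n : ℕ} {c : B} (σ : Fin m ≃ Fin n)
    (φ : p.invImage.obj a ⊗ tpow b n ⟶ c) :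
    corealizationEquiv p b a m c (_ ◁ tmap b σ ≫ φ) = corealizationEquiv p b a n c φ ≫ act _ σ := by
  have h : act ((corealization p b).obj c) σ
      = p.dirImage.map ((MonoidalClosed.pre (tmap b σ)).app c) := rfl
  rw [corealizationEquiv_apply, corealizationEquiv_apply, h]
  refine Eq.trans ?_ (p.adj.homEquiv_naturality_right _ _)
  rw [MonoidalClosed.curry_pre_app, BraidedCategory.braiding_inv_naturality_left_assoc]

theorem corealizationEquiv_comp {a : A} {n : ℕ} {c c' : B}
    (φ : p.invImage.obj a ⊗ tpow b n ⟶ c) (g : c ⟶ c') :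
    corealizationEquiv p b a n c' (φ ≫ g) = corealizationEquiv p b a n c φ ≫ comp ((corealization p b).map g) n := by
  have h : comp ((corealization p b).map g) n = p.dirImage.map ((ihom _).map g) := rfl
  rw [corealizationEquiv_apply, corealizationEquiv_apply, h]
  refine Eq.trans ?_ (p.adj.homEquiv_naturality_right _ _)
  rw [← MonoidalClosed.curry_natural_right, Category.assoc]

/-- A family is invariant exactly when its transposes form a morphism of symmetric sequences. -/
theorem invariantFamily_iff {X : QO A} {c : B}
    (φ : ∀ n, p.invImage.obj (X.term n) ⊗ tpow b n ⟶ c) :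
    InvariantFamily p b X φ ↔ ∀ (n : ℕ) (σ : Equiv.Perm (Fin n)),
      X.act σ ≫ corealizationEquiv p b _ n c (φ n) = corealizationEquiv p b _ n c (φ n) ≫ act _ σ := by
  constructor
  · intro h n σ
    rw [← corealizationEquiv_whiskerRight, ← corealizationEquiv_tmap, h]
  · intro h m n σ
    obtain rfl := Fin.equiv_iff_eq.1 ⟨σ⟩
    apply (corealizationEquiv p b _ _ _).injective
    rw [corealizationEquiv_whiskerRight, corealizationEquiv_tmap, h]

variable (p b) in
/-- The realization is the coequalizer of the two actions of all pairs of a degree `n` and a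
permutation of `n` letters on `⊔ (p^* X_n ⊗ b ⊗ ⋯ ⊗ b)`. -/
theorem exists_isRealization (X : QO A) :
    ∃ (c : B) (K : ∀ n, p.invImage.obj (X.term n) ⊗ tpow b n ⟶ c), IsRealization p b X K := by
  have := hasColimitsOfShape_type (A := B)
  let S : (n : ℕ) × Equiv.Perm (Fin n) → B := fun i => p.invImage.obj (X.term i.1) ⊗ tpow b i.1
  let T : ℕ → B := fun n => p.invImage.obj (X.term n) ⊗ tpow b n
  let u : ∐ S ⟶ ∐ T := Sigma.desc fun i => p.invImage.map (X.act i.2) ▷ _ ≫ Sigma.ι T i.1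
  let u' : ∐ S ⟶ ∐ T := Sigma.desc fun i => _ ◁ tmap b i.2 ≫ Sigma.ι T i.1
  refine ⟨coequalizer u u', fun n => Sigma.ι T n ≫ coequalizer.π u u', ?_, ?_, ?_⟩
  · intro m n σ
    obtain rfl := Fin.equiv_iff_eq.1 ⟨σ⟩
    have h := congrArg (fun t => Sigma.ι S ⟨m, σ⟩ ≫ t) (coequalizer.condition u u')
    simpa [u, u'] using h
  · intro d s t h
    apply coequalizer.hom_ext
    apply Sigma.hom_ext
    intro n
    simpa using h n
  · intro d φ hφ
    refine ⟨coequalizer.desc (Sigma.desc φ) ?_, fun n => ?_⟩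
    · apply Sigma.hom_ext
      rintro ⟨n, σ⟩
      simpa [u, u'] using hφ σ
    · simp [T]

variable (p b)

/-- The realization of a symmetric sequence at `b`. -/
def realizationObj (X : QO A) : B := (exists_isRealization p b X).choose

/-- The structure maps of a realization, before it is made a functor. -/
def realizationObjK (X : QO A) (n : ℕ) :
    p.invImage.obj (X.term n) ⊗ tpow b n ⟶ realizationObj p b X :=
  (exists_isRealization p b X).choose_spec.choose n

theorem isRealization_realizationObj (X : QO A) : IsRealization p b X (realizationObjK p b X) :=
  (exists_isRealization p b X).choose_spec.choose_spec

/-- The morphism of realizations given by a morphism of symmetric sequences. -/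
def realizationMap {X Y : QO A} (h : X ⟶ Y) : realizationObj p b X ⟶ realizationObj p b Y :=
  (isRealization_realizationObj p b X).desc
    (fun n => p.invImage.map (comp h n) ▷ _ ≫ realizationObjK p b Y n) fun m n σ => by
      rw [← comp_whiskerRight_assoc, ← Functor.map_comp, act_comp, Functor.map_comp,
        comp_whiskerRight_assoc, (isRealization_realizationObj p b Y).invariant,
        whisker_exchange_assoc]

theorem realizationObjK_map {X Y : QO A} (h : X ⟶ Y) (n : ℕ) :
    realizationObjK p b X n ≫ realizationMap p b h
      = p.invImage.map (comp h n) ▷ _ ≫ realizationObjK p b Y n :=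
  (isRealization_realizationObj p b X).fac _ _ n

/-- The realization of symmetric sequences at `b`, as a functor. -/
def realization : QO A ⥤ B where
  obj X := realizationObj p b X
  map h := realizationMap p b h
  map_id X := (isRealization_realizationObj p b X).hom_ext fun n => by
    rw [realizationObjK_map, comp_id, CategoryTheory.Functor.map_id, id_whiskerRight,
      Category.id_comp, Category.comp_id]
  map_comp {X Y Z} f g := (isRealization_realizationObj p b X).hom_ext fun n => by
    rw [realizationObjK_map, reassoc_of% realizationObjK_map, realizationObjK_map, comp_comp,
      Functor.map_comp, comp_whiskerRight_assoc]

/-- The structure maps of a realization. -/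
def realizationK (X : QO A) (n : ℕ) :
    p.invImage.obj (X.term n) ⊗ tpow b n ⟶ (realization p b).obj X :=
  realizationObjK p b X n

theorem isRealization_realization (X : QO A) : IsRealization p b X (realizationK p b X) :=
  isRealization_realizationObj p b X

theorem realizationK_natural {X Y : QO A} (h : X ⟶ Y) (n : ℕ) :
    realizationK p b X n ≫ (realization p b).map h
      = p.invImage.map (comp h n) ▷ _ ≫ realizationK p b Y n :=
  realizationObjK_map p b h n

/-- Morphisms from a realization. -/
def realizationHomEquiv (X : QO A) (c : B) :
    ((realization p b).obj X ⟶ c) ≃ (X ⟶ (corealization p b).obj c) where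
  toFun t := ofComp (fun n => corealizationEquiv p b _ n c (realizationK p b X n ≫ t))
    ((invariantFamily_iff fun n => realizationK p b X n ≫ t).1 fun m n σ => by
      rw [reassoc_of% ((isRealization_realization p b X).invariant σ)])
  invFun g := (isRealization_realization p b X).desc
    (fun n => (corealizationEquiv p b _ n c).symm (comp g n))
    ((invariantFamily_iff _).2 fun n σ => by
      rw [Equiv.apply_symm_apply]
      exact act_comp g σ)
  left_inv t := by
    apply (isRealization_realization p b X).hom_ext
    intro n
    rw [IsRealization.fac, comp_ofComp, Equiv.symm_apply_apply]
  right_inv g := by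
    apply hom_ext_comp
    intro n
    rw [comp_ofComp, IsRealization.fac, Equiv.apply_symm_apply]

theorem comp_realizationHomEquiv {X : QO A} {c : B} (t : (realization p b).obj X ⟶ c) (n : ℕ) :
    comp (realizationHomEquiv p b X c t) n
      = corealizationEquiv p b _ n c (realizationK p b X n ≫ t) := rfl

/-- The realization is left adjoint to `c ↦ p_* Hom(b ⊗ ⋯ ⊗ b, c)`. -/
def realizationAdj : realization p b ⊣ corealization p b := Adjunction.mkOfHomEquiv
  { homEquiv := realizationHomEquiv p b
    homEquiv_naturality_left_symm {X X' c} f g := by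
      apply (realizationHomEquiv p b X c).injective
      apply hom_ext_comp
      intro n
      rw [Equiv.apply_symm_apply, comp_realizationHomEquiv, reassoc_of% realizationK_natural,
        corealizationEquiv_whiskerRight, ← comp_realizationHomEquiv, Equiv.apply_symm_apply,
        comp_comp]
    homEquiv_naturality_right {X c c'} f g := by
      apply hom_ext_comp
      intro n
      rw [comp_comp, comp_realizationHomEquiv, comp_realizationHomEquiv, ← corealizationEquiv_comp,
        Category.assoc] }

/-- Morphisms out of `|X ⊗ Y|` are determined on the objects `p^* (X_m ⊗ Y_n) ⊗ b ⊗ ⋯ ⊗ b`. -/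
theorem realization_tensor_hom_ext {X Y : QO A} {c : B} {s t : (realization p b).obj (X ⊗ Y) ⟶ c}
    (h : ∀ m n, p.invImage.map (X.dayι Y m n) ▷ _ ≫ realizationK p b (X ⊗ Y) (m + n) ≫ s
      = p.invImage.map (X.dayι Y m n) ▷ _ ≫ realizationK p b (X ⊗ Y) (m + n) ≫ t) : s = t := by
  apply (realizationHomEquiv p b _ _).injective
  apply tensor_hom_ext
  intro m n
  rw [comp_realizationHomEquiv, comp_realizationHomEquiv, ← corealizationEquiv_whiskerRight,
    ← corealizationEquiv_whiskerRight]
  exact congrArg _ (h m n)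

theorem realization_unit_hom_ext {c : B} {s t : (realization p b).obj (𝟙_ (QO A)) ⟶ c}
    (h : p.invImage.map unitι ▷ _ ≫ realizationK p b _ 0 ≫ s
      = p.invImage.map unitι ▷ _ ≫ realizationK p b _ 0 ≫ t) : s = t := by
  apply (realizationHomEquiv p b _ _).injective
  apply unit_hom_ext
  rw [comp_realizationHomEquiv, comp_realizationHomEquiv, ← corealizationEquiv_whiskerRight,
    ← corealizationEquiv_whiskerRight]
  exact congrArg _ h

end RealizationExistence

/-! ### The realization as a symmetric monoidal functor -/

section RealizationMonoidal

variable {A : Type u} [Category.{v} A] [MonoidalCategory A] [SymmetricCategory A] [Prevectoid A]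
variable {B : Type w} [Category.{v} B] [MonoidalCategory B] [SymmetricCategory B] [Prevectoid B]

open QO

open CategoryTheory.Functor hiding const comp

variable (p : VectoidHom B A) (b : B)

/-- The structure map of the monoidal functor `(a, n) ↦ p^* a ⊗ b ⊗ ⋯ ⊗ b`. -/
def powμ (a c : A) (m n : ℕ) :
    (p.invImage.obj a ⊗ tpow b m) ⊗ p.invImage.obj c ⊗ tpow b n ⟶
      p.invImage.obj (a ⊗ c) ⊗ tpow b (m + n) :=
  tensorμ _ _ _ _ ≫ (LaxMonoidal.μ p.invImage a c ⊗ₘ tapp b m n)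

instance (a c : A) (m n : ℕ) : IsIso (powμ p b a c m n) := by
  have : IsIso (tensorμ (p.invImage.obj a) (tpow b m) (p.invImage.obj c) (tpow b n)) :=
    ⟨tensorδ _ _ _ _, tensorμ_tensorδ _ _ _ _, tensorδ_tensorμ _ _ _ _⟩
  unfold powμ
  infer_instance

theorem powμ_natural_left {a a' : A} (f : a ⟶ a') (c : A) (m n : ℕ) :
    (p.invImage.map f ▷ tpow b m) ▷ _ ≫ powμ p b a' c m n
      = powμ p b a c m n ≫ p.invImage.map (f ▷ c) ▷ _ := by
  rw [powμ, powμ, Category.assoc, ← tensorHom_id (p.invImage.map f), tensorμ_natural_left_assoc,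
    tensorHom_comp_tensorHom, ← tensorHom_id (p.invImage.map (f ▷ c)), tensorHom_comp_tensorHom,
    LaxMonoidal.μ_natural_left,
    id_whiskerRight, Category.id_comp, Category.comp_id]

theorem powμ_natural_right (a : A) {c c' : A} (f : c ⟶ c') (m n : ℕ) :
    _ ◁ p.invImage.map f ▷ tpow b n ≫ powμ p b a c' m n
      = powμ p b a c m n ≫ p.invImage.map (a ◁ f) ▷ _ := by
  rw [powμ, powμ, Category.assoc, ← tensorHom_id (p.invImage.map f), tensorμ_natural_right_assoc,
    tensorHom_comp_tensorHom, ← tensorHom_id (p.invImage.map (a ◁ f)), tensorHom_comp_tensorHom,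
    LaxMonoidal.μ_natural_right,
    MonoidalCategory.whiskerLeft_id, Category.id_comp, Category.comp_id]

theorem powμ_tmap_left (a c : A) {m m' : ℕ} (σ : Fin m ≃ Fin m') (n : ℕ) :
    (p.invImage.obj a ◁ tmap b σ) ▷ _ ≫ powμ p b a c m' n
      = powμ p b a c m n ≫ _ ◁ tmap b (NIso.sum σ (Equiv.refl _)) := by
  rw [powμ, powμ, Category.assoc, ← id_tensorHom _ (tmap b σ), tensorμ_natural_left_assoc,
    tensorHom_comp_tensorHom, ← id_tensorHom _ (tmap b (NIso.sum _ _)), tensorHom_comp_tensorHom,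
    tapp_natural_left,
    id_whiskerRight, Category.id_comp, Category.comp_id]

theorem powμ_tmap_right (a c : A) (m : ℕ) {n n' : ℕ} (σ : Fin n ≃ Fin n') :
    _ ◁ p.invImage.obj c ◁ tmap b σ ≫ powμ p b a c m n'
      = powμ p b a c m n ≫ _ ◁ tmap b (NIso.sum (Equiv.refl _) σ) := by
  rw [powμ, powμ, Category.assoc, ← id_tensorHom _ (tmap b σ), tensorμ_natural_right_assoc,
    tensorHom_comp_tensorHom, ← id_tensorHom _ (tmap b (NIso.sum _ _)), tensorHom_comp_tensorHom,
    tapp_natural_right,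
    MonoidalCategory.whiskerLeft_id, Category.id_comp, Category.comp_id]

theorem powμ_assoc (a c d : A) (l m n : ℕ) :
    powμ p b a c l m ▷ _ ≫ powμ p b (a ⊗ c) d (l + m) n ≫
        (p.invImage.map (α_ a c d).hom ⊗ₘ tmap b (NIso.assoc l m n))
      = (α_ _ _ _).hom ≫ _ ◁ powμ p b c d m n ≫ powμ p b a (c ⊗ d) l (m + n) := by
  rw [powμ, powμ, powμ, powμ, comp_whiskerRight, MonoidalCategory.whiskerLeft_comp]
  simp only [Category.assoc]
  rw [tensorμ_natural_left_assoc, tensorμ_natural_right_assoc, tensorHom_comp_tensorHom,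
    tensorHom_comp_tensorHom, tensorHom_comp_tensorHom, LaxMonoidal.associativity, tapp_assoc,
    ← tensor_associativity_assoc, tensorHom_comp_tensorHom]

theorem powμ_leftUnit (a : A) (n : ℕ) :
    ((λ_ (𝟙_ B)).inv ≫ (LaxMonoidal.ε p.invImage ⊗ₘ (tnil b).hom)) ▷ _ ≫ powμ p b (𝟙_ A) a 0 n ≫
        (p.invImage.map (λ_ a).hom ⊗ₘ tmap b (NIso.zeroAdd n)) = (λ_ _).hom := by
  rw [powμ, comp_whiskerRight, Category.assoc, Category.assoc, tensorμ_natural_left_assoc,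
    tensorHom_comp_tensorHom, tensorHom_comp_tensorHom, ← LaxMonoidal.left_unitality, tapp_zero,
    tensor_left_unitality]
  simp only [Category.assoc]
  rw [tmap_trans, Equiv.symm_trans_self, tmap_refl, Category.comp_id, ← comp_whiskerRight_assoc,
    Iso.hom_inv_id, id_whiskerRight, Category.id_comp]

theorem powμ_braiding (a c : A) (m n : ℕ) :
    powμ p b a c m n ≫ (p.invImage.map (β_ a c).hom ⊗ₘ tmap b (NIso.swap m n))
      = (β_ _ _).hom ≫ powμ p b c a n m := by
  have h : ∀ X Y Z W : B, tensorμ X Y Z W ≫ ((β_ X Z).hom ⊗ₘ (β_ Y W).hom)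
      = (β_ _ _).hom ≫ tensorμ Z W X Y := fun X Y Z W => by
    have e : (Z ◁ (β_ X W).hom) ▷ Y ≫ (α_ Z W X).inv ▷ Y ≫ (α_ (Z ⊗ W) X Y).hom ≫
        (α_ Z W (X ⊗ Y)).hom ≫ Z ◁ (α_ W X Y).inv ≫ Z ◁ (β_ W X).hom ▷ Y = (α_ _ _ _).hom := by
      have : Z ◁ (β_ X W).hom ▷ Y ≫ Z ◁ (β_ W X).hom ▷ Y = 𝟙 _ := by
        rw [← MonoidalCategory.whiskerLeft_comp, ← comp_whiskerRight, SymmetricCategory.symmetry,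
          id_whiskerRight, MonoidalCategory.whiskerLeft_id]
      rw [← cancel_epi (α_ Z (X ⊗ W) Y).inv, Iso.inv_hom_id, ← this]
      monoidal
    rw [tensorμ, tensorμ, BraidedCategory.braiding_tensor_left_hom,
      BraidedCategory.braiding_tensor_right_hom, BraidedCategory.braiding_tensor_right_hom,
      tensorHom_def']
    simp only [comp_whiskerRight, MonoidalCategory.whiskerLeft_comp, Category.assoc]
    rw [reassoc_of% e]
    monoidal
  rw [powμ, powμ, Category.assoc, tensorHom_comp_tensorHom, Functor.LaxBraided.braided,
    ← tapp_braiding, ← tensorHom_comp_tensorHom, reassoc_of% h]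

variable {p b}
variable (X Y Z : QO A)

/-- Concatenating tensor powers of `b` gives an invariant family on `|X| ⊗ |Y|`. -/
theorem exists_realizationμ :
    ∃ t : (realization p b).obj X ⊗ (realization p b).obj Y ⟶ (realization p b).obj (X ⊗ Y),
      ∀ m n, (realizationK p b X m ⊗ₘ realizationK p b Y n) ≫ t
        = powμ p b _ _ m n ≫ p.invImage.map (X.dayι Y m n) ▷ _ ≫
            realizationK p b (X ⊗ Y) (m + n) := by
  refine (isRealization_realization p b X).tensor_exists_desc (isRealization_realization p b Y) _
    (fun m m' σ n => ?_) (fun m n n' σ => ?_)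
  · rw [reassoc_of% powμ_natural_left, reassoc_of% powμ_tmap_left, ← comp_whiskerRight_assoc,
      ← Functor.map_comp, act_whiskerRight_dayι, Functor.map_comp, comp_whiskerRight_assoc,
      (isRealization_realization p b (X ⊗ Y)).invariant, whisker_exchange_assoc]
  · rw [reassoc_of% powμ_natural_right, reassoc_of% powμ_tmap_right, ← comp_whiskerRight_assoc,
      ← Functor.map_comp, act_whiskerLeft_dayι, Functor.map_comp, comp_whiskerRight_assoc,
      (isRealization_realization p b (X ⊗ Y)).invariant, whisker_exchange_assoc]

/-- The structure map `|X| ⊗ |Y| ⟶ |X ⊗ Y|` of the realization. -/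
def realizationμ :
    (realization p b).obj X ⊗ (realization p b).obj Y ⟶ (realization p b).obj (X ⊗ Y) :=
  (exists_realizationμ X Y).choose

theorem realizationK_μ (m n : ℕ) :
    (realizationK p b X m ⊗ₘ realizationK p b Y n) ≫ realizationμ X Y
      = powμ p b _ _ m n ≫ p.invImage.map (X.dayι Y m n) ▷ _ ≫ realizationK p b (X ⊗ Y) (m + n) :=
  (exists_realizationμ X Y).choose_spec m n

/-- The inverse of `|X| ⊗ |Y| ⟶ |X ⊗ Y|` is constructed by transposing along the adjunction and
using the universal property of the Day convolution. -/
theorem exists_realizationδ :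
    ∃ t : (realization p b).obj (X ⊗ Y) ⟶ (realization p b).obj X ⊗ (realization p b).obj Y,
      ∀ m n, p.invImage.map (X.dayι Y m n) ▷ _ ≫ realizationK p b (X ⊗ Y) (m + n) ≫ t
        = inv (powμ p b _ _ m n) ≫ (realizationK p b X m ⊗ₘ realizationK p b Y n) := by
  let φ : ∀ m n, X.term m ⊗ Y.term n ⟶ ((corealization p b).obj
      ((realization p b).obj X ⊗ (realization p b).obj Y)).term (m + n) := fun m n =>
    corealizationEquiv p b _ _ _ (inv (powμ p b (X.term m) (Y.term n) m n) ≫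
      (realizationK p b X m ⊗ₘ realizationK p b Y n))
  refine ⟨(realizationHomEquiv p b _ _).symm (dayDesc φ (fun m n σ => ?_) (fun m n σ => ?_)),
    fun m n => (corealizationEquiv p b _ _ _).injective ?_⟩
  · rw [← corealizationEquiv_whiskerRight, ← corealizationEquiv_tmap]
    refine congrArg _ ?_
    rw [← cancel_epi (powμ p b _ _ m n), ← reassoc_of% powμ_natural_left,
      ← reassoc_of% powμ_tmap_left, IsIso.hom_inv_id_assoc,
      MonoidalCategory.tensorHom_def, ← comp_whiskerRight_assoc, ← comp_whiskerRight_assoc,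
      (isRealization_realization p b X).invariant]
  · rw [← corealizationEquiv_whiskerRight, ← corealizationEquiv_tmap]
    refine congrArg _ ?_
    rw [← cancel_epi (powμ p b _ _ m n), ← reassoc_of% powμ_natural_right,
      ← reassoc_of% powμ_tmap_right, IsIso.hom_inv_id_assoc,
      tensorHom_def', ← MonoidalCategory.whiskerLeft_comp_assoc,
      ← MonoidalCategory.whiskerLeft_comp_assoc, (isRealization_realization p b Y).invariant]
  · rw [corealizationEquiv_whiskerRight, ← comp_realizationHomEquiv, Equiv.apply_symm_apply,
      dayι_dayDesc]

/-- The isomorphism `|X| ⊗ |Y| ≅ |X ⊗ Y|`. -/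
def realizationμIso :
    (realization p b).obj X ⊗ (realization p b).obj Y ≅ (realization p b).obj (X ⊗ Y) where
  hom := realizationμ X Y
  inv := (exists_realizationδ X Y).choose
  hom_inv_id := (isRealization_realization p b X).tensor_hom_ext (isRealization_realization p b Y)
    fun m n => by
      rw [reassoc_of% realizationK_μ, (exists_realizationδ X Y).choose_spec, IsIso.hom_inv_id_assoc,
        Category.comp_id]
  inv_hom_id := realization_tensor_hom_ext p b fun m n => by
    rw [reassoc_of% (exists_realizationδ X Y).choose_spec, realizationK_μ, IsIso.inv_hom_id_assoc,
      Category.comp_id]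

variable (p b) in
/-- The structure map `𝟙_ ⟶ |𝟙_|` of the realization. -/
def realizationε : 𝟙_ B ⟶ (realization p b).obj (𝟙_ (QO A)) :=
  ((λ_ (𝟙_ B)).inv ≫ (LaxMonoidal.ε p.invImage ⊗ₘ (tnil b).hom)) ≫
    p.invImage.map unitι ▷ _ ≫ realizationK p b _ 0

variable (p b) in
/-- The inverse of `𝟙_ ⟶ |𝟙_|`, again by transposing along the adjunction. -/
theorem exists_realizationη : ∃ t : (realization p b).obj (𝟙_ (QO A)) ⟶ 𝟙_ B,
    p.invImage.map unitι ▷ _ ≫ realizationK p b _ 0 ≫ t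
      = inv ((λ_ (𝟙_ B)).inv ≫ (LaxMonoidal.ε p.invImage ⊗ₘ (tnil b).hom)) := by
  let φ : 𝟙_ A ⟶ ((corealization p b).obj (𝟙_ B)).term 0 := corealizationEquiv p b _ 0 _
    (inv ((λ_ (𝟙_ B)).inv ≫ (LaxMonoidal.ε p.invImage ⊗ₘ (tnil b).hom)))
  refine ⟨(realizationHomEquiv p b _ _).symm (DayFunctor.unitDesc φ),
    (corealizationEquiv p b _ _ _).injective ?_⟩
  rw [corealizationEquiv_whiskerRight, ← comp_realizationHomEquiv, Equiv.apply_symm_apply]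
  exact DayFunctor.ν_comp_unitDesc φ

variable (p b) in
/-- The isomorphism `𝟙_ ≅ |𝟙_|`. -/
def realizationεIso : 𝟙_ B ≅ (realization p b).obj (𝟙_ (QO A)) where
  hom := realizationε p b
  inv := (exists_realizationη p b).choose
  hom_inv_id := by
    rw [realizationε, Category.assoc, Category.assoc, Category.assoc, (exists_realizationη p b).choose_spec]
    exact (Category.assoc _ _ _).symm.trans (IsIso.hom_inv_id _)
  inv_hom_id := realization_unit_hom_ext p b <| by
    rw [reassoc_of% (exists_realizationη p b).choose_spec, realizationε, IsIso.inv_hom_id_assoc,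
      Category.comp_id]

theorem realizationμ_natural_left {X X' : QO A} (h : X ⟶ X') :
    (realization p b).map h ▷ _ ≫ realizationμ X' Y
      = realizationμ X Y ≫ (realization p b).map (h ▷ Y) := by
  refine (isRealization_realization p b X).tensor_hom_ext (isRealization_realization p b Y)
    fun m n => ?_
  rw [reassoc_of% realizationK_μ, realizationK_natural, ← comp_whiskerRight_assoc,
    ← Functor.map_comp, dayι_whiskerRight, Functor.map_comp, comp_whiskerRight_assoc,
    ← reassoc_of% powμ_natural_left, ← realizationK_μ, reassoc_of% @tensorHom_comp_whiskerRight,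
    realizationK_natural, whiskerRight_comp_tensorHom_assoc]

theorem realizationμ_natural_right {Y Y' : QO A} (h : Y ⟶ Y') :
    _ ◁ (realization p b).map h ≫ realizationμ X Y'
      = realizationμ X Y ≫ (realization p b).map (X ◁ h) := by
  refine (isRealization_realization p b X).tensor_hom_ext (isRealization_realization p b Y)
    fun m n => ?_
  rw [reassoc_of% realizationK_μ, realizationK_natural, ← comp_whiskerRight_assoc,
    ← Functor.map_comp, dayι_whiskerLeft, Functor.map_comp, comp_whiskerRight_assoc,
    ← reassoc_of% powμ_natural_right, ← realizationK_μ, reassoc_of% @tensorHom_comp_whiskerLeft,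
    realizationK_natural, whiskerLeft_comp_tensorHom_assoc]

theorem realizationμ_braiding : (β_ _ _).hom ≫ realizationμ (p := p) (b := b) Y X
    = realizationμ X Y ≫ (realization p b).map (β_ X Y).hom := by
  refine (isRealization_realization p b X).tensor_hom_ext (isRealization_realization p b Y)
    fun m n => ?_
  rw [reassoc_of% realizationK_μ, realizationK_natural, ← comp_whiskerRight_assoc,
    ← Functor.map_comp, dayι_braiding, BraidedCategory.braiding_naturality_assoc, realizationK_μ,
    ← reassoc_of% powμ_braiding, MonoidalCategory.tensorHom_def', Functor.map_comp,
    Functor.map_comp]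
  simp only [comp_whiskerRight, Category.assoc]
  rw [(isRealization_realization p b (Y ⊗ X)).invariant]
  simp only [whisker_exchange_assoc]

theorem realizationμ_assoc :
    realizationμ (p := p) (b := b) X Y ▷ _ ≫ realizationμ (X ⊗ Y) Z ≫
        (realization p b).map (α_ X Y Z).hom
      = (α_ _ _ _).hom ≫ _ ◁ realizationμ Y Z ≫ realizationμ X (Y ⊗ Z) := by
  refine (isRealization_realization p b X).tensor₃_hom_ext (isRealization_realization p b Y)
    (isRealization_realization p b Z) fun l m n => ?_
  rw [reassoc_of% @tensorHom_comp_whiskerRight, realizationK_μ, ← whiskerRight_comp_tensorHom_assoc,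
    ← whiskerRight_comp_tensorHom_assoc, reassoc_of% realizationK_μ, realizationK_natural,
    reassoc_of% powμ_natural_left, associator_naturality_assoc,
    reassoc_of% @tensorHom_comp_whiskerLeft, realizationK_μ, ← whiskerLeft_comp_tensorHom_assoc,
    ← whiskerLeft_comp_tensorHom_assoc, realizationK_μ, reassoc_of% powμ_natural_right,
    ← reassoc_of% powμ_assoc]
  refine congrArg (fun t => _ ≫ _ ≫ t) ?_
  rw [← comp_whiskerRight_assoc, ← comp_whiskerRight_assoc, ← Functor.map_comp, ← Functor.map_comp,
    Category.assoc, dayι_associator, MonoidalCategory.tensorHom_def, Category.assoc, Functor.map_comp,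
    Functor.map_comp, Functor.map_comp]
  simp only [comp_whiskerRight, Category.assoc]
  rw [(isRealization_realization p b _).invariant]
  simp only [whisker_exchange_assoc]

theorem realizationμ_leftUnit : realizationε p b ▷ _ ≫ realizationμ (𝟙_ (QO A)) X ≫
    (realization p b).map (λ_ X).hom = (λ_ _).hom := by
  apply (isRealization_realization p b X).whiskerLeft_hom_ext
  intro n
  rw [whisker_exchange_assoc, realizationε]
  simp only [comp_whiskerRight, Category.assoc]
  rw [← MonoidalCategory.tensorHom_def_assoc, reassoc_of% realizationK_μ, realizationK_natural,
    reassoc_of% powμ_natural_left, leftUnitor_naturality, ← powμ_leftUnit p b]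
  simp only [comp_whiskerRight, Category.assoc]
  refine congrArg (fun t => _ ≫ _ ≫ _ ≫ t) ?_
  rw [← comp_whiskerRight_assoc, ← comp_whiskerRight_assoc, ← Functor.map_comp, ← Functor.map_comp,
    Category.assoc, dayι_leftUnitor, MonoidalCategory.tensorHom_def, Category.assoc,
    Functor.map_comp, comp_whiskerRight, Category.assoc,
    (isRealization_realization p b _).invariant]

theorem realizationμ_rightUnit : _ ◁ realizationε p b ≫ realizationμ X (𝟙_ (QO A)) ≫
    (realization p b).map (ρ_ X).hom = (ρ_ _).hom := by
  rw [← braiding_leftUnitor, Functor.map_comp, ← reassoc_of% realizationμ_braiding,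
    BraidedCategory.braiding_naturality_right_assoc, realizationμ_leftUnit, braiding_leftUnitor]

instance : (realization p b).Monoidal := Functor.CoreMonoidal.toMonoidal
  { εIso := realizationεIso p b
    μIso := realizationμIso
    μIso_hom_natural_left h Y := realizationμ_natural_left Y h
    μIso_hom_natural_right Y h := realizationμ_natural_right Y h
    associativity X Y Z := realizationμ_assoc X Y Z
    left_unitality X := (realizationμ_leftUnit X).symm
    right_unitality X := (realizationμ_rightUnit X).symm }

instance : (realization p b).Braided where
  braided X Y := realizationμ_braiding X Y |>.symm

end RealizationMonoidal

/-! ### The object classifier -/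

section ObjectClassifier

variable {A : Type u} [Category.{v} A] [MonoidalCategory A] [SymmetricCategory A] [Prevectoid A]
variable {B : Type w} [Category.{v} B] [MonoidalCategory B] [SymmetricCategory B] [Prevectoid B]

open QO

open CategoryTheory.Functor hiding const comp

variable (p : VectoidHom B A) (b : B)

/-- The realization of the free symmetric sequence on `a` in degree `n` is `p^* a ⊗ b ⊗ ⋯ ⊗ b`. -/
theorem isIso_realization_mono (a : A) (n : ℕ) : IsIso
    (p.invImage.map (monoι a ⟨n⟩) ▷ tpow b n ≫ realizationK p b (mono a ⟨n⟩) n) := by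
  -- morphisms out of either side into `c` are morphisms `a ⟶ p_* Hom(b ⊗ ⋯ ⊗ b, c)`
  refine isIso_of_coyoneda_map_bijective _ fun c => ⟨fun s t h => ?_, fun φ => ?_⟩
  · apply (realizationHomEquiv p b _ _).injective
    apply mono_hom_ext
    have h' : (p.invImage.map (monoι a ⟨n⟩) ▷ tpow b n ≫ realizationK p b (mono a ⟨n⟩) n) ≫ s
        = (p.invImage.map (monoι a ⟨n⟩) ▷ tpow b n ≫ realizationK p b (mono a ⟨n⟩) n) ≫ t := h
    rw [Category.assoc, Category.assoc] at h'
    apply (corealizationEquiv p b _ _ _).symm.injective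
    apply (corealizationEquiv p b _ _ _).injective
    rw [Equiv.apply_symm_apply, Equiv.apply_symm_apply]
    exact (corealizationEquiv_whiskerRight _ _).symm.trans
      ((congrArg _ h').trans (corealizationEquiv_whiskerRight _ _))
  · refine ⟨(realizationHomEquiv p b _ _).symm (monoDesc (corealizationEquiv p b a n c φ)),
      (corealizationEquiv p b _ _ _).injective ?_⟩
    dsimp only
    rw [Category.assoc]
    refine (corealizationEquiv_whiskerRight _ _).trans ?_
    rw [← comp_realizationHomEquiv, Equiv.apply_symm_apply]
    exact monoι_monoDesc _

/-- The insertion of the empty tensor power of `b`. -/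
def powNil (a : A) : p.invImage.obj a ≅ p.invImage.obj a ⊗ tpow b 0 :=
  (ρ_ _).symm ≪≫ whiskerLeftIso _ (tnil b)

theorem powNil_natural {a a' : A} (f : a ⟶ a') :
    p.invImage.map f ≫ (powNil p b a').hom = (powNil p b a).hom ≫ p.invImage.map f ▷ _ := by
  simp only [powNil, Iso.trans_hom, Iso.symm_hom, whiskerLeftIso_hom, Category.assoc,
    whisker_exchange]
  rw [rightUnitor_inv_naturality_assoc]

theorem powNil_tensor (a a' : A) : ((powNil p b a).hom ⊗ₘ (powNil p b a').hom) ≫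
    powμ p b a a' 0 0 ≫ _ ◁ tmap b (NIso.zeroAdd 0)
      = LaxMonoidal.μ p.invImage a a' ≫ (powNil p b (a ⊗ a')).hom := by
  have h : ((tnil b).hom ⊗ₘ (tnil b).hom) ≫ tapp b 0 0 ≫ tmap b (NIso.zeroAdd 0)
      = (λ_ (𝟙_ B)).hom ≫ (tnil b).hom := by
    rw [tapp_zero, Category.assoc, Category.assoc, tmap_trans, Equiv.symm_trans_self, tmap_refl,
      Category.comp_id, MonoidalCategory.tensorHom_def', Category.assoc, ← comp_whiskerRight_assoc,
      Iso.hom_inv_id, id_whiskerRight, Category.id_comp, leftUnitor_naturality]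
  have h' : ((ρ_ (p.invImage.obj a)).inv ⊗ₘ (ρ_ (p.invImage.obj a')).inv) ≫ tensorμ _ _ _ _ ≫
      _ ◁ (λ_ (𝟙_ B)).hom = (ρ_ _).inv := by
    rw [← cancel_mono (ρ_ _).hom, Category.assoc, Category.assoc, tensorμ_unit,
      tensorHom_comp_tensorHom, Iso.inv_hom_id, Iso.inv_hom_id, Iso.inv_hom_id, id_tensorHom_id]
  simp only [powNil, Iso.trans_hom, Iso.symm_hom, whiskerLeftIso_hom]
  rw [← tensorHom_comp_tensorHom, powμ, ← id_tensorHom, ← id_tensorHom, ← id_tensorHom,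
    Category.assoc, Category.assoc, tensorμ_natural_assoc, tensorHom_comp_tensorHom,
    tensorHom_comp_tensorHom, h, id_tensorHom_id, Category.id_comp, Category.comp_id,
    rightUnitor_inv_naturality_assoc, ← h', ← id_tensorHom, ← id_tensorHom]
  simp only [Category.assoc]
  rw [← tensorHom_id, tensorHom_comp_tensorHom, tensorHom_comp_tensorHom, Category.id_comp,
    Category.comp_id, Category.id_comp]

/-- The isomorphism `p^* a ≅ |(a, ∅, ∅, …)|`. -/
def realizationConst (a : A) : p.invImage.obj a ⟶ (realization p b).obj ((const A).obj a) :=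
  (powNil p b a).hom ≫ p.invImage.map (constElem a) ▷ _ ≫ realizationK p b _ 0

instance (a : A) : IsIso (realizationConst p b a) := by
  have := isIso_realization_mono p b a 0
  exact inferInstanceAs (IsIso ((powNil p b a).hom ≫
    p.invImage.map (monoι a ⟨0⟩) ▷ tpow b 0 ≫ realizationK p b (mono a ⟨0⟩) 0))

/-- The isomorphisms `p^* a ≅ |(a, ∅, ∅, …)|` are natural. -/
def realizationConstIso : p.invImage ≅ const A ⋙ realization p b :=
  NatIso.ofComponents (fun a => asIso (realizationConst p b a)) fun {a a'} f => by
    have h : p.invImage.map f ≫ realizationConst p b a'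
        = realizationConst p b a ≫ (realization p b).map ((const A).map f) := by
      rw [realizationConst, realizationConst, reassoc_of% powNil_natural, Category.assoc,
        Category.assoc, realizationK_natural, ← comp_whiskerRight_assoc, ← comp_whiskerRight_assoc,
        ← Functor.map_comp, ← Functor.map_comp, constElem_map]
    exact h

instance isMonoidal_realizationConstIso : (realizationConstIso p b).hom.IsMonoidal where
  unit := by
    have h : LaxMonoidal.ε p.invImage ≫ realizationConst p b (𝟙_ A)
        = realizationε p b ≫ (realization p b).map (LaxMonoidal.ε (const A)) := by
      rw [realizationConst, realizationε, constElem_ε]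
      simp only [Category.assoc]
      rw [realizationK_natural, Functor.map_comp, comp_whiskerRight_assoc, powNil]
      simp only [Iso.trans_hom, Iso.symm_hom, whiskerLeftIso_hom, Category.assoc]
      rw [rightUnitor_inv_naturality_assoc, MonoidalCategory.tensorHom_def, Category.assoc,
        unitors_inv_equal]
    exact h
  tensor a a' := by
    have h : LaxMonoidal.μ p.invImage a a' ≫ realizationConst p b (a ⊗ a')
        = (realizationConst p b a ⊗ₘ realizationConst p b a') ≫ realizationμ _ _ ≫
          (realization p b).map (LaxMonoidal.μ (const A) a a') := by
      have e := constElem_tmul a a'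
      rw [tmul, Category.assoc, MonoidalCategory.tensorHom_def, Category.assoc] at e
      rw [realizationConst, realizationConst, realizationConst, ← tensorHom_comp_tensorHom_assoc,
        ← tensorHom_comp_tensorHom_assoc, reassoc_of% realizationK_μ, realizationK_natural,
        MonoidalCategory.tensorHom_def (_ ▷ _), Category.assoc, reassoc_of% powμ_natural_right,
        reassoc_of% powμ_natural_left, ← comp_whiskerRight_assoc, ← comp_whiskerRight_assoc,
        ← comp_whiskerRight_assoc, ← Functor.map_comp, ← Functor.map_comp, ← Functor.map_comp]
      simp only [Category.assoc]
      rw [e, ← reassoc_of% powNil_tensor, Functor.map_comp, comp_whiskerRight_assoc,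
        (isRealization_realization p b _).invariant, whisker_exchange_assoc]
    exact h

/-- The isomorphism `b ≅ |X_o|`. -/
def realizationUniv : b ⟶ (realization p b).obj (univ A) :=
  (λ_ b).inv ≫ (LaxMonoidal.ε p.invImage ⊗ₘ ((ρ_ b).inv ≫ b ◁ (tnil b).hom ≫ (tcons' b 0).hom)) ≫
    p.invImage.map univι ▷ _ ≫ realizationK p b _ 1

instance : IsIso (realizationUniv p b) := by
  have := isIso_realization_mono p b (𝟙_ A) 1
  exact inferInstanceAs (IsIso ((λ_ b).inv ≫
    (LaxMonoidal.ε p.invImage ⊗ₘ ((ρ_ b).inv ≫ b ◁ (tnil b).hom ≫ (tcons' b 0).hom)) ≫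
      p.invImage.map (monoι (𝟙_ A) ⟨1⟩) ▷ tpow b 1 ≫ realizationK p b (mono (𝟙_ A) ⟨1⟩) 1))

/-- The morphism over `A` that classifies the object `b`. -/
def classify : OverHom p (toBase A) where
  hom :=
    { invImage := realization p b
      dirImage := corealization p b
      adj := realizationAdj p b
      braided := inferInstance }
  iso := (realizationConstIso p b).symm
  isMonoidal := inferInstanceAs (realizationConstIso p b).inv.IsMonoidal

/-- `q_o A` classifies objects over `A`. -/
theorem eval_isEquivalence : (OverHom.eval p (toBase A) (univ A)).IsEquivalence where
  faithful := OverHom.evalFullyFaithful.faithful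
  full := OverHom.evalFullyFaithful.full
  essSurj := ⟨fun b => ⟨classify p b, ⟨(asIso (realizationUniv p b)).symm⟩⟩⟩

end ObjectClassifier

/-! ### Finite Day convolutions -/

theorem tensorFamMap_zero {D : Type*} [Category* D] [MonoidalCategory D] {X Y : Fin 0 → D}
    (f : ∀ i, X i ⟶ Y i) : (famNil X).hom ≫ tensorFamMap 0 f = (famNil Y).hom :=
  Category.id_comp _

theorem tensorFamMap_succ {D : Type*} [Category* D] [MonoidalCategory D] {n : ℕ}
    {X Y : Fin (n + 1) → D} (f : ∀ i, X i ⟶ Y i) : (famCons X).hom ≫ tensorFamMap (n + 1) f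
      = (f 0 ⊗ₘ tensorFamMap n fun i => f i.succ) ≫ (famCons Y).hom :=
  (Category.id_comp _).trans (Category.comp_id _).symm

section BlockPermutations

variable {s : ℕ}

theorem blockSum_apply {p q : Fin s → ℕ} (τ : ∀ i, Fin (p i) ≃ Fin (q i)) (i : Fin s)
    (j : Fin (p i)) : blockSum τ (finSigmaFinEquiv ⟨i, j⟩) = finSigmaFinEquiv ⟨i, τ i j⟩ := by
  simp [blockSum]

theorem blockPerm_apply (σ : Equiv.Perm (Fin s)) (p : Fin s → ℕ) (i : Fin s) (j : Fin (p (σ i))) :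
    blockPerm σ p (finSigmaFinEquiv (n := fun i => p (σ i)) ⟨i, j⟩)
      = finSigmaFinEquiv ⟨σ i, j⟩ := by
  rw [blockPerm, Equiv.trans_apply, Equiv.symm_apply_apply, Equiv.trans_apply]
  rfl

theorem equiv_ext_blocks {p : Fin s → ℕ} {α : Type*} {f g : Fin (∑ i, p i) ≃ α}
    (h : ∀ (i : Fin s) (j : Fin (p i)), f (finSigmaFinEquiv ⟨i, j⟩) = g (finSigmaFinEquiv ⟨i, j⟩)) :
    f = g := by
  apply Equiv.ext
  intro x
  obtain ⟨⟨i, j⟩, rfl⟩ := finSigmaFinEquiv.surjective x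
  exact h i j

/-- The separation of the first block from the others. -/
def blockCons (p : Fin (s + 1) → ℕ) : Fin (∑ i, p i) ≃ Fin (p 0 + ∑ i : Fin s, p i.succ) :=
  finCongr (Fin.sum_univ_succ p)

theorem blockCons_zero (p : Fin (s + 1) → ℕ) (j : Fin (p 0)) :
    blockCons p (finSigmaFinEquiv ⟨0, j⟩) = Fin.castAdd _ j := by
  rw [finSigmaFinEquiv_cons_zero]
  rfl

theorem blockCons_succ (p : Fin (s + 1) → ℕ) (i : Fin s) (j : Fin (p i.succ)) :
    blockCons p (finSigmaFinEquiv ⟨i.succ, j⟩)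
      = Fin.natAdd _ (finSigmaFinEquiv (n := fun i : Fin s => p i.succ) ⟨i, j⟩) := by
  rw [finSigmaFinEquiv_cons_succ]
  rfl

theorem blockSum_succ {p q : Fin (s + 1) → ℕ} (τ : ∀ i, Fin (p i) ≃ Fin (q i)) :
    (blockSum τ).trans (blockCons q)
      = (blockCons p).trans (NIso.sum (τ 0) (blockSum fun i => τ i.succ)) := by
  apply equiv_ext_blocks
  refine Fin.cases (fun j => ?_) (fun i j => ?_)
  · rw [Equiv.trans_apply, Equiv.trans_apply, blockSum_apply, blockCons_zero, blockCons_zero,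
      NIso.sum_castAdd]
  · rw [Equiv.trans_apply, Equiv.trans_apply, blockSum_apply, blockCons_succ, blockCons_succ,
      NIso.sum_natAdd, blockSum_apply]

end BlockPermutations

section TensorFamEta

variable {A : Type u} [Category.{v} A] [MonoidalCategory A] [SymmetricCategory A] [Prevectoid A]

namespace QO

theorem tensorFamη_zero (p : Fin 0 → ℕ) (Y : Fin 0 → QO A) :
    (famNil fun i => (Y i).term (p i)).hom ≫ tensorFamη 0 p Y
      = unitι ≫ comp (famNil Y).hom 0 ≫ (tensorFam 0 Y).act (finCongr (Fin.sum_univ_zero p)) := by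
  have h : comp (famNil Y).hom 0 ≫ (tensorFam 0 Y).act (finCongr (Fin.sum_univ_zero p))
      = (tensorFam 0 Y).act (finCongr (Fin.sum_univ_zero p)) := Category.id_comp _
  rw [h]
  exact Category.id_comp _

variable {s : ℕ}

theorem tensorFamη_succ (p : Fin (s + 1) → ℕ) (Y : Fin (s + 1) → QO A) :
    (famCons fun i => (Y i).term (p i)).hom ≫ tensorFamη (s + 1) p Y
      = tmul (𝟙 ((Y 0).term (p 0))) (tensorFamη s (fun i => p i.succ) fun i => Y i.succ) ≫
        comp (famCons Y).hom _ ≫ (tensorFam (s + 1) Y).act (blockCons p) := by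
  have h : comp (famCons Y).hom _ ≫ (tensorFam (s + 1) Y).act (blockCons p)
      = (tensorFam (s + 1) Y).act (blockCons p) := Category.id_comp _
  rw [h, tmul, id_tensorHom]
  exact (Category.id_comp _).trans (Category.assoc _ _ _).symm

/-- The structure maps of a finite Day convolution are equivariant for the products of symmetric
groups. -/
theorem tensorFamη_act {p q : Fin s → ℕ} (Y : Fin s → QO A) (τ : ∀ i, Fin (p i) ≃ Fin (q i)) :
    tensorFamMap s (fun i => (Y i).act (τ i)) ≫ tensorFamη s p Y
      = tensorFamη s q Y ≫ (tensorFam s Y).act (blockSum τ) := by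
  induction s with
  | zero =>
    rw [← cancel_epi (famNil _).hom, reassoc_of% @tensorFamMap_zero, tensorFamη_zero,
      reassoc_of% tensorFamη_zero, act_act]
    refine congrArg (fun t => _ ≫ _ ≫ act _ t) ?_
    exact Equiv.ext fun i => i.elim0
  | succ s ih =>
    rw [← cancel_epi (famCons _).hom, reassoc_of% @tensorFamMap_succ, tensorFamη_succ,
      reassoc_of% tensorFamη_succ, reassoc_of% tensorHom_tmul, ih, Category.comp_id,
      ← Category.id_comp ((Y 0).act (τ 0)), tmul_act_act, Category.assoc, reassoc_of% act_comp,
      act_act, act_act, blockSum_succ]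

theorem tensorFamη_map (p : Fin s → ℕ) {Y Y' : Fin s → QO A} (f : ∀ i, Y i ⟶ Y' i) :
    tensorFamη s p Y ≫ comp (tensorFamMap s f) (∑ i, p i)
      = tensorFamMap s (fun i => comp (f i) (p i)) ≫ tensorFamη s p Y' := by
  induction s with
  | zero =>
    rw [← cancel_epi (famNil _).hom, reassoc_of% @tensorFamMap_zero, tensorFamη_zero,
      reassoc_of% tensorFamη_zero, act_comp, ← Category.assoc (comp _ _), ← comp_comp,
      tensorFamMap_zero]
  | succ s ih =>
    rw [← cancel_epi (famCons _).hom, reassoc_of% @tensorFamMap_succ, tensorFamη_succ,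
      reassoc_of% tensorFamη_succ, reassoc_of% tensorHom_tmul, act_comp,
      ← Category.assoc (comp _ _), ← comp_comp, tensorFamMap_succ, comp_comp, Category.assoc,
      reassoc_of% tmul_tensorHom, ih, Category.comp_id, Category.id_comp]

/-! ### The universal property of finite Day convolutions -/

attribute [local instance] Prevectoid.monoidalClosed

/-- The symmetric sequence `n ↦ Hom(a, Z_{k + n})`. -/
def shiftHom (a : A) (k : ℕ) (Z : QO A) : QO A where
  functor :=
    { obj n := (ihom a).obj (Z.term (k + n.unop.card))
      map f := (ihom a).map (Z.act (NIso.sum (Equiv.refl (Fin k)) (id f.unop : Fin _ ≃ Fin _)))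
      map_id n := by
        refine Eq.trans (congrArg (fun t => (ihom a).map (Z.act t)) (NIso.sum_refl k n.unop.card)) ?_
        rw [act_refl, CategoryTheory.Functor.map_id]
      map_comp f g := by
        rw [← Functor.map_comp, act_act, NIso.sum_trans]
        rfl }

/-- Morphisms `c ⟶ Hom(a, Z_{k + n})` are morphisms `a ⊗ c ⟶ Z_{k + n}`. -/
def shiftHomEquiv (a : A) (k : ℕ) (Z : QO A) (c : A) (n : ℕ) :
    (a ⊗ c ⟶ Z.term (k + n)) ≃ (c ⟶ (shiftHom a k Z).term n) :=
  (ihom.adjunction a).homEquiv _ _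

theorem shiftHomEquiv_whiskerLeft {a : A} {k : ℕ} {Z : QO A} {c c' : A} {n : ℕ} (f : c' ⟶ c)
    (φ : a ⊗ c ⟶ Z.term (k + n)) :
    shiftHomEquiv a k Z c' n (a ◁ f ≫ φ) = f ≫ shiftHomEquiv a k Z c n φ :=
  (ihom.adjunction a).homEquiv_naturality_left f φ

theorem shiftHomEquiv_act {a : A} {k : ℕ} {Z : QO A} {c : A} {m n : ℕ} (σ : Fin m ≃ Fin n)
    (φ : a ⊗ c ⟶ Z.term (k + n)) :
    shiftHomEquiv a k Z c m (φ ≫ Z.act (NIso.sum (Equiv.refl _) σ))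
      = shiftHomEquiv a k Z c n φ ≫ act _ σ :=
  (ihom.adjunction a).homEquiv_naturality_right φ _

/-- The morphism `V ⟶ Hom(a, Z_{k + -})` given by an equivariant family. -/
def shiftHomCurry {a : A} {k : ℕ} {V Z : QO A} (Φ : ∀ n, a ⊗ V.term n ⟶ Z.term (k + n))
    (hΦ : ∀ (n : ℕ) (σ : Equiv.Perm (Fin n)),
      a ◁ V.act σ ≫ Φ n = Φ n ≫ Z.act (NIso.sum (Equiv.refl _) σ)) : V ⟶ shiftHom a k Z :=
  ofComp (fun n => shiftHomEquiv a k Z _ n (Φ n)) fun n σ => by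
    rw [← shiftHomEquiv_whiskerLeft, ← shiftHomEquiv_act, hΦ]

theorem comp_shiftHomCurry {a : A} {k : ℕ} {V Z : QO A} (Φ : ∀ n, a ⊗ V.term n ⟶ Z.term (k + n))
    (hΦ) (n : ℕ) : comp (shiftHomCurry Φ hΦ) n = shiftHomEquiv a k Z _ n (Φ n) := rfl

/-- Morphisms out of a finite Day convolution are determined by its structure maps. In the induction
step the first degree `m` is held fixed, and the morphism is curried into a morphism from the
convolution of the remaining factors to `Hom((Y_0)_m, Z_{m + -})`. -/
theorem tensorFam_hom_ext {Y : Fin s → QO A} {Z : QO A} {f g : tensorFam s Y ⟶ Z}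
    (h : ∀ p, tensorFamη s p Y ≫ comp f _ = tensorFamη s p Y ≫ comp g _) : f = g := by
  induction s generalizing Z with
  | zero =>
    let p₀ : Fin 0 → ℕ := Fin.elim0
    rw [← cancel_epi (famNil Y).hom]
    apply unit_hom_ext
    have h' : ∀ f : tensorFam 0 Y ⟶ Z, unitι ≫ comp ((famNil Y).hom ≫ f) 0
        = ((famNil _).hom ≫ tensorFamη 0 p₀ Y ≫ comp f _) ≫
          Z.act (finCongr (Fin.sum_univ_zero p₀)).symm := fun f => by
      rw [reassoc_of% tensorFamη_zero, act_comp, comp_comp]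
      simp only [Category.assoc, act_act]
      rw [act_of_eq _ (Equiv.symm_trans_self _), Category.comp_id]
    rw [h', h', h]
  | succ s ih =>
    rw [← cancel_epi (famCons Y).hom]
    apply tensor_hom_ext
    intro m
    have hΦ : ∀ (f : tensorFam (s + 1) Y ⟶ Z) (n : ℕ) (σ : Equiv.Perm (Fin n)),
        (Y 0).term m ◁ act _ σ ≫ (Y 0).dayι _ m n ≫ comp ((famCons Y).hom ≫ f) (m + n)
          = ((Y 0).dayι _ m n ≫ comp ((famCons Y).hom ≫ f) (m + n)) ≫
            Z.act (NIso.sum (Equiv.refl _) σ) := fun f n σ => by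
      rw [reassoc_of% act_whiskerLeft_dayι, act_comp, Category.assoc]
    have e := ih (f := shiftHomCurry _ (hΦ f)) (g := shiftHomCurry _ (hΦ g)) fun p => by
      rw [comp_shiftHomCurry, comp_shiftHomCurry, ← shiftHomEquiv_whiskerLeft,
        ← shiftHomEquiv_whiskerLeft]
      refine congrArg _ ?_
      let q : Fin (s + 1) → ℕ := Fin.cons m p
      have h' : ∀ f : tensorFam (s + 1) Y ⟶ Z, (Y 0).term m ◁ tensorFamη s p (fun i => Y i.succ) ≫
          (Y 0).dayι _ m _ ≫ comp ((famCons Y).hom ≫ f) (m + ∑ i, p i)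
            = ((famCons fun i => (Y i).term (q i)).hom ≫ tensorFamη (s + 1) q Y ≫ comp f _) ≫
              Z.act (blockCons q).symm := fun f => by
        rw [reassoc_of% tensorFamη_succ, act_comp, comp_comp]
        simp only [Category.assoc, act_act]
        rw [act_of_eq _ (Equiv.symm_trans_self _), Category.comp_id, tmul, id_tensorHom,
          Category.assoc]
        rfl
      rw [h', h', h]
    intro n
    have e' := congrArg (fun t => comp t n) e
    exact (shiftHomEquiv _ _ _ _ _).injective e'

/-- The analogue of `tensorFam_hom_ext` after tensoring with a fixed object, for equivariant
families of morphisms. -/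
theorem tensorFam_whiskerLeft_ext {a : A} {k : ℕ} {Y : Fin s → QO A} {Z : QO A}
    {Φ Φ' : ∀ n, a ⊗ (tensorFam s Y).term n ⟶ Z.term (k + n)}
    (h : ∀ (n : ℕ) (σ : Equiv.Perm (Fin n)),
      a ◁ act _ σ ≫ Φ n = Φ n ≫ Z.act (NIso.sum (Equiv.refl _) σ))
    (h' : ∀ (n : ℕ) (σ : Equiv.Perm (Fin n)),
      a ◁ act _ σ ≫ Φ' n = Φ' n ≫ Z.act (NIso.sum (Equiv.refl _) σ))
    (e : ∀ p, a ◁ tensorFamη s p Y ≫ Φ _ = a ◁ tensorFamη s p Y ≫ Φ' _) (n : ℕ) : Φ n = Φ' n := by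
  have e' : shiftHomCurry Φ h = shiftHomCurry Φ' h' := tensorFam_hom_ext fun p => by
    rw [comp_shiftHomCurry, comp_shiftHomCurry, ← shiftHomEquiv_whiskerLeft,
      ← shiftHomEquiv_whiskerLeft, e]
  exact (shiftHomEquiv _ _ _ _ _).injective (congrArg (fun t => comp t n) e')

/-- The universal property of a finite Day convolution: its structure maps are universal among the
families that are equivariant for the products of symmetric groups. -/
theorem exists_tensorFam_desc (Y : Fin s → QO A) (Z : QO A)
    (χ : ∀ p : Fin s → ℕ, tensorFam s (fun i => (Y i).term (p i)) ⟶ Z.term (∑ i, p i))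
    (hχ : ∀ (p : Fin s → ℕ) (τ : ∀ i, Equiv.Perm (Fin (p i))),
      tensorFamMap s (fun i => (Y i).act (τ i)) ≫ χ p = χ p ≫ Z.act (blockSum τ)) :
    ∃ α : tensorFam s Y ⟶ Z, ∀ p, tensorFamη s p Y ≫ comp α _ = χ p := by
  induction s generalizing Z with
  | zero =>
    let p₀ : Fin 0 → ℕ := Fin.elim0
    have hp : ∀ p : Fin 0 → ℕ, p = p₀ := fun p => Subsingleton.elim _ _
    let φ : 𝟙_ A ⟶ Z.term 0 := (famNil _).hom ≫ χ p₀ ≫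
      Z.act (finCongr (Fin.sum_univ_zero p₀)).symm
    have hφ : unitι ≫ comp (DayFunctor.unitDesc φ) 0 = φ := DayFunctor.ν_comp_unitDesc φ
    refine ⟨(famNil Y).inv ≫ DayFunctor.unitDesc φ, fun p => ?_⟩
    obtain rfl := hp p
    rw [← cancel_epi (famNil _).hom, reassoc_of% tensorFamη_zero, act_comp,
      ← Category.assoc (comp _ _), ← comp_comp, Iso.hom_inv_id_assoc, reassoc_of% hφ]
    simp only [φ, Category.assoc, act_act]
    rw [act_of_eq _ (Equiv.self_trans_symm _), Category.comp_id]
  | succ s ih =>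
    -- separate the first factor from the remaining ones
    obtain ⟨χ', hχ'⟩ : ∃ χ' : ∀ (m : ℕ) (p : Fin s → ℕ),
        (Y 0).term m ⊗ tensorFam s (fun i => (Y i.succ).term (p i)) ⟶ Z.term (m + ∑ i, p i),
        ∀ p, (famCons fun i => (Y i).term (p i)).hom ≫ χ p
          = χ' (p 0) (fun i => p i.succ) ≫ Z.act (blockCons p) := by
      refine ⟨fun m p => (famCons fun i => (Y i).term
        (Fin.cons (α := fun _ => ℕ) m p i)).hom ≫ χ (Fin.cons m p) ≫
          Z.act (blockCons (Fin.cons m p)).symm, fun p => ?_⟩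
      obtain ⟨m, p', rfl⟩ : ∃ m p', p = Fin.cons (α := fun _ => ℕ) m p' :=
        ⟨p 0, Fin.tail p, (Fin.cons_self_tail p).symm⟩
      refine Eq.symm ((Category.assoc _ _ _).trans ?_)
      have h : ∀ q, (χ q ≫ Z.act (blockCons q).symm) ≫ Z.act (blockCons q) = χ q := fun q => by
        rw [Category.assoc, act_act, act_of_eq _ (Equiv.self_trans_symm _), Category.comp_id]
      exact congrArg (_ ≫ ·) (h (Fin.cons m p'))
    have h₀ : ∀ (p : Fin (s + 1) → ℕ) (τ : ∀ i, Equiv.Perm (Fin (p i))),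
        ((Y 0).act (τ 0) ⊗ₘ tensorFamMap s fun i => (Y i.succ).act (τ i.succ)) ≫
          χ' (p 0) (fun i => p i.succ) = χ' (p 0) (fun i => p i.succ) ≫
            Z.act (NIso.sum (τ 0) (blockSum fun i => τ i.succ)) := fun p τ => by
      have := isIso_act Z (blockCons p)
      rw [← cancel_mono (Z.act (blockCons p)), Category.assoc, Category.assoc, ← hχ', act_act,
        ← blockSum_succ, ← act_act, ← reassoc_of% hχ', ← hχ, reassoc_of% @tensorFamMap_succ]
    have h₁ : ∀ (m : ℕ) (p : Fin s → ℕ) (τ : Equiv.Perm (Fin m)) (τ' : ∀ i, Equiv.Perm (Fin (p i))),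
        ((Y 0).act τ ⊗ₘ tensorFamMap s fun i => (Y i.succ).act (τ' i)) ≫ χ' m p = χ' m p ≫
            Z.act (NIso.sum τ (blockSum τ')) := fun m p τ τ' =>
      h₀ (Fin.cons m p) (Fin.cons (α := fun i => Equiv.Perm (Fin
        (Fin.cons (α := fun _ => ℕ) m p i))) τ τ')
    have h₂ : ∀ (m : ℕ) (p : Fin s → ℕ) (τ : Equiv.Perm (Fin m)),
        (Y 0).act τ ▷ _ ≫ χ' m p = χ' m p ≫ Z.act (NIso.sum τ (Equiv.refl _)) := fun m p τ => by
      have h := h₁ m p τ fun i => Equiv.refl _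
      have e : (blockSum fun i => Equiv.refl (Fin (p i))) = Equiv.refl _ :=
        equiv_ext_blocks fun i j => blockSum_apply _ _ _
      simp only [act_refl, tensorFamMap_id, tensorHom_id, e] at h
      exact h
    -- by induction, descend the curried family for each degree `m` of the first factor
    choose α hα using fun m => ih (fun i => Y i.succ) (shiftHom ((Y 0).term m) m Z)
      (fun p => shiftHomEquiv _ _ _ _ _ (χ' m p)) fun p τ => by
        rw [← shiftHomEquiv_whiskerLeft, ← shiftHomEquiv_act, ← h₁ m p (Equiv.refl _) τ, act_refl,
          id_tensorHom]
    let Φ : ∀ m n, (Y 0).term m ⊗ (tensorFam s fun i => Y i.succ).term n ⟶ Z.term (m + n) :=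
      fun m n => (shiftHomEquiv _ _ _ _ _).symm (comp (α m) n)
    have hη : ∀ (m : ℕ) (p : Fin s → ℕ), (Y 0).term m ◁ tensorFamη s p _ ≫ Φ m _ = χ' m p :=
      fun m p => by
        apply (shiftHomEquiv _ _ _ _ _).injective
        rw [shiftHomEquiv_whiskerLeft, Equiv.apply_symm_apply, hα]
    have hΦ : ∀ m n (σ : Equiv.Perm (Fin n)), (Y 0).term m ◁ act _ σ ≫ Φ m n
        = Φ m n ≫ Z.act (NIso.sum (Equiv.refl _) σ) := fun m n σ => by
      apply (shiftHomEquiv _ _ _ _ _).injective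
      rw [shiftHomEquiv_whiskerLeft, shiftHomEquiv_act, Equiv.apply_symm_apply, act_comp]
    -- equivariance in the first factor only needs to be checked on the structure maps
    have hΦ' : ∀ m n (σ : Equiv.Perm (Fin m)), (Y 0).act σ ▷ _ ≫ Φ m n
        = Φ m n ≫ Z.act (NIso.sum σ (Equiv.refl _)) := fun m n σ => by
      refine tensorFam_whiskerLeft_ext (Φ := fun n => (Y 0).act σ ▷ _ ≫ Φ m n)
        (Φ' := fun n => Φ m n ≫ Z.act (NIso.sum σ (Equiv.refl _))) (fun n τ => ?_) (fun n τ => ?_)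
        (fun p => ?_) n
      · rw [whisker_exchange_assoc, hΦ, Category.assoc]
      · rw [reassoc_of% hΦ, Category.assoc, act_act, act_act, NIso.sum_trans, NIso.sum_trans]
        rfl
      · rw [whisker_exchange_assoc, hη, reassoc_of% hη, h₂]
    refine ⟨(famCons Y).inv ≫ dayDesc Φ hΦ' hΦ, fun p => ?_⟩
    rw [← cancel_epi (famCons _).hom, hχ', reassoc_of% tensorFamη_succ, act_comp,
      ← Category.assoc (comp _ _), ← comp_comp, Iso.hom_inv_id_assoc, tmul, id_tensorHom,
      Category.assoc, reassoc_of% dayι_dayDesc, reassoc_of% hη]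

end QO

end TensorFamEta

/-! ### Permutations of the factors of a finite Day convolution -/

section Insert

variable {D : Type u} [Category.{v} D] [MonoidalCategory D] [SymmetricCategory D]

theorem tensorFamInsert_zero (n : ℕ) (X : Fin (n + 1) → D) : tensorFamInsert n 0 X
    = X 0 ◁ tensorFamMap n (fun i => eqToHom (congrArg X (Fin.succAbove_zero_apply i))) ≫
      (famCons X).hom := by
  cases n with
  | zero =>
    refine Eq.trans ?_ (Category.comp_id _).symm
    exact (id_whiskerRight _ _).trans (whiskerLeft_id _ _).symm
  | succ n => exact (Category.comp_id _).symm

theorem tensorFamInsert_succ (n : ℕ) (j : Fin (n + 1)) (X : Fin (n + 2) → D) :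
    X j.succ ◁ (famCons fun i => X (j.succ.succAbove i)).hom ≫ tensorFamInsert (n + 1) j.succ X
      = swapFirst (X j.succ) (X (j.succ.succAbove 0)) _ ≫
        (eqToHom (congrArg X (Fin.succ_succAbove_zero j)) ⊗ₘ
          (X j.succ ◁ tensorFamMap n fun i =>
            eqToHom (congrArg X (Fin.succ_succAbove_succ j i))) ≫
          tensorFamInsert n j (fun i => X i.succ)) ≫ (famCons X).hom := by
  have h : swapFirst (X j.succ) (X (j.succ.succAbove 0)) (tensorFam n fun i =>
      X (j.succ.succAbove i.succ)) = (α_ _ _ _).inv ≫ (β_ _ _).hom ▷ _ ≫ (α_ _ _ _).hom := rfl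
  rw [h]
  simp only [Category.assoc]
  refine Eq.trans (congrArg (· ≫ _) (whiskerLeft_id _ _)) ((Category.id_comp _).trans ?_)
  exact congrArg (fun t => _ ≫ _ ≫ _ ≫ t) (Category.comp_id _).symm

theorem tensorFamPerm_succ (n : ℕ) (σ : Equiv.Perm (Fin (n + 1))) (X : Fin (n + 1) → D) :
    (famCons fun i => X (σ i)).hom ≫ tensorFamPerm (n + 1) σ X
      = X (σ 0) ◁ (tensorFamMap n (fun i => eqToHom (congrArg X (succAbove_permTail σ i).symm)) ≫
        tensorFamPerm n (permTail σ) (fun i => X ((σ 0).succAbove i))) ≫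
      tensorFamInsert n (σ 0) X :=
  Category.id_comp _

end Insert

section BlockInsertion

variable {n : ℕ} (k : Fin (n + 1)) (p : Fin (n + 1) → ℕ)

/-- The separation of the block `k` from the others. -/
def blockInsert : Fin (∑ i, p i) ≃ Fin (p k + ∑ i, p (k.succAbove i)) :=
  (finSumFinEquiv.symm.trans (((Equiv.refl _).sumCongr finSigmaFinEquiv.symm).trans
    ((Equiv.ofBijective (Sum.elim (fun j => ⟨k, j⟩) fun x => ⟨k.succAbove x.1, x.2⟩ :
        Fin (p k) ⊕ (Σ i, Fin (p (k.succAbove i))) → Σ i, Fin (p i)) (by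
      constructor
      · rintro (j | ⟨i, j⟩) (j' | ⟨i', j'⟩) h
        · simpa using h
        · exact absurd (congrArg Sigma.fst h).symm (Fin.succAbove_ne k i')
        · exact absurd (congrArg Sigma.fst h) (Fin.succAbove_ne k i)
        · obtain rfl := Fin.succAbove_right_injective (congrArg Sigma.fst h)
          simpa using h
      · rintro ⟨i, j⟩
        obtain rfl | ⟨i, rfl⟩ := Fin.eq_self_or_eq_succAbove k i
        · exact ⟨.inl j, rfl⟩
        · exact ⟨.inr ⟨i, j⟩, rfl⟩)).trans finSigmaFinEquiv))).symm

theorem blockInsert_self (j : Fin (p k)) :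
    blockInsert k p (finSigmaFinEquiv ⟨k, j⟩) = Fin.castAdd _ j := by
  rw [blockInsert, Equiv.symm_apply_eq]
  simp
  rfl

theorem blockInsert_succAbove (i : Fin n) (j : Fin (p (k.succAbove i))) :
    blockInsert k p (finSigmaFinEquiv ⟨k.succAbove i, j⟩)
      = Fin.natAdd _ (finSigmaFinEquiv (n := fun i => p (k.succAbove i)) ⟨i, j⟩) := by
  rw [blockInsert, Equiv.symm_apply_eq]
  simp
  rfl

theorem finSigmaFinEquiv_finCongr {s : ℕ} {p : Fin s → ℕ} {i i' : Fin s} (h : i = i')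
    (j : Fin (p i)) : finSigmaFinEquiv (n := p) ⟨i', finCongr (congrArg p h) j⟩
      = finSigmaFinEquiv ⟨i, j⟩ := by
  subst h
  rfl

theorem blockPerm_symm_apply {s : ℕ} (σ : Equiv.Perm (Fin s)) (p : Fin s → ℕ) (i : Fin s)
    (j : Fin (p (σ i))) : (blockPerm σ p).symm (finSigmaFinEquiv ⟨σ i, j⟩)
      = finSigmaFinEquiv (n := fun i => p (σ i)) ⟨i, j⟩ := by
  rw [Equiv.symm_apply_eq, blockPerm_apply]

theorem equiv_ext_blocks_succAbove {α : Type*} {f g : Fin (∑ i, p i) ≃ α}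
    (h₀ : ∀ j : Fin (p k), f (finSigmaFinEquiv ⟨k, j⟩) = g (finSigmaFinEquiv ⟨k, j⟩))
    (h : ∀ (i : Fin n) (j : Fin (p (k.succAbove i))),
      f (finSigmaFinEquiv ⟨k.succAbove i, j⟩) = g (finSigmaFinEquiv ⟨k.succAbove i, j⟩)) :
    f = g := by
  apply equiv_ext_blocks
  intro i j
  obtain rfl | ⟨i, rfl⟩ := Fin.eq_self_or_eq_succAbove k i
  · exact h₀ j
  · exact h i j

end BlockInsertion

section

variable {A : Type u} [Category.{v} A] [MonoidalCategory A] [SymmetricCategory A] [Prevectoid A]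

namespace QO

theorem eqToHom_term (Y : QO A) {m n : ℕ} (h : m = n) :
    eqToHom (congrArg Y.term h) = Y.act (finCongr h.symm) := by
  subst h
  exact (act_refl Y m).symm

theorem tensorFamMap_eqToHom_tensorFamη (Y : QO A) {n : ℕ} {p q : Fin n → ℕ} (h : ∀ i, q i = p i) :
    tensorFamMap n (fun i => eqToHom (congrArg Y.term (h i))) ≫ tensorFamη n p (fun _ => Y)
      = tensorFamη n q (fun _ => Y) ≫
        (tpow Y n).act (blockSum fun i => finCongr (h i).symm) := by
  rw [← tensorFamη_act]
  exact congrArg (tensorFamMap n · ≫ _) (funext fun i => eqToHom_term Y (h i))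

/-- Moving a factor to the first position, on the structure maps of a Day convolution power. -/
theorem tensorFamInsert_tensorFamη (Y : QO A) (n : ℕ) (k : Fin (n + 1)) (p : Fin (n + 1) → ℕ) :
    tensorFamInsert n k (fun i => Y.term (p i)) ≫ tensorFamη (n + 1) p (fun _ => Y)
      = tmul (𝟙 (Y.term (p k))) (tensorFamη n (fun i => p (k.succAbove i)) fun _ => Y) ≫
        comp (tcons' Y n).hom _ ≫ comp (tins Y n k) _ ≫
          (tpow Y (n + 1)).act (blockInsert k p) := by
  induction n with
  | zero =>
    obtain rfl : k = 0 := Fin.fin_one_eq_zero k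
    exact zero _ _
  | succ n ih =>
    obtain rfl | ⟨j, rfl⟩ := Fin.eq_zero_or_eq_succ k
    · exact zero _ _
    rw [← cancel_epi (Y.term (p j.succ) ◁ (famCons fun i => Y.term (p (j.succ.succAbove i))).hom),
      reassoc_of% tensorFamInsert_succ n j (fun i => Y.term (p i)), tensorFamη_succ,
      reassoc_of% @whiskerLeft_tmul, tensorFamη_succ, reassoc_of% @tensorHom_tmul]
    have e : p (j.succ.succAbove 0) = p 0 := congrArg p (Fin.succ_succAbove_zero j)
    have e' : ∀ i, p (j.succ.succAbove (Fin.succ i)) = p (j.succAbove i).succ :=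
      fun i => congrArg p (Fin.succ_succAbove_succ j i)
    rw [Category.assoc, ih j (fun i => p i.succ), reassoc_of% @whiskerLeft_tmul,
      tensorFamMap_eqToHom_tensorFamη Y (p := fun i => p (j.succAbove i).succ) e', Category.comp_id,
      eqToHom_term Y e, tmul_act_right, Category.assoc, reassoc_of% act_comp, reassoc_of% act_comp,
      act_act, ← Category.assoc (comp (tcons' Y n).hom _), ← comp_comp,
      ← Category.assoc (tmul _ (tensorFamη _ _ _)), ← Category.id_comp (Y.act _), tmul_act_act,
      ← tmul_whiskerLeft, Category.assoc, Category.assoc, reassoc_of% act_comp, act_act]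
    have key : Y ◁ (tcons' Y n).hom ≫ (tcons' Y (n + 1)).hom ≫ tins Y (n + 1) j.succ
        = swapFirst Y Y (tpow Y n) ≫ Y ◁ ((tcons' Y n).hom ≫ tins Y n j) ≫
          (tcons' Y (n + 1)).hom := by
      rw [tins_succ, ← reassoc_of% swapFirst_tcons', MonoidalCategory.whiskerLeft_comp,
        Category.assoc, whiskerLeft_tcons']
    rw [← Category.assoc (tmul _ (tensorFamη _ _ _)), tmul_act_right, ← tmul_whiskerLeft,
      Category.assoc, Category.assoc, ← Category.assoc (comp (tcons' Y (n + 1)).hom _), ← comp_comp,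
      reassoc_of% act_comp, act_act, ← Category.assoc (comp (Y ◁ (tcons' Y n).hom) _), ← comp_comp,
      key]
    simp only [comp_comp, Category.assoc, MonoidalCategory.whiskerLeft_comp]
    rw [reassoc_of% tmul_swapFirst, reassoc_of% act_comp, reassoc_of% act_comp,
      reassoc_of% act_comp, act_act]
    refine congrArg (fun t => _ ≫ _ ≫ _ ≫ _ ≫ _ ≫ act _ t) ?_
    apply equiv_ext_blocks_succAbove j.succ
    · intro i
      simp only [Equiv.trans_apply, blockInsert_self, blockCons_succ, NIso.sum_castAdd,
        NIso.sum_natAdd, NIso.assoc_symm_1, NIso.swap_castAdd, NIso.assoc_2, Equiv.refl_apply]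
    · refine Fin.cases (fun i => ?_) (fun l i => ?_)
      · simp only [Equiv.trans_apply, blockInsert_succAbove, NIso.sum_natAdd, blockCons_zero,
          NIso.assoc_symm_2, NIso.sum_castAdd, NIso.swap_natAdd, NIso.assoc_1]
        rw [← finSigmaFinEquiv_finCongr (Fin.succ_succAbove_zero j), blockCons_zero,
          NIso.sum_castAdd]
        rfl
      · simp only [Equiv.trans_apply, blockInsert_succAbove, NIso.sum_natAdd, blockCons_succ,
          NIso.assoc_symm_3, NIso.assoc_3, Equiv.refl_apply]
        rw [← finSigmaFinEquiv_finCongr (Fin.succ_succAbove_succ j l), blockCons_succ,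
          NIso.sum_natAdd, Equiv.trans_apply, blockInsert_succAbove j fun i => p i.succ,
          NIso.sum_natAdd, blockSum_apply]
        rfl
where
  zero (n : ℕ) (p : Fin (n + 1) → ℕ) :
      tensorFamInsert n 0 (fun i => Y.term (p i)) ≫ tensorFamη (n + 1) p (fun _ => Y)
      = tmul (𝟙 (Y.term (p 0))) (tensorFamη n (fun i => p (Fin.succAbove 0 i)) fun _ => Y) ≫
        comp (tcons' Y n).hom _ ≫ comp (tins Y n 0) _ ≫
          (tpow Y (n + 1)).act (blockInsert 0 p) := by
    rw [tensorFamInsert_zero, Category.assoc, tensorFamη_succ, reassoc_of% @whiskerLeft_tmul,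
      tensorFamMap_eqToHom_tensorFamη Y (p := fun i => p i.succ)
        fun i => congrArg p (Fin.succAbove_zero_apply i), tmul_act_right, tins_zero,
      comp_id, Category.id_comp, Category.assoc, reassoc_of% act_comp, act_act]
    refine congrArg (fun t => _ ≫ _ ≫ act _ t) ?_
    apply equiv_ext_blocks_succAbove 0
    · intro j
      rw [blockInsert_self, Equiv.trans_apply, blockCons_zero, NIso.sum_castAdd]
      rfl
    · intro i j
      rw [blockInsert_succAbove, Equiv.trans_apply,
        ← finSigmaFinEquiv_finCongr (Fin.succAbove_zero_apply i), blockCons_succ, NIso.sum_natAdd,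
        blockSum_apply]
      rfl

/-- Permuting the factors of the source of a structure map of a Day convolution power is permuting
the factors of the power, up to the block permutation. -/
theorem tensorFamPerm_tensorFamη (Y : QO A) (n : ℕ) (σ : Equiv.Perm (Fin n)) (p : Fin n → ℕ) :
    tensorFamPerm n σ (fun i => Y.term (p i)) ≫ tensorFamη n p (fun _ => Y)
      = tensorFamη n (fun i => p (σ i)) (fun _ => Y) ≫ comp (tperm Y n σ) _ ≫
        (tpow Y n).act (blockPerm σ p).symm := by
  induction n with
  | zero =>
    have h : (blockPerm σ p).symm = Equiv.refl _ := Equiv.ext fun i => (Fin.cast (by simp) i).elim0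
    rw [h]
    refine (Category.id_comp _).trans ?_
    refine Eq.trans ?_ (congrArg (tensorFamη 0 p (fun _ => Y) ≫ ·)
      ((congrArg (_ ≫ ·) (act_refl _ _)).trans (Category.comp_id _)).symm)
    exact (Category.comp_id _).symm
  | succ n ih =>
    rw [← cancel_epi (famCons fun i => Y.term (p (σ i))).hom,
      reassoc_of% tensorFamPerm_succ n σ (fun i => Y.term (p i)), tensorFamInsert_tensorFamη,
      reassoc_of% @whiskerLeft_tmul, Category.assoc,
      ih (permTail σ) fun i => p ((σ 0).succAbove i),
      reassoc_of% tensorFamMap_eqToHom_tensorFamη Y fun i =>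
        congrArg p (succAbove_permTail σ i).symm, reassoc_of% act_comp, act_act, tperm_succ,
      reassoc_of% tensorFamη_succ (fun i => p (σ i)), ← Category.assoc (tensorFamη n _ _),
      tmul_act_right, ← tmul_whiskerLeft, comp_comp]
    simp only [Category.assoc]
    rw [reassoc_of% act_comp, reassoc_of% act_comp, reassoc_of% act_comp, reassoc_of% act_comp,
      act_act, act_act, ← Category.assoc (comp (Y ◁ _) _), ← comp_comp,
      ← Category.assoc (comp (famCons _).hom _), ← comp_comp, ← whiskerLeft_tcons']
    refine congrArg (fun t => _ ≫ _ ≫ _ ≫ act _ t) ?_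
    apply equiv_ext_blocks_succAbove (σ 0)
    · intro i
      simp only [Equiv.trans_apply, blockInsert_self, NIso.sum_castAdd, blockPerm_symm_apply]
      rw [blockCons_zero fun i => p (σ i)]
      rfl
    · intro i j
      obtain ⟨i, rfl⟩ := (permTail σ).surjective i
      simp only [Equiv.trans_apply, blockInsert_succAbove, NIso.sum_natAdd]
      rw [blockPerm_symm_apply (permTail σ) fun i => p ((σ 0).succAbove i), blockSum_apply,
        ← finSigmaFinEquiv_finCongr (succAbove_permTail σ i), blockPerm_symm_apply,
        blockCons_succ fun i => p (σ i)]

end QO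
end

/-! ### Tensor products with constant sequences -/

section

variable {A : Type u} [Category.{v} A] [MonoidalCategory A] [SymmetricCategory A] [Prevectoid A]

namespace QO

variable {a b c c' : A} {V W Z : QO A} {m n : ℕ}

theorem _root_.NIso.zeroAdd_symm_sum (σ : Fin m ≃ Fin n) :
    (NIso.zeroAdd m).symm.trans (NIso.sum (Equiv.refl (Fin 0)) σ)
      = σ.trans (NIso.zeroAdd n).symm := by
  refine Equiv.ext fun i => ?_
  have h := congrArg (· ((NIso.zeroAdd m).symm i)) (NIso.zero_sum σ)
  simp only [Equiv.trans_apply, Equiv.apply_symm_apply] at h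
  rw [Equiv.trans_apply, Equiv.trans_apply, Equiv.eq_symm_apply, h]

/-- The element of `a ⊗ V` given by an element of `V`. -/
def scale (a : A) (y : c ⟶ V.term n) : a ⊗ c ⟶ ((const A).obj a ⊗ V).term n :=
  tmul (constElem a) y ≫ act _ (NIso.zeroAdd n).symm

theorem scale_eq (y : c ⟶ V.term n) :
    tmul (constElem a) y = scale a y ≫ act _ (NIso.zeroAdd n) := by
  rw [scale, Category.assoc, act_act, act_of_eq _ (Equiv.self_trans_symm _), Category.comp_id]

theorem whiskerLeft_scale (f : c' ⟶ c) (y : c ⟶ V.term n) :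
    a ◁ f ≫ scale a y = scale a (f ≫ y) := by
  rw [scale, reassoc_of% @whiskerLeft_tmul, scale]

theorem scale_act (y : c ⟶ V.term n) (σ : Fin m ≃ Fin n) :
    scale a (y ≫ V.act σ) = scale a y ≫ act _ σ := by
  rw [scale, tmul_act_right, scale, Category.assoc, Category.assoc, act_act, act_act]
  rw [NIso.zeroAdd_symm_sum]

theorem scale_whiskerLeft (y : c ⟶ V.term n) (f : V ⟶ W) :
    scale a y ≫ comp (_ ◁ f) n = scale a (y ≫ comp f n) := by
  rw [scale, Category.assoc, act_comp, reassoc_of% tmul_whiskerLeft, scale]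

theorem scale_whiskerRight (f : a ⟶ b) (y : c ⟶ V.term n) :
    scale a y ≫ comp ((const A).map f ▷ V) n = f ▷ c ≫ scale b y := by
  rw [scale, Category.assoc, act_comp, reassoc_of% tmul_whiskerRight, constElem_map, scale,
    ← whiskerRight_tmul, Category.assoc]

/-- Morphisms out of `(a, ∅, ∅, …) ⊗ V` are determined by their components on `a ⊗ V_n`. -/
theorem const_tensor_hom_ext {f g : (const A).obj a ⊗ V ⟶ Z}
    (h : ∀ n, scale a (𝟙 (V.term n)) ≫ comp f n = scale a (𝟙 (V.term n)) ≫ comp g n) : f = g := by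
  have h₁ : ∀ n, (const A).obj a ◁ monoDesc (n := ⟨n⟩) (𝟙 (V.term n)) ≫ f
      = (const A).obj a ◁ monoDesc (n := ⟨n⟩) (𝟙 (V.term n)) ≫ g := fun n => by
    apply ((isGen_constElem a).tmul (isGen_monoι (V.term n) n)).hom_ext
    have e : monoι (V.term n) ⟨n⟩ ≫ comp (monoDesc (n := ⟨n⟩) (𝟙 (V.term n))) n = 𝟙 _ :=
      monoι_monoDesc (n := ⟨n⟩) _
    rw [comp_comp, comp_comp, reassoc_of% tmul_whiskerLeft, reassoc_of% tmul_whiskerLeft, e,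
      scale_eq, Category.assoc, Category.assoc, act_comp, act_comp, reassoc_of% h]
  apply tensor_hom_ext
  intro m n
  have h₂ : ∀ f : (const A).obj a ⊗ V ⟶ Z, dayι _ V m n ≫ comp f (m + n)
      = QO.tmul (Y := mono (V.term n) ⟨n⟩) (𝟙 _) (monoι (V.term n) ⟨n⟩) ≫
        comp ((const A).obj a ◁ monoDesc (n := ⟨n⟩) (𝟙 (V.term n)) ≫ f) (m + n) := fun f => by
    have e : monoι (V.term n) ⟨n⟩ ≫ comp (monoDesc (n := ⟨n⟩) (𝟙 (V.term n))) n = 𝟙 _ :=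
      monoι_monoDesc (n := ⟨n⟩) _
    rw [comp_comp, reassoc_of% tmul_whiskerLeft, e, tmul, id_tensorHom_id, Category.id_comp]
  rw [h₂, h₂, h₁]

attribute [local instance] Prevectoid.monoidalClosed

/-- The tensor product `(a, ∅, ∅, …) ⊗ V` has the objects `a ⊗ V_n` as its components, in the form
of a universal property. -/
theorem exists_const_desc (Φ : ∀ n, a ⊗ V.term n ⟶ Z.term n)
    (hΦ : ∀ (n : ℕ) (σ : Equiv.Perm (Fin n)), a ◁ V.act σ ≫ Φ n = Φ n ≫ Z.act σ) :
    ∃ α : (const A).obj a ⊗ V ⟶ Z, ∀ {c : A} {n : ℕ} (y : c ⟶ V.term n),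
      scale a y ≫ comp α n = a ◁ y ≫ Φ n := by
  -- in degree `n`, curry `Φ` into a morphism `(a, ∅, ∅, …) ⟶ Hom(V_n, Z_{n + -})`, which only
  -- depends on its component in degree `0`; the order of the factors is reversed, so that Day
  -- convolution with the constant sequence on the right can be used
  let α : ∀ n, (const A).obj a ⟶ shiftHom (V.term n) n Z := fun n => monoDesc
    (shiftHomEquiv _ _ Z _ 0 ((β_ _ _).hom ≫ Φ n ≫ Z.act (NIso.addZero n)))
  have hα : ∀ n, constElem a ≫ comp (α n) 0
      = shiftHomEquiv _ _ Z _ 0 ((β_ _ _).hom ≫ Φ n ≫ Z.act (NIso.addZero n)) :=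
    fun n => monoι_monoDesc _
  let Ψ : ∀ n m, V.term n ⊗ ((const A).obj a).term m ⟶ Z.term (n + m) :=
    fun n m => (shiftHomEquiv _ _ _ _ _).symm (comp (α n) m)
  have hΨ : ∀ n, V.term n ◁ constElem a ≫ Ψ n 0
      = (β_ _ _).hom ≫ Φ n ≫ Z.act (NIso.addZero n) := fun n => by
    apply (shiftHomEquiv _ _ _ _ _).injective
    rw [shiftHomEquiv_whiskerLeft, Equiv.apply_symm_apply, hα]
  have h₂ : ∀ n m (σ : Equiv.Perm (Fin m)), V.term n ◁ act _ σ ≫ Ψ n m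
      = Ψ n m ≫ Z.act (NIso.sum (Equiv.refl _) σ) := fun n m σ => by
    apply (shiftHomEquiv _ _ _ _ _).injective
    rw [shiftHomEquiv_whiskerLeft, shiftHomEquiv_act, Equiv.apply_symm_apply, act_comp]
  have h₁ : ∀ n m (σ : Equiv.Perm (Fin n)), V.act σ ▷ _ ≫ Ψ n m
      = Ψ n m ≫ Z.act (NIso.sum σ (Equiv.refl _)) := fun n m σ => by
    have e₁ : ∀ (m) (τ : Equiv.Perm (Fin m)), V.term n ◁ act ((const A).obj a) τ ≫ V.act σ ▷ _ ≫ Ψ n m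
        = (V.act σ ▷ _ ≫ Ψ n m) ≫ Z.act (NIso.sum (Equiv.refl _) τ) := fun m τ => by
      rw [whisker_exchange_assoc, h₂, Category.assoc]
    have e₂ : ∀ (m) (τ : Equiv.Perm (Fin m)), V.term n ◁ act ((const A).obj a) τ ≫
        Ψ n m ≫ Z.act (NIso.sum σ (Equiv.refl _))
        = (Ψ n m ≫ Z.act (NIso.sum σ (Equiv.refl _))) ≫ Z.act (NIso.sum (Equiv.refl _) τ) :=
      fun m τ => by
        rw [reassoc_of% h₂, Category.assoc, act_act, act_act, NIso.sum_trans, NIso.sum_trans]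
        rfl
    -- both sides are morphisms out of the constant sequence, so they are compared in degree `0`
    have e : shiftHomCurry _ e₁ = shiftHomCurry _ e₂ := (isGen_constElem a).hom_ext (by
      rw [comp_shiftHomCurry, comp_shiftHomCurry, ← shiftHomEquiv_whiskerLeft,
        ← shiftHomEquiv_whiskerLeft, whisker_exchange_assoc, hΨ, reassoc_of% hΨ,
        BraidedCategory.braiding_naturality_left_assoc, reassoc_of% hΦ, act_act, act_act,
        NIso.sum_zero])
    exact (shiftHomEquiv _ _ _ _ _).injective (congrArg (fun t => comp t m) e)
  refine ⟨(β_ _ _).hom ≫ dayDesc Ψ h₁ h₂, fun {c n} y => ?_⟩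
  have e : ((NIso.zeroAdd n).symm.trans (NIso.swap 0 n)).trans (NIso.addZero n)
      = Equiv.refl _ := by
    refine Equiv.ext fun i => ?_
    have h : (NIso.zeroAdd n).symm i = Fin.natAdd 0 i := by
      rw [Equiv.symm_apply_eq, NIso.zeroAdd_natAdd]
    rw [Equiv.trans_apply, Equiv.trans_apply, h, NIso.swap_natAdd, NIso.addZero_castAdd]
    rfl
  rw [scale, Category.assoc, act_comp, comp_comp, Category.assoc, reassoc_of% tmul_braiding,
    reassoc_of% act_comp, tmul, Category.assoc, reassoc_of% dayι_dayDesc,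
    MonoidalCategory.tensorHom_def, Category.assoc, reassoc_of% hΨ,
    BraidedCategory.braiding_naturality_left_assoc, act_act, act_act, act_of_eq _ e,
    Category.comp_id, SymmetricCategory.symmetry_assoc]

section

variable {s : ℕ} {Y : Fin s → QO A}

/-- Morphisms out of `(a, ∅, ∅, …) ⊗ Y_1 ⊗ ⋯ ⊗ Y_s` are determined by their components on
`a ⊗ (Y_1)_{p_1} ⊗ ⋯ ⊗ (Y_s)_{p_s}`. -/
theorem const_tensorFam_hom_ext {f g : (const A).obj a ⊗ tensorFam s Y ⟶ Z}
    (h : ∀ p, scale a (tensorFamη s p Y) ≫ comp f _ = scale a (tensorFamη s p Y) ≫ comp g _) :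
    f = g := by
  have h₁ : ∀ (f : (const A).obj a ⊗ tensorFam s Y ⟶ Z) (n : ℕ) (σ : Equiv.Perm (Fin n)),
      a ◁ act _ σ ≫ (scale a (𝟙 ((tensorFam s Y).term n)) ≫ comp f n ≫ Z.act (NIso.zeroAdd n))
        = (scale a (𝟙 ((tensorFam s Y).term n)) ≫ comp f n ≫ Z.act (NIso.zeroAdd n)) ≫
          Z.act (NIso.sum (Equiv.refl (Fin 0)) σ) := fun f n σ => by
    rw [reassoc_of% @whiskerLeft_scale, Category.comp_id, ← Category.id_comp (act _ σ), scale_act,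
      Category.assoc, Category.assoc, Category.assoc, act_act, NIso.zero_sum, ← act_act,
      reassoc_of% act_comp]
  apply const_tensor_hom_ext
  intro n
  have e := tensorFam_whiskerLeft_ext (h₁ f) (h₁ g) (fun p => by
    rw [reassoc_of% @whiskerLeft_scale, reassoc_of% @whiskerLeft_scale, Category.comp_id,
      reassoc_of% h]) n
  have := isIso_act Z (NIso.zeroAdd n)
  rw [← Category.assoc, ← Category.assoc, cancel_mono] at e
  exact e

/-- The universal property of the tensor product of a constant sequence and a finite Day
convolution. -/
theorem exists_const_tensorFam_desc
    (χ : ∀ p : Fin s → ℕ, a ⊗ tensorFam s (fun i => (Y i).term (p i)) ⟶ Z.term (∑ i, p i))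
    (hχ : ∀ (p : Fin s → ℕ) (τ : ∀ i, Equiv.Perm (Fin (p i))),
      a ◁ tensorFamMap s (fun i => (Y i).act (τ i)) ≫ χ p = χ p ≫ Z.act (blockSum τ)) :
    ∃ α : (const A).obj a ⊗ tensorFam s Y ⟶ Z, ∀ p,
      scale a (tensorFamη s p Y) ≫ comp α _ = χ p := by
  -- descend the curried family, with values in `Hom(a, Z_{0 + -})`, to the finite Day convolution
  obtain ⟨β, hβ⟩ := exists_tensorFam_desc Y (shiftHom a 0 Z)
    (fun p => shiftHomEquiv _ _ _ _ _ (χ p ≫ Z.act (NIso.zeroAdd _))) fun p τ => by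
      rw [← shiftHomEquiv_whiskerLeft, ← shiftHomEquiv_act, reassoc_of% hχ, Category.assoc,
        act_act, act_act, NIso.zero_sum]
  let Φ : ∀ n, a ⊗ (tensorFam s Y).term n ⟶ Z.term (0 + n) :=
    fun n => (shiftHomEquiv _ _ _ _ _).symm (comp β n)
  have hη : ∀ p : Fin s → ℕ, a ◁ tensorFamη s p Y ≫ Φ _ = χ p ≫ Z.act (NIso.zeroAdd _) :=
    fun p => by
      apply (shiftHomEquiv _ _ _ _ _).injective
      rw [shiftHomEquiv_whiskerLeft, Equiv.apply_symm_apply, hβ]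
  have hΦ : ∀ n (σ : Equiv.Perm (Fin n)), a ◁ act _ σ ≫ Φ n
      = Φ n ≫ Z.act (NIso.sum (Equiv.refl _) σ) := fun n σ => by
    apply (shiftHomEquiv _ _ _ _ _).injective
    rw [shiftHomEquiv_whiskerLeft, shiftHomEquiv_act, Equiv.apply_symm_apply, act_comp]
  obtain ⟨α, hα⟩ := exists_const_desc (fun n => Φ n ≫ Z.act (NIso.zeroAdd n).symm) fun n σ => by
    rw [reassoc_of% hΦ, Category.assoc, act_act, act_act, NIso.zeroAdd_symm_sum]
  refine ⟨α, fun p => ?_⟩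
  rw [hα, reassoc_of% hη, act_act, act_of_eq _ (Equiv.symm_trans_self _), Category.comp_id]

end

end QO
end

/-! ### The plethysm formula -/

section

variable {A : Type u} [Category.{v} A] [MonoidalCategory A] [SymmetricCategory A] [Prevectoid A]

namespace QO

variable (g : End A) (X Z : QO A)

/-- The morphisms used to define the plethysm maps are the realization maps of `g`. -/
theorem termK_eq : g.termK X = pullbackTermMap g X := funext fun _ => Category.assoc _ _ _

/-- `g^* X` is the realization of `X` at `g^* X_o`. -/
theorem isRealization_pullbackTermMap :
    IsRealization (toBase A) ((θ A).obj g) X (pullbackTermMap g X) :=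
  termK_eq g X ▸ g.isRealization X

theorem pullbackTermMap_invariant {m n : ℕ} (σ : Fin m ≃ Fin n) :
    (const A).map (X.act σ) ▷ tpow ((θ A).obj g) m ≫ pullbackTermMap g X m
      = (const A).obj (X.term n) ◁ tmap ((θ A).obj g) σ ≫ pullbackTermMap g X n :=
  (isRealization_pullbackTermMap g X).invariant σ

variable {X} in
theorem pullbackTermMap_natural {X' : QO A} (f : X ⟶ X') (s : ℕ) :
    pullbackTermMap g X s ≫ g.hom.invImage.map f
      = (const A).map (comp f s) ▷ tpow ((θ A).obj g) s ≫ pullbackTermMap g X' s :=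
  termK_eq g X ▸ termK_eq g X' ▸ g.termK_natural f s

variable {g} in
theorem pullbackTermMap_app {g' : End A} (τ : g ⟶ g') (s : ℕ) :
    pullbackTermMap g X s ≫ τ.app.app X
      = (const A).obj (X.term s) ◁ tpowMap ((θ A).map τ) s ≫ pullbackTermMap g' X s :=
  termK_eq g X ▸ termK_eq g' X ▸ OverHom.termK_app τ X s

/-- The canonical morphisms `X_s ⊗ Y_{p_1} ⊗ ⋯ ⊗ Y_{p_s} ⟶ (g^* X)_{p_1 + ⋯ + p_s}` for
`Y = g^* X_o`. -/
def substMap (s : ℕ) (p : Fin s → ℕ) :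
    X.term s ⊗ tensorFam s (fun i => ((θ A).obj g).term (p i)) ⟶
      (g.hom.invImage.obj X).term (∑ i, p i) :=
  scale (X.term s) (tensorFamη s p fun _ => (θ A).obj g) ≫ comp (pullbackTermMap g X s) _

/-- The plethysm maps of `f` and `g` are the substitution maps for `X = f^* X_o`. -/
theorem plethysmMap_eq (f : End A) (s : ℕ) (p : Fin s → ℕ) :
    plethysmMap f g s p = substMap g ((θ A).obj f) s p := by
  rw [substMap, scale, Category.assoc, act_comp, tmul, Category.assoc]
  rfl

theorem isEquivariantFamily_substMap :
    IsEquivariantFamily X ((θ A).obj g) (g.hom.invImage.obj X) (substMap g X) where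
  inner s p τ := by
    rw [substMap, reassoc_of% @whiskerLeft_scale, tensorFamη_act, scale_act, Category.assoc,
      act_comp, Category.assoc]
  outer s p σ := by
    rw [substMap, substMap, Category.assoc, reassoc_of% @whiskerLeft_scale,
      tensorFamPerm_tensorFamη, ← Category.assoc (tensorFamη _ _ _), scale_act, ← scale_whiskerLeft,
      ← tmap_eq_tperm, ← reassoc_of% @scale_whiskerRight]
    simp only [Category.assoc]
    rw [reassoc_of% act_comp, act_act, act_of_eq _ (Equiv.self_trans_symm _), Category.comp_id,
      ← comp_comp, ← comp_comp, pullbackTermMap_invariant]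

variable {g X Z}

/-- Morphisms out of `g^* X` are determined by the substitution maps. -/
theorem substMap_hom_ext {t t' : g.hom.invImage.obj X ⟶ Z}
    (h : ∀ s p, substMap g X s p ≫ comp t _ = substMap g X s p ≫ comp t' _) : t = t' :=
  (isRealization_pullbackTermMap g X).hom_ext fun s => const_tensorFam_hom_ext fun p => by
    have h' := h s p
    rw [substMap, Category.assoc, Category.assoc, ← comp_comp, ← comp_comp] at h'
    exact h'

/-- The universal property of `g^* X` among symmetric sequences: the substitution maps are universal
among the equivariant families. -/
theorem exists_substMap_desc {φ : ∀ (s : ℕ) (p : Fin s → ℕ),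
      X.term s ⊗ tensorFam s (fun i => ((θ A).obj g).term (p i)) ⟶ Z.term (∑ i, p i)}
    (hφ : IsEquivariantFamily X ((θ A).obj g) Z φ) :
    ∃ t : g.hom.invImage.obj X ⟶ Z, ∀ s p, substMap g X s p ≫ comp t _ = φ s p := by
  -- inner equivariance descends the family to the Day convolutions, outer equivariance makes the
  -- result invariant
  choose α hα using fun s => exists_const_tensorFam_desc (Y := fun _ => (θ A).obj g) (φ s)
    (hφ.inner s)
  have hα' : ∀ ⦃m n : ℕ⦄ (σ : Fin m ≃ Fin n), (const A).map (X.act σ) ▷ tpow ((θ A).obj g) m ≫ α m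
      = (const A).obj (X.term n) ◁ tmap ((θ A).obj g) σ ≫ α n := fun m n σ => by
    obtain rfl : m = n := by simpa using Fintype.card_congr σ
    apply const_tensorFam_hom_ext
    intro p
    -- every `p` is a permutation of some `q`, which is the form in which `hφ.outer` applies
    obtain ⟨q, rfl⟩ : ∃ q : Fin m → ℕ, p = fun i => q (σ i) :=
      ⟨fun i => p (σ.symm i), funext fun i => congrArg p (σ.symm_apply_apply i).symm⟩
    rw [comp_comp, reassoc_of% @scale_whiskerRight, hα, hφ.outer, ← hα, comp_comp,
      Category.assoc, ← act_comp, reassoc_of% @whiskerLeft_scale, tensorFamPerm_tensorFamη,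
      ← Category.assoc (tensorFamη _ _ _), scale_act, ← scale_whiskerLeft, Category.assoc,
      Category.assoc, reassoc_of% act_act, act_of_eq _ (Equiv.self_trans_symm _),
      Category.id_comp, tmap_eq_tperm]
  obtain ⟨t, ht⟩ := (isRealization_pullbackTermMap g X).exists_desc α hα'
  refine ⟨t, fun s p => ?_⟩
  have h : pullbackTermMap g X s ≫ t = α s := ht s
  rw [substMap, Category.assoc, ← comp_comp, h, hα]

section Cofree

attribute [local instance] Prevectoid.hasFiniteLimits

/-- The symmetric sequence `m ↦ ∏_{n ≃ m} T`, which is cofree on the object `T` in degree `n`. -/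
def cofree (n : ℕ) (T : A) : QO A where
  functor :=
    { obj m := ∏ᶜ fun _ : Fin n ≃ Fin m.unop.card => T
      map f := Pi.lift fun h => Pi.π (fun _ => T) (h.trans (id f.unop : Fin _ ≃ Fin _))
      map_id m := Limits.Pi.hom_ext _ _ fun h => by
        rw [Pi.lift_π, Category.id_comp]
        rfl
      map_comp f g := Limits.Pi.hom_ext _ _ fun h => by
        rw [Pi.lift_π, Category.assoc, Pi.lift_π, Pi.lift_π]
        rfl }

variable {n m : ℕ} {T : A}

/-- The projections of the cofree sequence. -/
def cofreeπ (h : Fin n ≃ Fin m) : (cofree n T).term m ⟶ T :=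
  Pi.π (fun _ : Fin n ≃ Fin m => T) h

theorem cofree_hom_ext {c : A} {f g : c ⟶ (cofree n T).term m}
    (h : ∀ e, f ≫ cofreeπ e = g ≫ cofreeπ e) : f = g :=
  Limits.Pi.hom_ext _ _ h

theorem act_cofreeπ {m' : ℕ} (σ : Fin m ≃ Fin m') (h : Fin n ≃ Fin m) :
    (cofree n T).act σ ≫ cofreeπ h = cofreeπ (h.trans σ) :=
  Pi.lift_π _ _

/-- The morphism to a product of copies given by its components. -/
def cofreeLift {c : A} (φ : (Fin n ≃ Fin m) → (c ⟶ T)) : c ⟶ (cofree n T).term m :=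
  Pi.lift φ

theorem cofreeLift_π {c : A} (φ : (Fin n ≃ Fin m) → (c ⟶ T)) (h : Fin n ≃ Fin m) :
    cofreeLift φ ≫ cofreeπ h = φ h :=
  Pi.lift_π _ _

/-- Morphisms `Z_n ⟶ T` extend to morphisms from `Z` to the cofree sequence. -/
theorem exists_comp_cofreeπ {Z : QO A} (t : Z.term n ⟶ T) :
    ∃ f : Z ⟶ cofree n T, ∀ {m : ℕ} (h : Fin n ≃ Fin m), comp f m ≫ cofreeπ h = Z.act h ≫ t := by
  refine ⟨ofComp (fun m => cofreeLift fun h => Z.act h ≫ t) fun m σ => ?_, fun h => ?_⟩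
  · apply cofree_hom_ext
    intro h
    rw [Category.assoc, Category.assoc, cofreeLift_π, act_cofreeπ, cofreeLift_π, ← act_act,
      Category.assoc]
  · rw [comp_ofComp, cofreeLift_π]

end Cofree

/-- The structure maps of `g^* X` exhibit it as the plethysm of `X` and `g^* X_o`. -/
theorem isPlethysm_substMap (g : End A) (X : QO A) :
    IsPlethysm X ((θ A).obj g) (g.hom.invImage.obj X) (substMap g X) where
  equivariant := isEquivariantFamily_substMap g X
  existsUnique_desc n T φ h₁ h₂ := by
    -- a morphism from `(g^* X)_n` to `T` is a morphism from `g^* X` to the cofree sequence on `T`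
    -- in degree `n`
    obtain ⟨t, ht⟩ := exists_substMap_desc (Z := cofree n T)
      (φ := fun s p => cofreeLift fun h => φ s p h)
      ⟨fun s p τ => cofree_hom_ext fun h => by
        rw [Category.assoc, Category.assoc, act_cofreeπ, cofreeLift_π, cofreeLift_π, h₁],
      fun s p σ => cofree_hom_ext fun h => by
        rw [Category.assoc, Category.assoc, Category.assoc, act_cofreeπ, cofreeLift_π,
          cofreeLift_π, h₂]⟩
    refine ⟨comp t n ≫ cofreeπ (Equiv.refl _), fun s p h => ?_, fun t' ht' => ?_⟩
    · rw [reassoc_of% act_comp, act_cofreeπ, reassoc_of% ht, cofreeLift_π]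
      rfl
    · obtain ⟨f, hf⟩ := exists_comp_cofreeπ t'
      have e : f = t := substMap_hom_ext fun s p => cofree_hom_ext fun h => by
        rw [Category.assoc, Category.assoc, hf, ht', reassoc_of% ht, cofreeLift_π]
      rw [← e, hf, act_refl, Category.id_comp]

theorem isPlethysm_plethysmMap (f g : End A) :
    IsPlethysm ((θ A).obj f) ((θ A).obj g) ((θ A).obj (f ⊗ g)) (plethysmMap f g) := by
  have h : plethysmMap f g = substMap g ((θ A).obj f) :=
    funext fun s => funext fun p => plethysmMap_eq g f s p
  rw [h]
  exact isPlethysm_substMap g ((θ A).obj f)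

end QO
end

/-! ### Concatenation of finite Day convolutions -/

theorem blockSum_finCongr {s : ℕ} {p q : Fin s → ℕ} (h : ∀ i, p i = q i) :
    (blockSum fun i => finCongr (h i)) = finCongr (Finset.sum_congr rfl fun i _ => h i) := by
  obtain rfl : p = q := funext h
  exact equiv_ext_blocks fun i j => blockSum_apply _ _ _

theorem finCongr_trans_finCongr {l m n : ℕ} (h : l = m) (h' : m = n) :
    (finCongr h).trans (finCongr h') = finCongr (h.trans h') := rfl

theorem sum_finCongr {m m' n n' : ℕ} (h : m = m') (h' : n = n') :
    NIso.sum (finCongr h) (finCongr h') = finCongr (congrArg₂ (· + ·) h h') := by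
  subst h h'
  exact NIso.sum_refl _ _

theorem NIso.exchange_zero (m n : ℕ) :
    NIso.exchange 0 m 0 n = finCongr (by omega) := by
  refine Equiv.ext fun i => ?_
  refine Fin.addCases (fun i => ?_) (fun i => ?_) i
  · refine Fin.addCases (fun i => i.elim0) (fun i => ?_) i
    rw [NIso.exchange_castAdd_natAdd]
    apply Fin.ext
    simp
  · refine Fin.addCases (fun i => i.elim0) (fun i => ?_) i
    rw [NIso.exchange_natAdd_natAdd]
    apply Fin.ext
    simp

theorem Fin.natAdd_zero_eq_cast {n : ℕ} (j : Fin n) :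
    Fin.natAdd 0 j = Fin.cast (Nat.zero_add n).symm j := Fin.ext (by simp)

theorem Fin.castAdd_zero_eq_cast (m n : ℕ) :
    Fin.castAdd n (0 : Fin (m + 1)) = Fin.cast (Nat.succ_add m n).symm 0 := Fin.ext (by simp)

theorem Fin.castAdd_succ_eq_cast {m : ℕ} (n : ℕ) (i : Fin m) : Fin.castAdd n i.succ
    = Fin.cast (Nat.succ_add m n).symm (Fin.castAdd n i).succ := Fin.ext (by simp)

theorem Fin.natAdd_succ_eq_cast (m : ℕ) {n : ℕ} (j : Fin n) : Fin.natAdd (m + 1) j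
    = Fin.cast (Nat.succ_add m n).symm (Fin.natAdd m j).succ := Fin.ext (by simp; omega)

theorem tensorFamAppend_zero {D : Type u} [Category.{v} D] [MonoidalCategory D] (n : ℕ)
    (Z : Fin (0 + n) → D) : (famNil _).hom ▷ _ ≫ tensorFamAppend 0 n Z
      = (λ_ (tensorFam n fun j => Z (Fin.natAdd 0 j))).hom ≫
        tensorFamCast (Nat.zero_add n).symm fun j => congrArg Z (Fin.natAdd_zero_eq_cast j) :=
  (congrArg (· ≫ _) (id_whiskerRight _ _)).trans (Category.id_comp _)

theorem tensorFamAppend_succ {D : Type u} [Category.{v} D] [MonoidalCategory D] (m n : ℕ)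
    (Z : Fin (m + 1 + n) → D) : (famCons fun i => Z (Fin.castAdd n i)).hom ▷ _ ≫
        tensorFamAppend (m + 1) n Z
      = (α_ (Z (Fin.castAdd n 0)) (tensorFam m fun i => Z (Fin.castAdd n i.succ))
          (tensorFam n fun j => Z (Fin.natAdd (m + 1) j))).hom ≫
        (eqToHom (congrArg Z (Fin.castAdd_zero_eq_cast m n)) ⊗ₘ
          ((tensorFamMap m fun i => eqToHom (congrArg Z (Fin.castAdd_succ_eq_cast n i))) ⊗ₘ
            tensorFamMap n fun j => eqToHom (congrArg Z (Fin.natAdd_succ_eq_cast m j))) ≫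
          tensorFamAppend m n fun i => Z (Fin.cast (Nat.succ_add m n).symm i.succ)) ≫
        (famCons fun i => Z (Fin.cast (Nat.succ_add m n).symm i)).hom ≫
        tensorFamCast (X := fun i => Z (Fin.cast (Nat.succ_add m n).symm i))
          (Nat.succ_add m n).symm fun _ => rfl := by
  refine (congrArg (· ≫ _) (id_whiskerRight _ _)).trans ((Category.id_comp _).trans ?_)
  refine Eq.trans ?_ (congrArg (fun t => _ ≫ _ ≫ t) (Category.id_comp _).symm)
  have h : ∀ {m : ℕ} (X : Fin m → D), tensorFamMap m (fun i => eqToHom (Eq.refl (X i))) = 𝟙 _ :=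
    fun X => tensorFamMap_id _ X
  refine congrArg (fun t => _ ≫ t ≫ _) ?_
  refine Eq.trans ?_ (id_tensorHom _ _).symm
  refine congrArg (fun t => _ ◁ (t ≫ _)) ?_
  refine (id_tensorHom _ _).symm.trans (congrArg (· ⊗ₘ _) (h _).symm)

section

variable {A : Type u} [Category.{v} A] [MonoidalCategory A] [SymmetricCategory A] [Prevectoid A]

namespace QO

theorem tensorFamCast_tensorFamη (Y : QO A) {m n : ℕ} (h : m = n) {p : Fin m → ℕ} {q : Fin n → ℕ}
    (e : ∀ i, p i = q (Fin.cast h i)) :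
    tensorFamCast h (X := fun i => Y.term (p i)) (Y := fun i => Y.term (q i))
        (fun i => congrArg Y.term (e i)) ≫ tensorFamη n q (fun _ => Y)
      = tensorFamη m p (fun _ => Y) ≫ comp (tmap Y (finCongr h)) _ ≫
        (tpow Y n).act (finCongr (by subst h; exact Finset.sum_congr rfl fun i _ => (e i).symm)) := by
  subst h
  obtain rfl : p = q := funext e
  have h₁ : comp (tmap Y (finCongr (Eq.refl m))) (∑ i, p i) = 𝟙 _ :=
    (congrArg (fun t => comp t _) (tmap_refl Y m)).trans (comp_id _ _)
  rw [h₁, Category.id_comp]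
  refine (Category.id_comp _).trans ?_
  exact ((congrArg (_ ≫ ·) (act_refl _ _)).trans (Category.comp_id _)).symm

theorem comp_hom_inv_id_assoc {X Y : QO A} (e : X ≅ Y) (n : ℕ) {c : A} (f : X.term n ⟶ c) :
    comp e.hom n ≫ comp e.inv n ≫ f = f := by
  rw [← Category.assoc, ← comp_comp, Iso.hom_inv_id, comp_id, Category.id_comp]

theorem comp_hom_inv_id {X Y : QO A} (e : X ≅ Y) (n : ℕ) :
    comp e.hom n ≫ comp e.inv n = 𝟙 _ := by
  rw [← comp_comp, Iso.hom_inv_id, comp_id]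

/-- Concatenating the sources of two structure maps of Day convolution powers is concatenating the
powers. -/
theorem tensorFamAppend_tensorFamη (Y : QO A) (m n : ℕ) (q : Fin (m + n) → ℕ) :
    tensorFamAppend m n (fun i => Y.term (q i)) ≫ tensorFamη (m + n) q (fun _ => Y)
      = tmul (tensorFamη m (fun i => q (Fin.castAdd n i)) fun _ => Y)
          (tensorFamη n (fun i => q (Fin.natAdd m i)) fun _ => Y) ≫ comp (tapp Y m n) _ ≫
        (tpow Y (m + n)).act (finCongr (Fin.sum_univ_add q)) := by
  induction m with
  | zero =>
    have hq : ∀ j : Fin n, q (Fin.natAdd 0 j) = q (Fin.cast (Nat.zero_add n).symm j) :=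
      fun j => congrArg q (Fin.natAdd_zero_eq_cast j)
    rw [← cancel_epi ((famNil _).hom ▷ _),
      reassoc_of% tensorFamAppend_zero n fun i => Y.term (q i),
      reassoc_of% @whiskerRight_tmul, tensorFamη_zero, tapp_zero, comp_comp, comp_comp,
      Category.assoc, Category.assoc,
      reassoc_of% tmul_whiskerRight, tensorFamCast_tensorFamη Y _ hq, Category.assoc,
      Category.assoc, act_comp, comp_hom_inv_id_assoc, tmul_act_left, Category.assoc,
      reassoc_of% act_comp, reassoc_of% act_comp, reassoc_of% tmul_leftUnitor,
      reassoc_of% act_comp, act_act, act_act, sum_finCongr_refl]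
    rfl
  | succ m ih =>
    have h₀ : q (Fin.castAdd n 0) = q (Fin.cast (Nat.succ_add m n).symm 0) :=
      congrArg q (Fin.castAdd_zero_eq_cast m n)
    have h₁ : ∀ i : Fin m, q (Fin.castAdd n i.succ)
        = q (Fin.cast (Nat.succ_add m n).symm (Fin.castAdd n i).succ) :=
      fun i => congrArg q (Fin.castAdd_succ_eq_cast n i)
    have h₂ : ∀ j : Fin n, q (Fin.natAdd (m + 1) j)
        = q (Fin.cast (Nat.succ_add m n).symm (Fin.natAdd m j).succ) :=
      fun j => congrArg q (Fin.natAdd_succ_eq_cast m j)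
    rw [← cancel_epi ((famCons _).hom ▷ _),
      reassoc_of% tensorFamAppend_succ m n fun i => Y.term (q i),
      reassoc_of% @whiskerRight_tmul, tensorFamη_succ, tapp_succ,
      tensorFamCast_tensorFamη Y (Nat.succ_add m n).symm
        (p := fun i => q (Fin.cast (Nat.succ_add m n).symm i)) (q := q) fun _ => rfl,
      reassoc_of% tensorFamη_succ]
    simp only [comp_comp, Category.assoc]
    rw [reassoc_of% tmul_whiskerRight, Category.assoc, Category.assoc,
      act_comp, comp_hom_inv_id_assoc, tmul_act_left, Category.assoc]
    simp only [reassoc_of% @act_comp, act_act]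
    rw [reassoc_of% tmul_associator, reassoc_of% @tensorHom_tmul, Category.assoc, ih,
      reassoc_of% @tensorHom_tmul, tensorFamMap_eqToHom_tensorFamη Y h₁,
      tensorFamMap_eqToHom_tensorFamη Y h₂, tmul_act_act, Category.assoc, reassoc_of% act_comp,
      act_act, Category.comp_id, eqToHom_term Y h₀, ← Category.assoc (tmul (tensorFamη m _ _) _),
      ← Category.id_comp (Y.act _), tmul_act_act, ← tmul_whiskerLeft]
    simp only [Category.assoc, reassoc_of% @act_comp, act_act, blockSum_finCongr, sum_finCongr,
      sum_finCongr_refl, blockCons, NIso.assoc, finCongr_trans_finCongr]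

end QO
end

/-! ### Multiplicativity of the substitution maps -/

section

variable {A : Type u} [Category.{v} A] [MonoidalCategory A] [SymmetricCategory A] [Prevectoid A]

namespace QO

open CategoryTheory.Functor hiding const comp

variable (g : End A)

/-- Multiplicativity of the realization maps. -/
theorem pullbackTermMap_tensor (X Y : QO A) (m n : ℕ) :
    (pullbackTermMap g X m ⊗ₘ pullbackTermMap g Y n) ≫ LaxMonoidal.μ g.hom.invImage X Y
      = tensorμ ((const A).obj (X.term m)) (tpow ((θ A).obj g) m) ((const A).obj (Y.term n))
          (tpow ((θ A).obj g) n) ≫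
        (LaxMonoidal.μ (const A) _ _ ⊗ₘ tapp ((θ A).obj g) m n) ≫
          (const A).map (X.dayι Y m n) ▷ _ ≫ pullbackTermMap g (X ⊗ Y) (m + n) :=
  termK_eq g X ▸ termK_eq g Y ▸ termK_eq g (X ⊗ Y) ▸ g.termK_tensor X Y m n

theorem act_finCongr_self (X : QO A) {n : ℕ} (h : n = n) : X.act (finCongr h) = 𝟙 _ :=
  act_refl X n

theorem tmul_tensorFamη_tapp (Y : QO A) (m n : ℕ) (q : Fin (m + n) → ℕ) :
    tmul (tensorFamη m (fun i => q (Fin.castAdd n i)) fun _ => Y)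
          (tensorFamη n (fun i => q (Fin.natAdd m i)) fun _ => Y) ≫ comp (tapp Y m n) _
      = (tensorFamAppend m n (fun i => Y.term (q i)) ≫ tensorFamη (m + n) q (fun _ => Y)) ≫
        (tpow Y (m + n)).act (finCongr (Fin.sum_univ_add q).symm) := by
  rw [tensorFamAppend_tensorFamη, Category.assoc, Category.assoc, act_act, finCongr_trans_finCongr,
    act_finCongr_self, Category.comp_id]

/-- Substitution into a Day convolution `X ⊗ Y` is the product of the substitutions into `X` and
`Y`. -/
theorem substMap_tensor (X Y : QO A) (m n : ℕ) (q : Fin (m + n) → ℕ) :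
    tmul (substMap g X m fun i => q (Fin.castAdd n i)) (substMap g Y n fun i => q (Fin.natAdd m i)) ≫
        comp (LaxMonoidal.μ g.hom.invImage X Y) _
      = tensorμ (X.term m) _ (Y.term n) _ ≫
        (dayι X Y m n ⊗ₘ tensorFamAppend m n fun i => ((θ A).obj g).term (q i)) ≫
          substMap g (X ⊗ Y) (m + n) q ≫
            (g.hom.invImage.obj (X ⊗ Y)).act (finCongr (Fin.sum_univ_add q).symm) := by
  rw [substMap, substMap, ← tmul_tensorHom, Category.assoc, ← comp_comp, pullbackTermMap_tensor,
    scale, scale, tmul_act_act]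
  simp only [comp_comp, Category.assoc]
  rw [reassoc_of% act_comp, reassoc_of% tmul_tensorμ]
  simp only [reassoc_of% @act_comp, act_comp]
  rw [reassoc_of% @tmul_tensorHom, constElem_tmul, tmul_tensorFamη_tapp, tmul_act_act,
    ← Category.id_comp (constElem _), ← tensorHom_tmul]
  simp only [reassoc_of% @act_comp, Category.assoc, act_act]
  rw [reassoc_of% tmul_whiskerRight, constElem_map, ← Category.id_comp (tensorFamη _ q _),
    ← tensorHom_tmul, substMap, scale]
  simp only [act_comp, Category.assoc, act_act]
  rw [MonoidalCategory.tensorHom_comp_tensorHom_assoc, Category.id_comp, Category.comp_id]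
  simp only [NIso.zeroAdd, finCongr_symm, sum_finCongr, NIso.exchange_zero, finCongr_trans_finCongr]

end QO
end

/-! ### Substitution into finite Day convolutions -/

theorem sum_finSigmaFinEquiv {s : ℕ} {p : Fin s → ℕ} (q : Fin (∑ i, p i) → ℕ) :
    ∑ i, ∑ j, q (finSigmaFinEquiv ⟨i, j⟩) = ∑ k, q k := by
  rw [← finSigmaFinEquiv.sum_comp, Fintype.sum_sigma]

section

variable {D : Type u} [Category.{v} D] [MonoidalCategory D]

theorem tensorFamFlatten_succ {s : ℕ} (p : Fin (s + 1) → ℕ) (Z : Fin (∑ i, p i) → D) :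
    (famCons fun i => tensorFam (p i) fun j => Z (finSigmaFinEquiv ⟨i, j⟩)).hom ≫
        tensorFamFlatten (s + 1) p Z
      = ((tensorFamMap (p 0) fun j => eqToHom (congrArg Z (finSigmaFinEquiv_cons_zero p j))) ⊗ₘ
        ((tensorFamMap s fun i => tensorFamMap (p i.succ) fun j =>
            eqToHom (congrArg Z (finSigmaFinEquiv_cons_succ p i j))) ≫
          tensorFamFlatten s (fun i => p i.succ) fun k =>
            Z (Fin.cast (Fin.sum_univ_succ p).symm (Fin.natAdd (p 0) k)))) ≫
      tensorFamAppend (p 0) (∑ i : Fin s, p i.succ)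
        (fun k => Z (Fin.cast (Fin.sum_univ_succ p).symm k)) ≫
      tensorFamCast (X := fun k => Z (Fin.cast (Fin.sum_univ_succ p).symm k))
        (Fin.sum_univ_succ p).symm fun _ => rfl :=
  Category.id_comp _

variable [SymmetricCategory D]

theorem tensorFamTensor_succ {n : ℕ} (X Y : Fin (n + 1) → D) :
    ((famCons X).hom ⊗ₘ (famCons Y).hom) ≫ tensorFamTensor (n + 1) X Y
      = tensorμ (X 0) (tensorFam n fun i => X i.succ) (Y 0) (tensorFam n fun i => Y i.succ) ≫
        (X 0 ⊗ Y 0) ◁ tensorFamTensor n (fun i => X i.succ) (fun i => Y i.succ) ≫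
          (famCons fun i => X i ⊗ Y i).hom := by
  refine (congrArg (· ≫ _) (MonoidalCategory.id_tensorHom_id _ _)).trans ((Category.id_comp _).trans ?_)
  exact congrArg (_ ≫ ·) (Category.comp_id _).symm

theorem tensorFamTensor_zero (X Y : Fin 0 → D) :
    ((famNil X).hom ⊗ₘ (famNil Y).hom) ≫ tensorFamTensor 0 X Y
      = (λ_ (𝟙_ D)).hom ≫ (famNil fun i => X i ⊗ Y i).hom := by
  refine (congrArg (· ≫ _) (MonoidalCategory.id_tensorHom_id _ _)).trans ((Category.id_comp _).trans ?_)
  exact (Category.comp_id _).symm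

end

section

variable {A : Type u} [Category.{v} A] [MonoidalCategory A] [SymmetricCategory A] [Prevectoid A]

namespace QO

open CategoryTheory.Functor hiding const comp

variable (g : End A)

/-- Substitution is natural in the symmetric sequence that is substituted into. -/
theorem substMap_natural {X X' : QO A} (f : X ⟶ X') (s : ℕ) (p : Fin s → ℕ) :
    substMap g X s p ≫ comp (g.hom.invImage.map f) _
      = comp f s ▷ _ ≫ substMap g X' s p := by
  rw [substMap, Category.assoc, ← comp_comp, pullbackTermMap_natural, comp_comp,
    reassoc_of% scale_whiskerRight, substMap]

theorem substMap_recast (X : QO A) {n : ℕ} {p q : Fin n → ℕ} (e : ∀ i, p i = q i) :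
    substMap g X n p
      = (𝟙 (X.term n) ⊗ₘ
          tensorFamMap n fun i => eqToHom (congrArg ((θ A).obj g).term (e i))) ≫
        substMap g X n q ≫ act _ (finCongr (Finset.sum_congr rfl fun i _ => e i)) := by
  rw [substMap, substMap, id_tensorHom, Category.assoc, reassoc_of% @whiskerLeft_scale,
    tensorFamMap_eqToHom_tensorFamη _ e, blockSum_finCongr, scale_act, Category.assoc,
    reassoc_of% @act_comp, act_act, finCongr_trans_finCongr, act_finCongr_self,
    Category.comp_id]

/-- Substitution is compatible with replacing the indices by equal ones. -/
theorem substMap_cast (X : QO A) {m n : ℕ} (h : m = n) {p : Fin m → ℕ} {q : Fin n → ℕ}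
    (e : ∀ i, p i = q (Fin.cast h i)) :
    (X.act (finCongr h.symm) ⊗ₘ
        tensorFamCast h (X := fun i => ((θ A).obj g).term (p i))
          (Y := fun i => ((θ A).obj g).term (q i))
          (fun i => congrArg ((θ A).obj g).term (e i))) ≫ substMap g X n q
      = substMap g X m p ≫
        act _ (finCongr (by subst h; exact Finset.sum_congr rfl fun i _ => (e i).symm)) := by
  subst h
  obtain rfl : p = q := funext e
  rw [act_finCongr_self, act_finCongr_self, Category.comp_id]
  exact (congrArg (· ≫ _) (MonoidalCategory.id_tensorHom_id _ _)).trans (Category.id_comp _)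

theorem pullbackTermMap_unitι : (λ_ (𝟙_ (QO A))).inv ≫ (LaxMonoidal.ε (const A) ⊗ₘ
      (tnil ((θ A).obj g)).hom) ≫ (const A).map unitι ▷ _ ≫ pullbackTermMap g (𝟙_ (QO A)) 0
      = LaxMonoidal.ε g.hom.invImage :=
  termK_eq g (𝟙_ (QO A)) ▸ g.termK_unitι

theorem unitι_leftUnitor_inv : (λ_ (𝟙_ A)).hom ≫ unitι ≫ comp (λ_ (𝟙_ (QO A))).inv 0
    = tmul unitι unitι ≫ act _ (NIso.zeroAdd 0).symm := by
  have h := tmul_leftUnitor (unitι (A := A))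
  have h' := congrArg (· ≫ comp (λ_ (𝟙_ (QO A))).inv _ ≫ act _ (NIso.zeroAdd 0).symm) h
  simp only [Category.assoc] at h'
  rw [comp_hom_inv_id_assoc] at h'
  rw [h']
  simp only [reassoc_of% @act_comp, act_act]
  rw [act_of_eq _ (Equiv.symm_trans_self _), Category.comp_id]

/-- Substitution into the unit sequence is the unit constraint of `g^*`. -/
theorem substMap_unit (q : Fin 0 → ℕ) :
    (unitι ⊗ₘ (famNil fun i => ((θ A).obj g).term (q i)).hom) ≫ substMap g (𝟙_ (QO A)) 0 q
      = (λ_ (𝟙_ A)).hom ≫ unitι ≫ comp (LaxMonoidal.ε g.hom.invImage) 0 ≫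
        act _ (finCongr (Fin.sum_univ_zero q)) := by
  rw [← pullbackTermMap_unitι, substMap, scale, Category.assoc, reassoc_of% @tensorHom_tmul,
    tensorFamη_zero, ← constElem_map, constElem_ε, ← Category.assoc unitι (comp (famNil _).hom 0), tmul_act_right]
  simp only [comp_comp, Category.assoc]
  rw [reassoc_of% unitι_leftUnitor_inv]
  simp only [reassoc_of% @act_comp, act_comp, act_act]
  rw [reassoc_of% @tmul_tensorHom, ← Category.assoc unitι, reassoc_of% tmul_whiskerRight]
  simp only [Category.assoc, sum_refl_finCongr, NIso.zeroAdd, finCongr_symm, finCongr_trans_finCongr]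

end QO
end

section

variable {D : Type u} [Category.{v} D] [MonoidalCategory D]

theorem comp_comp_tensorHom_comp {a b c d x y z : D} (f : a ⟶ b) (g : b ⟶ c) (h : c ⟶ d)
    (k : x ⟶ y) (l : y ⟶ z) :
    (f ≫ g ≫ h) ⊗ₘ (k ≫ l) = (f ⊗ₘ k) ≫ g ▷ y ≫ (h ⊗ₘ l) := by
  rw [← tensorHom_id, tensorHom_comp_tensorHom, tensorHom_comp_tensorHom, Category.id_comp]

theorem tensorFamFlatten_zero (p : Fin 0 → ℕ) (Z : Fin (∑ i, p i) → D) :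
    (famNil fun i => tensorFam (p i) fun j => Z (finSigmaFinEquiv ⟨i, j⟩)).hom ≫
        tensorFamFlatten 0 p Z
      = (famNil fun i => Z (Fin.cast (Fin.sum_univ_zero p).symm i)).hom ≫
        tensorFamCast (X := fun i => Z (Fin.cast (Fin.sum_univ_zero p).symm i))
          (Fin.sum_univ_zero p).symm fun _ => rfl :=
  rfl

variable [SymmetricCategory D]

theorem tensorμ_tensorμ (a b c d : D) : tensorμ a b c d ≫ tensorμ a c b d = 𝟙 _ := by
  rw [QO.tensorμ_eq, QO.tensorμ_eq]
  simp only [Category.assoc, Iso.inv_hom_id_assoc]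
  rw [← MonoidalCategory.whiskerLeft_comp_assoc, swapFirst_swapFirst,
    MonoidalCategory.whiskerLeft_id, Category.id_comp, Iso.hom_inv_id]

theorem tensorFamMap_tensorFamTensor {n : ℕ} {X X' Y Y' : Fin n → D} (f : ∀ i, X i ⟶ X' i)
    (g : ∀ i, Y i ⟶ Y' i) : (tensorFamMap n f ⊗ₘ tensorFamMap n g) ≫ tensorFamTensor n X' Y'
      = tensorFamTensor n X Y ≫ tensorFamMap n fun i => f i ⊗ₘ g i := by
  induction n with
  | zero =>
    rw [← cancel_epi ((famNil X).hom ⊗ₘ (famNil Y).hom), tensorHom_comp_tensorHom_assoc,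
      reassoc_of% tensorFamTensor_zero, tensorFamMap_zero, tensorFamMap_zero, tensorFamMap_zero,
      tensorFamTensor_zero]
  | succ n ih =>
    rw [← cancel_epi ((famCons X).hom ⊗ₘ (famCons Y).hom), tensorHom_comp_tensorHom_assoc,
      reassoc_of% tensorFamTensor_succ, tensorFamMap_succ, tensorFamMap_succ, tensorFamMap_succ,
      ← tensorHom_comp_tensorHom_assoc, tensorFamTensor_succ, tensorμ_natural_assoc,
      ← id_tensorHom, ← id_tensorHom, tensorHom_comp_tensorHom_assoc,
      tensorHom_comp_tensorHom_assoc, ih, Category.id_comp, Category.comp_id]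

end

section

variable {A : Type u} [Category.{v} A] [MonoidalCategory A] [SymmetricCategory A] [Prevectoid A]

namespace QO

open CategoryTheory.Functor hiding const comp

variable (g : End A)

/-- Substitution into the Day convolution power of `Y` is the Day convolution of the substitutions
into the factors. The induction step is `substMap_tensor`, and `substMap_unit` starts the induction.
-/
theorem tensorFamMap_substMap (Y : QO A) (s : ℕ) (p : Fin s → ℕ) (q : Fin (∑ i, p i) → ℕ) :
    tensorFamTensor s (fun i => Y.term (p i))
        (fun i => tensorFam (p i) fun j => ((θ A).obj g).term (q (finSigmaFinEquiv ⟨i, j⟩))) ≫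
      tensorFamMap s (fun i => substMap g Y (p i) fun j => q (finSigmaFinEquiv ⟨i, j⟩)) ≫
      tensorFamη s (fun i => ∑ j, q (finSigmaFinEquiv ⟨i, j⟩)) (fun _ => g.hom.invImage.obj Y) ≫
      comp (tpowμ g.hom.invImage Y s) _
    = (tensorFamη s p (fun _ => Y) ⊗ₘ
        tensorFamFlatten s p fun k => ((θ A).obj g).term (q k)) ≫
      substMap g (tpow Y s) (∑ i, p i) q ≫ act _ (finCongr (sum_finSigmaFinEquiv q)) := by
  induction s with
  | zero =>
    rw [← cancel_epi ((famNil fun i => Y.term (p i)).hom ⊗ₘ (famNil _).hom),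
      reassoc_of% tensorFamTensor_zero, reassoc_of% @tensorFamMap_zero,
      reassoc_of% @tensorFamη_zero, act_comp, ← Category.assoc (comp _ _), ← comp_comp, tpowμ_zero,
      comp_comp, Category.assoc, tensorHom_comp_tensorHom_assoc, tensorFamη_zero,
      tensorFamFlatten_zero p fun k => ((θ A).obj g).term (q k)]
    have h := substMap_cast g (tpow Y 0) (Fin.sum_univ_zero p).symm
      (p := fun i => q (Fin.cast (Fin.sum_univ_zero p).symm i)) (q := q) fun _ => rfl
    have h' := substMap_natural g (tnil Y).hom 0
      fun i => q (Fin.cast (Fin.sum_univ_zero p).symm i)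
    rw [comp_comp_tensorHom_comp, Category.assoc, Category.assoc, reassoc_of% h,
      ← reassoc_of% h', reassoc_of% substMap_unit]
    simp only [reassoc_of% @act_comp, act_act, finCongr_trans_finCongr]
  | succ s ih =>
    -- the family `q` on the sum of the block sizes, split after the first block
    let q' : Fin (p 0 + ∑ i : Fin s, p i.succ) → ℕ := fun k =>
      q (Fin.cast (Fin.sum_univ_succ p).symm k)
    have e₀ : ∀ j, q (finSigmaFinEquiv ⟨0, j⟩) = q' (Fin.castAdd _ j) :=
      fun j => congrArg q (finSigmaFinEquiv_cons_zero p j)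
    have e₁ : ∀ (i : Fin s) (j : Fin (p i.succ)), q (finSigmaFinEquiv ⟨i.succ, j⟩)
        = q' (Fin.natAdd (p 0) (finSigmaFinEquiv (n := fun i : Fin s => p i.succ) ⟨i, j⟩)) :=
      fun i j => congrArg q (finSigmaFinEquiv_cons_succ p i j)
    have h₁ : (fun i : Fin s => substMap g Y (p i.succ) fun j => q (finSigmaFinEquiv ⟨i.succ, j⟩))
        = fun i => (𝟙 _ ⊗ₘ tensorFamMap (p i.succ) fun j =>
            eqToHom (congrArg ((θ A).obj g).term (e₁ i j))) ≫
          substMap g Y (p i.succ) (fun j => q' (Fin.natAdd (p 0) (finSigmaFinEquiv ⟨i, j⟩))) ≫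
            act _ (finCongr (Finset.sum_congr rfl fun j _ => e₁ i j)) :=
      funext fun i => substMap_recast g Y (e₁ i)
    have h₂ : tensorFamTensor s (fun i : Fin s => Y.term (p i.succ)) (fun i => tensorFam (p i.succ)
          fun j => ((θ A).obj g).term (q (finSigmaFinEquiv ⟨i.succ, j⟩))) ≫
        tensorFamMap s (fun i => substMap g Y (p i.succ) fun j => q (finSigmaFinEquiv ⟨i.succ, j⟩)) ≫
        tensorFamη s (fun i => ∑ j, q (finSigmaFinEquiv ⟨i.succ, j⟩))
          (fun _ => g.hom.invImage.obj Y) ≫ comp (tpowμ g.hom.invImage Y s) _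
        = (tensorFamη s (fun i => p i.succ) (fun _ => Y) ⊗ₘ
            (tensorFamMap s fun i => tensorFamMap (p i.succ) fun j =>
              eqToHom (congrArg ((θ A).obj g).term (e₁ i j))) ≫
            tensorFamFlatten s (fun i => p i.succ) fun k =>
              ((θ A).obj g).term (q' (Fin.natAdd (p 0) k))) ≫
          substMap g (tpow Y s) (∑ i : Fin s, p i.succ) (fun k => q' (Fin.natAdd (p 0) k)) ≫
            act _ (finCongr (by
              rw [← sum_finSigmaFinEquiv]; exact Finset.sum_congr rfl fun i _ =>
                Finset.sum_congr rfl fun j _ => e₁ i j)) := by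
      have ih' := ih (fun i => p i.succ) (fun k => q' (Fin.natAdd (p 0) k))
      rw [h₁, tensorFamMap_comp, tensorFamMap_comp]
      simp only [Category.assoc]
      rw [← reassoc_of% @tensorFamMap_tensorFamTensor, reassoc_of% @tensorFamη_act, act_comp,
        blockSum_finCongr, reassoc_of% ih', tensorFamMap_id, act_act,
        tensorHom_comp_tensorHom_assoc, Category.id_comp, finCongr_trans_finCongr]
    rw [← cancel_epi ((famCons fun i => Y.term (p i)).hom ⊗ₘ (famCons _).hom),
      reassoc_of% tensorFamTensor_succ, reassoc_of% @tensorFamMap_succ,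
      reassoc_of% @tensorFamη_succ, act_comp, ← Category.assoc (comp _ _), ← comp_comp, tpowμ_succ]
    have h := substMap_cast g (tpow Y (s + 1)) (Fin.sum_univ_succ p).symm (p := q') (q := q)
      fun _ => rfl
    have h' := substMap_natural g (tcons' Y s).hom (p 0 + ∑ i : Fin s, p i.succ) q'
    simp only [comp_comp, Category.assoc]
    rw [reassoc_of% tmul_whiskerLeft, reassoc_of% @tensorHom_tmul, reassoc_of% @whiskerLeft_tmul,
      h₂, substMap_recast g Y e₀, Category.comp_id, ← tensorHom_tmul, tmul_act_act]
    simp only [Category.assoc]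
    rw [reassoc_of% act_comp, reassoc_of% substMap_tensor, tensorμ_natural_assoc,
      reassoc_of% tensorμ_tensorμ]
    simp only [reassoc_of% @act_comp, act_act]
    rw [reassoc_of% h', tensorHom_comp_tensorHom_assoc (famCons fun i => Y.term (p i)).hom,
      tensorFamη_succ,
      tensorFamFlatten_succ p fun k => ((θ A).obj g).term (q k), ← Category.assoc (_ ⊗ₘ _) _ (tensorFamCast _ _), comp_comp_tensorHom_comp]
    simp only [Category.assoc, blockCons]
    rw [reassoc_of% h, tmul, ← tensorHom_comp_tensorHom_assoc]
    simp only [Category.assoc, act_act, sum_finCongr, finCongr_trans_finCongr]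
    rfl

end QO
end

/-! ### Associativity of substitution -/

theorem tensorFamMap_eqToHom_cast_cast {D : Type u} [Category.{v} D] [MonoidalCategory D] {m n : ℕ}
    (h : m = n) {X Y : Fin m → D} {Z : Fin n → D} (e₁ : ∀ i, X i = Y i)
    (e : ∀ i, Y i = Z (Fin.cast h i)) (e' : ∀ i, Z i = X (Fin.cast h.symm i)) :
    tensorFamMap m (fun i => eqToHom (e₁ i)) ≫ tensorFamCast h e ≫ tensorFamCast h.symm e' = 𝟙 _ := by
  obtain rfl : X = Y := funext e₁
  exact (congrArg (· ≫ _) (tensorFamMap_id m X)).trans ((Category.id_comp _).trans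
    ((eqToHom_trans _ _).trans (eqToHom_refl _ _)))

section

variable {C : Type*} {D : Type*} {E : Type*} [Category* C] [MonoidalCategory C] [Category* D]
  [MonoidalCategory D] [Category* E] [MonoidalCategory E] (F : C ⥤ D) (G : D ⥤ E)
  [F.LaxMonoidal] [G.LaxMonoidal]

open CategoryTheory.Functor in
theorem tensorHom_comp_μ_map {a b a' b' e : D} {x y : E} (f : x ⟶ G.obj a) (f' : a ⟶ a')
    (k : y ⟶ G.obj b) (k' : b ⟶ b') (t : a' ⊗ b' ⟶ e) :
    ((f ≫ G.map f') ⊗ₘ (k ≫ G.map k')) ≫ LaxMonoidal.μ G a' b' ≫ G.map t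
      = x ◁ k ≫ (f ▷ _ ≫ LaxMonoidal.μ G a b) ≫ G.map ((f' ⊗ₘ k') ≫ t) := by
  rw [← tensorHom_comp_tensorHom, Category.assoc, LaxMonoidal.μ_natural_assoc, tensorHom_def',
    Category.assoc, Category.assoc, G.map_comp]

theorem tpowμ_comp (b : C) : ∀ n, tpowμ (F ⋙ G) b n = tpowμ G (F.obj b) n ≫ G.map (tpowμ F b n)
  | 0 => rfl
  | n + 1 => by
    have ih := tpowμ_comp b n
    have h : G.obj (F.obj b) ◁ (tpowμ G (F.obj b) n ≫ G.map (tpowμ F b n)) ≫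
          Functor.LaxMonoidal.μ G _ _ ≫ G.map (Functor.LaxMonoidal.μ F b (tpow b n))
        = (G.obj (F.obj b) ◁ tpowμ G (F.obj b) n ≫ Functor.LaxMonoidal.μ G _ _) ≫
          G.map (F.obj b ◁ tpowμ F b n ≫ Functor.LaxMonoidal.μ F b (tpow b n)) := by
      rw [MonoidalCategory.whiskerLeft_comp, Category.assoc, Category.assoc,
        Functor.LaxMonoidal.μ_natural_right_assoc, G.map_comp]
    exact (congrArg (fun t => G.obj (F.obj b) ◁ t ≫ _) ih).trans h

end

theorem tensorμ_leftUnitor_inv {D : Type u} [Category.{v} D] [MonoidalCategory D]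
    [SymmetricCategory D] (a b c : D) :
    (a ⊗ b) ◁ (λ_ c).inv ≫ tensorμ a b (𝟙_ D) c ≫ (ρ_ a).hom ▷ (b ⊗ c) = (α_ a b c).hom := by
  rw [QO.tensorμ_eq, swapFirst, braiding_tensorUnit_right]
  monoidal

section

variable {A : Type u} [Category.{v} A] [MonoidalCategory A] [SymmetricCategory A] [Prevectoid A]

namespace QO

open CategoryTheory.Functor hiding const comp

variable (g h : End A)

/-- The comparison of `(a, ∅, ∅, …)` with its inverse image under an endomorphism over `A`. -/
def baseMap (a : A) : (const A).obj a ⟶ g.hom.invImage.obj ((const A).obj a) :=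
  g.iso.inv.app a

theorem pullbackTermMap_constElem (a : A) : (ρ_ ((const A).obj a)).inv ≫
    (const A).obj a ◁ (tnil ((θ A).obj g)).hom ≫
      (const A).map (constElem a) ▷ _ ≫ pullbackTermMap g ((const A).obj a) 0
    = baseMap g a :=
  termK_eq g ((const A).obj a) ▸ g.termK_constElem a

theorem constElem_rightUnitor_inv (a : A) :
    (ρ_ a).hom ≫ constElem a ≫ comp (ρ_ ((const A).obj a)).inv 0
      = tmul (constElem a) unitι ≫ act _ (NIso.addZero 0).symm := by
  have h := tmul_rightUnitor (constElem a)
  have h' := congrArg (· ≫ comp (ρ_ ((const A).obj a)).inv _ ≫ act _ (NIso.addZero 0).symm) h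
  simp only [Category.assoc] at h'
  rw [comp_hom_inv_id_assoc] at h'
  rw [h']
  simp only [reassoc_of% @act_comp, act_act]
  rw [act_of_eq _ (Equiv.symm_trans_self _), Category.comp_id]

/-- Substitution into a constant sequence is the structure isomorphism of `g` over `A`. -/
theorem substMap_constElem (a : A) (q : Fin 0 → ℕ) :
    (constElem a ⊗ₘ (famNil fun i => ((θ A).obj g).term (q i)).hom) ≫
        substMap g ((const A).obj a) 0 q
      = (ρ_ a).hom ≫ constElem a ≫ comp (baseMap g a) 0 ≫
        act _ (finCongr (Fin.sum_univ_zero q)) := by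
  rw [← pullbackTermMap_constElem, substMap, scale, Category.assoc, reassoc_of% @tensorHom_tmul,
    tensorFamη_zero, ← constElem_map, ← Category.assoc unitι (comp (famNil _).hom 0),
    tmul_act_right]
  simp only [comp_comp, Category.assoc]
  rw [reassoc_of% constElem_rightUnitor_inv]
  simp only [reassoc_of% @act_comp, act_comp, act_act]
  rw [reassoc_of% tmul_whiskerLeft, reassoc_of% tmul_whiskerRight]
  simp only [sum_refl_finCongr, NIso.zeroAdd, NIso.addZero, finCongr_symm,
    finCongr_trans_finCongr]

/-- Substitution into a tensor product with a constant sequence. -/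
theorem scale_substMap {a c d : A} {V : QO A} {n : ℕ} (y : c ⟶ V.term n) (q : Fin n → ℕ)
    (z : d ⟶ tensorFam n fun i => ((θ A).obj h).term (q i)) :
    (scale a y ⊗ₘ z) ≫ substMap h ((const A).obj a ⊗ V) n q
      = (α_ a c d).hom ≫ scale a ((y ⊗ₘ z) ≫ substMap h V n q) ≫
        comp (baseMap h a ▷ _ ≫ LaxMonoidal.μ h.hom.invImage ((const A).obj a) V) _ := by
  -- write `n` as `0 + n` and apply `substMap_tensor` to the product of an element of degree `0`
  -- and an element of degree `n`
  let q' : Fin (0 + n) → ℕ := fun i => q (Fin.cast (Nat.zero_add n) i)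
  have e := substMap_tensor h ((const A).obj a) V 0 n q'
  have e' := congrArg (· ≫ act _ (finCongr (Fin.sum_univ_add q'))) e
  simp only [Category.assoc, act_act, finCongr_trans_finCongr, act_finCongr_self,
    Category.comp_id] at e'
  have hq : ∀ i, q i = q' (Fin.natAdd 0 i) := fun i => congrArg q (Fin.ext (by simp))
  let E := tensorFamMap n fun i => eqToHom (congrArg ((θ A).obj h).term (hq i))
  have e₁ := tensorFamMap_eqToHom_cast_cast (Nat.zero_add n).symm
    (X := fun i => ((θ A).obj h).term (q i))
    (fun i => congrArg ((θ A).obj h).term (hq i))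
    (Z := fun i => ((θ A).obj h).term (q' i))
    (fun i => congrArg (fun i => ((θ A).obj h).term (q' i)) (Fin.natAdd_zero_eq_cast i))
    fun i => rfl
  have e₂ := tensorFamAppend_zero n fun i => ((θ A).obj h).term (q' i)
  have e₃ := substMap_cast h ((const A).obj a ⊗ V) (Nat.zero_add n) (p := q') (q := q) fun _ => rfl
  rw [← Iso.inv_comp_eq] at e₂
  have e₄ : z = ((λ_ d).inv ≫ ((famNil fun i => ((θ A).obj h).term (q' (Fin.castAdd n i))).hom ⊗ₘ
          (z ≫ E)) ≫ tensorFamAppend 0 n fun i => ((θ A).obj h).term (q' i)) ≫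
        tensorFamCast (X := fun i => ((θ A).obj h).term (q' i))
          (Y := fun i => ((θ A).obj h).term (q i)) (Nat.zero_add n) (fun _ => rfl) := by
    rw [tensorHom_def']
    simp only [Category.assoc]
    rw [← leftUnitor_inv_naturality_assoc, reassoc_of% e₂, Category.assoc]
    exact ((congrArg (z ≫ ·) e₁).trans (Category.comp_id z)).symm
  refine (congrArg (fun t => (scale a y ⊗ₘ t) ≫ _) e₄).trans ?_
  have e₅ := congrArg (tensorμ _ _ _ _ ≫ ·) e'
  rw [reassoc_of% tensorμ_tensorμ] at e₅
  rw [scale, ← tensorHom_comp_tensorHom, Category.assoc,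
    show (NIso.zeroAdd n).symm = finCongr (Nat.zero_add n).symm from rfl, e₃, tmul,
    ← Category.assoc (λ_ d).inv, ← tensorHom_comp_tensorHom_assoc, ← reassoc_of% e₅,
    ← Category.id_comp (constElem a ⊗ₘ y), ← tensorHom_comp_tensorHom, Category.assoc,
    tensorμ_natural_assoc, reassoc_of% @tensorHom_tmul, substMap_constElem,
    ← tensorμ_leftUnitor_inv, substMap_recast h V hq, tensorHom_comp_tensorHom_assoc,
    Category.comp_id, ← Category.assoc (y ⊗ₘ _) (substMap _ _ _ _), scale_act]
  simp only [Category.assoc, comp_comp]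
  rw [id_tensorHom, ← whiskerRight_tmul, ← Category.assoc (constElem a), tmul_act_left, scale]
  simp only [Category.assoc, reassoc_of% @act_comp, act_comp, act_act, sum_finCongr_refl]
  rw [reassoc_of% tmul_whiskerRight]
  rfl

/-- The realization map of a composite is obtained from the realization map of `g` by applying
`h^*`. -/
theorem pullbackTermMap_comp (X : QO A) (s : ℕ) :
    pullbackTermMap (g ⊗ h) X s
      = (const A).obj (X.term s) ◁ tpowμ h.hom.invImage ((θ A).obj g) s ≫
        (baseMap h (X.term s) ▷ _ ≫ LaxMonoidal.μ h.hom.invImage _ _) ≫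
          h.hom.invImage.map (pullbackTermMap g X s) := by
  have e : (g ⊗ h).iso.inv.app (X.term s)
      = baseMap h (X.term s) ≫ h.hom.invImage.map (g.iso.inv.app (X.term s)) :=
    Category.comp_id (baseMap h (X.term s) ≫ h.hom.invImage.map (g.iso.inv.app (X.term s)))
  have e' := tpowμ_comp g.hom.invImage h.hom.invImage (univ A) s
  have key := tensorHom_comp_μ_map h.hom.invImage (baseMap h (X.term s))
    (g.iso.inv.app (X.term s)) (tpowμ h.hom.invImage ((θ A).obj g) s)
    (tpowμ g.hom.invImage (univ A) s)
    (LaxMonoidal.μ g.hom.invImage _ _ ≫ g.hom.invImage.map (termMap X s))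
  -- the objects `(g ⊗ h)^* X` and `h^* (g^* X)` agree only up to unfolding, so the rewriting is
  -- done for variables
  have aux : ∀ u v, u = baseMap h (X.term s) ≫ h.hom.invImage.map (g.iso.inv.app (X.term s)) →
      v = tpowμ h.hom.invImage ((θ A).obj g) s ≫
        h.hom.invImage.map (tpowμ g.hom.invImage (univ A) s) →
      (u ⊗ₘ v) ≫ (LaxMonoidal.μ h.hom.invImage _ _ ≫
          h.hom.invImage.map (LaxMonoidal.μ g.hom.invImage _ _)) ≫
        h.hom.invImage.map (g.hom.invImage.map (termMap X s))
      = (const A).obj (X.term s) ◁ tpowμ h.hom.invImage ((θ A).obj g) s ≫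
        (baseMap h (X.term s) ▷ _ ≫ LaxMonoidal.μ h.hom.invImage _ _) ≫
          h.hom.invImage.map (pullbackTermMap g X s) := by
    rintro _ _ rfl rfl
    rw [Category.assoc, ← h.hom.invImage.map_comp]
    exact key
  exact aux _ _ e e'

/-- Associativity of substitution: substituting `θ g` into `X` and then `θ h` into the result is the
same as substituting into `X` the result of substituting `θ h` into `θ g`. -/
theorem substMap_substMap (X : QO A) (s : ℕ) (p : Fin s → ℕ) (q : Fin (∑ i, p i) → ℕ) :
    (substMap g X s p ⊗ₘ tensorFamFlatten s p fun k => ((θ A).obj h).term (q k)) ≫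
        substMap h (g.hom.invImage.obj X) (∑ i, p i) q
      = (α_ _ _ _).hom ≫ X.term s ◁ (tensorFamTensor s _ _ ≫
          tensorFamMap s fun i => substMap h ((θ A).obj g) (p i) fun j =>
            q (finSigmaFinEquiv ⟨i, j⟩)) ≫
        substMap (g ⊗ h) X s (fun i => ∑ j, q (finSigmaFinEquiv ⟨i, j⟩)) ≫
          act _ (finCongr (sum_finSigmaFinEquiv q).symm) := by
  have e := tensorFamMap_substMap h ((θ A).obj g) s p q
  have e' := congrArg (· ≫ act _ (finCongr (sum_finSigmaFinEquiv q).symm)) e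
  simp only [Category.assoc, act_act, finCongr_trans_finCongr, act_finCongr_self,
    Category.comp_id] at e'
  have e₁ := substMap_natural h (pullbackTermMap g X s) (∑ i, p i) q
  rw [substMap, ← Category.comp_id (tensorFamFlatten _ _ _), ← tensorHom_comp_tensorHom,
    tensorHom_id, Category.assoc, ← e₁, reassoc_of% scale_substMap, ← e']
  rw [← Category.assoc (tensorFamη _ _ _), ← Category.assoc (tensorFamMap _ _),
    ← Category.assoc (tensorFamTensor _ _ _), scale_act, ← Category.assoc (tensorFamTensor _ _ _),
    ← whiskerLeft_scale, ← scale_whiskerLeft]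
  simp only [Category.assoc]
  rw [reassoc_of% act_comp, act_comp]
  refine congrArg (fun t => _ ≫ _ ≫ t) ?_
  rw [← Category.assoc (comp _ _), ← Category.assoc (_ ≫ _), ← comp_comp, ← comp_comp,
    Category.assoc, ← pullbackTermMap_comp]
  exact (Category.assoc _ _ _).symm

end QO
end

/-! ### Naturality and unit laws of substitution -/

section

variable {A : Type u} [Category.{v} A] [MonoidalCategory A] [SymmetricCategory A] [Prevectoid A]

namespace QO

open CategoryTheory.Functor hiding const comp

/-- Substitution is natural in the endomorphism. -/
theorem substMap_app {g g' : End A} (τ : g ⟶ g') (X : QO A) (s : ℕ) (p : Fin s → ℕ) :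
    substMap g X s p ≫ comp (τ.app.app X) _
      = X.term s ◁ tensorFamMap s (fun i => comp ((θ A).map τ) (p i)) ≫ substMap g' X s p := by
  have h := tensorFamη_map p fun _ => (θ A).map τ
  rw [substMap, Category.assoc, ← comp_comp, pullbackTermMap_app, comp_comp,
    reassoc_of% @scale_whiskerLeft, h, ← whiskerLeft_scale, Category.assoc, substMap]

theorem tmul_unitι_id {V : QO A} (n : ℕ) : (λ_ (V.term n)).inv ≫ tmul unitι (𝟙 (V.term n))
    = comp (λ_ V).inv n ≫ act _ (NIso.zeroAdd n) := by
  have h := tmul_leftUnitor (𝟙 (V.term n))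
  have h' := congrArg (fun t => (λ_ (V.term n)).inv ≫ t ≫ comp (λ_ V).inv _) h
  simp only [Category.assoc, comp_hom_inv_id, Iso.inv_hom_id_assoc, Category.comp_id,
    Category.id_comp, act_comp] at h'
  exact h'

theorem tmul_id_unitι {V : QO A} (n : ℕ) : (ρ_ (V.term n)).inv ≫ tmul (𝟙 (V.term n)) unitι
    = comp (ρ_ V).inv n ≫ act _ (NIso.addZero n) := by
  have h := tmul_rightUnitor (𝟙 (V.term n))
  have h' := congrArg (fun t => (ρ_ (V.term n)).inv ≫ t ≫ comp (ρ_ V).inv _) h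
  simp only [Category.assoc, comp_hom_inv_id, Iso.inv_hom_id_assoc, Category.comp_id,
    Category.id_comp, act_comp] at h'
  exact h'

theorem tensorFamη_one (Y : QO A) (n : ℕ) :
    (ρ_ (Y.term n)).inv ≫ Y.term n ◁ (famNil _).hom ≫ (famCons fun _ => Y.term n).hom ≫
        tensorFamη 1 (fun _ => n) (fun _ => Y)
      = comp ((ρ_ Y).inv ≫ Y ◁ (tnil Y).hom ≫ (tcons' Y 0).hom) n ≫
        act _ (finCongr (Fin.sum_univ_one fun _ => n)) := by
  rw [tensorFamη_succ, reassoc_of% @whiskerLeft_tmul, tensorFamη_zero,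
    ← Category.assoc unitι (comp _ _), tmul_act_right, ← tmul_whiskerLeft]
  simp only [Category.assoc]
  rw [reassoc_of% tmul_id_unitι]
  simp only [comp_comp, Category.assoc, reassoc_of% @act_comp, act_act,
    NIso.addZero, sum_refl_finCongr, blockCons, finCongr_trans_finCongr]

/-- Substitution into the universal object. -/
theorem substMap_univι (g : End A) (n : ℕ) :
    (λ_ (((θ A).obj g).term n)).inv ≫ (univι ⊗ₘ ((ρ_ (((θ A).obj g).term n)).inv ≫
          _ ◁ (famNil _).hom ≫ (famCons fun _ => ((θ A).obj g).term n).hom)) ≫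
        substMap g (univ A) 1 (fun _ => n)
      = ((θ A).obj g).act (finCongr (Fin.sum_univ_one fun _ => n)) := by
  have h : (λ_ ((θ A).obj g)).inv ≫ (LaxMonoidal.ε (const A) ⊗ₘ
      ((ρ_ _).inv ≫ _ ◁ (tnil ((θ A).obj g)).hom ≫ (tcons' _ 0).hom)) ≫
      (const A).map univι ▷ _ ≫ pullbackTermMap g (univ A) 1 = 𝟙 _ :=
    termK_eq g (univ A) ▸ g.termK_univι
  rw [substMap, scale, Category.assoc, reassoc_of% @tensorHom_tmul]
  simp only [Category.assoc]
  have h₁ := tmul_tensorHom unitι (𝟙 (((θ A).obj g).term n)) (LaxMonoidal.ε (const A))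
    ((ρ_ ((θ A).obj g)).inv ≫ _ ◁ (tnil ((θ A).obj g)).hom ≫ (tcons' _ 0).hom)
  rw [Category.id_comp] at h₁
  rw [tensorFamη_one, ← constElem_map, constElem_ε, tmul_act_right, ← tmul_whiskerRight, ← h₁]
  simp only [Category.assoc]
  rw [reassoc_of% tmul_unitι_id]
  simp only [reassoc_of% @act_comp, act_comp, act_act, sum_refl_finCongr]
  have h₂ := congrArg (fun t => comp t n) h
  simp only [comp_comp, comp_id] at h₂ ⊢
  rw [reassoc_of% h₂]
  exact Category.id_comp (((θ A).obj g).act _)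

theorem tpowμ_id {C : Type*} [Category* C] [MonoidalCategory C] (b : C) :
    ∀ n, tpowμ (𝟭 C) b n = 𝟙 _
  | 0 => rfl
  | n + 1 => by
    refine (congrArg (fun t => b ◁ t ≫ 𝟙 _) (tpowμ_id b n)).trans ?_
    exact (Category.comp_id _).trans (MonoidalCategory.whiskerLeft_id _ _)

/-- The realization maps of the identity are the morphisms `(X_s, ∅, ∅, …) ⊗ X_o ⊗ ⋯ ⊗ X_o ⟶ X`. -/
theorem pullbackTermMap_id (X : QO A) (s : ℕ) : pullbackTermMap (𝟙_ (End A)) X s = termMap X s := by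
  have h : (𝟙 ((const A).obj (X.term s)) ⊗ₘ tpowμ (𝟭 (QO A)) (univ A) s) ≫ 𝟙 _ ≫ termMap X s
      = termMap X s := by
    rw [tpowμ_id, id_tensorHom_id, Category.id_comp, Category.id_comp]
  exact h

theorem tensorFamUnit_succ {D : Type*} [Category* D] [MonoidalCategory D] (n : ℕ) :
    tensorFamUnit (n + 1)
      = (λ_ (𝟙_ D)).inv ≫ 𝟙_ D ◁ tensorFamUnit n ≫ (famCons fun _ => 𝟙_ D).hom :=
  congrArg (_ ≫ ·) (Category.comp_id _).symm

/-- The universal element of `X_o ⊗ ⋯ ⊗ X_o` in terms of the structure maps of the Day convolution.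
-/
theorem tensorFamUnit_univι (n : ℕ) :
    tensorFamUnit n ≫ tensorFamMap n (fun _ => univι) ≫ tensorFamη n (fun _ => 1) (fun _ => univ A)
      = upowι n ≫ act _ (finCongr (by simp : ∑ _ : Fin n, 1 = n)) := by
  induction n with
  | zero =>
    have h : tensorFamUnit 0 = (famNil fun _ => 𝟙_ A).hom := rfl
    rw [h, reassoc_of% @tensorFamMap_zero, tensorFamη_zero, upowι_zero, Category.assoc]
  | succ n ih =>
    rw [tensorFamUnit_succ, Category.assoc, Category.assoc, reassoc_of% @tensorFamMap_succ,
      tensorFamη_succ, reassoc_of% @tensorHom_tmul, reassoc_of% @whiskerLeft_tmul, ih,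
      Category.comp_id, tmul_act_right, upowι_succ]
    simp only [Category.assoc, reassoc_of% @act_comp, act_act, sum_refl_finCongr,
      blockCons, finCongr_trans_finCongr]

/-- Substitution of the universal object. -/
theorem substMap_id (X : QO A) (n : ℕ) :
    (ρ_ (X.term n)).inv ≫ X.term n ◁ (tensorFamUnit n ≫ tensorFamMap n fun _ => univι) ≫
        substMap (𝟙_ (End A)) X n (fun _ => 1)
      = X.act (finCongr (by simp : ∑ _ : Fin n, 1 = n)) := by
  have h : substMap (𝟙_ (End A)) X n (fun _ => 1)
      = scale (X.term n) (tensorFamη n (fun _ => 1) fun _ => univ A) ≫ comp (termMap X n) _ := by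
    rw [← pullbackTermMap_id]
    rfl
  refine (congrArg (fun t => _ ≫ _ ≫ t) h).trans ?_
  have h' : (ρ_ (X.term n)).inv ≫ X.term n ◁ (tensorFamUnit n ≫ tensorFamMap n fun _ => univι) ≫
      scale (X.term n) (tensorFamη n (fun _ => 1) fun _ => univ A) ≫ comp (termMap X n) _
      = X.act (finCongr (by simp : ∑ _ : Fin n, 1 = n)) := by
    rw [reassoc_of% @whiskerLeft_scale, Category.assoc, tensorFamUnit_univι, scale_act, scale]
    simp only [Category.assoc, act_comp, reassoc_of% @act_comp]
    rw [reassoc_of% @termMap_elem, Iso.inv_hom_id_assoc]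
    simp only [act_act]
    rfl
  exact h'

end QO
end

/-! ### The operad of a monoid of endomorphisms -/

section

variable {A : Type u} [Category.{v} A] [MonoidalCategory A] [SymmetricCategory A] [Prevectoid A]

namespace QO

section

variable {f f' g g' : End A}

theorem θ_map_comp {h : End A} (τ : f ⟶ g) (τ' : g ⟶ h) :
    (θ A).map (τ ≫ τ') = (θ A).map τ ≫ (θ A).map τ' := rfl

/-- The composition product with `g` on the right is the functor `g^*` under `θ`. -/
theorem θ_map_whiskerRight (τ : f ⟶ f') (g : End A) :
    (θ A).map (τ ▷ g) = g.hom.invImage.map ((θ A).map τ) :=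
  Category.id_comp (g.hom.invImage.map ((θ A).map τ))

/-- The composition product with `f` on the left is evaluation at `f^* X_o` under `θ`. -/
theorem θ_map_whiskerLeft (f : End A) (τ : g ⟶ g') :
    (θ A).map (f ◁ τ) = τ.app.app ((θ A).obj f) := by
  refine (congrArg (τ.app.app ((θ A).obj f) ≫ ·) (g'.hom.invImage.map_id _)).trans ?_
  exact Category.comp_id (τ.app.app ((θ A).obj f))

theorem θ_map_tensorHom (τ : f ⟶ f') (τ' : g ⟶ g') :
    (θ A).map (τ ⊗ₘ τ') = τ'.app.app ((θ A).obj f) ≫ g'.hom.invImage.map ((θ A).map τ) := rfl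

end

/-- The component `X ⟶ f^* X` of a morphism from the identity to `f`. -/
def unitApp {f : End A} (τ : 𝟙_ (End A) ⟶ f) (X : QO A) : X ⟶ f.hom.invImage.obj X :=
  τ.app.app X

/-- The morphism `X_o ⟶ f^* X_o` given by a morphism from the identity to `f`. -/
def unitHom {f : End A} (τ : 𝟙_ (End A) ⟶ f) : univ A ⟶ (θ A).obj f := (θ A).map τ

/-- Substituting the image of the universal element under a morphism from the identity to `f`
computes the component of that morphism. -/
theorem substMap_unitApp {f : End A} (τ : 𝟙_ (End A) ⟶ f) (X : QO A) (n : ℕ) :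
    (ρ_ (X.term n)).inv ≫
        X.term n ◁ (tensorFamUnit n ≫ tensorFamMap n fun _ => univι ≫ comp (unitHom τ) 1) ≫
          substMap f X n (fun _ => 1)
      = X.act (finCongr (by simp : ∑ _ : Fin n, 1 = n)) ≫ comp (unitApp τ X) _ := by
  -- the inverse image under the identity is `X` only up to unfolding; `S` is the substitution map
  -- of the identity, seen as a map to `X`
  obtain ⟨S, h, h'⟩ : ∃ S : X.term n ⊗ tensorFam n (fun _ => (univ A).term 1) ⟶
        X.term (∑ _ : Fin n, 1),
      S ≫ comp (unitApp τ X) _ = X.term n ◁ tensorFamMap n (fun _ => comp (unitHom τ) 1) ≫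
        substMap f X n (fun _ => 1) ∧
      (ρ_ (X.term n)).inv ≫ X.term n ◁ (tensorFamUnit n ≫ tensorFamMap n fun _ => univι) ≫ S
        = X.act (finCongr (by simp : ∑ _ : Fin n, 1 = n)) :=
    ⟨substMap (𝟙_ (End A)) X n fun _ => 1, substMap_app τ X n fun _ => 1, substMap_id X n⟩
  simp only [← h', tensorFamMap_comp, MonoidalCategory.whiskerLeft_comp, Category.assoc, h]

variable (f : End A) [MonObj f]

/-- The unit of a monoid of endomorphisms, as a morphism of symmetric sequences. -/
def oneHom : univ A ⟶ (θ A).obj f := unitHom (MonObj.one (X := f))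

/-- The multiplication of a monoid of endomorphisms, as a morphism of symmetric sequences. -/
def mulHom : f.hom.invImage.obj ((θ A).obj f) ⟶ (θ A).obj f := (θ A).map (MonObj.mul (X := f))

/-- The left unit law of a monoid of endomorphisms, under `θ`. -/
theorem map_oneHom_mulHom : f.hom.invImage.map (oneHom f) ≫ mulHom f = 𝟙 _ := by
  have h := congrArg (fun t => (θ A).map t) (MonObj.one_mul f)
  rw [θ_map_comp, θ_map_whiskerRight] at h
  exact h

/-- The right unit law of a monoid of endomorphisms, under `θ`. -/
theorem one_app_mulHom :
    (MonObj.one (X := f)).app.app ((θ A).obj f) ≫ mulHom f = 𝟙 ((θ A).obj f) := by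
  have h := congrArg (fun t => (θ A).map t) (MonObj.mul_one f)
  rw [θ_map_comp, θ_map_whiskerLeft] at h
  exact h

/-- The associativity law of a monoid of endomorphisms, under `θ`. -/
theorem map_mulHom_mulHom : f.hom.invImage.map (mulHom f) ≫ mulHom f
    = (MonObj.mul (X := f)).app.app ((θ A).obj f) ≫ mulHom f := by
  have h := congrArg (fun t => (θ A).map t) (MonObj.mul_assoc f)
  rw [θ_map_comp, θ_map_whiskerRight, θ_map_comp, θ_map_comp, θ_map_whiskerLeft] at h
  refine Eq.trans h ?_
  exact Category.id_comp _

/-- Compatibility of a morphism of monoids with the multiplications, under `θ`. -/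
theorem mulHom_hom {f g : End A} [MonObj f] [MonObj g] (φ : f ⟶ g) [IsMonHom φ] :
    mulHom f ≫ (θ A).map φ
      = φ.app.app ((θ A).obj f) ≫ g.hom.invImage.map ((θ A).map φ) ≫ mulHom g := by
  have h := congrArg (fun t => (θ A).map t) (IsMonHom.mul_hom φ)
  rw [θ_map_comp, θ_map_comp, θ_map_tensorHom] at h
  exact h.trans (Category.assoc (φ.app.app ((θ A).obj f)) (g.hom.invImage.map ((θ A).map φ))
    (mulHom g))

theorem oneHom_hom {f g : End A} [MonObj f] [MonObj g] (φ : f ⟶ g) [IsMonHom φ] :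
    oneHom f ≫ (θ A).map φ = oneHom g :=
  congrArg (fun t => (θ A).map t) (IsMonHom.one_hom φ)

theorem IsEquivariantFamily.postcomp {X Y Z Z' : QO A} {φ} (h : IsEquivariantFamily X Y Z φ)
    (t : Z ⟶ Z') : IsEquivariantFamily X Y Z' fun s p => φ s p ≫ comp t _ where
  inner s p τ := by rw [reassoc_of% h.inner, Category.assoc, act_comp]
  outer s p σ := by rw [reassoc_of% h.outer, Category.assoc, act_comp]

/-- The composition maps of the operad of a monoid of endomorphisms. -/
def operadMul (s : ℕ) (p : Fin s → ℕ) :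
    ((θ A).obj f).term s ⊗ tensorFam s (fun i => ((θ A).obj f).term (p i)) ⟶
      ((θ A).obj f).term (∑ i, p i) :=
  substMap f ((θ A).obj f) s p ≫ comp (mulHom f) _

theorem operadMul_eq (s : ℕ) (p : Fin s → ℕ) :
    operadMul f s p = plethysmMap f f s p ≫ comp ((θ A).map (MonObj.mul (X := f))) _ := by
  rw [plethysmMap_eq]
  rfl

theorem rightUnitor_inv_famCons (b : A) : (ρ_ b).inv ≫
      b ◁ (famNil fun _ => b).hom ≫ (famCons fun _ : Fin 1 => b).hom
    = (ρ_ b).inv :=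
  (congrArg (_ ≫ ·) ((congrArg (· ≫ _) (whiskerLeft_id _ _)).trans (Category.id_comp _))).trans
    (Category.comp_id _)

theorem operad_one_mul (n : ℕ) : (λ_ (((θ A).obj f).term n)).inv ≫
    ((univι ≫ comp (oneHom f) 1) ⊗ₘ (ρ_ (((θ A).obj f).term n)).inv) ≫ operadMul f 1 (fun _ => n)
    = ((θ A).obj f).act (finCongr (Fin.sum_univ_one fun _ => n)) := by
  have h := substMap_univι f n
  have h' : ((univι ≫ comp (oneHom f) 1) ⊗ₘ ((ρ_ (((θ A).obj f).term n)).inv ≫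
          _ ◁ (famNil _).hom ≫ (famCons fun _ => ((θ A).obj f).term n).hom)) ≫
        operadMul f 1 (fun _ => n)
      = (univι ⊗ₘ ((ρ_ (((θ A).obj f).term n)).inv ≫
          _ ◁ (famNil _).hom ≫ (famCons fun _ => ((θ A).obj f).term n).hom)) ≫
        substMap f (univ A) 1 (fun _ => n) := by
    rw [operadMul, ← Category.comp_id (_ ≫ _ ◁ _ ≫ _), ← tensorHom_comp_tensorHom, tensorHom_id,
      Category.assoc, ← reassoc_of% substMap_natural, ← comp_comp, map_oneHom_mulHom, comp_id,
      Category.comp_id]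
    exact congrArg (_ ≫ ·) (Category.comp_id _)
  refine Eq.trans ?_ ((congrArg (_ ≫ ·) h').trans h)
  exact congrArg (fun t => _ ≫ ((univι ≫ comp (oneHom f) 1) ⊗ₘ t) ≫ operadMul f 1 fun _ => n)
    (rightUnitor_inv_famCons _).symm

theorem operad_mul_one (n : ℕ) : (ρ_ (((θ A).obj f).term n)).inv ≫
    ((θ A).obj f).term n ◁ (tensorFamUnit n ≫ tensorFamMap n fun _ => univι ≫ comp (oneHom f) 1) ≫
      operadMul f n (fun _ => 1)
    = ((θ A).obj f).act (finCongr (by simp : ∑ _ : Fin n, 1 = n)) := by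
  have h : comp (unitApp (MonObj.one (X := f)) ((θ A).obj f)) (∑ _ : Fin n, 1) ≫
      comp (mulHom f) _ = 𝟙 _ := by
    rw [← comp_comp, ← comp_id]
    exact congrArg (comp · _) (one_app_mulHom f)
  have h' := substMap_unitApp (MonObj.one (X := f)) ((θ A).obj f) n
  refine (congrArg (_ ≫ ·) (Category.assoc _ _ _).symm).trans
    ((Category.assoc _ _ _).symm.trans ((congrArg (· ≫ comp (mulHom f) _) h').trans ?_))
  rw [Category.assoc, h, Category.comp_id]

variable (g h : End A) (X : QO A) in
/-- The canonical maps of `X` composed with `g ⊗ h`, whose `θ` is `h^* (θ g)`. -/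
def substMap₂ (s : ℕ) (p : Fin s → ℕ) :
    X.term s ⊗ tensorFam s (fun i => (h.hom.invImage.obj ((θ A).obj g)).term (p i)) ⟶
      (h.hom.invImage.obj (g.hom.invImage.obj X)).term (∑ i, p i) :=
  substMap (g ⊗ h) X s p

theorem substMap_substMap₂ (g h : End A) (X : QO A) (s : ℕ) (p : Fin s → ℕ)
    (q : Fin (∑ i, p i) → ℕ) :
    (substMap g X s p ⊗ₘ tensorFamFlatten s p fun k => ((θ A).obj h).term (q k)) ≫
        substMap h (g.hom.invImage.obj X) (∑ i, p i) q
      = (α_ _ _ _).hom ≫ X.term s ◁ (tensorFamTensor s _ _ ≫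
            tensorFamMap s fun i => substMap h ((θ A).obj g) (p i) fun j =>
              q (finSigmaFinEquiv ⟨i, j⟩)) ≫
          substMap₂ g h X s (fun i => ∑ j, q (finSigmaFinEquiv ⟨i, j⟩)) ≫
            (h.hom.invImage.obj (g.hom.invImage.obj X)).act
              (finCongr (sum_finSigmaFinEquiv q).symm) :=
  substMap_substMap g h X s p q

/-- Naturality of substitution with respect to the multiplication of a monoid of endomorphisms. -/
theorem substMap₂_mul (s : ℕ) (p : Fin s → ℕ) :
    substMap₂ f f ((θ A).obj f) s p ≫ comp ((MonObj.mul (X := f)).app.app ((θ A).obj f)) _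
      = _ ◁ tensorFamMap s (fun i => comp (mulHom f) (p i)) ≫ substMap f ((θ A).obj f) s p :=
  substMap_app (MonObj.mul (X := f)) ((θ A).obj f) s p

/-- Associativity of the composition maps, from the associativity of substitution and of the
multiplication. -/
theorem operad_mul_assoc (s : ℕ) (p : Fin s → ℕ) (q : Fin (∑ i, p i) → ℕ) :
    (α_ _ _ _).inv ≫
      (operadMul f s p ⊗ₘ tensorFamFlatten s p fun k => ((θ A).obj f).term (q k)) ≫
        operadMul f (∑ i, p i) q
    = ((θ A).obj f).term s ◁ (tensorFamTensor s _ _ ≫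
          tensorFamMap s fun i => operadMul f (p i) fun j => q (finSigmaFinEquiv ⟨i, j⟩)) ≫
        operadMul f s (fun i => ∑ j, q (finSigmaFinEquiv ⟨i, j⟩)) ≫
          ((θ A).obj f).act (finCongr (sum_finSigmaFinEquiv q).symm) := by
  -- multiplying twice after a substitution for `f ⊗ f`: first in the inner variables, then outside
  have h2 : substMap₂ f f ((θ A).obj f) s (fun i => ∑ j, q (finSigmaFinEquiv ⟨i, j⟩)) ≫
      comp (f.hom.invImage.map (mulHom f)) _ ≫ comp (mulHom f) _
      = _ ◁ tensorFamMap s (fun i => comp (mulHom f) (∑ j, q (finSigmaFinEquiv ⟨i, j⟩))) ≫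
        operadMul f s fun i => ∑ j, q (finSigmaFinEquiv ⟨i, j⟩) := by
    rw [← comp_comp, map_mulHom_mulHom]
    refine (congrArg (_ ≫ ·) (comp_comp _ _ _)).trans ?_
    exact (Category.assoc _ _ _).symm.trans
      ((congrArg (· ≫ comp (mulHom f) _) (substMap₂_mul f s _)).trans (Category.assoc _ _ _))
  -- the left hand side as an iterated substitution followed by two multiplications
  have h3 : (operadMul f s p ⊗ₘ tensorFamFlatten s p fun k => ((θ A).obj f).term (q k)) ≫
        operadMul f (∑ i, p i) q
      = ((substMap f ((θ A).obj f) s p ⊗ₘ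
          tensorFamFlatten s p fun k => ((θ A).obj f).term (q k)) ≫
        substMap f (f.hom.invImage.obj ((θ A).obj f)) (∑ i, p i) q) ≫
        comp (f.hom.invImage.map (mulHom f)) _ ≫ comp (mulHom f) _ := by
    rw [Category.assoc, reassoc_of% substMap_natural, tensorHom_comp_whiskerRight_assoc]
    rfl
  rw [h3, substMap_substMap₂]
  simp only [Category.assoc]
  rw [Iso.inv_hom_id_assoc, reassoc_of% act_comp, act_comp]
  rw [reassoc_of% h2]
  simp only [operadMul, tensorFamMap_comp, MonoidalCategory.whiskerLeft_comp, Category.assoc]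

theorem isEquivariantFamily_operadMul :
    IsEquivariantFamily ((θ A).obj f) ((θ A).obj f) ((θ A).obj f) (operadMul f) :=
  (isEquivariantFamily_substMap f ((θ A).obj f)).postcomp (mulHom f)

theorem operadMul_hom {f g : End A} [MonObj f] [MonObj g] (φ : f ⟶ g) [IsMonHom φ] (s : ℕ)
    (p : Fin s → ℕ) : operadMul f s p ≫ comp ((θ A).map φ) _
      = (comp ((θ A).map φ) s ⊗ₘ tensorFamMap s fun i => comp ((θ A).map φ) (p i)) ≫
        operadMul g s p := by
  have h := substMap_app φ ((θ A).obj f) s p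
  rw [operadMul, Category.assoc, ← comp_comp, mulHom_hom, comp_comp, comp_comp, reassoc_of% h,
    reassoc_of% substMap_natural, operadMul, tensorHom_def', Category.assoc]

end QO

open QO in
variable (A) in
/-- The functor from monoids of endomorphisms of `q_o A` over `A` to symmetric operads, which takes
`M` to the operad with underlying symmetric sequence `θ M`. -/
def toSymOperad : Mon (QO.End A) ⥤ SymOperad A where
  obj M :=
    { seq := (θ A).obj M.X
      one := univι ≫ comp (oneHom M.X) 1
      mul := operadMul M.X
      equivariant := isEquivariantFamily_operadMul M.X
      one_mul := operad_one_mul M.X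
      mul_one := operad_mul_one M.X
      mul_assoc := operad_mul_assoc M.X }
  map φ :=
    { hom := (θ A).map φ.hom
      one_hom := by
        rw [Category.assoc, ← comp_comp, oneHom_hom]
      mul_hom := operadMul_hom φ.hom }
  map_id _ := SymOperad.Hom.ext ((θ A).map_id _)
  map_comp _ _ := SymOperad.Hom.ext ((θ A).map_comp _ _)

end

section

variable {A : Type u} [Category.{v} A] [MonoidalCategory A] [SymmetricCategory A] [Vectoid A]

namespace QO

instance : (θ A).IsEquivalence := eval_isEquivalence (toBase A)

theorem univ_hom_ext {Z : QO A} {t t' : univ A ⟶ Z} (h : univι ≫ comp t 1 = univι ≫ comp t' 1) :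
    t = t' :=
  mono_hom_ext h

/-- A 2-morphism whose image under `θ` is a morphism of operads is a morphism of monoids: the
compatibility with the multiplications is tested on the substitution maps. -/
theorem isMonHom_of_operad {f g : End A} [MonObj f] [MonObj g] (φ : f ⟶ g)
    (h : (univι ≫ comp (oneHom f) 1) ≫ comp ((θ A).map φ) 1 = univι ≫ comp (oneHom g) 1)
    (h' : ∀ s p, operadMul f s p ≫ comp ((θ A).map φ) _
      = (comp ((θ A).map φ) s ⊗ₘ tensorFamMap s fun i => comp ((θ A).map φ) (p i)) ≫
        operadMul g s p) : IsMonHom φ where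
  one_hom := by
    apply (θ A).map_injective
    have e : oneHom f ≫ (θ A).map φ = oneHom g := univ_hom_ext (by
      rw [comp_comp, ← h, Category.assoc])
    exact e
  mul_hom := by
    apply (θ A).map_injective
    have e : mulHom f ≫ (θ A).map φ
        = φ.app.app ((θ A).obj f) ≫ g.hom.invImage.map ((θ A).map φ) ≫ mulHom g :=
      substMap_hom_ext fun s p => by
        have k := substMap_app φ ((θ A).obj f) s p
        have h' := h' s p
        rw [operadMul, Category.assoc] at h'
        rw [comp_comp, h', comp_comp, comp_comp, reassoc_of% k, reassoc_of% substMap_natural,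
          operadMul, tensorHom_def', Category.assoc]
    exact e.trans (Category.assoc (φ.app.app ((θ A).obj f)) (g.hom.invImage.map ((θ A).map φ))
      (mulHom g)).symm

end QO

open QO in
instance : (toSymOperad A).Faithful where
  map_injective h :=
    Mon.Hom.ext ((θ A).map_injective (congrArg SymOperad.Hom.hom h))

open QO in
instance : (toSymOperad A).Full where
  map_surjective t :=
    have e : (θ A).map ((θ A).preimage t.hom) = t.hom := (θ A).map_preimage _
    have : IsMonHom ((θ A).preimage t.hom) :=
      isMonHom_of_operad _ (by rw [e]; exact t.one_hom) (by rw [e]; exact t.mul_hom)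
    ⟨⟨(θ A).preimage t.hom⟩, SymOperad.Hom.ext e⟩

end

/-! ### Naturality of the rebracketing of iterated tensor products -/

section

variable {D : Type u} [Category.{v} D] [MonoidalCategory D]

theorem tensorFamCast_natural {m n : ℕ} (h : m = n) {ι : Type*} {Z Z' : ι → D} (f : ∀ i, Z i ⟶ Z' i)
    {a : Fin m → ι} {b : Fin n → ι} (e : ∀ i, a i = b (Fin.cast h i)) :
    tensorFamMap m (fun i => f (a i)) ≫ tensorFamCast (Y := fun i => Z' (b i)) h
        (fun i => congrArg Z' (e i))
      = tensorFamCast (X := fun i => Z (a i)) h (fun i => congrArg Z (e i)) ≫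
        tensorFamMap n fun i => f (b i) := by
  subst h
  obtain rfl : a = b := funext e
  exact (Category.comp_id _).trans (Category.id_comp _).symm

theorem tensorFamCast_natural' {m n : ℕ} (h : m = n) {Z Z' : Fin n → D} (f : ∀ i, Z i ⟶ Z' i) :
    tensorFamMap m (fun i => f (Fin.cast h i)) ≫
        tensorFamCast (X := fun i => Z' (Fin.cast h i)) h (fun _ => rfl)
      = tensorFamCast (X := fun i => Z (Fin.cast h i)) h (fun _ => rfl) ≫ tensorFamMap n f :=
  tensorFamCast_natural h f (a := fun i => Fin.cast h i) (b := fun i => i) fun _ => rfl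

theorem tensorFamMap_eqToHom_natural {n : ℕ} {ι : Type*} {Z Z' : ι → D} (f : ∀ i, Z i ⟶ Z' i)
    {a b : Fin n → ι} (e : ∀ i, a i = b i) :
    tensorFamMap n (fun i => f (a i)) ≫ tensorFamMap n (fun i => eqToHom (congrArg Z' (e i)))
      = tensorFamMap n (fun i => eqToHom (congrArg Z (e i))) ≫ tensorFamMap n fun i => f (b i) := by
  rw [← tensorFamMap_comp, ← tensorFamMap_comp]
  exact congrArg (tensorFamMap n) (funext fun i => eqToHom_naturality f (e i))

theorem tensorFamAppend_natural (m n : ℕ) {Z Z' : Fin (m + n) → D} (f : ∀ i, Z i ⟶ Z' i) :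
    (tensorFamMap m (fun i => f (Fin.castAdd n i)) ⊗ₘ tensorFamMap n fun j => f (Fin.natAdd m j)) ≫
        tensorFamAppend m n Z'
      = tensorFamAppend m n Z ≫ tensorFamMap (m + n) f := by
  induction m with
  | zero =>
    rw [← cancel_epi ((famNil _).hom ▷ _), whiskerRight_comp_tensorHom_assoc, tensorFamMap_zero,
      tensorHom_def', Category.assoc, tensorFamAppend_zero, reassoc_of% tensorFamAppend_zero,
      leftUnitor_naturality_assoc]
    exact congrArg (_ ≫ ·) (tensorFamCast_natural (Nat.zero_add n).symm f
      fun j => Fin.natAdd_zero_eq_cast j)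
  | succ m ih =>
    have k : ((tensorFamMap m fun i => f (Fin.castAdd n i.succ)) ⊗ₘ
          tensorFamMap n fun j => f (Fin.natAdd (m + 1) j)) ≫
        ((tensorFamMap m fun i => eqToHom (congrArg Z' (Fin.castAdd_succ_eq_cast n i))) ⊗ₘ
          tensorFamMap n fun j => eqToHom (congrArg Z' (Fin.natAdd_succ_eq_cast m j))) ≫
        (tensorFamAppend m n fun i => Z' (Fin.cast (Nat.succ_add m n).symm i.succ))
        = (((tensorFamMap m fun i => eqToHom (congrArg Z (Fin.castAdd_succ_eq_cast n i))) ⊗ₘ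
          tensorFamMap n fun j => eqToHom (congrArg Z (Fin.natAdd_succ_eq_cast m j))) ≫
        (tensorFamAppend m n fun i => Z (Fin.cast (Nat.succ_add m n).symm i.succ))) ≫
          tensorFamMap (m + n) fun i => f (Fin.cast (Nat.succ_add m n).symm i.succ) := by
      rw [tensorHom_comp_tensorHom_assoc,
        tensorFamMap_eqToHom_natural f (fun i => Fin.castAdd_succ_eq_cast n i),
        tensorFamMap_eqToHom_natural f (fun j => Fin.natAdd_succ_eq_cast m j),
        Category.assoc, ← ih fun i => f (Fin.cast (Nat.succ_add m n).symm i.succ),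
        tensorHom_comp_tensorHom_assoc]
    rw [← cancel_epi ((famCons _).hom ▷ _), whiskerRight_comp_tensorHom_assoc, tensorFamMap_succ,
      ← tensorHom_comp_whiskerRight_assoc, tensorFamAppend_succ, reassoc_of% tensorFamAppend_succ,
      associator_naturality_assoc, tensorHom_comp_tensorHom_assoc, k,
      eqToHom_naturality f (Fin.castAdd_zero_eq_cast m n),
      ← tensorHom_comp_tensorHom_assoc]
    refine congrArg (_ ≫ _ ≫ ·) ?_
    rw [← tensorFamCast_natural' (Nat.succ_add m n).symm f]
    exact (reassoc_of% tensorFamMap_succ fun i => f (Fin.cast (Nat.succ_add m n).symm i)) _ |>.symm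

/-- The rebracketing `⨂_i ⨂_j Z_{i,j} ≅ ⨂_k Z_k` is natural. -/
theorem tensorFamFlatten_natural (s : ℕ) (p : Fin s → ℕ) {Z Z' : Fin (∑ i, p i) → D}
    (f : ∀ i, Z i ⟶ Z' i) :
    tensorFamMap s (fun i => tensorFamMap (p i) fun j => f (finSigmaFinEquiv ⟨i, j⟩)) ≫
        tensorFamFlatten s p Z'
      = tensorFamFlatten s p Z ≫ tensorFamMap (∑ i, p i) f := by
  induction s with
  | zero =>
    rw [← cancel_epi (famNil _).hom, reassoc_of% tensorFamMap_zero, tensorFamFlatten_zero,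
      reassoc_of% tensorFamFlatten_zero]
    rw [← tensorFamCast_natural' (Fin.sum_univ_zero p).symm f]
    exact (reassoc_of% tensorFamMap_zero fun i => f (Fin.cast (Fin.sum_univ_zero p).symm i)) _ |>.symm
  | succ s ih =>
    have k₁ : (tensorFamMap (p 0) fun j => f (finSigmaFinEquiv ⟨0, j⟩)) ≫
        tensorFamMap (p 0) (fun j => eqToHom (congrArg Z' (finSigmaFinEquiv_cons_zero p j)))
        = _ := tensorFamMap_eqToHom_natural f fun j => finSigmaFinEquiv_cons_zero p j
    have k₂ : (tensorFamMap s fun i => tensorFamMap (p i.succ) fun j =>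
          f (finSigmaFinEquiv ⟨i.succ, j⟩)) ≫
        (tensorFamMap s fun i => tensorFamMap (p i.succ) fun j =>
            eqToHom (congrArg Z' (finSigmaFinEquiv_cons_succ p i j)))
        = (tensorFamMap s fun i => tensorFamMap (p i.succ) fun j =>
            eqToHom (congrArg Z (finSigmaFinEquiv_cons_succ p i j))) ≫
          tensorFamMap s fun i => tensorFamMap (p i.succ) fun j =>
            f (Fin.cast (Fin.sum_univ_succ p).symm (Fin.natAdd (p 0) (finSigmaFinEquiv ⟨i, j⟩))) := by
      rw [← tensorFamMap_comp, ← tensorFamMap_comp]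
      exact congrArg (tensorFamMap s) (funext fun i =>
        tensorFamMap_eqToHom_natural f fun j => finSigmaFinEquiv_cons_succ p i j)
    have k₃ := ih (fun i => p i.succ) fun k =>
      f (Fin.cast (Fin.sum_univ_succ p).symm (Fin.natAdd (p 0) k))
    rw [← cancel_epi (famCons _).hom, reassoc_of% tensorFamMap_succ, tensorFamFlatten_succ,
      reassoc_of% tensorFamFlatten_succ, tensorHom_comp_tensorHom_assoc, k₁, reassoc_of% k₂, k₃]
    refine (congrArg (fun t => (_ ⊗ₘ t) ≫ _) (Category.assoc _ _ _).symm).trans ?_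
    rw [← tensorHom_comp_tensorHom, Category.assoc]
    refine congrArg (_ ≫ ·) ?_
    rw [← tensorFamCast_natural' (Fin.sum_univ_succ p).symm f]
    exact (reassoc_of% tensorFamAppend_natural (p 0) (∑ i : Fin s, p i.succ) fun k =>
      f (Fin.cast (Fin.sum_univ_succ p).symm k)) _

instance isIso_tensorFamMap {n : ℕ} {X Y : Fin n → D} (f : ∀ i, X i ⟶ Y i) [∀ i, IsIso (f i)] :
    IsIso (tensorFamMap n f) :=
  ⟨tensorFamMap n fun i => inv (f i), by
    rw [← tensorFamMap_comp]; simp [tensorFamMap_id], by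
    rw [← tensorFamMap_comp]; simp [tensorFamMap_id]⟩

instance isIso_tensorFamCast {m n : ℕ} (h : m = n) {X : Fin m → D} {Y : Fin n → D} (e : ∀ i, X i = Y (Fin.cast h i)) :
    IsIso (tensorFamCast h e) :=
  inferInstanceAs (IsIso (eqToHom _))

instance isIso_tensorFamAppend (m n : ℕ) (Z : Fin (m + n) → D) :
    IsIso (tensorFamAppend m n Z) := by
  induction m with
  | zero =>
    have : IsIso ((famNil _).hom ▷ _ ≫ tensorFamAppend 0 n Z) := by
      rw [tensorFamAppend_zero]
      infer_instance
    exact IsIso.of_isIso_comp_left ((famNil _).hom ▷ _) _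
  | succ m ih =>
    have : IsIso ((famCons fun i => Z (Fin.castAdd n i)).hom ▷ _ ≫ tensorFamAppend (m + 1) n Z) := by
      rw [tensorFamAppend_succ]
      infer_instance
    exact IsIso.of_isIso_comp_left ((famCons fun i => Z (Fin.castAdd n i)).hom ▷ _) _

instance isIso_tensorFamFlatten (s : ℕ) (p : Fin s → ℕ) (Z : Fin (∑ i, p i) → D) :
    IsIso (tensorFamFlatten s p Z) := by
  induction s with
  | zero =>
    have : IsIso ((famNil _).hom ≫ tensorFamFlatten 0 p Z) := by
      rw [tensorFamFlatten_zero]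
      infer_instance
    exact IsIso.of_isIso_comp_left (famNil _).hom _
  | succ s ih =>
    have : IsIso ((famCons _).hom ≫ tensorFamFlatten (s + 1) p Z) := by
      rw [tensorFamFlatten_succ]
      infer_instance
    exact IsIso.of_isIso_comp_left (famCons _).hom _

variable [SymmetricCategory D]

theorem tensorFamInsert_natural (n : ℕ) (k : Fin (n + 1)) {X Y : Fin (n + 1) → D}
    (f : ∀ i, X i ⟶ Y i) :
    (f k ⊗ₘ tensorFamMap n fun i => f (k.succAbove i)) ≫ tensorFamInsert n k Y
      = tensorFamInsert n k X ≫ tensorFamMap (n + 1) f := by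
  have h₀ : ∀ (n : ℕ) {X Y : Fin (n + 1) → D} (f : ∀ i, X i ⟶ Y i),
      (f 0 ⊗ₘ tensorFamMap n fun i => f ((0 : Fin (n + 1)).succAbove i)) ≫ tensorFamInsert n 0 Y
        = tensorFamInsert n 0 X ≫ tensorFamMap (n + 1) f := fun n X Y f => by
    rw [tensorFamInsert_zero, tensorFamInsert_zero, tensorHom_comp_whiskerLeft_assoc,
      tensorFamMap_eqToHom_natural f fun i => Fin.succAbove_zero_apply i, Category.assoc,
      tensorFamMap_succ, whiskerLeft_comp_tensorHom_assoc]
  induction n with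
  | zero =>
    obtain rfl : k = 0 := Fin.fin_one_eq_zero k
    exact h₀ 0 f
  | succ n ih =>
    cases k using Fin.cases with
    | zero => exact h₀ (n + 1) f
    | succ j =>
      have k₁ : (f j.succ ⊗ₘ tensorFamMap n fun i => f (j.succ.succAbove i.succ)) ≫
          (Y j.succ ◁ tensorFamMap n fun i =>
            eqToHom (congrArg Y (Fin.succ_succAbove_succ j i))) ≫
          (tensorFamInsert n j fun i => Y i.succ)
          = ((X j.succ ◁ tensorFamMap n fun i =>
            eqToHom (congrArg X (Fin.succ_succAbove_succ j i))) ≫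
          tensorFamInsert n j fun i => X i.succ) ≫ tensorFamMap (n + 1) fun i => f i.succ := by
        rw [tensorHom_comp_whiskerLeft_assoc,
          tensorFamMap_eqToHom_natural f fun i => Fin.succ_succAbove_succ j i, Category.assoc,
          ← ih j fun i => f i.succ, whiskerLeft_comp_tensorHom_assoc]
      rw [← cancel_epi (X j.succ ◁ (famCons fun i => X (j.succ.succAbove i)).hom),
        reassoc_of% tensorFamInsert_succ, whiskerLeft_comp_tensorHom_assoc, tensorFamMap_succ,
        ← tensorHom_comp_whiskerLeft_assoc, tensorFamInsert_succ,
        reassoc_of% swapFirst_natural (f j.succ) (f (j.succ.succAbove 0)),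
        tensorHom_comp_tensorHom_assoc, k₁, eqToHom_naturality f (Fin.succ_succAbove_zero j),
        tensorFamMap_succ, tensorHom_comp_tensorHom_assoc]

theorem tensorFamPerm_natural (n : ℕ) (σ : Equiv.Perm (Fin n)) {X Y : Fin n → D}
    (f : ∀ i, X i ⟶ Y i) :
    tensorFamMap n (fun i => f (σ i)) ≫ tensorFamPerm n σ Y
      = tensorFamPerm n σ X ≫ tensorFamMap n f := by
  induction n with
  | zero => rfl
  | succ n ih =>
    rw [← cancel_epi (famCons fun i => X (σ i)).hom, reassoc_of% tensorFamMap_succ,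
      tensorFamPerm_succ, reassoc_of% tensorFamPerm_succ, tensorHom_comp_whiskerLeft_assoc,
      reassoc_of% tensorFamMap_eqToHom_natural f fun i => (succAbove_permTail σ i).symm,
      ih (permTail σ) fun i => f ((σ 0).succAbove i), ← tensorFamInsert_natural,
      whiskerLeft_comp_tensorHom_assoc, Category.assoc]

end

/-! ### Morphisms out of an iterated composition product -/

section

variable {A : Type u} [Category.{v} A] [MonoidalCategory A] [SymmetricCategory A] [Prevectoid A]

namespace QO

/-- Morphisms out of a component of a plethysm are determined on the structure maps, followed by all
bijections. -/
theorem IsPlethysm.hom_ext {X Y W : QO A} {κ} (hκ : IsPlethysm X Y W κ) {n : ℕ} {T : A}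
    {t t' : W.term n ⟶ T} (h : ∀ (s : ℕ) (p : Fin s → ℕ) (σ : Fin n ≃ Fin (∑ i, p i)),
      κ s p ≫ W.act σ ≫ t = κ s p ≫ W.act σ ≫ t') : t = t' :=
  (hκ.existsUnique_desc n T (fun s p σ => κ s p ≫ W.act σ ≫ t')
    (fun s p σ τ => by rw [reassoc_of% hκ.equivariant.inner, reassoc_of% @act_act])
    (fun s p σ τ => by rw [reassoc_of% hκ.equivariant.outer, reassoc_of% @act_act])).unique h
      fun _ _ _ => rfl

/-- The tensor product of a component of a plethysm with an object has the same property, because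
`A` is closed. -/
theorem IsPlethysm.whiskerRight_hom_ext {X Y W : QO A} {κ} (hκ : IsPlethysm X Y W κ) {n : ℕ}
    {T V : A} {t t' : W.term n ⊗ T ⟶ V}
    (h : ∀ (s : ℕ) (p : Fin s → ℕ) (σ : Fin n ≃ Fin (∑ i, p i)),
      κ s p ▷ T ≫ W.act σ ▷ T ≫ t = κ s p ▷ T ≫ W.act σ ▷ T ≫ t') : t = t' := by
  let _ := Prevectoid.monoidalClosed A
  rw [← cancel_epi (β_ T (W.term n)).hom]
  apply MonoidalClosed.curry_injective
  refine hκ.hom_ext fun s p σ => ?_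
  simp only [← MonoidalClosed.curry_natural_left, BraidedCategory.braiding_naturality_right_assoc, h]

/-- Morphisms out of `h^* (g^* X)` are determined on iterated substitutions. -/
theorem substMap_substMap_hom_ext {g h : End A} {X Z : QO A}
    {t t' : h.hom.invImage.obj (g.hom.invImage.obj X) ⟶ Z}
    (H : ∀ (s : ℕ) (p : Fin s → ℕ) (q : Fin (∑ i, p i) → ℕ),
      (substMap g X s p ⊗ₘ tensorFamFlatten s p fun k => ((θ A).obj h).term (q k)) ≫
          substMap h (g.hom.invImage.obj X) (∑ i, p i) q ≫ comp t _
        = (substMap g X s p ⊗ₘ tensorFamFlatten s p fun k => ((θ A).obj h).term (q k)) ≫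
          substMap h (g.hom.invImage.obj X) (∑ i, p i) q ≫ comp t' _) : t = t' := by
  refine substMap_hom_ext fun n q => (isPlethysm_substMap g X).whiskerRight_hom_ext fun s p σ => ?_
  obtain rfl : n = ∑ i, p i := by simpa using Fintype.card_congr σ
  -- the bijection `σ` is moved to the second substitution by outer equivariance, and the
  -- rebracketing isomorphism is cancelled
  obtain ⟨q, rfl⟩ : ∃ q', q = fun i => q' (σ i) := ⟨fun k => q (σ.symm k), by simp⟩
  have e := (isEquivariantFamily_substMap h (g.hom.invImage.obj X)).outer _ q σ
  have H' := H s p q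
  rw [tensorHom_def', Category.assoc, Category.assoc, cancel_epi] at H'
  rw [reassoc_of% e, reassoc_of% e, ← whisker_exchange_assoc, ← whisker_exchange_assoc, act_comp,
    act_comp, reassoc_of% H']

end QO
end

/-! ### The monoid of endomorphisms of an operad -/

section

variable {A : Type u} [Category.{v} A] [MonoidalCategory A] [SymmetricCategory A]

namespace QO

section

variable [Prevectoid A]

/-- Equivariant families are stable under morphisms in both variables. -/
theorem IsEquivariantFamily.precomp {X X' Y Y' Z : QO A} {φ} (h : IsEquivariantFamily X Y Z φ)
    (a : X' ⟶ X) (b : Y' ⟶ Y) : IsEquivariantFamily X' Y' Z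
      fun s p => (comp a s ⊗ₘ tensorFamMap s fun i => comp b (p i)) ≫ φ s p where
  inner s p τ := by
    rw [whiskerLeft_comp_tensorHom_assoc, ← tensorFamMap_comp, Category.assoc, ← h.inner,
      tensorHom_comp_whiskerLeft_assoc, ← tensorFamMap_comp]
    simp only [act_comp]
  outer s p σ := by
    rw [whiskerRight_comp_tensorHom_assoc, act_comp, ← tensorHom_comp_whiskerRight_assoc, h.outer,
      tensorHom_comp_whiskerLeft_assoc, tensorFamPerm_natural s σ fun i => comp b (p i),
      Category.assoc, whiskerLeft_comp_tensorHom_assoc]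

variable {P : SymOperad A} {f : End A} (i : (θ A).obj f ≅ P.seq)

/-- The unit of an operad on `θ f` is a morphism `X_o ⟶ θ f`. -/
theorem exists_operad_unit : ∃ e : univ A ⟶ (θ A).obj f,
    univι ≫ comp e 1 ≫ comp i.hom 1 = P.one := by
  obtain ⟨e, he⟩ : ∃ e : univ A ⟶ (θ A).obj f, univι ≫ comp e 1 = P.one ≫ comp i.inv 1 :=
    ⟨monoDesc (P.one ≫ comp i.inv 1), monoι_monoDesc _⟩
  refine ⟨e, ?_⟩
  rw [reassoc_of% he, ← comp_comp, i.inv_hom_id, comp_id, Category.comp_id]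

/-- The composition maps of an operad on `θ f` descend to a morphism `f^* (θ f) ⟶ θ f`, because they
form an equivariant family. -/
theorem exists_operad_mul : ∃ m : f.hom.invImage.obj ((θ A).obj f) ⟶ (θ A).obj f, ∀ s p,
    substMap f ((θ A).obj f) s p ≫ comp m _ ≫ comp i.hom _
      = (comp i.hom s ⊗ₘ tensorFamMap s fun k => comp i.hom (p k)) ≫ P.mul s p := by
  obtain ⟨m, hm⟩ := exists_substMap_desc ((P.equivariant.precomp i.hom i.hom).postcomp i.inv)
  refine ⟨m, fun s p => ?_⟩
  have h := hm s p
  rw [reassoc_of% h, ← comp_comp, i.inv_hom_id, comp_id, Category.comp_id]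

variable {i} {m : f.hom.invImage.obj ((θ A).obj f) ⟶ (θ A).obj f}

/-- The left unit law for the multiplication induced by an operad. -/
theorem map_operad_unit_mul {e : univ A ⟶ (θ A).obj f}
    (he : univι ≫ comp e 1 ≫ comp i.hom 1 = P.one)
    (hm : ∀ s p, substMap f ((θ A).obj f) s p ≫ comp m _ ≫ comp i.hom _
      = (comp i.hom s ⊗ₘ tensorFamMap s fun k => comp i.hom (p k)) ≫ P.mul s p) :
    f.hom.invImage.map e ≫ m = 𝟙 ((θ A).obj f) := by
  -- `f^* X_o` and `θ f` are equal by definition but not syntactically; `t` is an endomorphism of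
  -- `θ f`
  obtain ⟨t, ht⟩ : ∃ t : (θ A).obj f ⟶ (θ A).obj f, f.hom.invImage.map e ≫ m = t := ⟨_, rfl⟩
  refine ht.trans ((cancel_mono i.hom).1 (hom_ext_comp fun n => ?_))
  have ht' : ∀ n, comp t n = comp (f.hom.invImage.map e) n ≫ comp m n := fun n =>
    ht ▸ comp_comp _ _ _
  -- the composite is evaluated with `substMap_univι`, which exhibits substitution into `X_o` as
  -- the identity
  have h : ((θ A).obj f).act (finCongr (Fin.sum_univ_one fun _ => n)) ≫ comp t _
      = (λ_ (((θ A).obj f).term n)).inv ≫ (univι ⊗ₘ ((ρ_ (((θ A).obj f).term n)).inv ≫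
          _ ◁ (famNil _).hom ≫ (famCons fun _ => ((θ A).obj f).term n).hom)) ≫
        comp e 1 ▷ _ ≫ substMap f ((θ A).obj f) 1 (fun _ => n) ≫ comp m _ := by
    have hs : substMap f (univ A) 1 (fun _ => n) ≫ comp t _
        = comp e 1 ▷ _ ≫ substMap f ((θ A).obj f) 1 (fun _ => n) ≫ comp m _ :=
      (congrArg (_ ≫ ·) (ht' _)).trans ((Category.assoc _ _ _).symm.trans
        ((congrArg (· ≫ comp m _) (substMap_natural f e 1 fun _ => n)).trans (Category.assoc _ _ _)))
    exact (congrArg (· ≫ comp t _) (substMap_univι f n).symm).trans ((Category.assoc _ _ _).trans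
      (congrArg (_ ≫ ·) ((Category.assoc _ _ _).trans (congrArg (_ ≫ ·) hs))))
  have h₁ : (λ_ (P.seq.term n)).inv ≫ (P.one ⊗ₘ ((ρ_ (P.seq.term n)).inv ≫
        _ ◁ (famNil _).hom ≫ (famCons fun _ => P.seq.term n).hom)) ≫ P.mul 1 (fun _ => n)
      = P.seq.act (finCongr (Fin.sum_univ_one fun _ => n)) :=
    (congrArg (fun t => _ ≫ (P.one ⊗ₘ t) ≫ P.mul 1 fun _ => n)
      (rightUnitor_inv_famCons _)).trans (P.one_mul n)
  have h₂ := hm 1 fun _ => n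
  have h₃ : ((ρ_ (((θ A).obj f).term n)).inv ≫
          _ ◁ (famNil _).hom ≫ (famCons fun _ => ((θ A).obj f).term n).hom) ≫
        tensorFamMap 1 (fun _ => comp i.hom n)
      = comp i.hom n ≫ (ρ_ (P.seq.term n)).inv ≫
          _ ◁ (famNil _).hom ≫ (famCons fun _ => P.seq.term n).hom := by
    rw [Category.assoc, Category.assoc, tensorFamMap_succ, whiskerLeft_comp_tensorHom_assoc,
      tensorFamMap_zero, MonoidalCategory.tensorHom_def, Category.assoc, ← rightUnitor_inv_naturality_assoc]
  have := isIso_act P.seq (finCongr (Fin.sum_univ_one fun _ => n))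
  rw [Category.id_comp, comp_comp, ← cancel_mono (P.seq.act (finCongr (Fin.sum_univ_one fun _ => n))),
    Category.assoc, ← act_comp, ← reassoc_of% @act_comp, act_comp, reassoc_of% h, ← h₁, h₂, tensorHom_comp_whiskerRight_assoc,
    tensorHom_comp_tensorHom_assoc, h₃, Category.assoc, he, leftUnitor_inv_naturality_assoc,
    whiskerLeft_comp_tensorHom_assoc]

/-- The right unit law for the multiplication induced by an operad; `t` is the component at `θ f` of
the morphism from the identity given by the unit. -/
theorem unit_app_operad_mul {e : univ A ⟶ (θ A).obj f} {t : (θ A).obj f ⟶ f.hom.invImage.obj ((θ A).obj f)}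
    (he : univι ≫ comp e 1 ≫ comp i.hom 1 = P.one)
    (ht : ∀ n, (ρ_ (((θ A).obj f).term n)).inv ≫
        ((θ A).obj f).term n ◁ (tensorFamUnit n ≫ tensorFamMap n fun _ => univι ≫ comp e 1) ≫
          substMap f ((θ A).obj f) n (fun _ => 1)
      = ((θ A).obj f).act (finCongr (by simp : ∑ _ : Fin n, 1 = n)) ≫ comp t _)
    (hm : ∀ s p, substMap f ((θ A).obj f) s p ≫ comp m _ ≫ comp i.hom _
      = (comp i.hom s ⊗ₘ tensorFamMap s fun k => comp i.hom (p k)) ≫ P.mul s p) :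
    t ≫ m = 𝟙 ((θ A).obj f) := by
  refine (cancel_mono i.hom).1 (hom_ext_comp fun n => ?_)
  have h : ∑ _ : Fin n, 1 = n := by simp
  have := isIso_act P.seq (finCongr h)
  rw [Category.id_comp, comp_comp, comp_comp, ← cancel_mono (P.seq.act (finCongr h)),
    Category.assoc, Category.assoc, ← act_comp, ← reassoc_of% @act_comp, ← reassoc_of% @act_comp,
    ← reassoc_of% ht, hm, act_comp, ← P.mul_one n, whiskerLeft_comp_tensorHom_assoc,
    Category.assoc (tensorFamUnit n), ← tensorFamMap_comp, MonoidalCategory.tensorHom_def, Category.assoc,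
    ← rightUnitor_inv_naturality_assoc]
  simp only [Category.assoc, he, MonoidalCategory.whiskerLeft_comp]

/-- The associativity law for the multiplication induced by an operad; `t` is the component at `θ f`
of the multiplication. Both sides are compared on iterated substitutions, where the law is
associativity of the operad. -/
theorem map_operad_mul_mul
    {t : f.hom.invImage.obj (f.hom.invImage.obj ((θ A).obj f)) ⟶ f.hom.invImage.obj ((θ A).obj f)}
    (ht : ∀ s p, substMap₂ f f ((θ A).obj f) s p ≫ comp t _
      = _ ◁ tensorFamMap s (fun i => comp m (p i)) ≫ substMap f ((θ A).obj f) s p)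
    (hm : ∀ s p, substMap f ((θ A).obj f) s p ≫ comp m _ ≫ comp i.hom _
      = (comp i.hom s ⊗ₘ tensorFamMap s fun k => comp i.hom (p k)) ≫ P.mul s p) :
    f.hom.invImage.map m ≫ m = t ≫ m := by
  rw [← cancel_mono i.hom]
  apply substMap_substMap_hom_ext
  intro s p q
  have h := (Iso.inv_comp_eq _).1 (P.mul_assoc s p q)
  rw [Category.assoc, Category.assoc, comp_comp, comp_comp, comp_comp, comp_comp,
    reassoc_of% substMap_natural, hm, reassoc_of% substMap_substMap₂,
    tensorHom_comp_whiskerRight_assoc, tensorHom_comp_tensorHom_assoc, ← tensorFamFlatten_natural,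
    Category.assoc, hm, ← tensorHom_comp_tensorHom, Category.assoc, h, associator_naturality_assoc,
    reassoc_of% act_comp, reassoc_of% act_comp, act_comp, reassoc_of% ht, reassoc_of% hm]
  refine congrArg (_ ≫ ·) ?_
  -- the composition maps inside the blocks, before and after transport along `i`
  have e : (tensorFamTensor s (fun k => ((θ A).obj f).term (p k)) (fun k => tensorFam (p k) fun j =>
        ((θ A).obj f).term (q (finSigmaFinEquiv ⟨k, j⟩))) ≫
      tensorFamMap s fun k => substMap f ((θ A).obj f) (p k) fun j => q (finSigmaFinEquiv ⟨k, j⟩)) ≫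
      (tensorFamMap s fun k => comp m (∑ j, q (finSigmaFinEquiv ⟨k, j⟩))) ≫
      (tensorFamMap s fun k => comp i.hom (∑ j, q (finSigmaFinEquiv ⟨k, j⟩)))
      = ((tensorFamMap s fun k => comp i.hom (p k)) ⊗ₘ
          tensorFamMap s fun k => tensorFamMap (p k) fun j =>
            comp i.hom (q (finSigmaFinEquiv ⟨k, j⟩))) ≫
        tensorFamTensor s _ _ ≫
        tensorFamMap s fun k => P.mul (p k) fun j => q (finSigmaFinEquiv ⟨k, j⟩) := by
    rw [reassoc_of% @tensorFamMap_tensorFamTensor, Category.assoc, ← tensorFamMap_comp,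
      ← tensorFamMap_comp, ← tensorFamMap_comp]
    exact congrArg (fun t => _ ≫ tensorFamMap s t) (funext fun k => hm (p k) _)
  rw [tensorHom_comp_whiskerLeft_assoc, ← e, whiskerLeft_comp_tensorHom_assoc,
    whiskerLeft_comp_tensorHom_assoc]

end
end QO
end

/-! ### The equivalence of monoids of endomorphisms with operads -/

section

variable {A : Type u} [Category.{v} A] [MonoidalCategory A] [SymmetricCategory A] [Vectoid A]

namespace QO

/-- An operad structure on `θ f` comes from a monoid structure on `f`. -/
theorem exists_monObj {P : SymOperad A} {f : End A} (i : (θ A).obj f ≅ P.seq) :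
    ∃ _ : MonObj f, (univι ≫ comp (oneHom f) 1) ≫ comp i.hom 1 = P.one ∧
      ∀ s p, operadMul f s p ≫ comp i.hom _
        = (comp i.hom s ⊗ₘ tensorFamMap s fun k => comp i.hom (p k)) ≫ P.mul s p := by
  obtain ⟨e', he⟩ := exists_operad_unit i
  obtain ⟨m', hm⟩ := exists_operad_mul i
  -- lift the unit and the multiplication along the full functor `θ`, using `θ (f ⊗ f) = f^* (θ f)`
  obtain ⟨e, rfl⟩ : ∃ e : 𝟙_ (End A) ⟶ f, unitHom e = e' :=
    (θ A).map_surjective (X := 𝟙_ (End A)) e'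
  obtain ⟨m, hm'⟩ : ∃ m : f ⊗ f ⟶ f, (θ A).map m = m' :=
    (θ A).map_surjective (X := f ⊗ f) m'
  have h₁ := map_operad_unit_mul he hm
  have h₂ := unit_app_operad_mul he (substMap_unitApp e ((θ A).obj f)) hm
  have h₃ : f.hom.invImage.map m' ≫ m' = m.app.app ((θ A).obj f) ≫ m' :=
    map_operad_mul_mul (fun s p => by subst hm'; exact substMap_app m ((θ A).obj f) s p) hm
  let _ : MonObj f :=
    { one := e
      mul := m
      one_mul := (θ A).map_injective (by
        rw [θ_map_comp, θ_map_whiskerRight, hm']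
        exact h₁)
      mul_one := (θ A).map_injective (by
        rw [θ_map_comp, θ_map_whiskerLeft, hm']
        exact h₂)
      mul_assoc := (θ A).map_injective (by
        rw [θ_map_comp, θ_map_whiskerRight, θ_map_comp, θ_map_comp, θ_map_whiskerLeft, hm']
        exact h₃.trans (Category.id_comp _).symm) }
  refine ⟨inferInstance, (Category.assoc _ _ _).trans he, fun s p => ?_⟩
  subst hm'
  exact (Category.assoc _ _ _).trans (hm s p)

end QO

namespace SymOperad

/-- A morphism of operads with invertible underlying morphism is an isomorphism. -/
def isoMk {P Q : SymOperad A} (i : P.seq ≅ Q.seq) (h : P.one ≫ QO.comp i.hom 1 = Q.one)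
    (h' : ∀ (s : ℕ) (p : Fin s → ℕ), P.mul s p ≫ QO.comp i.hom (∑ i, p i)
      = (QO.comp i.hom s ⊗ₘ tensorFamMap s fun k => QO.comp i.hom (p k)) ≫ Q.mul s p) : P ≅ Q where
  hom := ⟨i.hom, h, h'⟩
  inv := ⟨i.inv, by
    rw [← h, Category.assoc, ← QO.comp_comp, i.hom_inv_id, QO.comp_id, Category.comp_id],
    fun s p => by
      have e : (QO.comp i.inv s ⊗ₘ tensorFamMap s fun k => QO.comp i.inv (p k)) ≫
          (QO.comp i.hom s ⊗ₘ tensorFamMap s fun k => QO.comp i.hom (p k)) = 𝟙 _ := by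
        rw [tensorHom_comp_tensorHom, ← tensorFamMap_comp]
        simp only [← QO.comp_comp, i.inv_hom_id, QO.comp_id, tensorFamMap_id, id_tensorHom_id]
      rw [← Category.id_comp (Q.mul s p), ← e]
      simp only [Category.assoc]
      rw [← reassoc_of% h' s p]
      simp only [← QO.comp_comp, i.hom_inv_id, QO.comp_id, Category.comp_id]⟩
  hom_inv_id := Hom.ext i.hom_inv_id
  inv_hom_id := Hom.ext i.inv_hom_id

end SymOperad

open QO in
instance : (toSymOperad A).EssSurj where
  mem_essImage P := by
    obtain ⟨_, h, h'⟩ := exists_monObj ((θ A).objObjPreimageIso P.seq)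
    exact ⟨⟨(θ A).objPreimage P.seq⟩, ⟨SymOperad.isoMk _ h h'⟩⟩

instance : (toSymOperad A).IsEquivalence where

open QO in
/-- The equivalence `toSymOperad`, whose unit and composition maps are the prescribed ones by
construction. -/
theorem exists_equivalence_symOperad : ∃ (e : Mon (QO.End A) ≌ SymOperad A)
      (i : e.functor ⋙ SymOperad.forget A ≅ Mon.forget (QO.End A) ⋙ QO.θ A),
      ∀ M : Mon (QO.End A),
        (e.functor.obj M).one ≫ QO.comp (i.hom.app M) 1
          = QO.univι ≫ QO.comp ((QO.θ A).map (MonObj.one (X := M.X))) 1 ∧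
        ∀ (s : ℕ) (p : Fin s → ℕ),
          (e.functor.obj M).mul s p ≫ QO.comp (i.hom.app M) (∑ k, p k)
            = (QO.comp (i.hom.app M) s ⊗ₘ tensorFamMap s fun k => QO.comp (i.hom.app M) (p k)) ≫
                QO.plethysmMap M.X M.X s p ≫
                QO.comp ((QO.θ A).map (MonObj.mul (X := M.X))) (∑ k, p k) := by
  refine ⟨(toSymOperad A).asEquivalence, Iso.refl _, fun M => ⟨Category.comp_id _, fun s p => ?_⟩⟩
  have e : (𝟙 (((θ A).obj M.X).term s) ⊗ₘ
      tensorFamMap s fun k => 𝟙 (((θ A).obj M.X).term (p k))) = 𝟙 _ := by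
    rw [tensorFamMap_id, id_tensorHom_id]
  refine (Category.comp_id (operadMul M.X s p)).trans ((operadMul_eq M.X s p).trans ?_)
  exact ((congrArg (· ≫ _) e).trans (Category.id_comp _)).symm

end

end

theorem mainTheorem2 {A : Type u} [Category.{v} A] [MonoidalCategory A] [SymmetricCategory A]
    [Vectoid A] :
    Vectoid (QO A) ∧
    QO.IsObjectClassifier.{w} A ∧
    (QO.θ A).IsEquivalence ∧
    (∀ f g : QO.End A,
      QO.IsPlethysm ((QO.θ A).obj f) ((QO.θ A).obj g) ((QO.θ A).obj (f ⊗ g))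
        (QO.plethysmMap f g)) ∧
    ∃ (e : Mon (QO.End A) ≌ SymOperad A)
      (i : e.functor ⋙ SymOperad.forget A ≅ Mon.forget (QO.End A) ⋙ QO.θ A),
      ∀ M : Mon (QO.End A),
        (e.functor.obj M).one ≫ QO.comp (i.hom.app M) 1
          = QO.univι ≫ QO.comp ((QO.θ A).map (MonObj.one (X := M.X))) 1 ∧
        ∀ (s : ℕ) (p : Fin s → ℕ),
          (e.functor.obj M).mul s p ≫ QO.comp (i.hom.app M) (∑ k, p k)
            = (QO.comp (i.hom.app M) s ⊗ₘ tensorFamMap s fun k => QO.comp (i.hom.app M) (p k)) ≫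
                QO.plethysmMap M.X M.X s p ≫
                QO.comp ((QO.θ A).map (MonObj.mul (X := M.X))) (∑ k, p k) := by
  exact ⟨inferInstance, fun B _ _ _ _ p => eval_isEquivalence p, eval_isEquivalence _,
    QO.isPlethysm_plethysmMap, exists_equivalence_symOperad⟩
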